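/- **Setting.** Let $d_1,d_2\ge 1$, $\tilde d=d_1+d_2$, let $\mathcal Y\subseteq\mathbb R^{d_2}$ be nonempty, closed and convex, let $\xi\sim\mathcal D$, and consider $\min_{x\in\mathbb R^{d_1}}\max_{y\in\mathcal Y}f(x,y)$ with $f(x,y)=\mathbb E_\xi[f(x,y;\xi)]$. Put $g(x)=\max_{y\in\mathcal Y}f(x,y)$, $g^*=\inf_x g(x)$, $y^*(x)=\arg\max_{y\in\mathcal Y}f(x,y)$. For $\mu>0$ let $f_{\mu_1}(x,y)=\mathbb E_u f(x+\mu_1u,y)$, $f_{\mu_2}(x,y)=\mathbb E_u f(x,y+\mu_2u)$, $g_{\mu_1}(x)=\mathbb E_u\, g(x+\mu_1u)$ with $u$ uniform on the unit ball, and, for $u$ on the unit sphere, let $$\hat\nabla_xf(x,y;\xi,u)=\frac{f(x+\mu_1u,y;\xi)-f(x,y;\xi)}{\mu_1/d_1}u,\qquad \hat\nabla_yf(x,y;\xi,u)=\frac{f(x,y+\mu_2u;\xi)-f(x,y;\xi)}{\mu_2/d_2}u .$$ Let $L_f,\tau>0$ and $\delta\in\mathbb R$, $\kappa_y=L_f/\tau$,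 $L_g=L_f+L_f^2/\tau$. Assume: 1. For every $\xi$, $f(\cdot,\cdot;\xi)$ has an $L_f$-Lipschitz gradient on $\mathbb R^{d_1}\times U$ for some open set $U$ containing $\{y:\operatorname{dist}(y,\mathcal Y)\le\mu_2\}$. 2. For every $x$, $f(x,\cdot)$ is $\tau$-strongly concave on $\mathcal Y$. 3. $g$ is bounded below. 4. For $u$ uniform on the unit sphere independent of $\xi$, and all $x\in\mathbb R^{d_1}$, $y\in\mathcal Y$: $\mathbb E\|\hat\nabla_xf(x,y;\xi,u)-\nabla_xf_{\mu_1}(x,y)\|^2\le\delta^2$ and $\mathbb E\|\hat\nabla_yf(x,y;\xi,u)-\nabla_yf_{\mu_2}(x,y)\|^2\le\delta^2$. **Algorithm (Acc-ZOMDA, $\mathcal X=\mathbb R^{d_1}$).** For each $t\ge1$ draw a batch $\mathcal B_t$ of $b$ triples $(\xi_i,\hat u_i,\tilde u_i)$, all independent, with $\xi_i\sim\mathcal D$ and $\hat u_i,\tilde u_i$ uniform on the unit spheres of $\mathbb R^{d_1}$, $\mathbb R^{d_2}$. Let $\hat\nabla_xf(x,y;\mathcal B)$, $\hat\nabla_yf(x,y;\mathcal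 B)$ be the averages over the batch of the estimators above. Start from $x_1$, $y_1=y^*(x_1)$, $v_1=\hat\nabla_xf(x_1,y_1;\mathcal B_1)$, $w_1=\hat\nabla_yf(x_1,y_1;\mathcal B_1)$, and for $t=1,\dots,T$ with $\eta_t=k/(m+t)^{1/3}$ put $$x_{t+1}=x_t-\gamma\eta_tv_t,\qquad y_{t+1}=y_t+\eta_t\big(\mathcal P_{\mathcal Y}(y_t+\lambda w_t)-y_t\big),$$ $$v_{t+1}=\hat\nabla_xf(x_{t+1},y_{t+1};\mathcal B_{t+1})+(1-c_1\eta_t^2)\big[v_t-\hat\nabla_xf(x_t,y_t;\mathcal B_{t+1})\big],$$ $$w_{t+1}=\hat\nabla_yf(x_{t+1},y_{t+1};\mathcal B_{t+1})+(1-c_2\eta_t^2)\big[w_t-\hat\nabla_yf(x_t,y_t;\mathcal B_{t+1})\big].$$ **Parameters.** Let $T\ge1$, $k>0$, $1\le b\le\tilde d$, $c_1\ge\frac2{3k^3}+\frac{9\tau^2}4$, $c_2\ge\frac2{3k^3}+\frac{625\tilde dL_f^2}{3b}$, $m\ge\max(2,k^3,(c_1k)^3,(c_2k)^3)$, $0<\lambda\le\min\big(\frac1{6L_f},\frac{75\tau}{24}\big)$,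 $0<\gamma\le\min\Big(\frac{\lambda\tau}{2L_f}\sqrt{\frac{6b/\tilde d}{36\lambda^2+625\kappa_y^2}},\frac{m^{1/3}}{2L_gk}\Big)$, $0<\mu_1\le\frac1{d_1(m+T)^{2/3}}$, $0<\mu_2\le\frac1{\tilde d^{1/2}d_2(m+T)^{2/3}}$. **Theorem.** (a) Under these assumptions $g$ is differentiable and $$\frac1T\sum_{t=1}^T\mathbb E\|\nabla g(x_t)\|\le\frac{\sqrt{2M'}\,m^{1/6}}{T^{1/2}}+\frac{\sqrt{2M'}}{T^{1/3}}+\frac{L_g}{2(m+T)^{2/3}},$$ where $$M'=\frac{g_{\mu_1}(x_1)-g^*}{\gamma k}+\frac{2\delta^2}{b\tau^2k\eta_0}+\frac{36\tau^2L_f^2+625L_f^4}{8b\tau^2}(m+T)^{-2/3}+\frac{9L_f^2}{4b\tau^2k^2}+\frac{2(c_1^2+c_2^2)\delta^2k^2}{b\tau^2}\ln(m+T).$$ If $b\le100\,d_1$ (in particular if $b=1$), the last term $\frac{L_g}{2(m+T)^{2/3}}$ may be replaced by $\frac{L_f}{2(m+T)^{2/3}}$. (b) Query complexity. For all $L_f,k>0$,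 $\delta$ and $\Delta$ there is a constant $C>0$ such that for all $d_1,d_2\ge1$, all $0<\tau\le L_f$, all $0<\lambda\le\min\big(\frac1{6L_f},\frac{75\tau}{24}\big)$ and all $\varepsilon\in(0,1]$ there are $T$ and admissible parameters (with the given $k,\lambda$ and with $b=1$) such that, for every problem as above with $g(x_1)-g^*\le\Delta$, one has $\frac1T\sum_{t=1}^T\mathbb E\|\nabla g(x_t)\|\le\varepsilon$, and the $T$ iterations use at most $$C\,\lambda^{-3/2}\,\kappa_y^3\,\tilde d^{\,3}\,\varepsilon^{-3}\Big(1+\ln\big(1+\tfrac{\kappa_y\tilde d}{\lambda\varepsilon}\big)\Big)^{3/2}$$ function values $f(\cdot,\cdot;\xi)$; that is, $\tilde O(\kappa_y^3\tilde d^3\varepsilon^{-3})$ for fixed $\lambda$. The same holds with $b=\lceil\tilde d^{3/5}\rceil$ and $\tilde d^{\,9/10}$ in place of $\tilde d^{\,3}$, that is, $\tilde O(\tilde d^{9/10}\kappa_y^3\varepsilon^{-3})$, for all $\varepsilon\in(0,1]$ with $\varepsilon\le\kappa_y\tilde d^{-3/10}$. -/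

import Mathlib

open MeasureTheory ProbabilityTheory

universe u v

noncomputable section

namespace AccZOMDA

/-- Euclidean space of dimension `d`, with the `ℓ²` norm. -/
abbrev E (d : ℕ) : Type := EuclideanSpace ℝ (Fin d)

/-- The uniform probability distribution on the unit sphere of `ℝ^d`, as a measure on `ℝ^d`
(normalized surface measure; `d ≥ 1`). -/
def unifSphere (d : ℕ) : Measure (E d) :=
  ((volume : Measure (E d)).toSphere Set.univ)⁻¹ •
    ((volume : Measure (E d)).toSphere.map Subtype.val)

/-- The smoothing `φ_μ(x) = 𝔼[φ(x + μ u)]` with `u` uniform on the closed unit ball. -/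
def smoothing {d : ℕ} (μ : ℝ) (φ : E d → ℝ) (x : E d) : ℝ :=
  ⨍ u in Metric.closedBall (0 : E d) 1, φ (x + μ • u)

open Classical in
/-- The projection onto `C`: a minimizer over `C` of the distance to `z`
(it exists and is unique when `C` is nonempty, closed and convex). -/
def proj {d : ℕ} (C : Set (E d)) (z : E d) : E d :=
  if h : ∃ p ∈ C, ∀ q ∈ C, ‖p - z‖ ≤ ‖q - z‖ then h.choose else z

/-- The data of a stochastic minimax problem
`min_{x ∈ ℝ^{d₁}} max_{y ∈ 𝒴} 𝔼_{ξ ∼ 𝒟} [loss x y ξ]`. -/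
structure Problem (d₁ d₂ : ℕ) (Ξ : Type u) [MeasurableSpace Ξ] where
  /-- the component function `f(x, y; ξ)` -/
  loss : E d₁ → E d₂ → Ξ → ℝ
  /-- the distribution `𝒟` of `ξ` -/
  law : Measure Ξ
  /-- the constraint set `𝒴` -/
  feasible : Set (E d₂)

namespace Problem

variable {d₁ d₂ : ℕ} {Ξ : Type u} [MeasurableSpace Ξ] (P : Problem d₁ d₂ Ξ)

/-- The objective `f(x, y) = 𝔼[f(x, y; ξ)]`. -/
def f (x : E d₁) (y : E d₂) : ℝ := ∫ ξ, P.loss x y ξ ∂P.law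

/-- The primal function `g(x) = max_{y ∈ 𝒴} f(x, y)`. -/
def g (x : E d₁) : ℝ := sSup (P.f x '' P.feasible)

/-- `g^* = inf_x g(x)`. -/
def gStar : ℝ := ⨅ x, P.g x

/-- The one-sample zeroth-order partial gradient in `x`:
`(f(x + μ₁ u, y; ξ) - f(x, y; ξ)) / (μ₁ / d₁) • u`. -/
def zoGradX (μ₁ : ℝ) (x : E d₁) (y : E d₂) (ξ : Ξ) (u : E d₁) : E d₁ :=
  ((P.loss (x + μ₁ • u) y ξ - P.loss x y ξ) / (μ₁ / d₁)) • u

/-- The one-sample zeroth-order partial gradient in `y`: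
`(f(x, y + μ₂ u; ξ) - f(x, y; ξ)) / (μ₂ / d₂) • u`. -/
def zoGradY (μ₂ : ℝ) (x : E d₁) (y : E d₂) (ξ : Ξ) (u : E d₂) : E d₂ :=
  ((P.loss x (y + μ₂ • u) ξ - P.loss x y ξ) / (μ₂ / d₂)) • u

/-- On `ℝ^{d₁} × U`, every component function is differentiable and its gradient
`(∇ₓ f(·,·;ξ), ∇_y f(·,·;ξ))` is `L`-Lipschitz for the Euclidean norm of the product; the
expectation defining `f` exists there. -/
structure IsSmoothOn (U : Set (E d₂)) (L : ℝ) : Prop where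
  measurable : ∀ x, ∀ y ∈ U, Measurable (P.loss x y)
  integrable : ∀ x, ∀ y ∈ U, Integrable (P.loss x y) P.law
  differentiable_x : ∀ ξ x, ∀ y ∈ U, DifferentiableAt ℝ (fun x' => P.loss x' y ξ) x
  differentiable_y : ∀ ξ x, ∀ y ∈ U, DifferentiableAt ℝ (fun y' => P.loss x y' ξ) y
  lipschitz : ∀ ξ x x', ∀ y ∈ U, ∀ y' ∈ U,
    ‖gradient (fun z => P.loss z y ξ) x - gradient (fun z => P.loss z y' ξ) x'‖ ^ 2
      + ‖gradient (fun z => P.loss x z ξ) y - gradient (fun z => P.loss x' z ξ) y'‖ ^ 2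
      ≤ L ^ 2 * (‖x - x'‖ ^ 2 + ‖y - y'‖ ^ 2)

/-- The standing assumptions. The zeroth-order estimator in `y` evaluates the component functions
at distance `μ₂` from `𝒴`, so smoothness is required on an open neighbourhood of the closed
`μ₂`-thickening of `𝒴`. -/
structure Assumptions (L τ δ μ₁ μ₂ : ℝ) : Prop where
  isProbabilityMeasure : IsProbabilityMeasure P.law
  isClosed : IsClosed P.feasible
  convex : Convex ℝ P.feasible
  smooth : ∃ U : Set (E d₂), IsOpen U ∧ Metric.cthickening μ₂ P.feasible ⊆ U ∧ P.IsSmoothOn U L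
  strongConcave : ∀ x, StrongConcaveOn P.feasible τ (P.f x)
  bddBelow : BddBelow (Set.range P.g)
  variance_x : ∀ x, ∀ y ∈ P.feasible,
    ∫⁻ q, ‖P.zoGradX μ₁ x y q.1 q.2
        - gradient (smoothing μ₁ (fun x' => P.f x' y)) x‖ₑ ^ 2 ∂(P.law.prod (unifSphere d₁))
      ≤ ENNReal.ofReal (δ ^ 2)
  variance_y : ∀ x, ∀ y ∈ P.feasible,
    ∫⁻ q, ‖P.zoGradY μ₂ x y q.1 q.2
        - gradient (smoothing μ₂ (fun y' => P.f x y')) y‖ₑ ^ 2 ∂(P.law.prod (unifSphere d₂))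
      ≤ ENNReal.ofReal (δ ^ 2)

end Problem

/-- The parameters of the algorithm; `lam` is the step size `λ` in `y`. -/
structure Params where
  γ : ℝ
  lam : ℝ
  k : ℝ
  m : ℝ
  c₁ : ℝ
  c₂ : ℝ
  μ₁ : ℝ
  μ₂ : ℝ

namespace Params

/-- `η_t = k / (m + t)^{1/3}`. -/
def eta (p : Params) (t : ℕ) : ℝ := p.k / (p.m + t) ^ (1 / 3 : ℝ)

/-- The conditions on the parameters, with `κ_y = L / τ` and `L_g = L + L² / τ`. -/
structure Admissible (p : Params) (d₁ d₂ b T : ℕ) (L τ : ℝ) : Prop where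
  one_le_b : 1 ≤ b
  b_le : b ≤ d₁ + d₂
  k_pos : 0 < p.k
  c₁_ge : 2 / (3 * p.k ^ 3) + 9 * τ ^ 2 / 4 ≤ p.c₁
  c₂_ge : 2 / (3 * p.k ^ 3) + 625 * (d₁ + d₂ : ℝ) * L ^ 2 / (3 * b) ≤ p.c₂
  m_ge_two : 2 ≤ p.m
  m_ge_k : p.k ^ 3 ≤ p.m
  m_ge_c₁ : (p.c₁ * p.k) ^ 3 ≤ p.m
  m_ge_c₂ : (p.c₂ * p.k) ^ 3 ≤ p.m
  lam_pos : 0 < p.lam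
  lam_le_L : p.lam ≤ 1 / (6 * L)
  lam_le_τ : p.lam ≤ 75 * τ / 24
  γ_pos : 0 < p.γ
  γ_le : p.γ ≤ p.lam * τ / (2 * L) *
    Real.sqrt (6 * b / (d₁ + d₂ : ℝ) / (36 * p.lam ^ 2 + 625 * (L / τ) ^ 2))
  γ_le_m : p.γ ≤ p.m ^ (1 / 3 : ℝ) / (2 * (L + L ^ 2 / τ) * p.k)
  μ₁_pos : 0 < p.μ₁
  μ₁_le : p.μ₁ ≤ 1 / (d₁ * (p.m + T) ^ (2 / 3 : ℝ))
  μ₂_pos : 0 < p.μ₂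
  μ₂_le : p.μ₂ ≤ 1 / ((d₁ + d₂ : ℝ) ^ (1 / 2 : ℝ) * d₂ * (p.m + T) ^ (2 / 3 : ℝ))

/-- The constant `M'`, where `gap` stands for `g_{μ₁}(x₁) - g^*`. -/
def M' (p : Params) (b T : ℕ) (L τ δ gap : ℝ) : ℝ :=
  gap / (p.γ * p.k)
    + 2 * δ ^ 2 / (b * τ ^ 2 * p.k * p.eta 0)
    + (36 * τ ^ 2 * L ^ 2 + 625 * L ^ 4) / (8 * b * τ ^ 2) * (p.m + T) ^ (-(2 / 3) : ℝ)
    + 9 * L ^ 2 / (4 * b * τ ^ 2 * p.k ^ 2)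
    + 2 * (p.c₁ ^ 2 + p.c₂ ^ 2) * δ ^ 2 * p.k ^ 2 / (b * τ ^ 2) * Real.log (p.m + T)

end Params

/-- The random input of one iteration: `b` triples `(ξ_i, û_i, ũ_i)`. -/
abbrev Batch (d₁ d₂ b : ℕ) (Ξ : Type u) : Type u := Fin b → Ξ × E d₁ × E d₂

/-- The state of the algorithm: the iterates `x_t, y_t`, the gradient estimators `v_t, w_t`, and
the number of function values queried so far. -/
structure State (d₁ d₂ : ℕ) where
  x : E d₁
  y : E d₂
  v : E d₁
  w : E d₂
  queries : ℕ

section Algorithm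

variable {d₁ d₂ b : ℕ} {Ξ : Type u} [MeasurableSpace Ξ] (P : Problem d₁ d₂ Ξ) (p : Params)

/-- The mini-batch zeroth-order partial gradient in `x`; it uses `2 * b` function values. -/
def batchGradX (x : E d₁) (y : E d₂) (B : Batch d₁ d₂ b Ξ) : E d₁ :=
  (1 / (b : ℝ)) • ∑ i, P.zoGradX p.μ₁ x y (B i).1 (B i).2.1

/-- The mini-batch zeroth-order partial gradient in `y`; it uses `2 * b` function values. -/
def batchGradY (x : E d₁) (y : E d₂) (B : Batch d₁ d₂ b Ξ) : E d₂ :=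
  (1 / (b : ℝ)) • ∑ i, P.zoGradY p.μ₂ x y (B i).1 (B i).2.2

/-- The initialization: two mini-batch estimators are evaluated. -/
def init (x₁ : E d₁) (y₁ : E d₂) (B : Batch d₁ d₂ b Ξ) : State d₁ d₂ where
  x := x₁
  y := y₁
  v := batchGradX P p x₁ y₁ B
  w := batchGradY P p x₁ y₁ B
  queries := 2 * (2 * b)

/-- Iteration `t` (for `𝒳 = ℝ^{d₁}`), from `(x_t, y_t, v_t, w_t)` to
`(x_{t+1}, y_{t+1}, v_{t+1}, w_{t+1})`, with the fresh batch `B`: four mini-batch estimators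
are evaluated. -/
def step (t : ℕ) (B : Batch d₁ d₂ b Ξ) (s : State d₁ d₂) : State d₁ d₂ :=
  let η := p.eta t
  let x' := s.x - (p.γ * η) • s.v
  let y' := s.y + η • (proj P.feasible (s.y + p.lam • s.w) - s.y)
  { x := x'
    y := y'
    v := batchGradX P p x' y' B + (1 - p.c₁ * η ^ 2) • (s.v - batchGradX P p s.x s.y B)
    w := batchGradY P p x' y' B + (1 - p.c₂ * η ^ 2) • (s.w - batchGradY P p s.x s.y B)
    queries := s.queries + 4 * (2 * b) }

/-- `run P p x₁ y₁ B n` is the state of the algorithm at time `t = n + 1`, i.e. after `n`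
iterations: it holds `x_{n+1}, y_{n+1}, v_{n+1}, w_{n+1}`. The batch `B n` is the one drawn for
time `n + 1`. -/
def run (x₁ : E d₁) (y₁ : E d₂) (B : ℕ → Batch d₁ d₂ b Ξ) : ℕ → State d₁ d₂
  | 0 => init P p x₁ y₁ (B 0)
  | n + 1 => step P p (n + 1) (B (n + 1)) (run x₁ y₁ B n)

variable {Ω : Type v} [MeasurableSpace Ω]

/-- All triples `(ξ_i, û_i, ũ_i)`, over all times and all `i`, are independent, and in each of them
`ξ_i ∼ 𝒟`, `û_i` and `ũ_i` (uniform on the unit spheres) are independent. -/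
structure IsSampling (Pr : Measure Ω) (Z : ℕ → Ω → Batch d₁ d₂ b Ξ) : Prop where
  measurable : ∀ n i, Measurable fun ω => Z n ω i
  indep : iIndepFun (fun (q : ℕ × Fin b) ω => Z q.1 ω q.2) Pr
  map_eq : ∀ n i, Pr.map (fun ω => Z n ω i) = P.law.prod ((unifSphere d₁).prod (unifSphere d₂))

/-- The norm `‖∇ g(x_{n+1})‖`, as a random variable. -/
def gradNorm (x₁ : E d₁) (y₁ : E d₂) (Z : ℕ → Ω → Batch d₁ d₂ b Ξ) (n : ℕ) (ω : Ω) : ℝ :=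
  ‖gradient P.g (run P p x₁ y₁ (fun j => Z j ω) n).x‖

/-- The average `(1/T) ∑_{t=1}^T 𝔼 ‖∇ g(x_t)‖`, that is, `𝔼 ‖∇ g(x_ζ)‖` for the output `x_ζ`. -/
def avgGradNorm (Pr : Measure Ω) (x₁ : E d₁) (y₁ : E d₂) (Z : ℕ → Ω → Batch d₁ d₂ b Ξ)
    (T : ℕ) : ℝ :=
  1 / (T : ℝ) * ∑ n ∈ Finset.range T, ∫ ω, gradNorm P p x₁ y₁ Z n ω ∂Pr

end Algorithm

/-- With mini-batch size `bs d̃` (where `d̃ = d₁ + d₂`), the algorithm finds an `ε`-stationary point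
with `Õ(κ_y³ d̃^a ε⁻³)` function queries, for all target accuracies `ε ≤ 1` with
`ε ≤ κ_y d̃^{-r}`. The constant `C` depends only on the smoothness constant `L`, the parameter
`k`, the noise level `δ` and the bound `Δ` on the initial gap. The dependence on the step-size
parameter `λ` is explicit. -/
def QueryComplexity (bs : ℕ → ℕ) (a r : ℝ) : Prop :=
  ∀ L k δ Δ : ℝ, 0 < L → 0 < k → ∃ C : ℝ, 0 < C ∧
    ∀ (d₁ d₂ : ℕ), 1 ≤ d₁ → 1 ≤ d₂ →
    ∀ τ lam : ℝ, 0 < τ → τ ≤ L → 0 < lam → lam ≤ 1 / (6 * L) → lam ≤ 75 * τ / 24 →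
    ∀ ε : ℝ, 0 < ε → ε ≤ 1 → ε ≤ L / τ * (d₁ + d₂ : ℝ) ^ (-r) →
    ∃ (T : ℕ) (p : Params), 1 ≤ T ∧ p.k = k ∧ p.lam = lam ∧
      p.Admissible d₁ d₂ (bs (d₁ + d₂)) T L τ ∧
      ∀ (Ξ : Type u) [MeasurableSpace Ξ] (P : Problem d₁ d₂ Ξ), P.Assumptions L τ δ p.μ₁ p.μ₂ →
      ∀ (x₁ : E d₁) (y₁ : E d₂), y₁ ∈ P.feasible → IsMaxOn (P.f x₁) P.feasible y₁ →
        P.g x₁ - P.gStar ≤ Δ →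
      ∀ (Ω : Type v) [MeasurableSpace Ω] (Pr : Measure Ω) [IsProbabilityMeasure Pr]
        (Z : ℕ → Ω → Batch d₁ d₂ (bs (d₁ + d₂)) Ξ), IsSampling P Pr Z →
        avgGradNorm P p Pr x₁ y₁ Z T ≤ ε ∧
        ∀ ω, ((run P p x₁ y₁ (fun j => Z j ω) T).queries : ℝ) ≤
          C * lam ^ (-(3 / 2) : ℝ) * ((L / τ) ^ 3 * (d₁ + d₂ : ℝ) ^ a * ε ^ (-3 : ℝ)) *
            (1 + Real.log (1 + L / τ * (d₁ + d₂ : ℝ) / (lam * ε))) ^ (3 / 2 : ℝ)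

end AccZOMDA

end

open AccZOMDA

/-! ### Polar coordinates and the divergence theorem on the unit ball. -/

namespace AccZOMDA
open Set Metric Filter Topology
open scoped RealInnerProductSpace ENNReal

/-! The convergence bound is a Lyapunov argument. The Lyapunov function is a potential of `x_t`
(either `g - g*` or its smoothing), plus a fixed multiple of `‖y_t - y*(x_t)‖²`, plus multiples of
order `1 / η_t` of the squared errors of `v_t` and `w_t` as estimates of the smoothed partial
gradients. Three one-step facts feed it. A step in `x` along `v` lowers the potential by `γη/2`
times the squared gradient, at the price of the error of `v` and of the distance from `y` to `y*(x)`
(`descent_g`, `descent_smoothing`). A projected ascent step contracts towards the maximizer by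
strong concavity, up to the error of `w` and the motion of the maximizer, which is `L/τ`-Lipschitz
in `x` (`gapY_next_le`). The recursive momentum contracts the estimation errors by `1 - cη²`, up to
the variance of a batch mean and the mean-square change of the one-sample estimators
(`lintegral_momentum_sub_le`). The weights are balanced so that the sum decreases
(`lyapunov_decrease`); telescoping over time and summing powers of `m + t` bounds the weighted sum
of the expected squared gradients.

The input about random directions is Stein's identity on the sphere. It makes the estimators
unbiased for the gradients of the smoothed functions, and it gives `𝔼⟪e, u⟫² = ‖e‖²/d`, which turns
the factor `d²` of a naive bound on the change of the estimators into `d`. Since the losses are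
controlled only near the feasible set, measurability is proved for a retracted copy of the problem,
whose algorithm agrees almost surely with the given one. Expectations are first handled as lower
integrals, so that integrability is a conclusion of the estimates.

The stated constants need three regimes. If `L < τ`, the feasible set is a single point, the
maximizer does not move, and the smoothed potential has exactly the gradient that is estimated. If
`τ ≤ L` and `b ≤ 100 d₁`, the smoothed potential still works: the bias due to the moving maximizer
carries a factor `1/(d₁+1)²`, which is of order `1/b` and fits into `M'`. For general batches and `τ
≤ L` the potential is `g` itself. Its initial value exceeds the smoothed gap and its bias is not of
order `1/b`, so the telescoped bound on the mean square gradient is interpolated with the bound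
obtained from `‖∇g‖² ≤ 2K(g - g*)` (`sqrt_le_of_two_bounds`); the loss is exactly the larger final
term with `L_g`.

For the query complexity, all parameters are powers of `ρ = d̃/b` times constants, with `m` of order
`ρ³`. Then `M'` is at most a constant times `κ²/λ` times a dimension factor and a logarithm of `m +
T`, and `T` is the cube of the scale at which the bound drops below `ε`. The logarithm contains `T`,
but it costs only a factor linear in the constant that defines the scale, while the other side gains
a square (`exists_scale`). -/

/-- The surface measure of the unit sphere. -/
noncomputable abbrev surf (d : ℕ) : Measure (sphere (0 : E d) 1) := (volume : Measure (E d)).toSphere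

theorem nontrivial_E {d : ℕ} (hd : 1 ≤ d) : Nontrivial (E d) := by
  have : Nonempty (Fin d) := ⟨⟨0, hd⟩⟩
  infer_instance

/-- Integration in polar coordinates. -/
theorem integral_polar {d : ℕ} (hd : 1 ≤ d) {F : E d → ℝ} (hF : Integrable F) :
    ∫ x, F x = ∫ r in Ioi (0 : ℝ), r ^ (d - 1) * ∫ u, F (r • (u : E d)) ∂(surf d) := by
  have := nontrivial_E hd
  have hmp := (volume : Measure (E d)).measurePreserving_homeomorphUnitSphereProd
  have hdim : Module.finrank ℝ (E d) = d := by simp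
  have hcomp : ∀ x : ({(0)}ᶜ : Set (E d)),
      F x = (fun q : sphere (0 : E d) 1 × Ioi (0 : ℝ) => F ((q.2 : ℝ) • (q.1 : E d)))
        (homeomorphUnitSphereProd (E d) x) := by
    intro x
    have : ((homeomorphUnitSphereProd (E d)).symm (homeomorphUnitSphereProd (E d) x) : E d) = x := by
      rw [Homeomorph.symm_apply_apply]
    rw [homeomorphUnitSphereProd_symm_apply_coe] at this
    simp only [this]
  have hint : Integrable (fun q : sphere (0 : E d) 1 × Ioi (0 : ℝ) => F ((q.2 : ℝ) • (q.1 : E d)))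
      ((surf d).prod (Measure.volumeIoiPow (Module.finrank ℝ (E d) - 1))) := by
    rw [← hmp.integrable_comp_emb (Homeomorph.measurableEmbedding _)]
    have : ((fun q : sphere (0 : E d) 1 × Ioi (0 : ℝ) => F ((q.2 : ℝ) • (q.1 : E d))) ∘
        homeomorphUnitSphereProd (E d)) = F ∘ Subtype.val := by
      funext x; exact (hcomp x).symm
    rw [this, ← integrableOn_iff_comap_subtypeVal (measurableSet_singleton _).compl,
      IntegrableOn, restrict_compl_singleton]
    exact hF
  calc ∫ x, F x = ∫ x : ({(0)}ᶜ : Set (E d)), F x ∂((volume : Measure (E d)).comap (↑)) := by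
        rw [integral_subtype_comap (measurableSet_singleton _).compl F, restrict_compl_singleton]
    _ = ∫ q, F ((q.2 : ℝ) • (q.1 : E d))
          ∂((surf d).prod (Measure.volumeIoiPow (Module.finrank ℝ (E d) - 1))) := by
        rw [← hmp.integral_comp (Homeomorph.measurableEmbedding _)]
        exact integral_congr_ae (Eventually.of_forall hcomp)
    _ = ∫ r : Ioi (0 : ℝ), ∫ u, F ((r : ℝ) • (u : E d)) ∂(surf d)
          ∂(Measure.volumeIoiPow (Module.finrank ℝ (E d) - 1)) := integral_prod_symm _ hint
    _ = _ := by
      simp only [Measure.volumeIoiPow, ENNReal.ofReal, hdim]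
      rw [integral_withDensity_eq_integral_smul,
        integral_subtype_comap measurableSet_Ioi
          fun a ↦ Real.toNNReal (a ^ (d - 1)) • ∫ u, F (a • (u : E d)) ∂(surf d),
        setIntegral_congr_fun measurableSet_Ioi fun x hx ↦ ?_]
      · simp only [NNReal.smul_def, Real.coe_toNNReal _ (pow_nonneg (mem_Ioi.1 hx).le _), smul_eq_mul]
      · exact (measurable_subtype_coe.pow_const _).real_toNNReal

/-- Squaring flattens the kink of the positive part, so the cutoff in the integration by parts is
differentiable everywhere. -/
theorem hasDerivAt_max_sq (t : ℝ) : HasDerivAt (fun t : ℝ => (max t 0) ^ 2) (2 * max t 0) t := by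
  rcases lt_trichotomy t 0 with h | h | h
  · have : (fun t : ℝ => (max t 0) ^ 2) =ᶠ[𝓝 t] fun _ => 0 := by
      filter_upwards [eventually_lt_nhds h] with s hs
      simp [max_eq_right hs.le]
    rw [max_eq_right h.le, mul_zero]
    exact (hasDerivAt_const t (0 : ℝ)).congr_of_eventuallyEq this
  · subst h
    rw [hasDerivAt_iff_isLittleO]
    simp only [max_self, ne_eq, OfNat.ofNat_ne_zero, not_false_eq_true, zero_pow, sub_zero,
      mul_zero, smul_zero]
    have h1 : (fun x : ℝ => x ^ 2) =o[𝓝 0] fun x => x := by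
      simpa using Asymptotics.isLittleO_pow_pow (𝕜 := ℝ) (m := 1) (n := 2) (by norm_num)
    refine Asymptotics.IsBigO.trans_isLittleO ?_ h1
    refine Asymptotics.IsBigO.of_bound 1 (Eventually.of_forall fun x => ?_)
    rw [one_mul, Real.norm_eq_abs, Real.norm_eq_abs, abs_pow, abs_pow, sq_le_sq]
    simp only [abs_abs]
    rcases le_total x 0 with h | h
    · rw [max_eq_right h]; simp
    · rw [max_eq_left h]
  · have : (fun t : ℝ => (max t 0) ^ 2) =ᶠ[𝓝 t] fun t => t ^ 2 := by
      filter_upwards [eventually_gt_nhds h] with s hs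
      rw [max_eq_left hs.le]
    rw [max_eq_left h.le]
    exact (by simpa using hasDerivAt_pow 2 t : HasDerivAt (fun t : ℝ => t ^ 2) (2 * t) t).congr_of_eventuallyEq this

/-- Integration by parts against the cutoff `((r² - ‖x‖²)₊)²`. -/
theorem integral_cutoff_parts {d : ℕ} {φ : E d → ℝ} (hφ : ContDiff ℝ 1 φ) (e : E d) (r : ℝ) :
    ∫ x, fderiv ℝ φ x e * (max (r ^ 2 - ‖x‖ ^ 2) 0) ^ 2
      = ∫ x, φ x * (4 * ⟪x, e⟫ * max (r ^ 2 - ‖x‖ ^ 2) 0) := by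
  set χ : E d → ℝ := fun x => (max (r ^ 2 - ‖x‖ ^ 2) 0) ^ 2 with hχ
  have hder : ∀ x, HasFDerivAt χ ((2 * max (r ^ 2 - ‖x‖ ^ 2) 0) • (-((2 : ℝ) • innerSL ℝ x) : E d →L[ℝ] ℝ)) x := by
    intro x
    have h1 : HasFDerivAt (fun x : E d => r ^ 2 - ‖x‖ ^ 2) (-((2 : ℝ) • innerSL ℝ x)) x := by
      have := (hasStrictFDerivAt_norm_sq x).hasFDerivAt.const_sub (r ^ 2)
      rwa [← Nat.cast_smul_eq_nsmul ℝ] at this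
    exact (hasDerivAt_max_sq _).comp_hasFDerivAt x h1
  have hfd : ∀ x, fderiv ℝ χ x e = -(4 * ⟪x, e⟫ * max (r ^ 2 - ‖x‖ ^ 2) 0) := by
    intro x
    rw [(hder x).fderiv]
    simp [two_smul]
    ring
  have hzero : ∀ x : E d, x ∉ closedBall (0 : E d) |r| → max (r ^ 2 - ‖x‖ ^ 2) 0 = 0 := by
    intro x hx
    rw [mem_closedBall_zero_iff, not_le] at hx
    refine max_eq_right (sub_nonpos.2 ?_)
    rw [← sq_abs r]
    exact pow_le_pow_left₀ (abs_nonneg r) hx.le 2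
  have hcs : ∀ g : E d → ℝ, Continuous g → (∀ x, x ∉ closedBall (0 : E d) |r| → g x = 0) →
      Integrable g := fun g hg h0 =>
    hg.integrable_of_hasCompactSupport
      (HasCompactSupport.intro (isCompact_closedBall (0 : E d) |r|) h0)
  have hcφ := hφ.continuous
  have hcφ' : Continuous fun x => fderiv ℝ φ x e :=
    (hφ.continuous_fderiv (by norm_num)).clm_apply continuous_const
  have key := integral_mul_fderiv_eq_neg_fderiv_mul_of_integrable (μ := (volume : Measure (E d)))
    (f := φ) (g := χ) (v := e) ?_ ?_ ?_
    (fun x _ => hφ.differentiable (by norm_num) x) (fun x _ => (hder x).differentiableAt)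
  · simp only [hfd] at key
    simp only [mul_neg] at key
    rw [integral_neg] at key
    exact (neg_injective key).symm
  · exact hcs _ (by simp only [hχ]; fun_prop) fun x hx => by simp only [hχ, hzero x hx]; simp
  · refine hcs _ (by simp only [hfd]; fun_prop) fun x hx => by rw [hfd, hzero x hx]; simp
  · exact hcs _ (by simp only [hχ]; fun_prop) fun x hx => by simp only [hχ, hzero x hx]; simp

/-- Expanded in powers of `r`, both sides are combinations of moments of `H` and `G` over `[0, r]`.
The cutoff vanishes at `s = r`, so differentiating in `r` produces no boundary terms on the left;
cancelling `4r`, differentiating again and cancelling `2r` removes the cutoff and leaves the sharp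
identity. -/
theorem eq_integral_of_cutoff_identity {G H : ℝ → ℝ} (hG : Continuous G) (hH : Continuous H)
    (h : ∀ r : ℝ, 0 < r → ∫ s in (0 : ℝ)..r, (r ^ 2 - s ^ 2) ^ 2 * H s
      = ∫ s in (0 : ℝ)..r, 4 * s * (r ^ 2 - s ^ 2) * G s) {r : ℝ} (hr : 0 < r) :
    ∫ s in (0 : ℝ)..r, H s = G r := by
  have FTC : ∀ {f : ℝ → ℝ}, Continuous f → ∀ r, HasDerivAt (fun r => ∫ s in (0 : ℝ)..r, f s) (f r) r :=
    fun hf r => intervalIntegral.integral_hasDerivAt_right (hf.intervalIntegrable _ _)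
      hf.aestronglyMeasurable.stronglyMeasurableAtFilter hf.continuousAt
  have ii : ∀ {f : ℝ → ℝ} (r : ℝ), Continuous f → IntervalIntegrable f volume 0 r :=
    fun r hf => hf.intervalIntegrable _ _
  set K0 : ℝ → ℝ := fun r => ∫ s in (0 : ℝ)..r, H s with hK0
  set K2 : ℝ → ℝ := fun r => ∫ s in (0 : ℝ)..r, s ^ 2 * H s with hK2
  set K4 : ℝ → ℝ := fun r => ∫ s in (0 : ℝ)..r, s ^ 4 * H s with hK4
  set L1 : ℝ → ℝ := fun r => ∫ s in (0 : ℝ)..r, s * G s with hL1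
  set L3 : ℝ → ℝ := fun r => ∫ s in (0 : ℝ)..r, s ^ 3 * G s with hL3
  have dK0 : ∀ r, HasDerivAt K0 (H r) r := FTC hH
  have dK2 : ∀ r, HasDerivAt K2 (r ^ 2 * H r) r := FTC (by fun_prop)
  have dK4 : ∀ r, HasDerivAt K4 (r ^ 4 * H r) r := FTC (by fun_prop)
  have dL1 : ∀ r, HasDerivAt L1 (r * G r) r := FTC (by fun_prop)
  have dL3 : ∀ r, HasDerivAt L3 (r ^ 3 * G r) r := FTC (by fun_prop)
  have h1 : ∀ r, 0 < r → r ^ 4 * K0 r - 2 * r ^ 2 * K2 r + K4 r = 4 * r ^ 2 * L1 r - 4 * L3 r := by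
    intro r hr
    have := h r hr
    have e1 : ∫ s in (0 : ℝ)..r, (r ^ 2 - s ^ 2) ^ 2 * H s
        = r ^ 4 * K0 r - 2 * r ^ 2 * K2 r + K4 r := by
      simp only [hK0, hK2, hK4]
      rw [← intervalIntegral.integral_const_mul, ← intervalIntegral.integral_const_mul,
        ← intervalIntegral.integral_sub (ii r (by fun_prop)) (ii r (by fun_prop)),
        ← intervalIntegral.integral_add (ii r (by fun_prop)) (ii r (by fun_prop))]
      congr 1; funext s; ring
    have e2 : ∫ s in (0 : ℝ)..r, 4 * s * (r ^ 2 - s ^ 2) * G s = 4 * r ^ 2 * L1 r - 4 * L3 r := by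
      simp only [hL1, hL3]
      rw [← intervalIntegral.integral_const_mul, ← intervalIntegral.integral_const_mul,
        ← intervalIntegral.integral_sub (ii r (by fun_prop)) (ii r (by fun_prop))]
      congr 1; funext s; ring
    rw [← e1, ← e2, this]
  have step : ∀ {f g f' g' : ℝ → ℝ}, (∀ r, 0 < r → f r = g r) → (∀ r, HasDerivAt f (f' r) r) →
      (∀ r, HasDerivAt g (g' r) r) → ∀ r, 0 < r → f' r = g' r := by
    intro f g f' g' hfg hf hg r hr
    have : f =ᶠ[𝓝 r] g := by
      filter_upwards [eventually_gt_nhds hr] with s hs using hfg s hs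
    exact (hf r).unique ((hg r).congr_of_eventuallyEq this)
  have h2 : ∀ r, 0 < r → r ^ 2 * K0 r - K2 r = 2 * L1 r := by
    intro r hr
    have := step h1
      (fun r => (((hasDerivAt_pow 4 r).mul (dK0 r)).sub
        (((hasDerivAt_pow 2 r).const_mul 2).mul (dK2 r))).add (dK4 r))
      (fun r => ((((hasDerivAt_pow 2 r).const_mul 4).mul (dL1 r))).sub ((dL3 r).const_mul 4)) r hr
    simp only [Nat.cast_ofNat, Nat.add_one_sub_one, pow_one] at this
    have h3 : 4 * r * (r ^ 2 * K0 r - K2 r) = 4 * r * (2 * L1 r) := by linear_combination this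
    exact mul_left_cancel₀ (by positivity) h3
  have := step h2 (fun r => ((hasDerivAt_pow 2 r).mul (dK0 r)).sub (dK2 r))
      (fun r => (dL1 r).const_mul 2) r hr
  simp only [Nat.cast_ofNat, Nat.add_one_sub_one, pow_one] at this
  have h3 : 2 * r * K0 r = 2 * r * G r := by linear_combination this
  exact mul_left_cancel₀ (by positivity) h3

/-- The divergence theorem for the unit ball. -/
theorem integral_ball_fderiv {d : ℕ} (hd : 1 ≤ d) {φ : E d → ℝ} (hφ : ContDiff ℝ 1 φ) (e : E d) :
    ∫ x in closedBall (0 : E d) 1, fderiv ℝ φ x e = ∫ u, φ (u : E d) * ⟪(u : E d), e⟫ ∂(surf d) := by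
  have hcφ := hφ.continuous
  have hcφ' : Continuous fun x => fderiv ℝ φ x e :=
    (hφ.continuous_fderiv (by norm_num)).clm_apply continuous_const
  have : CompactSpace (sphere (0 : E d) 1) := isCompact_iff_compactSpace.1 (isCompact_sphere _ _)
  have par : ∀ ψ : E d → ℝ, Continuous ψ →
      Continuous fun s : ℝ => ∫ u, ψ (s • (u : E d)) ∂(surf d) := by
    intro ψ hψ
    have : Continuous (Function.uncurry fun (s : ℝ) (u : sphere (0 : E d) 1) =>
        ψ (s • (u : E d))) := by
      simp only [Function.uncurry_def]; fun_prop
    exact (continuous_parametric_integral_of_continuous (μ := surf d) this isCompact_univ).congr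
      fun s => by simp
  set A : ℝ → ℝ := fun s => ∫ u, φ (s • (u : E d)) * ⟪(u : E d), e⟫ ∂(surf d) with hA
  set B : ℝ → ℝ := fun s => ∫ u, fderiv ℝ φ (s • (u : E d)) e ∂(surf d) with hB
  have cA : Continuous A := by
    have : Continuous (Function.uncurry fun (s : ℝ) (u : sphere (0 : E d) 1) =>
        φ (s • (u : E d)) * ⟪(u : E d), e⟫) := by
      simp only [Function.uncurry_def]; fun_prop
    exact (continuous_parametric_integral_of_continuous (μ := surf d) this isCompact_univ).congr
      fun s => by simp [hA]
  have cB : Continuous B := par _ hcφ'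
  have hns : ∀ (s : ℝ) (u : sphere (0 : E d) 1), ‖s • (u : E d)‖ ^ 2 = s ^ 2 := by
    intro s u
    rw [norm_smul, norm_eq_of_mem_sphere u, mul_one, Real.norm_eq_abs, sq_abs]
  have toInt : ∀ (f : ℝ → ℝ) (r : ℝ), 0 < r → (∀ s, r < s → f s = 0) →
      ∫ s in Ioi (0 : ℝ), f s = ∫ s in (0 : ℝ)..r, f s := by
    intro f r hr h0
    rw [intervalIntegral.integral_of_le hr.le]
    refine (setIntegral_eq_of_subset_of_forall_sdiff_eq_zero measurableSet_Ioi
      Ioc_subset_Ioi_self fun x hx => h0 x ?_)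
    by_contra hxr
    exact hx.2 ⟨hx.1, not_lt.1 hxr⟩
  have hzero : ∀ {r : ℝ}, 0 < r → ∀ x : E d, x ∉ closedBall (0 : E d) r →
      max (r ^ 2 - ‖x‖ ^ 2) 0 = 0 := by
    intro r hr x hx
    rw [mem_closedBall_zero_iff, not_le] at hx
    refine max_eq_right (sub_nonpos.2 ?_)
    exact pow_le_pow_left₀ hr.le hx.le 2
  -- The cutoff identity in polar coordinates; the factor `s` on the right comes from `⟪s u, e⟫`.
  have hid : ∀ r : ℝ, 0 < r → ∫ s in (0 : ℝ)..r, (r ^ 2 - s ^ 2) ^ 2 * (s ^ (d - 1) * B s)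
      = ∫ s in (0 : ℝ)..r, 4 * s * (r ^ 2 - s ^ 2) * (s ^ (d - 1) * A s) := by
    intro r hr
    have hcs : ∀ g : E d → ℝ, Continuous g → (∀ x, x ∉ closedBall (0 : E d) r → g x = 0) →
        Integrable g := fun g hg h0 =>
      hg.integrable_of_hasCompactSupport
        (HasCompactSupport.intro (isCompact_closedBall (0 : E d) r) h0)
    have h := integral_cutoff_parts hφ e r
    rw [integral_polar hd, integral_polar hd] at h
    rotate_left
    · exact hcs _ (by fun_prop) fun x hx => by rw [hzero hr x hx]; simp
    · exact hcs _ (by fun_prop) fun x hx => by rw [hzero hr x hx]; simp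
    simp only [hns] at h
    have hmax : ∀ s : ℝ, r < s → max (r ^ 2 - s ^ 2) 0 = 0 := fun s hs =>
      max_eq_right (sub_nonpos.2 (pow_le_pow_left₀ hr.le hs.le 2))
    rw [toInt _ r hr (fun s hs => by simp [hmax s hs]),
      toInt _ r hr (fun s hs => by simp [hmax s hs])] at h
    have hmax' : ∀ s ∈ uIcc 0 r, max (r ^ 2 - s ^ 2) 0 = r ^ 2 - s ^ 2 := by
      intro s hs
      rw [uIcc_of_le hr.le] at hs
      exact max_eq_left (sub_nonneg.2 (pow_le_pow_left₀ hs.1 hs.2 2))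
    refine (intervalIntegral.integral_congr fun s hs => ?_).trans
      (h.trans (intervalIntegral.integral_congr fun s hs => ?_))
    · simp only [hmax' s hs, integral_mul_const, hB]; ring
    · simp only [hmax' s hs, hA, real_inner_smul_left]
      rw [← integral_const_mul, ← integral_const_mul, ← integral_const_mul]
      refine integral_congr_ae (Eventually.of_forall fun u => ?_)
      simp only; ring
  have hfin := eq_integral_of_cutoff_identity (G := fun s => s ^ (d - 1) * A s)
    (H := fun s => s ^ (d - 1) * B s) (by fun_prop) (by fun_prop) hid one_pos
  have hball : ∫ x in closedBall (0 : E d) 1, fderiv ℝ φ x e = ∫ s in (0 : ℝ)..1, s ^ (d - 1) * B s := by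
    rw [← integral_indicator measurableSet_closedBall, integral_polar hd]
    · rw [toInt _ 1 one_pos]
      · refine intervalIntegral.integral_congr fun s hs => ?_
        rw [uIcc_of_le zero_le_one] at hs
        simp only [hB]
        congr 1
        refine integral_congr_ae (Eventually.of_forall fun u => ?_)
        refine indicator_of_mem ?_ _
        rw [mem_closedBall_zero_iff, norm_smul, norm_eq_of_mem_sphere u, mul_one,
          Real.norm_eq_abs, abs_of_nonneg hs.1]
        exact hs.2
      · intro s hs
        have : ∀ u : sphere (0 : E d) 1, (closedBall (0 : E d) 1).indicator
            (fun x => fderiv ℝ φ x e) (s • (u : E d)) = 0 := by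
          intro u
          refine indicator_of_notMem ?_ _
          rw [mem_closedBall_zero_iff, norm_smul, norm_eq_of_mem_sphere u, mul_one,
            Real.norm_eq_abs, abs_of_pos (by linarith)]
          exact not_le.2 hs
        simp [this]
    · rw [integrable_indicator_iff measurableSet_closedBall]
      exact hcφ'.continuousOn.integrableOn_compact (isCompact_closedBall _ _)
  rw [hball, hfin]
  simp [hA]

end AccZOMDA

/-! ### Quadratic Taylor bounds and moments of the uniform laws. -/

namespace AccZOMDA
open Set Metric Filter Topology
open scoped RealInnerProductSpace ENNReal

/-- Along the segment, the derivative of the remainder is dominated by that of `L/2 ‖h‖² t²`. The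
gradient is compared only with its value at the base point. -/
theorem abs_sub_sub_inner_gradient_le {d : ℕ} {φ : E d → ℝ} {s : Set (E d)} (hs : Convex ℝ s)
    {L : ℝ} {x z : E d} (hx : x ∈ s) (hz : z ∈ s) (hφ : ∀ y ∈ s, DifferentiableAt ℝ φ y)
    (hL : ∀ y ∈ s, ‖gradient φ y - gradient φ x‖ ≤ L * ‖y - x‖) :
    |φ z - φ x - ⟪gradient φ x, z - x⟫| ≤ L / 2 * ‖z - x‖ ^ 2 := by
  set h := z - x with hh
  have hmem : ∀ t ∈ Icc (0 : ℝ) 1, x + t • h ∈ s := fun t ht => by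
    have := hs.add_smul_sub_mem hx hz ht
    simpa [hh] using this
  have hd : ∀ t ∈ Icc (0 : ℝ) 1, HasDerivAt (fun t : ℝ => φ (x + t • h) - φ x - t * ⟪gradient φ x, h⟫)
      (⟪gradient φ (x + t • h) - gradient φ x, h⟫) t := by
    intro t ht
    have h1 := (hφ _ (hmem t ht)).hasGradientAt.hasFDerivAt
    have h2 : HasDerivAt (fun t : ℝ => x + t • h) h t := by
      simpa using ((hasDerivAt_id t).smul_const h).const_add x
    have h3 := (h1.comp_hasDerivAt t h2).sub_const (φ x)
    have h4 := h3.sub ((hasDerivAt_id t).mul_const ⟪gradient φ x, h⟫)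
    simp only [InnerProductSpace.toDual_apply_apply, one_mul, ← inner_sub_left] at h4
    exact h4
  have key := image_norm_le_of_norm_deriv_right_le_deriv_boundary (a := (0 : ℝ)) (b := 1)
    (f := fun t : ℝ => φ (x + t • h) - φ x - t * ⟪gradient φ x, h⟫)
    (f' := fun t => ⟪gradient φ (x + t • h) - gradient φ x, h⟫)
    (B := fun t => L / 2 * ‖h‖ ^ 2 * t ^ 2) (B' := fun t => L * ‖h‖ ^ 2 * t)
    (fun t ht => (hd t ht).continuousAt.continuousWithinAt)
    (fun t ht => (hd t (Ico_subset_Icc_self ht)).hasDerivWithinAt) (by simp)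
    (fun t => by
      have := (hasDerivAt_pow 2 t).const_mul (L / 2 * ‖h‖ ^ 2)
      refine this.congr_deriv ?_
      simp; ring)
    (fun t ht => by
      have := hL _ (hmem t (Ico_subset_Icc_self ht))
      rw [add_sub_cancel_left, norm_smul, Real.norm_eq_abs, abs_of_nonneg ht.1] at this
      calc ‖⟪gradient φ (x + t • h) - gradient φ x, h⟫‖
          ≤ ‖gradient φ (x + t • h) - gradient φ x‖ * ‖h‖ := norm_inner_le_norm _ _
        _ ≤ (L * (t * ‖h‖)) * ‖h‖ := by gcongr
        _ = L * ‖h‖ ^ 2 * t := by ring) (right_mem_Icc.2 zero_le_one)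
  simpa [hh, Real.norm_eq_abs] using key

/-- The converse of the Taylor bound: a quadratic error certifies the gradient. The gradients of
smoothings, of maxima and of expectations are all found this way, because a quadratic error survives
averaging and comparison. -/
theorem hasGradientAt_of_abs_le_sq {d : ℕ} {φ : E d → ℝ} {x v : E d} {C r : ℝ} (hr : 0 < r)
    (h : ∀ z, ‖z - x‖ < r → |φ z - φ x - ⟪v, z - x⟫| ≤ C * ‖z - x‖ ^ 2) : HasGradientAt φ v x := by
  rw [hasGradientAt_iff_isLittleO]
  have h1 : (fun z => ‖z - x‖ ^ 2) =o[𝓝 x] fun z => z - x := by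
    have := Asymptotics.isLittleO_norm_pow_id (E' := E d) (n := 2) (by norm_num)
    have ht : Tendsto (fun z : E d => z - x) (𝓝 x) (𝓝 0) := by
      have : Continuous fun z : E d => z - x := by fun_prop
      simpa using this.tendsto x
    exact this.comp_tendsto ht
  refine Asymptotics.IsBigO.trans_isLittleO (Asymptotics.IsBigO.of_bound C ?_) h1
  filter_upwards [ball_mem_nhds x hr] with z hz
  rw [mem_ball_iff_norm] at hz
  simpa [Real.norm_eq_abs] using h z hz

/-! ### The uniform distribution on the sphere -/

theorem isProbabilityMeasure_unifSphere {d : ℕ} (hd : 1 ≤ d) : IsProbabilityMeasure (unifSphere d) := by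
  have := nontrivial_E hd
  constructor
  rw [unifSphere, Measure.smul_apply, Measure.map_apply measurable_subtype_coe MeasurableSet.univ,
    preimage_univ, smul_eq_mul]
  refine ENNReal.inv_mul_cancel ?_ (measure_ne_top _ _)
  rw [Ne, Measure.measure_univ_eq_zero]
  exact Measure.toSphere_ne_zero _

theorem ae_norm_eq_one_unifSphere (d : ℕ) : ∀ᵐ u ∂(unifSphere d), ‖u‖ = 1 := by
  refine Measure.ae_smul_measure ?_ _
  rw [ae_map_iff measurable_subtype_coe.aemeasurable (measurableSet_eq_fun (by fun_prop) (by fun_prop))]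
  exact Eventually.of_forall fun u => norm_eq_of_mem_sphere u

theorem integral_unifSphere {d : ℕ} (hd : 1 ≤ d) (F : E d → ℝ) :
    ∫ u, F u ∂(unifSphere d) = (d * volume.real (closedBall (0 : E d) 1))⁻¹ * ∫ u, F (u : E d) ∂(surf d) := by
  have := nontrivial_E hd
  rw [unifSphere, integral_smul_measure,
    (MeasurableEmbedding.subtype_coe isClosed_sphere.measurableSet).integral_map]
  rw [Measure.toSphere_apply_univ, ENNReal.toReal_inv, ENNReal.toReal_mul, smul_eq_mul,
    finrank_euclideanSpace_fin, ENNReal.toReal_natCast, Measure.addHaar_real_closedBall_eq_addHaar_real_ball]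
  rfl

theorem volume_closedBall_pos (d : ℕ) : 0 < volume.real (closedBall (0 : E d) 1) := by
  rw [measureReal_def, ENNReal.toReal_pos_iff]
  exact ⟨measure_closedBall_pos _ _ one_pos, measure_closedBall_lt_top⟩

/-- Stein's identity: sphere averages of `φ(u) u` are ball averages of the gradient. -/
theorem integral_unifSphere_mul_inner {d : ℕ} (hd : 1 ≤ d) {φ : E d → ℝ} (hφ : ContDiff ℝ 1 φ)
    (e : E d) :
    d * ∫ u, φ u * ⟪u, e⟫ ∂(unifSphere d) = ⨍ u in closedBall (0 : E d) 1, fderiv ℝ φ u e := by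
  rw [integral_unifSphere hd, setAverage_eq, ← integral_ball_fderiv hd hφ e, smul_eq_mul, mul_inv,
    ← mul_assoc, ← mul_assoc, mul_inv_cancel₀ (by positivity), one_mul]

theorem integral_inner_unifSphere {d : ℕ} (hd : 1 ≤ d) (e : E d) :
    ∫ u, ⟪u, e⟫ ∂(unifSphere d) = 0 := by
  have h := integral_unifSphere_mul_inner hd (contDiff_const (c := (1 : ℝ))) e
  have hc : ∀ u, fderiv ℝ (fun _ : E d => (1 : ℝ)) u e = 0 := fun u => by simp
  simp only [one_mul, hc] at h
  rw [setAverage_eq, integral_zero, smul_zero] at h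
  have : (d : ℝ) ≠ 0 := by positivity
  exact (mul_eq_zero.1 h).resolve_left this

/-- Stein's identity for a linear function. This `1/d` saves one factor `d` in the mean-square
change of the estimators. -/
theorem integral_inner_sq_unifSphere {d : ℕ} (hd : 1 ≤ d) (e : E d) :
    ∫ u, ⟪e, u⟫ ^ 2 ∂(unifSphere d) = ‖e‖ ^ 2 / d := by
  have h := integral_unifSphere_mul_inner hd (φ := fun u => ⟪e, u⟫)
    (contDiff_const.inner ℝ contDiff_id) e
  have hf : ∀ u, fderiv ℝ (fun u => ⟪e, u⟫) u e = ‖e‖ ^ 2 := by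
    intro u
    have : HasFDerivAt (fun u : E d => ⟪e, u⟫) (innerSL ℝ e) u := (innerSL ℝ e).hasFDerivAt
    rw [this.fderiv]; simp
  simp only [hf] at h
  rw [setAverage_const (measure_closedBall_pos _ _ one_pos).ne' measure_closedBall_lt_top.ne] at h
  rw [eq_div_iff (by positivity), mul_comm, ← h]
  congr 2
  funext u
  rw [real_inner_comm u e, sq]

/-- The exact mean, rather than the bound 1, matters: combined with `d₁ μ₁ ≤ (m+T)^(-2/3)` it makes
the smoothing bias smaller by `1/(d₁+1) ≤ 1/2`. -/
theorem average_norm_ball {d : ℕ} (hd : 1 ≤ d) :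
    ⨍ u in closedBall (0 : E d) 1, ‖u‖ = d / (d + 1) := by
  have := nontrivial_E hd
  rw [setAverage_eq, smul_eq_mul]
  have h1 : ∫ u in closedBall (0 : E d) 1, ‖u‖ = ∫ u : E d, (Iic (1 : ℝ)).indicator id ‖u‖ := by
    rw [← integral_indicator measurableSet_closedBall]
    refine integral_congr_ae (Eventually.of_forall fun u => ?_)
    simp [indicator]
  have h2 : ∫ y in Ioi (0 : ℝ), y ^ (d - 1) • (Iic (1 : ℝ)).indicator id y = 1 / (d + 1) := by
    have : ∀ y : ℝ, y ^ (d - 1) • (Iic (1 : ℝ)).indicator id y = (Iic (1 : ℝ)).indicator (fun y => y ^ d) y := by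
      intro y
      by_cases hy : y ≤ 1
      · simp [hy, ← pow_succ, Nat.sub_add_cancel hd]
      · simp [hy]
    simp only [this]
    rw [setIntegral_indicator measurableSet_Iic, Ioi_inter_Iic, ← intervalIntegral.integral_of_le zero_le_one,
      integral_pow]
    simp
  rw [h1, integral_fun_norm_addHaar, finrank_euclideanSpace_fin, h2,
    ← Measure.addHaar_real_closedBall_eq_addHaar_real_ball]
  have := volume_closedBall_pos d
  simp only [nsmul_eq_mul, smul_eq_mul]
  field_simp

end AccZOMDA

/-! ### Ball smoothing and its sphere estimator. -/

namespace AccZOMDA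
open Set Metric Filter Topology
open scoped RealInnerProductSpace ENNReal

theorem integrable_unifSphere_of_continuousOn {d : ℕ} (hd : 1 ≤ d) {F : Type*}
    [NormedAddCommGroup F] {f : E d → F} (hf : ContinuousOn f (closedBall 0 1)) :
    Integrable f (unifSphere d) := by
  have := isProbabilityMeasure_unifSphere hd
  have h := hf.integrableOn_compact (μ := unifSphere d) (isCompact_closedBall _ _)
  rwa [IntegrableOn, Measure.restrict_eq_self_of_ae_mem] at h
  filter_upwards [ae_norm_eq_one_unifSphere d] with u hu
  simp [hu]

theorem average_ball_mono {d : ℕ} {f g : E d → ℝ} (hf : IntegrableOn f (closedBall 0 1))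
    (hg : IntegrableOn g (closedBall 0 1)) (h : ∀ u ∈ closedBall (0 : E d) 1, f u ≤ g u) :
    ⨍ u in closedBall (0 : E d) 1, f u ≤ ⨍ u in closedBall (0 : E d) 1, g u := by
  rw [setAverage_eq, setAverage_eq, smul_eq_mul, smul_eq_mul]
  exact mul_le_mul_of_nonneg_left (setIntegral_mono_on hf hg measurableSet_closedBall h)
    (inv_nonneg.2 measureReal_nonneg)

theorem average_ball_const {d : ℕ} {F : Type*} [NormedAddCommGroup F] [NormedSpace ℝ F]
    [CompleteSpace F] (c : F) : ⨍ _u in closedBall (0 : E d) 1, c = c :=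
  setAverage_const (measure_closedBall_pos _ _ one_pos).ne' measure_closedBall_lt_top.ne c

theorem average_ball_sub {d : ℕ} {F : Type*} [NormedAddCommGroup F] [NormedSpace ℝ F]
    {f g : E d → F} (hf : IntegrableOn f (closedBall 0 1))
    (hg : IntegrableOn g (closedBall 0 1)) :
    ⨍ u in closedBall (0 : E d) 1, (f u - g u)
      = (⨍ u in closedBall (0 : E d) 1, f u) - ⨍ u in closedBall (0 : E d) 1, g u := by
  rw [setAverage_eq, setAverage_eq, setAverage_eq, integral_sub hf hg, smul_sub]

theorem average_ball_inner {d : ℕ} {f : E d → E d} (hf : IntegrableOn f (closedBall 0 1)) (e : E d) :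
    ⨍ u in closedBall (0 : E d) 1, ⟪f u, e⟫ = ⟪⨍ u in closedBall (0 : E d) 1, f u, e⟫ := by
  rw [setAverage_eq, setAverage_eq, real_inner_smul_left, smul_eq_mul]
  congr 1
  rw [real_inner_comm, ← integral_inner hf]
  simp_rw [real_inner_comm]

theorem norm_average_ball_le {d : ℕ} (f : E d → E d) :
    ‖⨍ u in closedBall (0 : E d) 1, f u‖ ≤ ⨍ u in closedBall (0 : E d) 1, ‖f u‖ := by
  rw [setAverage_eq, setAverage_eq, norm_smul, smul_eq_mul, Real.norm_eq_abs,
    abs_of_nonneg (inv_nonneg.2 measureReal_nonneg)]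
  exact mul_le_mul_of_nonneg_left (norm_integral_le_integral_norm _) (inv_nonneg.2 measureReal_nonneg)

theorem integrableOn_norm_ball (d : ℕ) : IntegrableOn (fun u : E d => ‖u‖) (closedBall 0 1) :=
  continuous_norm.continuousOn.integrableOn_compact (isCompact_closedBall _ _)

theorem norm_average_ball_le_of_le {d : ℕ} (hd : 1 ≤ d) {f : E d → E d}
    (hf : IntegrableOn f (closedBall 0 1)) {c : ℝ}
    (h : ∀ u ∈ closedBall (0 : E d) 1, ‖f u‖ ≤ c * ‖u‖) :
    ‖⨍ u in closedBall (0 : E d) 1, f u‖ ≤ c * (d / (d + 1)) := by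
  refine (norm_average_ball_le f).trans ?_
  refine (average_ball_mono hf.norm ((integrableOn_norm_ball d).const_mul c) h).trans ?_
  rw [← average_norm_ball hd, setAverage_eq, setAverage_eq, integral_const_mul, smul_eq_mul,
    smul_eq_mul]
  exact le_of_eq (by ring)

section Smoothing

variable {d : ℕ} {φ : E d → ℝ} {x : E d} {μ ρ L : ℝ}

theorem add_smul_mem_ball (hμ : 0 < μ) (hρ : μ < ρ) {u : E d} (hu : u ∈ closedBall (0 : E d) 1) :
    x + μ • u ∈ ball x ρ := by
  rw [mem_closedBall_zero_iff] at hu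
  rw [mem_ball_iff_norm, add_sub_cancel_left, norm_smul, Real.norm_eq_abs, abs_of_pos hμ]
  nlinarith

theorem continuousOn_gradient (hL : ∀ z ∈ ball x ρ, ∀ z' ∈ ball x ρ,
    ‖gradient φ z - gradient φ z'‖ ≤ L * ‖z - z'‖) : ContinuousOn (gradient φ) (ball x ρ) := by
  refine (LipschitzOnWith.of_dist_le_mul (K := Real.toNNReal L) fun z hz z' hz' => ?_).continuousOn
  rw [dist_eq_norm, dist_eq_norm]
  refine (hL z hz z' hz').trans ?_
  gcongr
  exact Real.le_coe_toNNReal L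

theorem integrableOn_gradient_add (hμ : 0 < μ) (hρ : μ < ρ) (hL : ∀ z ∈ ball x ρ, ∀ z' ∈ ball x ρ,
    ‖gradient φ z - gradient φ z'‖ ≤ L * ‖z - z'‖) :
    IntegrableOn (fun u => gradient φ (x + μ • u)) (closedBall 0 1) := by
  have h : ContinuousOn (fun u => gradient φ (x + μ • u)) (closedBall 0 1) :=
    (continuousOn_gradient hL).comp (by fun_prop) fun u hu => add_smul_mem_ball hμ hρ hu
  exact h.integrableOn_compact (isCompact_closedBall _ _)

/-- The Taylor remainder at `x + μu` is quadratic in `z - x` uniformly in `u`, so the average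
inherits it. The margin `ρ - μ` keeps the translated balls inside the region of smoothness. -/
theorem hasGradientAt_smoothing (hμ : 0 < μ) (hρ : μ < ρ)
    (hφ : ∀ z ∈ ball x ρ, DifferentiableAt ℝ φ z) (hL : ∀ z ∈ ball x ρ, ∀ z' ∈ ball x ρ,
      ‖gradient φ z - gradient φ z'‖ ≤ L * ‖z - z'‖) :
    HasGradientAt (smoothing μ φ) (⨍ u in closedBall (0 : E d) 1, gradient φ (x + μ • u)) x := by
  have hint := integrableOn_gradient_add hμ hρ hL
  refine hasGradientAt_of_abs_le_sq (C := L / 2) (sub_pos.2 hρ) fun z hz => ?_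
  have hmem : ∀ u ∈ closedBall (0 : E d) 1, z + μ • u ∈ ball x ρ := by
    intro u hu
    rw [mem_closedBall_zero_iff] at hu
    rw [mem_ball_iff_norm]
    calc ‖z + μ • u - x‖ = ‖(z - x) + μ • u‖ := by congr 1; abel
      _ ≤ ‖z - x‖ + μ * ‖u‖ := by
        refine (norm_add_le _ _).trans ?_
        rw [norm_smul, Real.norm_eq_abs, abs_of_pos hμ]
      _ < ρ := by nlinarith
  have hcφ : ContinuousOn φ (ball x ρ) := fun y hy => (hφ y hy).continuousAt.continuousWithinAt
  have i1 : IntegrableOn (fun u => φ (z + μ • u)) (closedBall 0 1) :=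
    (hcφ.comp (by fun_prop) fun u hu => hmem u hu).integrableOn_compact (isCompact_closedBall _ _)
  have i2 : IntegrableOn (fun u => φ (x + μ • u)) (closedBall 0 1) :=
    (hcφ.comp (by fun_prop) fun u hu => add_smul_mem_ball hμ hρ hu).integrableOn_compact
      (isCompact_closedBall _ _)
  have i3 : IntegrableOn (fun u => ⟪gradient φ (x + μ • u), z - x⟫) (closedBall 0 1) :=
    hint.inner_const _
  have e : smoothing μ φ z - smoothing μ φ x
      - ⟪⨍ u in closedBall (0 : E d) 1, gradient φ (x + μ • u), z - x⟫
      = ⨍ u in closedBall (0 : E d) 1,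
        (φ (z + μ • u) - φ (x + μ • u) - ⟪gradient φ (x + μ • u), z - x⟫) := by
    rw [average_ball_sub (f := fun u => φ (z + μ • u) - φ (x + μ • u)) (i1.sub i2) i3,
      average_ball_sub i1 i2, average_ball_inner hint]
    rfl
  have hb : ∀ u ∈ closedBall (0 : E d) 1,
      |φ (z + μ • u) - φ (x + μ • u) - ⟪gradient φ (x + μ • u), z - x⟫| ≤ L / 2 * ‖z - x‖ ^ 2 := by
    intro u hu
    have hxu := add_smul_mem_ball (x := x) hμ hρ hu
    have := abs_sub_sub_inner_gradient_le (convex_ball x ρ) hxu (hmem u hu) hφ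
      fun y hy => hL y hy _ hxu
    simpa [add_sub_add_right_eq_sub] using this
  rw [e, abs_le]
  constructor
  · rw [← average_ball_const (d := d) (-(L / 2 * ‖z - x‖ ^ 2))]
    exact average_ball_mono (integrableOn_const measure_closedBall_lt_top.ne) ((i1.sub i2).sub i3)
      fun u hu => (abs_le.1 (hb u hu)).1
  · rw [← average_ball_const (d := d) (L / 2 * ‖z - x‖ ^ 2)]
    exact average_ball_mono ((i1.sub i2).sub i3) (integrableOn_const measure_closedBall_lt_top.ne)
      fun u hu => (abs_le.1 (hb u hu)).2

theorem norm_average_gradient_sub_le (hd : 1 ≤ d) (hμ : 0 < μ) (hρ : μ < ρ)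
    (hL : ∀ z ∈ ball x ρ, ∀ z' ∈ ball x ρ, ‖gradient φ z - gradient φ z'‖ ≤ L * ‖z - z'‖) :
    ‖(⨍ u in closedBall (0 : E d) 1, gradient φ (x + μ • u)) - gradient φ x‖
      ≤ L * μ * (d / (d + 1)) := by
  have hint := integrableOn_gradient_add hμ hρ hL
  have hc : IntegrableOn (fun _ : E d => gradient φ x) (closedBall 0 1) :=
    integrableOn_const measure_closedBall_lt_top.ne
  rw [← average_ball_const (d := d) (gradient φ x), ← average_ball_sub hint hc]
  refine norm_average_ball_le_of_le hd (hint.sub hc) fun u hu => ?_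
  refine (hL _ (add_smul_mem_ball hμ hρ hu) _ (mem_ball_self (hμ.trans hρ))).trans (le_of_eq ?_)
  rw [add_sub_cancel_left, norm_smul, Real.norm_eq_abs, abs_of_pos hμ, mul_assoc]

/-- Stein's identity was proved for functions smooth everywhere. Multiplying `φ` by a bump function
equal to 1 near the closed `μ`-ball makes it so, without changing the sphere integral or the
gradients inside. -/
theorem integral_unifSphere_mul_inner_local (hd : 1 ≤ d) (hμ : 0 < μ) (hρ : μ < ρ)
    (hφ : ∀ z ∈ ball x ρ, DifferentiableAt ℝ φ z) (hL : ∀ z ∈ ball x ρ, ∀ z' ∈ ball x ρ,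
      ‖gradient φ z - gradient φ z'‖ ≤ L * ‖z - z'‖) (e : E d) :
    d * ∫ u, φ (x + μ • u) * ⟪u, e⟫ ∂(unifSphere d)
      = ⨍ u in closedBall (0 : E d) 1, μ * ⟪gradient φ (x + μ • u), e⟫ := by
  -- The two radii cut `[μ, ρ]` into thirds, so the bump is 1 past radius `μ` and vanishes before
  -- radius `ρ`.
  let β : ContDiffBump x := ⟨(2 * μ + ρ) / 3, (μ + 2 * ρ) / 3, by linarith, by linarith⟩
  have hβρ : β.rOut < ρ := by change (μ + 2 * ρ) / 3 < ρ; linarith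
  have hβμ : μ < β.rIn := by change μ < (2 * μ + ρ) / 3; linarith
  have hC1 : ContDiff ℝ 1 fun z => β z * φ z := by
    rw [contDiff_iff_contDiffAt]
    intro z
    by_cases hz : z ∈ ball x ρ
    · refine (β.contDiffAt).mul (contDiffAt_one_iff.2 ⟨fun y => InnerProductSpace.toDual ℝ (E d) (gradient φ y), ball x ρ,
        isOpen_ball.mem_nhds hz, ?_, fun y hy => (hφ y hy).hasGradientAt.hasFDerivAt⟩)
      exact (InnerProductSpace.toDual ℝ (E d)).continuous.comp_continuousOn (continuousOn_gradient hL)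
    · have hz' : β.rOut < dist z x := hβρ.trans_le (not_lt.1 hz)
      have : (fun z => β z * φ z) =ᶠ[𝓝 z] fun _ => 0 := by
        have ho : IsOpen {y | β.rOut < dist y x} := isOpen_lt continuous_const (by fun_prop)
        filter_upwards [ho.mem_nhds hz'] with y hy
        rw [β.zero_of_le_dist (le_of_lt hy), zero_mul]
      exact contDiffAt_const.congr_of_eventuallyEq this
  have hΦ : ContDiff ℝ 1 fun u : E d => β (x + μ • u) * φ (x + μ • u) :=
    hC1.comp (contDiff_const.add (contDiff_id.const_smul μ))
  have hin : ∀ u ∈ ball (0 : E d) (β.rIn / μ), β (x + μ • u) = 1 := by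
    intro u hu
    refine β.one_of_mem_closedBall ?_
    rw [mem_ball_zero_iff, lt_div_iff₀ hμ] at hu
    rw [mem_closedBall_iff_norm, add_sub_cancel_left, norm_smul, Real.norm_eq_abs, abs_of_pos hμ]
    linarith
  have hsub : closedBall (0 : E d) 1 ⊆ ball (0 : E d) (β.rIn / μ) :=
    closedBall_subset_ball ((one_lt_div hμ).2 hβμ)
  have h := integral_unifSphere_mul_inner hd hΦ e
  have hl : ∫ u, β (x + μ • u) * φ (x + μ • u) * ⟪u, e⟫ ∂(unifSphere d)
      = ∫ u, φ (x + μ • u) * ⟪u, e⟫ ∂(unifSphere d) := by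
    refine integral_congr_ae ?_
    filter_upwards [ae_norm_eq_one_unifSphere d] with u hu
    rw [hin u (hsub (by simp [hu])), one_mul]
  rw [hl] at h
  rw [h, setAverage_eq, setAverage_eq]
  congr 1
  refine setIntegral_congr_fun measurableSet_closedBall fun u hu => ?_
  have hev : (fun u : E d => β (x + μ • u) * φ (x + μ • u)) =ᶠ[𝓝 u] fun u => φ (x + μ • u) := by
    filter_upwards [isOpen_ball.mem_nhds (hsub hu)] with w hw
    rw [hin w hw, one_mul]
  have h1 := (hφ _ (add_smul_mem_ball hμ hρ hu)).hasGradientAt.hasFDerivAt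
  have h2 : HasFDerivAt (fun u : E d => x + μ • u) (μ • ContinuousLinearMap.id ℝ (E d)) u :=
    ((hasFDerivAt_id u).const_smul μ).const_add x
  have h3 := (h1.comp u h2).congr_of_eventuallyEq hev
  rw [h3.fderiv]
  simp

/-- The sphere estimator of the gradient is unbiased for the smoothed function. -/
theorem integral_unifSphere_estimator (hd : 1 ≤ d) (hμ : 0 < μ) (hρ : μ < ρ)
    (hφ : ∀ z ∈ ball x ρ, DifferentiableAt ℝ φ z) (hL : ∀ z ∈ ball x ρ, ∀ z' ∈ ball x ρ,
      ‖gradient φ z - gradient φ z'‖ ≤ L * ‖z - z'‖) :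
    ∫ u, ((φ (x + μ • u) - φ x) / (μ / d)) • u ∂(unifSphere d)
      = ⨍ u in closedBall (0 : E d) 1, gradient φ (x + μ • u) := by
  have hd0 : (d : ℝ) ≠ 0 := by positivity
  have hcφ : ContinuousOn φ (ball x ρ) := fun y hy => (hφ y hy).continuousAt.continuousWithinAt
  have hc : ContinuousOn (fun u => φ (x + μ • u)) (closedBall (0 : E d) 1) :=
    hcφ.comp (by fun_prop) fun u hu => add_smul_mem_ball hμ hρ hu
  have i1 : Integrable (fun u => ((φ (x + μ • u) - φ x) / (μ / d)) • u) (unifSphere d) :=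
    integrable_unifSphere_of_continuousOn hd
      (((hc.sub continuousOn_const).div_const _).smul continuousOn_id)
  refine ext_inner_right ℝ fun e => ?_
  rw [← average_ball_inner (integrableOn_gradient_add hμ hρ hL)]
  have h := integral_unifSphere_mul_inner_local hd hμ hρ hφ hL e
  rw [real_inner_comm, ← integral_inner i1]
  have j1 : Integrable (fun u => φ (x + μ • u) * ⟪u, e⟫) (unifSphere d) :=
    integrable_unifSphere_of_continuousOn hd (hc.mul (continuousOn_id.inner continuousOn_const))
  have j2 : Integrable (fun u => φ x * ⟪u, e⟫) (unifSphere d) :=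
    integrable_unifSphere_of_continuousOn hd (by fun_prop)
  calc ∫ u, ⟪e, ((φ (x + μ • u) - φ x) / (μ / d)) • u⟫ ∂(unifSphere d)
      = ∫ u, (d / μ) * (φ (x + μ • u) * ⟪u, e⟫ - φ x * ⟪u, e⟫) ∂(unifSphere d) := by
        refine integral_congr_ae (Eventually.of_forall fun u => ?_)
        simp only [real_inner_smul_right, real_inner_comm e u]
        field_simp
    _ = μ⁻¹ * (d * ∫ u, φ (x + μ • u) * ⟪u, e⟫ ∂(unifSphere d)) := by
        rw [integral_const_mul, integral_sub j1 j2, integral_const_mul, integral_inner_unifSphere hd]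
        field_simp; ring
    _ = _ := by
        rw [h, setAverage_eq, setAverage_eq, integral_const_mul, smul_eq_mul, smul_eq_mul]
        field_simp

end Smoothing

end AccZOMDA

/-! ### Convex analysis of the projected ascent step. -/

namespace AccZOMDA
open Set Metric Filter Topology
open scoped RealInnerProductSpace ENNReal

/-! ### Projections -/

section Projection

variable {d : ℕ} {C : Set (E d)}

theorem exists_proj (hne : C.Nonempty) (hcl : IsClosed C) (hcv : Convex ℝ C) (z : E d) :
    ∃ p ∈ C, ∀ q ∈ C, ‖p - z‖ ≤ ‖q - z‖ := by
  obtain ⟨p, hp, h⟩ := exists_norm_eq_iInf_of_complete_convex hne hcl.isComplete hcv z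
  refine ⟨p, hp, fun q hq => ?_⟩
  rw [norm_sub_rev p, norm_sub_rev q, h]
  exact ciInf_le ⟨0, forall_mem_range.2 fun _ => norm_nonneg _⟩ (⟨q, hq⟩ : C)

theorem proj_spec (hne : C.Nonempty) (hcl : IsClosed C) (hcv : Convex ℝ C) (z : E d) :
    proj C z ∈ C ∧ ∀ q ∈ C, ‖proj C z - z‖ ≤ ‖q - z‖ := by
  have h := exists_proj hne hcl hcv z
  rw [proj, dif_pos h]
  exact h.choose_spec

theorem proj_mem (hne : C.Nonempty) (hcl : IsClosed C) (hcv : Convex ℝ C) (z : E d) :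
    proj C z ∈ C := (proj_spec hne hcl hcv z).1

theorem inner_proj_le_zero (hne : C.Nonempty) (hcl : IsClosed C) (hcv : Convex ℝ C) (z : E d)
    {w : E d} (hw : w ∈ C) : ⟪z - proj C z, w - proj C z⟫ ≤ 0 := by
  obtain ⟨hp, hmin⟩ := proj_spec hne hcl hcv z
  refine (norm_eq_iInf_iff_real_inner_le_zero hcv hp).1 ?_ w hw
  have : Nonempty C := ⟨⟨_, hp⟩⟩
  refine le_antisymm (le_ciInf fun q => ?_)
    (ciInf_le ⟨0, forall_mem_range.2 fun _ => norm_nonneg _⟩ (⟨_, hp⟩ : C))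
  rw [norm_sub_rev z, norm_sub_rev z]
  exact hmin q q.2

theorem proj_of_mem (hcl : IsClosed C) (hcv : Convex ℝ C) {z : E d} (hz : z ∈ C) : proj C z = z := by
  have := (proj_spec ⟨z, hz⟩ hcl hcv z).2 z hz
  rw [sub_self, norm_zero] at this
  exact sub_eq_zero.1 (norm_le_zero_iff.1 this)

theorem norm_proj_sub_proj_le (hne : C.Nonempty) (hcl : IsClosed C) (hcv : Convex ℝ C) (z z' : E d) :
    ‖proj C z - proj C z'‖ ≤ ‖z - z'‖ := by
  have h1 := inner_proj_le_zero hne hcl hcv z (proj_mem hne hcl hcv z')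
  have h2 := inner_proj_le_zero hne hcl hcv z' (proj_mem hne hcl hcv z)
  set p := proj C z
  set q := proj C z'
  have h3 : ‖p - q‖ ^ 2 ≤ ⟪z - z', p - q⟫ := by
    have e : ⟪z - z', p - q⟫ - ‖p - q‖ ^ 2 = -⟪z - p, q - p⟫ - ⟪z' - q, p - q⟫ := by
      rw [← real_inner_self_eq_norm_sq]
      simp only [inner_sub_left, inner_sub_right, real_inner_comm]
      ring
    linarith
  have h4 := real_inner_le_norm (z - z') (p - q)
  by_contra hlt
  rw [not_le] at hlt
  have := norm_nonneg (z - z')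
  nlinarith

theorem continuous_proj (hne : C.Nonempty) (hcl : IsClosed C) (hcv : Convex ℝ C) :
    Continuous (proj C) :=
  (LipschitzWith.of_dist_le_mul (K := 1) fun z z' => by
    rw [dist_eq_norm, dist_eq_norm, NNReal.coe_one, one_mul]
    exact norm_proj_sub_proj_le hne hcl hcv z z').continuous

end Projection

/-! ### Strongly concave functions -/

section StrongConcave

variable {d : ℕ} {h : E d → ℝ} {Y : Set (E d)} {τ : ℝ}

/-- Strong concavity rearranged as a lower bound on a difference quotient. As `t → 0` it yields the
tangent inequality where `h` is differentiable, and quadratic growth at a maximizer without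
differentiability. -/
theorem StrongConcaveOn.le_segment (hs : StrongConcaveOn Y τ h) {y z : E d} (hy : y ∈ Y) (hz : z ∈ Y)
    {t : ℝ} (ht : t ∈ Ioo (0 : ℝ) 1) :
    h z - h y + (1 - t) * (τ / 2 * ‖z - y‖ ^ 2) ≤ (h (y + t • (z - y)) - h y) / t := by
  have := hs.2 hy hz (sub_nonneg.2 ht.2.le) ht.1.le (by ring)
  simp only [smul_eq_mul] at this
  rw [le_div_iff₀ ht.1]
  have e : (1 - t) • y + t • z = y + t • (z - y) := by
    rw [sub_smul, one_smul, smul_sub]; abel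
  rw [e, norm_sub_rev y z] at this
  linarith

theorem StrongConcaveOn.le_tangent (hs : StrongConcaveOn Y τ h) {y z : E d} (hy : y ∈ Y) (hz : z ∈ Y)
    (hd : DifferentiableAt ℝ h y) :
    h z ≤ h y + ⟪gradient h y, z - y⟫ - τ / 2 * ‖z - y‖ ^ 2 := by
  have h1 : HasDerivAt (fun t : ℝ => h (y + t • (z - y))) ⟪gradient h y, z - y⟫ 0 := by
    have h2 : HasDerivAt (fun t : ℝ => y + t • (z - y)) (z - y) 0 := by
      simpa using ((hasDerivAt_id (0 : ℝ)).smul_const (z - y)).const_add y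
    have h3 := hd.hasGradientAt.hasFDerivAt
    have h4 : HasFDerivAt h (InnerProductSpace.toDual ℝ (E d) (gradient h y)) (y + (0 : ℝ) • (z - y)) := by
      simpa using h3
    have h5 := h4.comp_hasDerivAt (0 : ℝ) h2
    rwa [InnerProductSpace.toDual_apply_apply] at h5
  have h5 : Tendsto (fun t : ℝ => (h (y + t • (z - y)) - h y) / t) (𝓝[>] 0) (𝓝 ⟪gradient h y, z - y⟫) := by
    have := h1.tendsto_slope_zero_right
    refine this.congr fun t => ?_
    simp [div_eq_inv_mul]
  have h6 : Tendsto (fun t : ℝ => h z - h y + (1 - t) * (τ / 2 * ‖z - y‖ ^ 2)) (𝓝[>] 0)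
      (𝓝 (h z - h y + (1 - 0) * (τ / 2 * ‖z - y‖ ^ 2))) := by
    refine Tendsto.mono_left ?_ nhdsWithin_le_nhds
    exact Continuous.tendsto (by fun_prop) 0
  have h7 := le_of_tendsto_of_tendsto h6 h5 (by
    filter_upwards [Ioo_mem_nhdsGT one_pos] with t ht using StrongConcaveOn.le_segment hs hy hz ht)
  linarith

theorem StrongConcaveOn.le_max (hs : StrongConcaveOn Y τ h) {p z : E d} (hp : p ∈ Y) (hz : z ∈ Y)
    (hm : IsMaxOn h Y p) : h z ≤ h p - τ / 2 * ‖z - p‖ ^ 2 := by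
  have h6 : Tendsto (fun t : ℝ => h z - h p + (1 - t) * (τ / 2 * ‖z - p‖ ^ 2)) (𝓝[>] 0)
      (𝓝 (h z - h p + (1 - 0) * (τ / 2 * ‖z - p‖ ^ 2))) := by
    refine Tendsto.mono_left ?_ nhdsWithin_le_nhds
    exact Continuous.tendsto (by fun_prop) 0
  have h7 := le_of_tendsto h6 (b := 0) (by
    filter_upwards [Ioo_mem_nhdsGT one_pos] with t ht
    refine (StrongConcaveOn.le_segment hs hp hz ht).trans ?_
    refine div_nonpos_of_nonpos_of_nonneg (sub_nonpos.2 (hm ?_)) ht.1.le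
    exact hs.1.add_smul_sub_mem hp hz ⟨ht.1.le, ht.2.le⟩)
  linarith

/-- By the tangent inequality at `y`, points farther than `2‖∇h(y)‖/τ` from `y` have values at most
`h y`, so it suffices to maximize over a compact piece. -/
theorem StrongConcaveOn.exists_isMaxOn (hs : StrongConcaveOn Y τ h) (hτ : 0 < τ) (hcl : IsClosed Y)
    (hne : Y.Nonempty) (hd : ∀ y ∈ Y, DifferentiableAt ℝ h y) : ∃ p ∈ Y, IsMaxOn h Y p := by
  obtain ⟨y, hy⟩ := hne
  set R := 2 * ‖gradient h y‖ / τ with hR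
  have hcpt : IsCompact (Y ∩ closedBall y R) := (isCompact_closedBall y R).inter_left hcl
  have hR0 : 0 ≤ R := by positivity
  obtain ⟨p, hp, hmax⟩ := hcpt.exists_isMaxOn ⟨y, hy, mem_closedBall_self hR0⟩
    (fun z hz => (hd z hz.1).continuousAt.continuousWithinAt)
  refine ⟨p, hp.1, fun z hz => ?_⟩
  by_cases hzR : z ∈ closedBall y R
  · exact hmax ⟨hz, hzR⟩
  · have h0 : h y ≤ h p := hmax ⟨hy, mem_closedBall_self hR0⟩
    refine le_trans ?_ h0
    have h1 := StrongConcaveOn.le_tangent hs hy hz (hd y hy)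
    have h2 := real_inner_le_norm (gradient h y) (z - y)
    rw [mem_closedBall_iff_norm, not_le, hR, div_lt_iff₀ hτ] at hzR
    have h3 := norm_nonneg (z - y)
    nlinarith

/-- One projected step `ỹ = P(y + λ w)` along an inexact gradient contracts towards the maximizer. -/
theorem StrongConcaveOn.norm_proj_step_sub_sq_le (hs : StrongConcaveOn Y τ h) (hτ : 0 < τ) (hcl : IsClosed Y)
    (hd : ∀ y ∈ Y, DifferentiableAt ℝ h y) {L lam : ℝ} (hlam : 0 < lam)
    (hL : ∀ y ∈ Y, ∀ y' ∈ Y, ‖gradient h y - gradient h y'‖ ≤ L * ‖y - y'‖) (hlamL : lam * L ≤ 1 / 6)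
    {y p : E d} (hy : y ∈ Y) (hp : p ∈ Y) (hm : IsMaxOn h Y p) (w : E d) :
    ‖proj Y (y + lam • w) - p‖ ^ 2 ≤ (1 - τ * lam) * ‖y - p‖ ^ 2
      - 5 / 6 * ‖proj Y (y + lam • w) - y‖ ^ 2 + lam / τ * ‖gradient h y - w‖ ^ 2 := by
  have hne : Y.Nonempty := ⟨y, hy⟩
  set q := proj Y (y + lam • w) with hq
  have hqY : q ∈ Y := proj_mem hne hcl hs.1 _
  have h1 := inner_proj_le_zero hne hcl hs.1 (y + lam • w) hp
  rw [← hq] at h1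
  have h2 := StrongConcaveOn.le_tangent hs hy hp (hd y hy)
  have h3 := (abs_le.1 (abs_sub_sub_inner_gradient_le hs.1 hy hqY hd fun z hz => hL z hz y hy)).1
  have h4 := StrongConcaveOn.le_max hs hp hqY hm
  have e1 : ⟪y + lam • w - q, p - q⟫ = lam * ⟪w, p - q⟫
      - 1 / 2 * (‖y - p‖ ^ 2 - ‖q - y‖ ^ 2 - ‖q - p‖ ^ 2) := by
    have : y - p = (y - q) + (q - p) := by abel
    have h5 : ‖y - p‖ ^ 2 = ‖y - q‖ ^ 2 + 2 * ⟪y - q, q - p⟫ + ‖q - p‖ ^ 2 := by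
      rw [this]; exact norm_add_sq_real _ _
    have h6 : y + lam • w - q = (y - q) + lam • w := by abel
    have h7 : p - q = -(q - p) := by abel
    rw [h5, h6, inner_add_left, real_inner_smul_left, norm_sub_rev q y, h7, inner_neg_right,
      inner_neg_right]
    ring
  have e2 : ⟪gradient h y, p - y⟫ - ⟪gradient h y, q - y⟫ = ⟪w, p - q⟫ + ⟪gradient h y - w, p - q⟫ := by
    rw [← inner_sub_right, ← inner_add_left]
    congr 1 <;> abel
  -- Young's inequality with weight `τ`: the term `τ λ ‖q - p‖²` is cancelled by the quadratic
  -- growth at the maximizer `p`, and the whole contraction `1 - τλ` at `y` survives.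
  have h8 : 2 * lam * ⟪gradient h y - w, p - q⟫ ≤ lam / τ * ‖gradient h y - w‖ ^ 2 + τ * lam * ‖q - p‖ ^ 2 := by
    have := real_inner_le_norm (gradient h y - w) (p - q)
    rw [norm_sub_rev p q] at this
    have h9 : 0 ≤ lam / τ * (‖gradient h y - w‖ - τ * ‖q - p‖) ^ 2 := by positivity
    have h10 : lam / τ * (‖gradient h y - w‖ - τ * ‖q - p‖) ^ 2 = lam / τ * ‖gradient h y - w‖ ^ 2
        - 2 * lam * (‖gradient h y - w‖ * ‖q - p‖) + τ * lam * ‖q - p‖ ^ 2 := by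
      field_simp; ring
    nlinarith
  rw [norm_sub_rev p y] at h2
  have h11 : lam * L * ‖q - y‖ ^ 2 ≤ 1 / 6 * ‖q - y‖ ^ 2 := by gcongr
  rw [e1] at h1
  have h12 : 0 ≤ 2 * lam * (⟪gradient h y, p - y⟫ - ⟪gradient h y, q - y⟫ - τ / 2 * ‖y - p‖ ^ 2
      + L / 2 * ‖q - y‖ ^ 2 - τ / 2 * ‖q - p‖ ^ 2) := by
    refine mul_nonneg (by positivity) ?_
    linarith
  rw [e2] at h12
  nlinarith

end StrongConcave

end AccZOMDA

/-! ### Danskin's theorem with quantitative constants, and smooth expectations. -/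

namespace AccZOMDA
open Set Metric Filter Topology
open scoped RealInnerProductSpace ENNReal

/-- The partial gradient in the first variable. -/
noncomputable def gradX {d₁ d₂ : ℕ} (f : E d₁ → E d₂ → ℝ) (x : E d₁) (y : E d₂) : E d₁ :=
  gradient (fun x' => f x' y) x

/-- The partial gradient in the second variable. -/
noncomputable def gradY {d₁ d₂ : ℕ} (f : E d₁ → E d₂ → ℝ) (x : E d₁) (y : E d₂) : E d₂ :=
  gradient (fun y' => f x y') y

/-- Partial differentiability with a jointly `L`-Lipschitz gradient on `ℝ^{d₁} × U`. -/
structure SmoothPair {d₁ d₂ : ℕ} (f : E d₁ → E d₂ → ℝ) (U : Set (E d₂)) (L : ℝ) : Prop where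
  diff_x : ∀ x, ∀ y ∈ U, DifferentiableAt ℝ (fun x' => f x' y) x
  diff_y : ∀ x, ∀ y ∈ U, DifferentiableAt ℝ (fun y' => f x y') y
  lip : ∀ x x', ∀ y ∈ U, ∀ y' ∈ U, ‖gradX f x y - gradX f x' y'‖ ^ 2 + ‖gradY f x y - gradY f x' y'‖ ^ 2
    ≤ L ^ 2 * (‖x - x'‖ ^ 2 + ‖y - y'‖ ^ 2)

namespace SmoothPair

variable {d₁ d₂ : ℕ} {f : E d₁ → E d₂ → ℝ} {U : Set (E d₂)} {L : ℝ}

theorem gradX_lip_sq (h : SmoothPair f U L) (x x' : E d₁) {y y' : E d₂} (hy : y ∈ U) (hy' : y' ∈ U) :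
    ‖gradX f x y - gradX f x' y'‖ ^ 2 ≤ L ^ 2 * (‖x - x'‖ ^ 2 + ‖y - y'‖ ^ 2) := by
  have := h.lip x x' y hy y' hy'
  have := sq_nonneg ‖gradY f x y - gradY f x' y'‖
  linarith

theorem gradY_lip_sq (h : SmoothPair f U L) (x x' : E d₁) {y y' : E d₂} (hy : y ∈ U) (hy' : y' ∈ U) :
    ‖gradY f x y - gradY f x' y'‖ ^ 2 ≤ L ^ 2 * (‖x - x'‖ ^ 2 + ‖y - y'‖ ^ 2) := by
  have := h.lip x x' y hy y' hy'
  have := sq_nonneg ‖gradX f x y - gradX f x' y'‖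
  linarith

theorem gradX_lip_x (h : SmoothPair f U L) (hL : 0 ≤ L) (x x' : E d₁) {y : E d₂} (hy : y ∈ U) :
    ‖gradX f x y - gradX f x' y‖ ≤ L * ‖x - x'‖ := by
  have := h.gradX_lip_sq x x' hy hy
  rw [sub_self, norm_zero] at this
  exact abs_le_of_sq_le_sq' (by linarith) (by positivity) |>.2

theorem gradX_lip_y (h : SmoothPair f U L) (hL : 0 ≤ L) (x : E d₁) {y y' : E d₂} (hy : y ∈ U)
    (hy' : y' ∈ U) : ‖gradX f x y - gradX f x y'‖ ≤ L * ‖y - y'‖ := by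
  have := h.gradX_lip_sq x x hy hy'
  rw [sub_self, norm_zero] at this
  exact abs_le_of_sq_le_sq' (by linarith) (by positivity) |>.2

theorem gradY_lip_x (h : SmoothPair f U L) (hL : 0 ≤ L) (x x' : E d₁) {y : E d₂} (hy : y ∈ U) :
    ‖gradY f x y - gradY f x' y‖ ≤ L * ‖x - x'‖ := by
  have := h.gradY_lip_sq x x' hy hy
  rw [sub_self, norm_zero] at this
  exact abs_le_of_sq_le_sq' (by linarith) (by positivity) |>.2

theorem gradY_lip_y (h : SmoothPair f U L) (hL : 0 ≤ L) (x : E d₁) {y y' : E d₂} (hy : y ∈ U)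
    (hy' : y' ∈ U) : ‖gradY f x y - gradY f x y'‖ ≤ L * ‖y - y'‖ := by
  have := h.gradY_lip_sq x x hy hy'
  rw [sub_self, norm_zero] at this
  exact abs_le_of_sq_le_sq' (by linarith) (by positivity) |>.2

theorem mono (h : SmoothPair f U L) {V : Set (E d₂)} (hV : V ⊆ U) : SmoothPair f V L :=
  ⟨fun x y hy => h.diff_x x y (hV hy), fun x y hy => h.diff_y x y (hV hy),
    fun x x' y hy y' hy' => h.lip x x' y (hV hy) y' (hV hy')⟩

theorem taylor_x (h : SmoothPair f U L) (hL : 0 ≤ L) (x z : E d₁) {y : E d₂} (hy : y ∈ U) :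
    |f z y - f x y - ⟪gradX f x y, z - x⟫| ≤ L / 2 * ‖z - x‖ ^ 2 :=
  abs_sub_sub_inner_gradient_le (φ := fun x' => f x' y) convex_univ (mem_univ x) (mem_univ z)
    (fun w _ => h.diff_x w y hy) fun w _ => h.gradX_lip_x hL w x hy

theorem taylor_y (h : SmoothPair f U L) (hL : 0 ≤ L) (hU : Convex ℝ U) (x : E d₁) {y z : E d₂}
    (hy : y ∈ U) (hz : z ∈ U) :
    |f x z - f x y - ⟪gradY f x y, z - y⟫| ≤ L / 2 * ‖z - y‖ ^ 2 :=
  abs_sub_sub_inner_gradient_le (φ := fun y' => f x y') hU hy hz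
    (fun w hw => h.diff_y x w hw) fun _ hw => h.gradY_lip_y hL x hw hy

end SmoothPair

open Classical in
/-- A maximizer of `f x` over `Y`. -/
noncomputable def argmaxOn {d₁ d₂ : ℕ} (f : E d₁ → E d₂ → ℝ) (Y : Set (E d₂)) (x : E d₁) : E d₂ :=
  if h : ∃ p ∈ Y, IsMaxOn (f x) Y p then h.choose else 0

/-- A smooth, strongly concave (in `y`) max-objective. -/
structure SmoothMax {d₁ d₂ : ℕ} (f : E d₁ → E d₂ → ℝ) (Y : Set (E d₂)) (L τ : ℝ) : Prop where
  L_pos : 0 < L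
  τ_pos : 0 < τ
  closed : IsClosed Y
  nonempty : Y.Nonempty
  smooth : SmoothPair f Y L
  concave : ∀ x, StrongConcaveOn Y τ (f x)

namespace SmoothMax

variable {d₁ d₂ : ℕ} {f : E d₁ → E d₂ → ℝ} {Y : Set (E d₂)} {L τ : ℝ}

theorem convex (h : SmoothMax f Y L τ) : Convex ℝ Y := (h.concave 0).1

theorem argmax_spec (h : SmoothMax f Y L τ) (x : E d₁) :
    argmaxOn f Y x ∈ Y ∧ IsMaxOn (f x) Y (argmaxOn f Y x) := by
  have := StrongConcaveOn.exists_isMaxOn (h.concave x) h.τ_pos h.closed h.nonempty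
    fun y hy => h.smooth.diff_y x y hy
  rw [argmaxOn, dif_pos this]
  exact this.choose_spec

theorem argmax_mem (h : SmoothMax f Y L τ) (x : E d₁) : argmaxOn f Y x ∈ Y := (h.argmax_spec x).1

theorem le_argmax (h : SmoothMax f Y L τ) (x : E d₁) {y : E d₂} (hy : y ∈ Y) :
    f x y ≤ f x (argmaxOn f Y x) := (h.argmax_spec x).2 hy

theorem sSup_eq (h : SmoothMax f Y L τ) (x : E d₁) : sSup (f x '' Y) = f x (argmaxOn f Y x) := by
  refine IsGreatest.csSup_eq ⟨mem_image_of_mem _ (h.argmax_mem x), ?_⟩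
  rintro _ ⟨y, hy, rfl⟩
  exact h.le_argmax x hy

theorem le_argmax_sub (h : SmoothMax f Y L τ) (x : E d₁) {y : E d₂} (hy : y ∈ Y) :
    f x y ≤ f x (argmaxOn f Y x) - τ / 2 * ‖y - argmaxOn f Y x‖ ^ 2 :=
  StrongConcaveOn.le_max (h.concave x) (h.argmax_mem x) hy (h.argmax_spec x).2

theorem eq_argmax (h : SmoothMax f Y L τ) {x : E d₁} {y : E d₂} (hy : y ∈ Y) (hm : IsMaxOn (f x) Y y) :
    y = argmaxOn f Y x := by
  have h1 := h.le_argmax_sub x hy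
  have h2 : f x (argmaxOn f Y x) ≤ f x y := hm (h.argmax_mem x)
  have h3 : ‖y - argmaxOn f Y x‖ ^ 2 ≤ 0 := by
    have := h.τ_pos
    by_contra hlt
    rw [not_le] at hlt
    have := mul_pos (half_pos this) hlt
    linarith
  have h4 : ‖y - argmaxOn f Y x‖ = 0 := by
    have := sq_nonneg ‖y - argmaxOn f Y x‖
    exact pow_eq_zero_iff (two_ne_zero) |>.1 (le_antisymm h3 this)
  exact sub_eq_zero.1 (norm_eq_zero.1 h4)

/-- Adding the quadratic growth at the two maximizers bounds `τ‖p - q‖²` by the variation from `q`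
to `p` of `f x - f x'`, whose gradient in `y` is at most `L‖x - x'‖`. No first-order optimality
condition is used. -/
theorem norm_argmax_sub_le (h : SmoothMax f Y L τ) (x x' : E d₁) :
    ‖argmaxOn f Y x - argmaxOn f Y x'‖ ≤ L / τ * ‖x - x'‖ := by
  set p := argmaxOn f Y x with hp
  set q := argmaxOn f Y x' with hq
  have h1 := h.le_argmax_sub x (h.argmax_mem x')
  have h2 := h.le_argmax_sub x' (h.argmax_mem x)
  rw [← hp, ← hq] at h1 h2
  have hpY := h.argmax_mem x
  have hqY := h.argmax_mem x'
  have h3 : ‖(f x p - f x' p) - (f x q - f x' q)‖ ≤ L * ‖x - x'‖ * ‖p - q‖ := by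
    refine h.convex.norm_image_sub_le_of_norm_hasFDerivWithin_le
      (f := fun y => f x y - f x' y)
      (f' := fun y => InnerProductSpace.toDual ℝ (E d₂) (gradY f x y) -
        InnerProductSpace.toDual ℝ (E d₂) (gradY f x' y)) (fun y hy => ?_) (fun y hy => ?_) hqY hpY
    · exact ((h.smooth.diff_y x y hy).hasGradientAt.hasFDerivAt.sub
        (h.smooth.diff_y x' y hy).hasGradientAt.hasFDerivAt).hasFDerivWithinAt
    · rw [← map_sub, LinearIsometryEquiv.norm_map]
      exact h.smooth.gradY_lip_x h.L_pos.le x x' hy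
  have h4 := le_of_abs_le h3
  rw [norm_sub_rev q p] at h1
  have hτ := h.τ_pos
  have h5 : τ * ‖p - q‖ * ‖p - q‖ ≤ L * ‖x - x'‖ * ‖p - q‖ := by nlinarith
  rcases (norm_nonneg (p - q)).eq_or_lt with h0 | h0
  · rw [← h0]
    have := h.L_pos
    positivity
  · rw [div_mul_eq_mul_div, le_div_iff₀ hτ, mul_comm]
    exact le_of_mul_le_mul_right h5 h0

/-- Adding the tangent inequalities at two points makes the gradient strongly monotone with modulus
`τ`, while it is `L`-Lipschitz. Read backwards: `L < τ` forces the feasible set to be a single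
point. -/
theorem le_of_nontrivial (h : SmoothMax f Y L τ) {p q : E d₂} (hp : p ∈ Y) (hq : q ∈ Y) (hpq : p ≠ q) :
    τ ≤ L := by
  have h1 := StrongConcaveOn.le_tangent (h.concave 0) hp hq (h.smooth.diff_y 0 p hp)
  have h2 := StrongConcaveOn.le_tangent (h.concave 0) hq hp (h.smooth.diff_y 0 q hq)
  have h3 := h.smooth.gradY_lip_y h.L_pos.le 0 hp hq
  have h4 : ⟪gradient (f 0) p, q - p⟫ + ⟪gradient (f 0) q, p - q⟫
      = ⟪gradY f 0 p - gradY f 0 q, q - p⟫ := by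
    rw [inner_sub_left, ← neg_sub q p, inner_neg_right]; rfl
  have h5 := real_inner_le_norm (gradY f 0 p - gradY f 0 q) (q - p)
  rw [norm_sub_rev q p] at h1 h5
  have h0 : 0 < ‖p - q‖ := norm_pos_iff.2 (sub_ne_zero.2 hpq)
  have h6 : τ * ‖p - q‖ ^ 2 ≤ L * ‖p - q‖ ^ 2 := by nlinarith
  exact le_of_mul_le_mul_right h6 (by positivity)

/-- The value `max_{y ∈ Y} f x y`. -/
noncomputable abbrev _root_.AccZOMDA.maxValue (f : E d₁ → E d₂ → ℝ) (Y : Set (E d₂)) (x : E d₁) : ℝ :=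
  f x (argmaxOn f Y x)

/-- Freezing the maximizer of one endpoint bounds the maximum at the other from below, which
sandwiches the increment between two Taylor expansions. As the maximizer is Lipschitz, the two
gradients differ by `O(‖z - x‖)` and the error is quadratic. -/
theorem hasGradientAt_maxValue (h : SmoothMax f Y L τ) (x : E d₁) :
    HasGradientAt (maxValue f Y) (gradX f x (argmaxOn f Y x)) x := by
  have hL := h.L_pos.le
  have hτ := h.τ_pos
  refine hasGradientAt_of_abs_le_sq (r := 1) (C := L / 2 + (L + L * (L / τ))) one_pos fun z _ => ?_
  have hx := h.argmax_mem x
  have hz := h.argmax_mem z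
  set p := argmaxOn f Y x
  set q := argmaxOn f Y z
  have h1 := abs_le.1 (h.smooth.taylor_x hL x z hx)
  have h2 := abs_le.1 (h.smooth.taylor_x hL z x hz)
  have h3 := h.le_argmax z hx
  have h4 := h.le_argmax x hz
  have h5 : ‖gradX f z q - gradX f x p‖ ≤ (L + L * (L / τ)) * ‖z - x‖ := by
    calc ‖gradX f z q - gradX f x p‖ ≤ ‖gradX f z q - gradX f x q‖ + ‖gradX f x q - gradX f x p‖ :=
          norm_sub_le_norm_sub_add_norm_sub _ _ _
      _ ≤ L * ‖z - x‖ + L * ‖q - p‖ :=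
          add_le_add (h.smooth.gradX_lip_x hL z x hz) (h.smooth.gradX_lip_y hL x hz hx)
      _ ≤ L * ‖z - x‖ + L * (L / τ * ‖z - x‖) := by
          gcongr; exact h.norm_argmax_sub_le z x
      _ = _ := by ring
  have h6 : ⟪gradX f z q, x - z⟫ = - ⟪gradX f x p, z - x⟫ - ⟪gradX f z q - gradX f x p, z - x⟫ := by
    rw [inner_sub_left, ← neg_sub z x, inner_neg_right]; ring
  have h7 := real_inner_le_norm (gradX f z q - gradX f x p) (z - x)
  have h8 : ‖gradX f z q - gradX f x p‖ * ‖z - x‖ ≤ (L + L * (L / τ)) * ‖z - x‖ * ‖z - x‖ := by gcongr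
  rw [norm_sub_rev x z] at h2
  have h9 : 0 ≤ (L + L * (L / τ)) * ‖z - x‖ ^ 2 := by positivity
  rw [abs_le]
  constructor <;> simp only [maxValue] <;> nlinarith

theorem gradient_maxValue (h : SmoothMax f Y L τ) (x : E d₁) :
    gradient (maxValue f Y) x = gradX f x (argmaxOn f Y x) := (h.hasGradientAt_maxValue x).gradient

/-- The joint Lipschitz bound is applied to the pairs `(x, y*(x))`. This gives `L√(1 + K²)` instead
of `L(1 + K)`, and the interpolation `sqrt_le_of_two_bounds` spends the difference. -/
theorem gradient_maxValue_lip (h : SmoothMax f Y L τ) {K : ℝ}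
    (hK : ∀ x x', ‖argmaxOn f Y x - argmaxOn f Y x'‖ ≤ K * ‖x - x'‖) (x x' : E d₁) :
    ‖gradient (maxValue f Y) x - gradient (maxValue f Y) x'‖ ≤ L * √(1 + K ^ 2) * ‖x - x'‖ := by
  rw [h.gradient_maxValue, h.gradient_maxValue]
  refine abs_le_of_sq_le_sq' ?_ (by have := h.L_pos; positivity) |>.2
  refine (h.smooth.gradX_lip_sq x x' (h.argmax_mem x) (h.argmax_mem x')).trans ?_
  have h1 := hK x x'
  have h2 : ‖argmaxOn f Y x - argmaxOn f Y x'‖ ^ 2 ≤ (K * ‖x - x'‖) ^ 2 := by gcongr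
  rw [mul_pow, mul_pow, Real.sq_sqrt (by positivity)]
  have : L ^ 2 * (‖x - x'‖ ^ 2 + ‖argmaxOn f Y x - argmaxOn f Y x'‖ ^ 2)
      ≤ L ^ 2 * (‖x - x'‖ ^ 2 + (K * ‖x - x'‖) ^ 2) := by gcongr
  refine this.trans (le_of_eq (by ring))

end SmoothMax

/-! ### Expectations of smooth functions -/

section Expectation

variable {Ξ : Type u} [MeasurableSpace Ξ] {ν : Measure Ξ} {d : ℕ}

/-- In each coordinate direction the gradient is a limit of difference quotients, hence measurable,
and it differs by a constant at most from the single difference quotient of length `ρ/2`, hence is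
integrable. -/
theorem integrable_gradient_of_lipschitz {F : E d → Ξ → ℝ} {x : E d} {ρ L : ℝ} (hρ : 0 < ρ)
    (hint : ∀ z ∈ ball x ρ, Integrable (F z) ν)
    (hd : ∀ ξ, ∀ z ∈ ball x ρ, DifferentiableAt ℝ (fun z => F z ξ) z)
    (hL : ∀ ξ, ∀ z ∈ ball x ρ, ‖gradient (fun z => F z ξ) z - gradient (fun z => F z ξ) x‖ ≤ L * ‖z - x‖)
    [IsFiniteMeasure ν] :
    Integrable (fun ξ => gradient (fun z => F z ξ) x) ν := by
  have hx : x ∈ ball x ρ := mem_ball_self hρ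
  have key : ∀ e : E d, ‖e‖ = 1 → Integrable (fun ξ => ⟪e, gradient (fun z => F z ξ) x⟫) ν := by
    intro e he
    have hmem : ∀ t : ℝ, |t| < ρ → x + t • e ∈ ball x ρ := by
      intro t ht
      rw [mem_ball_iff_norm, add_sub_cancel_left, norm_smul, he, mul_one]
      exact ht
    have hmeas : AEStronglyMeasurable (fun ξ => ⟪e, gradient (fun z => F z ξ) x⟫) ν := by
      have ht0 : Tendsto (fun n : ℕ => ρ / 2 * (1 / ((n : ℝ) + 1))) atTop (𝓝[≠] 0) := by
        refine tendsto_nhdsWithin_iff.2 ⟨?_, Eventually.of_forall fun n => ?_⟩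
        · simpa using (tendsto_one_div_add_atTop_nhds_zero_nat (𝕜 := ℝ)).const_mul (ρ / 2)
        · have : 0 < ρ / 2 * (1 / ((n : ℝ) + 1)) := by positivity
          exact this.ne'
      refine aestronglyMeasurable_of_tendsto_ae atTop
        (f := fun (n : ℕ) ξ => (ρ / 2 * (1 / ((n : ℝ) + 1)))⁻¹ *
          (F (x + (ρ / 2 * (1 / ((n : ℝ) + 1))) • e) ξ - F x ξ)) (fun n => ?_)
        (Eventually.of_forall fun ξ => ?_)
      · refine ((hint _ (hmem _ ?_)).sub (hint x hx)).aestronglyMeasurable.const_mul _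
        rw [abs_of_pos (by positivity)]
        have : 1 / ((n : ℝ) + 1) ≤ 1 := by
          rw [div_le_one (by positivity)]
          have : (0 : ℝ) ≤ n := n.cast_nonneg
          linarith
        nlinarith
      · have h1 : HasDerivAt (fun t : ℝ => F (x + t • e) ξ) ⟪e, gradient (fun z => F z ξ) x⟫ 0 := by
          have h2 : HasDerivAt (fun t : ℝ => x + t • e) e 0 := by
            simpa using ((hasDerivAt_id (0 : ℝ)).smul_const e).const_add x
          have h3 := (hd ξ x hx).hasGradientAt.hasFDerivAt
          have h4 : HasFDerivAt (fun z => F z ξ)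
              (InnerProductSpace.toDual ℝ (E d) (gradient (fun z => F z ξ) x)) (x + (0 : ℝ) • e) := by
            simpa using h3
          have h5 := h4.comp_hasDerivAt (0 : ℝ) h2
          rwa [InnerProductSpace.toDual_apply_apply, real_inner_comm] at h5
        have h2 := h1.tendsto_slope_zero.comp ht0
        refine h2.congr fun n => ?_
        simp
    have hm := hmem (ρ / 2) (by rw [abs_of_pos (by positivity)]; linarith)
    have hdom : Integrable (fun ξ => (ρ / 2)⁻¹ * (|F (x + (ρ / 2) • e) ξ - F x ξ| + L / 2 * (ρ / 2) ^ 2)) ν :=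
      ((((hint _ hm).sub (hint x hx)).abs).add (integrable_const _)).const_mul _
    refine hdom.mono' hmeas (Eventually.of_forall fun ξ => ?_)
    have h1 := abs_sub_sub_inner_gradient_le (convex_ball x ρ) hx hm (hd ξ) (hL ξ)
    rw [add_sub_cancel_left, real_inner_smul_right, norm_smul, he, mul_one, Real.norm_eq_abs, sq_abs,
      real_inner_comm] at h1
    rw [Real.norm_eq_abs, inv_mul_eq_div, le_div_iff₀ (by positivity)]
    have h2 := abs_sub_abs_le_abs_sub ((ρ / 2) * ⟪e, gradient (fun z => F z ξ) x⟫)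
      (F (x + (ρ / 2) • e) ξ - F x ξ)
    rw [abs_sub_comm (_ * _) _, abs_mul, abs_of_pos (half_pos hρ)] at h2
    linarith
  have : (fun ξ => gradient (fun z => F z ξ) x) = fun ξ => ∑ i,
      ⟪EuclideanSpace.basisFun (Fin d) ℝ i, gradient (fun z => F z ξ) x⟫
        • EuclideanSpace.basisFun (Fin d) ℝ i := by
    funext ξ
    exact (OrthonormalBasis.sum_repr' _ _).symm
  rw [this]
  exact integrable_finsetSum _ fun i _ => (key _ ((EuclideanSpace.basisFun (Fin d) ℝ).norm_eq_one i)).smul_const _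

theorem hasGradientAt_integral_of_lipschitz {F : E d → Ξ → ℝ} {x : E d} {ρ L : ℝ} (hρ : 0 < ρ)
    (hint : ∀ z ∈ ball x ρ, Integrable (F z) ν)
    (hd : ∀ ξ, ∀ z ∈ ball x ρ, DifferentiableAt ℝ (fun z => F z ξ) z)
    (hL : ∀ ξ, ∀ z ∈ ball x ρ, ‖gradient (fun z => F z ξ) z - gradient (fun z => F z ξ) x‖ ≤ L * ‖z - x‖)
    [IsProbabilityMeasure ν] :
    HasGradientAt (fun z => ∫ ξ, F z ξ ∂ν) (∫ ξ, gradient (fun z => F z ξ) x ∂ν) x := by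
  have hx : x ∈ ball x ρ := mem_ball_self hρ
  have hg := integrable_gradient_of_lipschitz hρ hint hd hL
  refine hasGradientAt_of_abs_le_sq (C := L / 2) hρ fun z hz => ?_
  rw [← mem_ball_iff_norm] at hz
  have e : (∫ ξ, F z ξ ∂ν) - (∫ ξ, F x ξ ∂ν) - ⟪∫ ξ, gradient (fun z => F z ξ) x ∂ν, z - x⟫
      = ∫ ξ, (F z ξ - F x ξ - ⟪gradient (fun z => F z ξ) x, z - x⟫) ∂ν := by
    rw [integral_sub (f := fun ξ => F z ξ - F x ξ) ((hint z hz).sub (hint x hx)) (hg.inner_const _),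
      integral_sub (hint z hz) (hint x hx), real_inner_comm, ← integral_inner hg]
    simp_rw [real_inner_comm (z - x)]
  rw [e, ← Real.norm_eq_abs]
  have := norm_integral_le_of_norm_le_const (μ := ν)
    (f := fun ξ => F z ξ - F x ξ - ⟪gradient (fun z => F z ξ) x, z - x⟫) (C := L / 2 * ‖z - x‖ ^ 2)
    (Eventually.of_forall fun ξ =>
      abs_sub_sub_inner_gradient_le (convex_ball x ρ) hx hz (hd ξ) (hL ξ))
  simpa using this

/-- Jensen's inequality for the product norm: pair `(a, b)` with the vector of its own integrals and
apply Cauchy–Schwarz. Separate bounds on the two blocks would lose the joint Lipschitz constant. -/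
theorem norm_integral_sq_add_le [IsProbabilityMeasure ν] {d' : ℕ} {a : Ξ → E d} {b : Ξ → E d'}
    (ha : Integrable a ν) (hb : Integrable b ν) {C : ℝ} (hC : 0 ≤ C)
    (h : ∀ ξ, ‖a ξ‖ ^ 2 + ‖b ξ‖ ^ 2 ≤ C ^ 2) :
    ‖∫ ξ, a ξ ∂ν‖ ^ 2 + ‖∫ ξ, b ξ ∂ν‖ ^ 2 ≤ C ^ 2 := by
  set p := ∫ ξ, a ξ ∂ν with hp
  set q := ∫ ξ, b ξ ∂ν with hq
  set S := √(‖p‖ ^ 2 + ‖q‖ ^ 2) with hS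
  have hS2 : S ^ 2 = ‖p‖ ^ 2 + ‖q‖ ^ 2 := Real.sq_sqrt (by positivity)
  have hS0 : 0 ≤ S := Real.sqrt_nonneg _
  have e : S ^ 2 = ∫ ξ, (⟪p, a ξ⟫ + ⟪q, b ξ⟫) ∂ν := by
    rw [integral_add (ha.const_inner p) (hb.const_inner q), integral_inner ha, integral_inner hb,
      hS2, ← hp, ← hq, real_inner_self_eq_norm_sq, real_inner_self_eq_norm_sq]
  have hle : S ^ 2 ≤ C * S := by
    rw [e]
    have : ∫ _ξ, C * S ∂ν = C * S := by simp
    rw [← this]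
    refine integral_mono ((ha.const_inner p).add (hb.const_inner q)) (integrable_const _) fun ξ => ?_
    have h1 := real_inner_le_norm p (a ξ)
    have h2 := real_inner_le_norm q (b ξ)
    have h3 : (‖p‖ * ‖a ξ‖ + ‖q‖ * ‖b ξ‖) ^ 2 ≤ (C * S) ^ 2 := by
      rw [mul_pow, hS2]
      have h5 := mul_le_mul_of_nonneg_right (h ξ) (show 0 ≤ ‖p‖ ^ 2 + ‖q‖ ^ 2 by positivity)
      nlinarith [sq_nonneg (‖p‖ * ‖b ξ‖ - ‖q‖ * ‖a ξ‖)]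
    have h4 := abs_le_of_sq_le_sq' h3 (by positivity) |>.2
    simp only
    linarith
  rw [← hS2]
  rcases hS0.eq_or_lt with h0 | h0
  · rw [← h0, zero_pow two_ne_zero]; exact sq_nonneg C
  · have : S ≤ C := le_of_mul_le_mul_right (by linarith [sq S]) h0
    gcongr

end Expectation

/-- The expectation of smooth component functions is smooth. -/
theorem Problem.IsSmoothOn.smoothPair_loss {d₁ d₂ : ℕ} {Ξ : Type u} [MeasurableSpace Ξ]
    {P : Problem d₁ d₂ Ξ} {U : Set (E d₂)} {L : ℝ} (h : P.IsSmoothOn U L) (ξ : Ξ) :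
    SmoothPair (fun x y => P.loss x y ξ) U L :=
  ⟨h.differentiable_x ξ, h.differentiable_y ξ, h.lipschitz ξ⟩

theorem Problem.IsSmoothOn.smoothPair_f {d₁ d₂ : ℕ} {Ξ : Type u} [MeasurableSpace Ξ]
    {P : Problem d₁ d₂ Ξ} {U : Set (E d₂)} {L : ℝ} (hU : IsOpen U) (hL : 0 ≤ L)
    (h : P.IsSmoothOn U L) [IsProbabilityMeasure P.law] : SmoothPair P.f U L := by
  have lipx : ∀ ξ x, ∀ y ∈ U, ∀ z ∈ ball x 1, ‖gradient (fun z => P.loss z y ξ) z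
      - gradient (fun z => P.loss z y ξ) x‖ ≤ L * ‖z - x‖ := fun ξ x y hy z _ =>
    (h.smoothPair_loss ξ).gradX_lip_x hL z x hy
  have ix : ∀ x, ∀ y ∈ U, Integrable (fun ξ => gradX (fun x y => P.loss x y ξ) x y) P.law :=
    fun x y hy => integrable_gradient_of_lipschitz (F := fun z ξ => P.loss z y ξ) one_pos
      (fun z _ => h.integrable z y hy) (fun ξ z _ => h.differentiable_x ξ z y hy)
      fun ξ z hz => lipx ξ x y hy z hz
  have gx : ∀ x, ∀ y ∈ U, HasGradientAt (fun x' => P.f x' y)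
      (∫ ξ, gradX (fun x y => P.loss x y ξ) x y ∂P.law) x :=
    fun x y hy => hasGradientAt_integral_of_lipschitz (F := fun z ξ => P.loss z y ξ) one_pos
      (fun z _ => h.integrable z y hy) (fun ξ z _ => h.differentiable_x ξ z y hy)
      fun ξ z hz => lipx ξ x y hy z hz
  have iy : ∀ x, ∀ y ∈ U, Integrable (fun ξ => gradY (fun x y => P.loss x y ξ) x y) P.law ∧
      HasGradientAt (fun y' => P.f x y') (∫ ξ, gradY (fun x y => P.loss x y ξ) x y ∂P.law) y := by
    intro x y hy
    obtain ⟨ρ, hρ, hsub⟩ := Metric.isOpen_iff.1 hU y hy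
    have lipy : ∀ ξ, ∀ z ∈ ball y ρ, ‖gradient (fun z => P.loss x z ξ) z
      - gradient (fun z => P.loss x z ξ) y‖ ≤ L * ‖z - y‖ := fun ξ z hz =>
      (h.smoothPair_loss ξ).gradY_lip_y hL x (hsub hz) hy
    exact ⟨integrable_gradient_of_lipschitz (F := fun z ξ => P.loss x z ξ) hρ
      (fun z hz => h.integrable x z (hsub hz)) (fun ξ z hz => h.differentiable_y ξ x z (hsub hz)) lipy,
      hasGradientAt_integral_of_lipschitz (F := fun z ξ => P.loss x z ξ) hρ
      (fun z hz => h.integrable x z (hsub hz)) (fun ξ z hz => h.differentiable_y ξ x z (hsub hz)) lipy⟩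
  refine ⟨fun x y hy => (gx x y hy).differentiableAt, fun x y hy => (iy x y hy).2.differentiableAt,
    fun x x' y hy y' hy' => ?_⟩
  have e1 : ∀ x, ∀ y ∈ U, gradX P.f x y = ∫ ξ, gradX (fun x y => P.loss x y ξ) x y ∂P.law :=
    fun x y hy => (gx x y hy).gradient
  have e2 : ∀ x, ∀ y ∈ U, gradY P.f x y = ∫ ξ, gradY (fun x y => P.loss x y ξ) x y ∂P.law :=
    fun x y hy => (iy x y hy).2.gradient
  rw [e1 x y hy, e1 x' y' hy', e2 x y hy, e2 x' y' hy', ← integral_sub (ix x y hy) (ix x' y' hy'),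
    ← integral_sub (iy x y hy).1 (iy x' y' hy').1]
  have e3 : L ^ 2 * (‖x - x'‖ ^ 2 + ‖y - y'‖ ^ 2) = (L * √(‖x - x'‖ ^ 2 + ‖y - y'‖ ^ 2)) ^ 2 := by
    rw [mul_pow, Real.sq_sqrt (by positivity)]
  rw [e3]
  refine norm_integral_sq_add_le ((ix x y hy).sub (ix x' y' hy')) ((iy x y hy).1.sub (iy x' y' hy').1)
    (by positivity) fun ξ => ?_
  rw [← e3]
  exact (h.smoothPair_loss ξ).lip x x' y hy y' hy'

end AccZOMDA

namespace AccZOMDA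
open Set Metric Filter Topology
open scoped RealInnerProductSpace ENNReal

/-! ### One-sample sphere estimators -/

section SphereEstimator

variable {d : ℕ}

theorem norm_estimator_sub_sq {a c : ℝ} {u : E d} {μ : ℝ} (hu : ‖u‖ = 1) :
    ‖(a / (μ / d)) • u - (c / (μ / d)) • u‖ ^ 2 = (d : ℝ) ^ 2 * ((a - c) ^ 2 / μ ^ 2) := by
  rw [← sub_smul, norm_smul, hu, mul_one, Real.norm_eq_abs, sq_abs, ← sub_div, div_div_eq_mul_div,
    div_pow, mul_pow, mul_comm, ← mul_div_assoc']

/-- Each finite difference is `μ⟪∇, u⟫` up to `Lμ²/2`, so the quotients differ by `⟪q - p, u⟫ + r`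
with `|r| ≤ Lμ`, and Young's inequality with parameter `θ` separates the two. Keeping the inner
product instead of a norm lets the sphere average gain `1/d`. -/
theorem norm_estimator_sub_sq_le {φ ψ : E d → ℝ} {x x' p q u : E d} {μ L θ : ℝ} (hμ : 0 < μ) (hθ : 0 < θ)
    (hu : ‖u‖ = 1) (hφ : |φ (x + μ • u) - φ x - μ * ⟪p, u⟫| ≤ L / 2 * μ ^ 2)
    (hψ : |ψ (x' + μ • u) - ψ x' - μ * ⟪q, u⟫| ≤ L / 2 * μ ^ 2) :
    ‖((ψ (x' + μ • u) - ψ x') / (μ / d)) • u - ((φ (x + μ • u) - φ x) / (μ / d)) • u‖ ^ 2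
      ≤ (d : ℝ) ^ 2 * ((1 + θ) * ⟪q - p, u⟫ ^ 2 + (1 + 1 / θ) * (L ^ 2 * μ ^ 2)) := by
  rw [norm_estimator_sub_sq hu]
  refine mul_le_mul_of_nonneg_left ?_ (sq_nonneg _)
  set r := ((ψ (x' + μ • u) - ψ x') - (φ (x + μ • u) - φ x)) / μ - ⟪q - p, u⟫ with hr
  have hr1 : μ * r = (ψ (x' + μ • u) - ψ x' - μ * ⟪q, u⟫) - (φ (x + μ • u) - φ x - μ * ⟪p, u⟫) := by
    rw [hr, inner_sub_left]; field_simp; ring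
  have hr2 : |μ * r| ≤ L * μ ^ 2 := by
    rw [hr1]
    refine (abs_sub _ _).trans ?_
    linarith
  have hr3 : r ^ 2 ≤ L ^ 2 * μ ^ 2 := by
    have h1 : (μ * r) ^ 2 ≤ (L * μ ^ 2) ^ 2 := sq_le_sq' (by linarith [(abs_le.1 hr2).1]) (abs_le.1 hr2).2
    have h2 : μ ^ 2 * r ^ 2 ≤ μ ^ 2 * (L ^ 2 * μ ^ 2) := by nlinarith
    exact le_of_mul_le_mul_left h2 (by positivity)
  have e : ((ψ (x' + μ • u) - ψ x') - (φ (x + μ • u) - φ x)) ^ 2 / μ ^ 2 = (⟪q - p, u⟫ + r) ^ 2 := by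
    rw [← div_pow, hr]; ring
  rw [e]
  have h4 : 0 ≤ 1 / θ * (θ * ⟪q - p, u⟫ - r) ^ 2 := by positivity
  have h5 : 1 / θ * (θ * ⟪q - p, u⟫ - r) ^ 2 = θ * ⟪q - p, u⟫ ^ 2 - 2 * ⟪q - p, u⟫ * r + 1 / θ * r ^ 2 := by
    field_simp; ring
  have h6 : (1 + 1 / θ) * r ^ 2 ≤ (1 + 1 / θ) * (L ^ 2 * μ ^ 2) := by gcongr
  nlinarith

/-- The mean value inequality leaves no additive smoothing error, but costs `d²` instead of `d`; it
serves in dimension one, where these agree. -/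
theorem norm_estimator_sub_sq_le_of_lipschitz {φ ψ : E d → ℝ} {x x' u : E d} {μ C : ℝ} (hμ : 0 < μ)
    (hu : ‖u‖ = 1)
    (hφ : ∀ t ∈ Icc (0 : ℝ) 1, DifferentiableAt ℝ φ (x + t • (μ • u)))
    (hψ : ∀ t ∈ Icc (0 : ℝ) 1, DifferentiableAt ℝ ψ (x' + t • (μ • u)))
    (hC : ∀ t ∈ Icc (0 : ℝ) 1, ‖gradient ψ (x' + t • (μ • u)) - gradient φ (x + t • (μ • u))‖ ≤ C) :
    ‖((ψ (x' + μ • u) - ψ x') / (μ / d)) • u - ((φ (x + μ • u) - φ x) / (μ / d)) • u‖ ^ 2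
      ≤ (d : ℝ) ^ 2 * C ^ 2 := by
  rw [norm_estimator_sub_sq hu]
  refine mul_le_mul_of_nonneg_left ?_ (sq_nonneg _)
  have hd : ∀ t ∈ Icc (0 : ℝ) 1, HasDerivWithinAt
      (fun t : ℝ => ψ (x' + t • (μ • u)) - φ (x + t • (μ • u)))
      (⟪gradient ψ (x' + t • (μ • u)), μ • u⟫ - ⟪gradient φ (x + t • (μ • u)), μ • u⟫) (Icc 0 1) t := by
    intro t ht
    have aux : ∀ (χ : E d → ℝ) (z : E d), DifferentiableAt ℝ χ (z + t • (μ • u)) →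
        HasDerivAt (fun t : ℝ => χ (z + t • (μ • u))) ⟪gradient χ (z + t • (μ • u)), μ • u⟫ t := by
      intro χ z hχ
      have h2 : HasDerivAt (fun t : ℝ => z + t • (μ • u)) (μ • u) t := by
        simpa using ((hasDerivAt_id t).smul_const (μ • u)).const_add z
      have h5 := hχ.hasGradientAt.hasFDerivAt.comp_hasDerivAt t h2
      rwa [InnerProductSpace.toDual_apply_apply] at h5
    exact ((aux ψ x' (hψ t ht)).sub (aux φ x (hφ t ht))).hasDerivWithinAt
  have key := (convex_Icc (0 : ℝ) 1).norm_image_sub_le_of_norm_hasDerivWithin_le (C := C * μ) hd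
    (fun t ht => by
      rw [← inner_sub_left]
      refine (norm_inner_le_norm _ _).trans ?_
      rw [norm_smul, hu, mul_one, Real.norm_eq_abs, abs_of_pos hμ]
      gcongr
      exact hC t ht) (left_mem_Icc.2 zero_le_one) (right_mem_Icc.2 zero_le_one)
  simp only [one_smul, zero_smul, add_zero, sub_zero, norm_one, mul_one] at key
  have e : ψ (x' + μ • u) - φ (x + μ • u) - (ψ x' - φ x) = (ψ (x' + μ • u) - ψ x') - (φ (x + μ • u) - φ x) := by
    ring
  rw [e, Real.norm_eq_abs] at key
  rw [div_le_iff₀ (by positivity), ← mul_pow, ← sq_abs]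
  gcongr

/-- Averaged over the sphere, a uniform quadratic bound on the estimator difference. -/
theorem lintegral_estimator_bound (hd : 1 ≤ d) (p : E d) {a c : ℝ} (ha : 0 ≤ a) (hc : 0 ≤ c) :
    ∫⁻ u, ENNReal.ofReal ((d : ℝ) ^ 2 * (a * ⟪p, u⟫ ^ 2 + c)) ∂(unifSphere d)
      = ENNReal.ofReal (a * d * ‖p‖ ^ 2 + d ^ 2 * c) := by
  have := isProbabilityMeasure_unifSphere hd
  have hi : Integrable (fun u => ⟪p, u⟫ ^ 2) (unifSphere d) :=
    integrable_unifSphere_of_continuousOn hd (by fun_prop)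
  rw [← ofReal_integral_eq_lintegral_ofReal]
  · congr 1
    rw [integral_const_mul, integral_add (hi.const_mul a) (integrable_const _), integral_const_mul,
      integral_inner_sq_unifSphere hd]
    have : (d : ℝ) ≠ 0 := by positivity
    simp
    field_simp
  · exact ((hi.const_mul a).add (integrable_const _)).const_mul _
  · exact Eventually.of_forall fun u => by positivity

variable {Ξ : Type u} [MeasurableSpace Ξ] {ν : Measure Ξ} [IsProbabilityMeasure ν]

/-- Fubini: at a fixed direction the expectation over `ξ` replaces the component function by its
mean, to which the unbiasedness of the sphere estimator applies. -/
theorem integral_estimator_eq_gradient_smoothing (hd : 1 ≤ d) {F : E d → Ξ → ℝ} {x : E d} {μ ρ L : ℝ}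
    (hμ : 0 < μ) (hρ : μ < ρ) (hint : ∀ z ∈ ball x ρ, Integrable (F z) ν)
    (hφ : ∀ z ∈ ball x ρ, DifferentiableAt ℝ (fun z => ∫ ξ, F z ξ ∂ν) z)
    (hL : ∀ z ∈ ball x ρ, ∀ z' ∈ ball x ρ, ‖gradient (fun z => ∫ ξ, F z ξ ∂ν) z
      - gradient (fun z => ∫ ξ, F z ξ ∂ν) z'‖ ≤ L * ‖z - z'‖)
    (hest : Integrable (fun q : Ξ × E d => ((F (x + μ • q.2) q.1 - F x q.1) / (μ / d)) • q.2)
      (ν.prod (unifSphere d))) :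
    ∫ q, ((F (x + μ • q.2) q.1 - F x q.1) / (μ / d)) • q.2 ∂(ν.prod (unifSphere d))
      = gradient (smoothing μ fun z => ∫ ξ, F z ξ ∂ν) x := by
  have := isProbabilityMeasure_unifSphere hd
  rw [(hasGradientAt_smoothing hμ hρ hφ hL).gradient, ← integral_unifSphere_estimator hd hμ hρ hφ hL,
    integral_prod_symm _ hest]
  refine integral_congr_ae ?_
  filter_upwards [ae_norm_eq_one_unifSphere d] with u hu
  have hxu : x + μ • u ∈ ball x ρ := add_smul_mem_ball hμ hρ (by simp [hu])
  rw [integral_smul_const, integral_div, integral_sub (hint _ hxu) (hint _ (mem_ball_self (hμ.trans hρ)))]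

end SphereEstimator

/-- Only partial differentiability is available. Joint continuity follows because the expansion in
`x` has an error controlled locally uniformly in `y`; the projection extends the function beyond
`K`. -/
theorem SmoothPair.continuous_comp_proj {d₁ d₂ : ℕ} {f : E d₁ → E d₂ → ℝ} {K : Set (E d₂)} {L : ℝ}
    (h : SmoothPair f K L) (hL : 0 ≤ L) (hne : K.Nonempty) (hcl : IsClosed K) (hcv : Convex ℝ K) :
    Continuous fun z : E d₁ × E d₂ => f z.1 (proj K z.2) := by
  have hp := continuous_proj hne hcl hcv
  have hm := proj_mem hne hcl hcv
  rw [continuous_iff_continuousAt]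
  rintro ⟨x, y⟩
  rw [ContinuousAt, tendsto_iff_norm_sub_tendsto_zero]
  have hy : Continuous fun y => f x (proj K y) := by
    rw [continuous_iff_continuousAt]
    intro y
    exact ContinuousAt.comp (f := proj K) (g := fun y' => f x y')
      (h.diff_y x _ (hm y)).continuousAt hp.continuousAt
  have hb : Continuous fun z : E d₁ × E d₂ => |f x (proj K z.2) - f x (proj K y)|
      + (‖gradX f x (proj K y)‖ + L * ‖proj K z.2 - proj K y‖) * ‖z.1 - x‖ + L / 2 * ‖z.1 - x‖ ^ 2 := by
    have h1 : Continuous fun z : E d₁ × E d₂ => f x (proj K z.2) := hy.comp continuous_snd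
    have h2 : Continuous fun z : E d₁ × E d₂ => proj K z.2 := hp.comp continuous_snd
    have h3 : Continuous fun z : E d₁ × E d₂ => ‖z.1 - x‖ := by fun_prop
    exact ((h1.sub continuous_const).abs.add ((continuous_const.add
      (continuous_const.mul (h2.sub continuous_const).norm)).mul h3)).add
      (continuous_const.mul (h3.pow 2))
  have hb0 := hb.tendsto (x, y)
  simp only [sub_self, abs_zero, norm_zero, mul_zero, add_zero, ne_eq, OfNat.ofNat_ne_zero,
    not_false_eq_true, zero_pow] at hb0
  refine squeeze_zero (fun _ => norm_nonneg _) (fun z => ?_) hb0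
  have h1 := h.taylor_x hL x z.1 (hm z.2)
  have h2 := h.gradX_lip_y hL x (hm z.2) (hm y)
  have h3 := norm_le_norm_add_norm_sub' (gradX f x (proj K z.2)) (gradX f x (proj K y))
  have h4 := abs_real_inner_le_norm (gradX f x (proj K z.2)) (z.1 - x)
  have h5 : ‖gradX f x (proj K z.2)‖ * ‖z.1 - x‖
      ≤ (‖gradX f x (proj K y)‖ + L * ‖proj K z.2 - proj K y‖) * ‖z.1 - x‖ := by
    gcongr; linarith
  rw [Real.norm_eq_abs]
  have e : f z.1 (proj K z.2) - f x (proj K y) = (f x (proj K z.2) - f x (proj K y)) +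
      ⟪gradX f x (proj K z.2), z.1 - x⟫
      + (f z.1 (proj K z.2) - f x (proj K z.2) - ⟪gradX f x (proj K z.2), z.1 - x⟫) := by ring
  rw [e]
  refine (abs_add_three _ _ _).trans ?_
  linarith

end AccZOMDA

/-! ### The standing setup and the moments of the one-sample estimators. -/

namespace AccZOMDA
open Set Metric Filter Topology
open scoped RealInnerProductSpace ENNReal

variable {d₁ d₂ : ℕ} {Ξ : Type u} [MeasurableSpace Ξ]

/-- The problem whose component functions are precomposed with the projection of `y` onto `K`. -/
noncomputable def Problem.retract (P : Problem d₁ d₂ Ξ) (K : Set (E d₂)) : Problem d₁ d₂ Ξ where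
  loss x y ξ := P.loss x (proj K y) ξ
  law := P.law
  feasible := P.feasible

/-- The expectation of the estimator in `x`. -/
noncomputable def Problem.meanX (P : Problem d₁ d₂ Ξ) (μ₁ : ℝ) (x : E d₁) (y : E d₂) : E d₁ :=
  gradient (smoothing μ₁ fun x' => P.f x' y) x

/-- The expectation of the estimator in `y`. -/
noncomputable def Problem.meanY (P : Problem d₁ d₂ Ξ) (μ₂ : ℝ) (x : E d₁) (y : E d₂) : E d₂ :=
  gradient (smoothing μ₂ fun y' => P.f x y') y

/-- The standing assumptions, with the neighbourhood `U` of the thickened feasible set fixed. -/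
structure Setup (P : Problem d₁ d₂ Ξ) (L τ δ μ₁ μ₂ : ℝ) (U : Set (E d₂)) : Prop where
  one_le_d₁ : 1 ≤ d₁
  one_le_d₂ : 1 ≤ d₂
  L_pos : 0 < L
  τ_pos : 0 < τ
  μ₁_pos : 0 < μ₁
  μ₂_pos : 0 < μ₂
  assum : P.Assumptions L τ δ μ₁ μ₂
  isOpen : IsOpen U
  subset : cthickening μ₂ P.feasible ⊆ U
  smooth : P.IsSmoothOn U L
  nonempty : P.feasible.Nonempty

namespace Setup

variable {P : Problem d₁ d₂ Ξ} {L τ δ μ₁ μ₂ : ℝ} {U : Set (E d₂)}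

theorem isProb (h : Setup P L τ δ μ₁ μ₂ U) : IsProbabilityMeasure P.law := h.assum.isProbabilityMeasure

theorem feasible_subset_thick (_h : Setup P L τ δ μ₁ μ₂ U) :
    P.feasible ⊆ cthickening μ₂ P.feasible := self_subset_cthickening _

theorem mem_U (h : Setup P L τ δ μ₁ μ₂ U) {y : E d₂} (hy : y ∈ P.feasible) : y ∈ U :=
  h.subset (h.feasible_subset_thick hy)

theorem smoothPair_f (h : Setup P L τ δ μ₁ μ₂ U) : SmoothPair P.f U L :=
  have := h.isProb
  h.smooth.smoothPair_f h.isOpen h.L_pos.le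

theorem smoothMax (h : Setup P L τ δ μ₁ μ₂ U) : SmoothMax P.f P.feasible L τ where
  L_pos := h.L_pos
  τ_pos := h.τ_pos
  closed := h.assum.isClosed
  nonempty := h.nonempty
  smooth := h.smoothPair_f.mono fun _ hy => h.mem_U hy
  concave := h.assum.strongConcave

theorem g_eq (h : Setup P L τ δ μ₁ μ₂ U) : P.g = maxValue P.f P.feasible :=
  funext fun x => h.smoothMax.sSup_eq x

theorem add_smul_mem_thick (h : Setup P L τ δ μ₁ μ₂ U) {y u : E d₂} (hy : y ∈ P.feasible)
    (hu : ‖u‖ ≤ 1) : y + μ₂ • u ∈ cthickening μ₂ P.feasible := by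
  refine closedBall_subset_cthickening hy μ₂ ?_
  rw [mem_closedBall_iff_norm, add_sub_cancel_left, norm_smul, Real.norm_eq_abs, abs_of_pos h.μ₂_pos]
  nlinarith [h.μ₂_pos]

/-- The estimator in `y` uses the full ball of radius `μ₂`, whereas the results on smoothing need a
strictly larger ball; compactness inside the open set `U` provides it. -/
theorem exists_ball (h : Setup P L τ δ μ₁ μ₂ U) {y : E d₂} (hy : y ∈ P.feasible) :
    ∃ ρ, μ₂ < ρ ∧ ball y ρ ⊆ U := by
  have hsub : closedBall y μ₂ ⊆ U := (closedBall_subset_cthickening hy μ₂).trans h.subset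
  obtain ⟨ε, hε, hsub'⟩ := (isCompact_closedBall y μ₂).exists_thickening_subset_open h.isOpen hsub
  rw [thickening_closedBall hε h.μ₂_pos.le] at hsub'
  exact ⟨ε + μ₂, by linarith, hsub'⟩

section Means

theorem meanX_eq (h : Setup P L τ δ μ₁ μ₂ U) (x : E d₁) {y : E d₂} (hy : y ∈ P.feasible) :
    P.meanX μ₁ x y = ⨍ u in closedBall (0 : E d₁) 1, gradX P.f (x + μ₁ • u) y :=
  (hasGradientAt_smoothing (φ := fun x' => P.f x' y) (ρ := μ₁ + 1) h.μ₁_pos (by linarith)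
    (fun z _ => h.smoothPair_f.diff_x z y (h.mem_U hy))
    fun z _ z' _ => h.smoothPair_f.gradX_lip_x h.L_pos.le z z' (h.mem_U hy)).gradient

theorem meanY_eq (h : Setup P L τ δ μ₁ μ₂ U) (x : E d₁) {y : E d₂} (hy : y ∈ P.feasible) :
    P.meanY μ₂ x y = ⨍ u in closedBall (0 : E d₂) 1, gradY P.f x (y + μ₂ • u) := by
  obtain ⟨ρ, hρ, hsub⟩ := h.exists_ball hy
  exact (hasGradientAt_smoothing (φ := fun y' => P.f x y') h.μ₂_pos hρ
    (fun z hz => h.smoothPair_f.diff_y x z (hsub hz))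
    fun z hz z' hz' => h.smoothPair_f.gradY_lip_y h.L_pos.le x (hsub hz) (hsub hz')).gradient

theorem integrableOn_gradX (h : Setup P L τ δ μ₁ μ₂ U) (x : E d₁) {y : E d₂} (hy : y ∈ P.feasible) :
    IntegrableOn (fun u => gradX P.f (x + μ₁ • u) y) (closedBall 0 1) :=
  integrableOn_gradient_add (φ := fun x' => P.f x' y) (ρ := μ₁ + 1) h.μ₁_pos (by linarith)
    fun z _ z' _ => h.smoothPair_f.gradX_lip_x h.L_pos.le z z' (h.mem_U hy)

theorem integrableOn_gradY (h : Setup P L τ δ μ₁ μ₂ U) (x : E d₁) {y : E d₂} (hy : y ∈ P.feasible) :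
    IntegrableOn (fun u => gradY P.f x (y + μ₂ • u)) (closedBall 0 1) := by
  obtain ⟨ρ, hρ, hsub⟩ := h.exists_ball hy
  exact integrableOn_gradient_add (φ := fun y' => P.f x y') h.μ₂_pos hρ
    fun z hz z' hz' => h.smoothPair_f.gradY_lip_y h.L_pos.le x (hsub hz) (hsub hz')

theorem norm_meanX_sub_gradX_le (h : Setup P L τ δ μ₁ μ₂ U) (x : E d₁) {y : E d₂} (hy : y ∈ P.feasible) :
    ‖P.meanX μ₁ x y - gradX P.f x y‖ ≤ L * μ₁ * (d₁ / (d₁ + 1)) := by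
  rw [h.meanX_eq x hy]
  exact norm_average_gradient_sub_le (φ := fun x' => P.f x' y) (ρ := μ₁ + 1) h.one_le_d₁ h.μ₁_pos
    (by linarith) fun z _ z' _ => h.smoothPair_f.gradX_lip_x h.L_pos.le z z' (h.mem_U hy)

theorem norm_meanY_sub_gradY_le (h : Setup P L τ δ μ₁ μ₂ U) (x : E d₁) {y : E d₂} (hy : y ∈ P.feasible) :
    ‖P.meanY μ₂ x y - gradY P.f x y‖ ≤ L * μ₂ * (d₂ / (d₂ + 1)) := by
  obtain ⟨ρ, hρ, hsub⟩ := h.exists_ball hy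
  rw [h.meanY_eq x hy]
  exact norm_average_gradient_sub_le (φ := fun y' => P.f x y') h.one_le_d₂ h.μ₂_pos hρ
    fun z hz z' hz' => h.smoothPair_f.gradY_lip_y h.L_pos.le x (hsub hz) (hsub hz')

theorem norm_average_sub_average_le {d : ℕ} {f g : E d → E d} {c : ℝ}
    (hf : IntegrableOn f (closedBall 0 1)) (hg : IntegrableOn g (closedBall 0 1))
    (hfg : ∀ u ∈ closedBall (0 : E d) 1, ‖f u - g u‖ ≤ c) :
    ‖(⨍ u in closedBall (0 : E d) 1, f u) - ⨍ u in closedBall (0 : E d) 1, g u‖ ≤ c := by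
  rw [← average_ball_sub hf hg]
  refine (norm_average_ball_le _).trans ?_
  rw [← average_ball_const (d := d) c]
  exact average_ball_mono (hf.sub hg).norm (integrableOn_const measure_closedBall_lt_top.ne) hfg

theorem norm_meanX_sub_le (h : Setup P L τ δ μ₁ μ₂ U) (x x' : E d₁) {y y' : E d₂} (hy : y ∈ P.feasible)
    (hy' : y' ∈ P.feasible) :
    ‖P.meanX μ₁ x y - P.meanX μ₁ x' y'‖ ≤ L * √(‖x - x'‖ ^ 2 + ‖y - y'‖ ^ 2) := by
  rw [h.meanX_eq x hy, h.meanX_eq x' hy']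
  refine norm_average_sub_average_le (h.integrableOn_gradX x hy) (h.integrableOn_gradX x' hy') fun u _ => ?_
  have := h.smoothPair_f.gradX_lip_sq (x + μ₁ • u) (x' + μ₁ • u) (h.mem_U hy) (h.mem_U hy')
  rw [add_sub_add_right_eq_sub] at this
  refine abs_le_of_sq_le_sq' ?_ (by have := h.L_pos; positivity) |>.2
  rwa [mul_pow, Real.sq_sqrt (by positivity)]

theorem norm_meanY_sub_le (h : Setup P L τ δ μ₁ μ₂ U) (x x' : E d₁) {y y' : E d₂} (hy : y ∈ P.feasible)
    (hy' : y' ∈ P.feasible) :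
    ‖P.meanY μ₂ x y - P.meanY μ₂ x' y'‖ ≤ L * √(‖x - x'‖ ^ 2 + ‖y - y'‖ ^ 2) := by
  rw [h.meanY_eq x hy, h.meanY_eq x' hy']
  refine norm_average_sub_average_le (h.integrableOn_gradY x hy) (h.integrableOn_gradY x' hy') fun u hu => ?_
  rw [mem_closedBall_zero_iff] at hu
  have := h.smoothPair_f.gradY_lip_sq x x' (h.subset (h.add_smul_mem_thick hy hu))
    (h.subset (h.add_smul_mem_thick hy' hu))
  rw [add_sub_add_right_eq_sub] at this
  refine abs_le_of_sq_le_sq' ?_ (by have := h.L_pos; positivity) |>.2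
  rwa [mul_pow, Real.sq_sqrt (by positivity)]

theorem continuous_of_norm_sub_le {d : ℕ} (h : Setup P L τ δ μ₁ μ₂ U) {m : E d₁ → E d₂ → E d}
    (hm : ∀ x x', ∀ y ∈ P.feasible, ∀ y' ∈ P.feasible,
      ‖m x y - m x' y'‖ ≤ L * √(‖x - x'‖ ^ 2 + ‖y - y'‖ ^ 2)) :
    Continuous fun z : E d₁ × E d₂ => m z.1 (proj P.feasible z.2) := by
  have hp := continuous_proj h.nonempty h.assum.isClosed h.assum.convex
  have hpm := proj_mem h.nonempty h.assum.isClosed h.assum.convex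
  rw [continuous_iff_continuousAt]
  intro z
  rw [ContinuousAt, tendsto_iff_norm_sub_tendsto_zero]
  have hb : Continuous fun w : E d₁ × E d₂ => L * √(‖w.1 - z.1‖ ^ 2
      + ‖proj P.feasible w.2 - proj P.feasible z.2‖ ^ 2) := by
    have h2 : Continuous fun w : E d₁ × E d₂ => proj P.feasible w.2 := hp.comp continuous_snd
    have h3 : Continuous fun w : E d₁ × E d₂ => ‖w.1 - z.1‖ := by fun_prop
    exact continuous_const.mul ((h3.pow 2).add ((h2.sub continuous_const).norm.pow 2)).sqrt
  have hb0 := hb.tendsto z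
  simp only [sub_self, norm_zero, ne_eq, OfNat.ofNat_ne_zero, not_false_eq_true, zero_pow, add_zero,
    Real.sqrt_zero, mul_zero] at hb0
  exact squeeze_zero (fun _ => norm_nonneg _) (fun w => hm _ _ _ (hpm _) _ (hpm _)) hb0

theorem measurable_meanX_proj (h : Setup P L τ δ μ₁ μ₂ U) :
    Measurable fun z : E d₁ × E d₂ => P.meanX μ₁ z.1 (proj P.feasible z.2) :=
  (h.continuous_of_norm_sub_le fun x x' _ hy _ hy' => h.norm_meanX_sub_le x x' hy hy').measurable

theorem measurable_meanY_proj (h : Setup P L τ δ μ₁ μ₂ U) :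
    Measurable fun z : E d₁ × E d₂ => P.meanY μ₂ z.1 (proj P.feasible z.2) :=
  (h.continuous_of_norm_sub_le fun x x' _ hy _ hy' => h.norm_meanY_sub_le x x' hy hy').measurable

end Means

section Retract

/-- The closed neighbourhood of the feasible set in which the estimators query. -/
noncomputable abbrev retraction (P : Problem d₁ d₂ Ξ) (μ₂ : ℝ) : Problem d₁ d₂ Ξ :=
  P.retract (cthickening μ₂ P.feasible)

/-- After retraction onto the closed thickening the loss is continuous in `(x, y)` everywhere and
measurable in `ξ`, hence jointly measurable. The original loss need not be measurable away from `U`.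
-/
theorem measurable_retract_loss (h : Setup P L τ δ μ₁ μ₂ U) :
    Measurable fun q : (E d₁ × E d₂) × Ξ => (retraction P μ₂).loss q.1.1 q.1.2 q.2 := by
  have hne : (cthickening μ₂ P.feasible).Nonempty := h.nonempty.mono h.feasible_subset_thick
  have hcv := h.assum.convex.cthickening μ₂
  exact measurable_uncurry_of_continuous_of_measurable
    (u := fun (z : E d₁ × E d₂) (ξ : Ξ) => (retraction P μ₂).loss z.1 z.2 ξ)
    (fun ξ => ((h.smooth.smoothPair_loss ξ).mono h.subset).continuous_comp_proj h.L_pos.le hne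
      isClosed_cthickening hcv)
    fun z => h.smooth.measurable _ _ (h.subset (proj_mem hne isClosed_cthickening hcv _))

theorem measurable_retract_zoGradX (h : Setup P L τ δ μ₁ μ₂ U) :
    Measurable fun q : (E d₁ × E d₂) × Ξ × E d₁ =>
      (retraction P μ₂).zoGradX μ₁ q.1.1 q.1.2 q.2.1 q.2.2 := by
  have hl := h.measurable_retract_loss
  have h1 : Measurable fun q : (E d₁ × E d₂) × Ξ × E d₁ =>
      (retraction P μ₂).loss (q.1.1 + μ₁ • q.2.2) q.1.2 q.2.1 :=
    hl.comp (f := fun q : (E d₁ × E d₂) × Ξ × E d₁ => ((q.1.1 + μ₁ • q.2.2, q.1.2), q.2.1))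
      (by fun_prop)
  have h2 : Measurable fun q : (E d₁ × E d₂) × Ξ × E d₁ =>
      (retraction P μ₂).loss q.1.1 q.1.2 q.2.1 :=
    hl.comp (f := fun q : (E d₁ × E d₂) × Ξ × E d₁ => (q.1, q.2.1)) (by fun_prop)
  exact ((h1.sub h2).div_const _).smul (by fun_prop)

theorem measurable_retract_zoGradY (h : Setup P L τ δ μ₁ μ₂ U) :
    Measurable fun q : (E d₁ × E d₂) × Ξ × E d₂ =>
      (retraction P μ₂).zoGradY μ₂ q.1.1 q.1.2 q.2.1 q.2.2 := by
  have hl := h.measurable_retract_loss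
  have h1 : Measurable fun q : (E d₁ × E d₂) × Ξ × E d₂ =>
      (retraction P μ₂).loss q.1.1 (q.1.2 + μ₂ • q.2.2) q.2.1 :=
    hl.comp (f := fun q : (E d₁ × E d₂) × Ξ × E d₂ => ((q.1.1, q.1.2 + μ₂ • q.2.2), q.2.1))
      (by fun_prop)
  have h2 : Measurable fun q : (E d₁ × E d₂) × Ξ × E d₂ =>
      (retraction P μ₂).loss q.1.1 q.1.2 q.2.1 :=
    hl.comp (f := fun q : (E d₁ × E d₂) × Ξ × E d₂ => (q.1, q.2.1)) (by fun_prop)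
  exact ((h1.sub h2).div_const _).smul (by fun_prop)

theorem retract_loss_eq (h : Setup P L τ δ μ₁ μ₂ U) (x : E d₁) {y : E d₂}
    (hy : y ∈ cthickening μ₂ P.feasible) (ξ : Ξ) : (retraction P μ₂).loss x y ξ = P.loss x y ξ := by
  change P.loss x (proj _ y) ξ = _
  rw [proj_of_mem isClosed_cthickening (h.assum.convex.cthickening μ₂) hy]

theorem retract_zoGradX_eq (h : Setup P L τ δ μ₁ μ₂ U) (x : E d₁) {y : E d₂} (hy : y ∈ P.feasible)
    (ξ : Ξ) (u : E d₁) : (retraction P μ₂).zoGradX μ₁ x y ξ u = P.zoGradX μ₁ x y ξ u := by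
  have hy' := h.feasible_subset_thick hy
  rw [Problem.zoGradX, Problem.zoGradX, h.retract_loss_eq _ hy', h.retract_loss_eq _ hy']

theorem retract_zoGradY_eq (h : Setup P L τ δ μ₁ μ₂ U) (x : E d₁) {y : E d₂} (hy : y ∈ P.feasible)
    (ξ : Ξ) {u : E d₂} (hu : ‖u‖ ≤ 1) :
    (retraction P μ₂).zoGradY μ₂ x y ξ u = P.zoGradY μ₂ x y ξ u := by
  rw [Problem.zoGradY, Problem.zoGradY, h.retract_loss_eq _ (h.feasible_subset_thick hy),
    h.retract_loss_eq _ (h.add_smul_mem_thick hy hu)]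

theorem aestronglyMeasurable_zoGradX (h : Setup P L τ δ μ₁ μ₂ U) (x : E d₁) {y : E d₂}
    (hy : y ∈ P.feasible) :
    AEStronglyMeasurable (fun q : Ξ × E d₁ => P.zoGradX μ₁ x y q.1 q.2) (P.law.prod (unifSphere d₁)) := by
  have := h.measurable_retract_zoGradX.comp (measurable_prodMk_left (x := (x, y)))
  refine this.aestronglyMeasurable.congr (Eventually.of_forall fun q => ?_)
  exact h.retract_zoGradX_eq x hy q.1 q.2

theorem ae_norm_eq_one_prod {d : ℕ} (hd : 1 ≤ d) (ν : Measure Ξ) [SFinite ν] :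
    ∀ᵐ q ∂(ν.prod (unifSphere d)), ‖q.2‖ = 1 := by
  have := isProbabilityMeasure_unifSphere hd
  exact Measure.quasiMeasurePreserving_snd.ae (ae_norm_eq_one_unifSphere d)

theorem aestronglyMeasurable_zoGradY (h : Setup P L τ δ μ₁ μ₂ U) (x : E d₁) {y : E d₂}
    (hy : y ∈ P.feasible) :
    AEStronglyMeasurable (fun q : Ξ × E d₂ => P.zoGradY μ₂ x y q.1 q.2) (P.law.prod (unifSphere d₂)) := by
  have := h.isProb
  have := h.measurable_retract_zoGradY.comp (measurable_prodMk_left (x := (x, y)))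
  refine this.aestronglyMeasurable.congr ?_
  filter_upwards [ae_norm_eq_one_prod h.one_le_d₂ P.law] with q hq
  exact h.retract_zoGradY_eq x hy q.1 hq.le

end Retract

section Moments

theorem memLp_of_lintegral_le {Ω' : Type*} [MeasurableSpace Ω'] {ν : Measure Ω'} {F : Type*}
    [NormedAddCommGroup F] {f : Ω' → F} (hf : AEStronglyMeasurable f ν) {C : ℝ}
    (h : ∫⁻ q, ‖f q‖ₑ ^ 2 ∂ν ≤ ENNReal.ofReal C) : MemLp f 2 ν := by
  refine ⟨hf, ?_⟩
  rw [eLpNorm_lt_top_iff_lintegral_rpow_enorm_lt_top two_ne_zero ENNReal.ofNat_ne_top]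
  simp only [ENNReal.toReal_ofNat, ENNReal.rpow_ofNat]
  exact h.trans_lt ENNReal.ofReal_lt_top

theorem memLp_zoGradX_sub (h : Setup P L τ δ μ₁ μ₂ U) (x : E d₁) {y : E d₂} (hy : y ∈ P.feasible) :
    MemLp (fun q : Ξ × E d₁ => P.zoGradX μ₁ x y q.1 q.2 - P.meanX μ₁ x y) 2
      (P.law.prod (unifSphere d₁)) :=
  memLp_of_lintegral_le ((h.aestronglyMeasurable_zoGradX x hy).sub aestronglyMeasurable_const)
    (h.assum.variance_x x y hy)

theorem memLp_zoGradY_sub (h : Setup P L τ δ μ₁ μ₂ U) (x : E d₁) {y : E d₂} (hy : y ∈ P.feasible) :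
    MemLp (fun q : Ξ × E d₂ => P.zoGradY μ₂ x y q.1 q.2 - P.meanY μ₂ x y) 2
      (P.law.prod (unifSphere d₂)) :=
  memLp_of_lintegral_le ((h.aestronglyMeasurable_zoGradY x hy).sub aestronglyMeasurable_const)
    (h.assum.variance_y x y hy)

theorem memLp_zoGradX (h : Setup P L τ δ μ₁ μ₂ U) (x : E d₁) {y : E d₂} (hy : y ∈ P.feasible) :
    MemLp (fun q : Ξ × E d₁ => P.zoGradX μ₁ x y q.1 q.2) 2 (P.law.prod (unifSphere d₁)) := by
  have := h.isProb
  have := isProbabilityMeasure_unifSphere h.one_le_d₁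
  exact ((h.memLp_zoGradX_sub x hy).add (memLp_const (P.meanX μ₁ x y))).ae_eq
    (Eventually.of_forall fun _ => sub_add_cancel _ _)

theorem memLp_zoGradY (h : Setup P L τ δ μ₁ μ₂ U) (x : E d₁) {y : E d₂} (hy : y ∈ P.feasible) :
    MemLp (fun q : Ξ × E d₂ => P.zoGradY μ₂ x y q.1 q.2) 2 (P.law.prod (unifSphere d₂)) := by
  have := h.isProb
  have := isProbabilityMeasure_unifSphere h.one_le_d₂
  exact ((h.memLp_zoGradY_sub x hy).add (memLp_const (P.meanY μ₂ x y))).ae_eq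
    (Eventually.of_forall fun _ => sub_add_cancel _ _)

theorem integral_zoGradX (h : Setup P L τ δ μ₁ μ₂ U) (x : E d₁) {y : E d₂} (hy : y ∈ P.feasible) :
    ∫ q, P.zoGradX μ₁ x y q.1 q.2 ∂(P.law.prod (unifSphere d₁)) = P.meanX μ₁ x y := by
  have := h.isProb
  have := isProbabilityMeasure_unifSphere h.one_le_d₁
  exact integral_estimator_eq_gradient_smoothing (F := fun z ξ => P.loss z y ξ) (ρ := μ₁ + 1)
    h.one_le_d₁ h.μ₁_pos (by linarith) (fun z _ => h.smooth.integrable z y (h.mem_U hy))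
    (fun z _ => h.smoothPair_f.diff_x z y (h.mem_U hy))
    (fun z _ z' _ => h.smoothPair_f.gradX_lip_x h.L_pos.le z z' (h.mem_U hy))
    ((h.memLp_zoGradX x hy).integrable one_le_two)

theorem integral_zoGradY (h : Setup P L τ δ μ₁ μ₂ U) (x : E d₁) {y : E d₂} (hy : y ∈ P.feasible) :
    ∫ q, P.zoGradY μ₂ x y q.1 q.2 ∂(P.law.prod (unifSphere d₂)) = P.meanY μ₂ x y := by
  have := h.isProb
  have := isProbabilityMeasure_unifSphere h.one_le_d₂
  obtain ⟨ρ, hρ, hsub⟩ := h.exists_ball hy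
  exact integral_estimator_eq_gradient_smoothing (F := fun z ξ => P.loss x z ξ)
    h.one_le_d₂ h.μ₂_pos hρ (fun z hz => h.smooth.integrable x z (hsub hz))
    (fun z hz => h.smoothPair_f.diff_y x z (hsub hz))
    (fun z hz z' hz' => h.smoothPair_f.gradY_lip_y h.L_pos.le x (hsub hz) (hsub hz'))
    ((h.memLp_zoGradY x hy).integrable one_le_two)

/-- Here the sphere is averaged first, at fixed `ξ`: the vector `p ξ` does not depend on the
direction, so the second moment of `⟪p, u⟫` applies. -/
theorem lintegral_prod_unifSphere_le {d : ℕ} (hd : 1 ≤ d) {ν : Measure Ξ} [IsProbabilityMeasure ν]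
    {X : Ξ × E d → E d} (hX : AEStronglyMeasurable X (ν.prod (unifSphere d))) {a c M : ℝ} (ha : 0 ≤ a)
    (hc : 0 ≤ c) (p : Ξ → E d) (hp : ∀ ξ, ‖p ξ‖ ^ 2 ≤ M)
    (hb : ∀ ξ u, ‖u‖ = 1 → ‖X (ξ, u)‖ ^ 2 ≤ (d : ℝ) ^ 2 * (a * ⟪p ξ, u⟫ ^ 2 + c)) :
    ∫⁻ q, ‖X q‖ₑ ^ 2 ∂(ν.prod (unifSphere d)) ≤ ENNReal.ofReal (a * d * M + d ^ 2 * c) := by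
  have := isProbabilityMeasure_unifSphere hd
  rw [lintegral_prod _ (hX.enorm.pow_const 2)]
  calc ∫⁻ ξ, ∫⁻ u, ‖X (ξ, u)‖ₑ ^ 2 ∂(unifSphere d) ∂ν
      ≤ ∫⁻ _ξ, ENNReal.ofReal (a * d * M + d ^ 2 * c) ∂ν := by
        refine lintegral_mono fun ξ => ?_
        calc ∫⁻ u, ‖X (ξ, u)‖ₑ ^ 2 ∂(unifSphere d)
            ≤ ∫⁻ u, ENNReal.ofReal ((d : ℝ) ^ 2 * (a * ⟪p ξ, u⟫ ^ 2 + c)) ∂(unifSphere d) := by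
              refine lintegral_mono_ae ?_
              filter_upwards [ae_norm_eq_one_unifSphere d] with u hu
              rw [← ofReal_norm, ← ENNReal.ofReal_pow (norm_nonneg _)]
              exact ENNReal.ofReal_le_ofReal (hb ξ u hu)
          _ = _ := lintegral_estimator_bound hd (p ξ) ha hc
          _ ≤ _ := by
              refine ENNReal.ofReal_le_ofReal ?_
              have := hp ξ
              gcongr
    _ = _ := by simp

theorem taylor_estimator {d : ℕ} {φ : E d → ℝ} {x p u : E d} {μ L : ℝ} (hu : ‖u‖ = 1)
    (h : |φ (x + μ • u) - φ x - ⟪p, x + μ • u - x⟫| ≤ L / 2 * ‖x + μ • u - x‖ ^ 2) :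
    |φ (x + μ • u) - φ x - μ * ⟪p, u⟫| ≤ L / 2 * μ ^ 2 := by
  rwa [add_sub_cancel_left, real_inner_smul_right, norm_smul, hu, mul_one, Real.norm_eq_abs, sq_abs] at h

/-- The parameter `θ` trades the coefficient of the displacement against that of the smoothing
error. It is 5 in general, and 2 when the feasible set is a point. -/
theorem lintegral_zoGradX_sub_le (h : Setup P L τ δ μ₁ μ₂ U) {θ : ℝ} (hθ : 0 < θ) (x x' : E d₁)
    {y y' : E d₂} (hy : y ∈ P.feasible) (hy' : y' ∈ P.feasible) :
    ∫⁻ q, ‖P.zoGradX μ₁ x' y' q.1 q.2 - P.zoGradX μ₁ x y q.1 q.2‖ₑ ^ 2 ∂(P.law.prod (unifSphere d₁))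
      ≤ ENNReal.ofReal ((1 + θ) * d₁ * (L ^ 2 * (‖x' - x‖ ^ 2 + ‖y' - y‖ ^ 2))
        + d₁ ^ 2 * ((1 + 1 / θ) * (L ^ 2 * μ₁ ^ 2))) := by
  have := h.isProb
  refine lintegral_prod_unifSphere_le h.one_le_d₁
    ((h.aestronglyMeasurable_zoGradX x' hy').sub (h.aestronglyMeasurable_zoGradX x hy))
    (by positivity) (by positivity)
    (fun ξ => gradX (fun x y => P.loss x y ξ) x' y' - gradX (fun x y => P.loss x y ξ) x y)
    (fun ξ => (h.smooth.smoothPair_loss ξ).gradX_lip_sq x' x (h.mem_U hy') (h.mem_U hy)) fun ξ u hu => ?_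
  have hs := h.smooth.smoothPair_loss ξ
  exact norm_estimator_sub_sq_le (φ := fun z => P.loss z y ξ) (ψ := fun z => P.loss z y' ξ)
    h.μ₁_pos hθ hu
    (taylor_estimator (φ := fun z => P.loss z y ξ) hu
      (hs.taylor_x h.L_pos.le x (x + μ₁ • u) (h.mem_U hy)))
    (taylor_estimator (φ := fun z => P.loss z y' ξ) hu
      (hs.taylor_x h.L_pos.le x' (x' + μ₁ • u) (h.mem_U hy')))

theorem lintegral_zoGradY_sub_le (h : Setup P L τ δ μ₁ μ₂ U) {θ : ℝ} (hθ : 0 < θ) (x x' : E d₁)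
    {y y' : E d₂} (hy : y ∈ P.feasible) (hy' : y' ∈ P.feasible) :
    ∫⁻ q, ‖P.zoGradY μ₂ x' y' q.1 q.2 - P.zoGradY μ₂ x y q.1 q.2‖ₑ ^ 2 ∂(P.law.prod (unifSphere d₂))
      ≤ ENNReal.ofReal ((1 + θ) * d₂ * (L ^ 2 * (‖x' - x‖ ^ 2 + ‖y' - y‖ ^ 2))
        + d₂ ^ 2 * ((1 + 1 / θ) * (L ^ 2 * μ₂ ^ 2))) := by
  have := h.isProb
  refine lintegral_prod_unifSphere_le h.one_le_d₂
    ((h.aestronglyMeasurable_zoGradY x' hy').sub (h.aestronglyMeasurable_zoGradY x hy))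
    (by positivity) (by positivity)
    (fun ξ => gradY (fun x y => P.loss x y ξ) x' y' - gradY (fun x y => P.loss x y ξ) x y)
    (fun ξ => (h.smooth.smoothPair_loss ξ).gradY_lip_sq x' x (h.mem_U hy') (h.mem_U hy)) fun ξ u hu => ?_
  have hs := (h.smooth.smoothPair_loss ξ).mono h.subset
  have hcv := h.assum.convex.cthickening μ₂
  exact norm_estimator_sub_sq_le (φ := fun z => P.loss x z ξ) (ψ := fun z => P.loss x' z ξ)
    h.μ₂_pos hθ hu
    (taylor_estimator (φ := fun z => P.loss x z ξ) hu
      (hs.taylor_y h.L_pos.le hcv x (h.feasible_subset_thick hy) (h.add_smul_mem_thick hy hu.le)))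
    (taylor_estimator (φ := fun z => P.loss x' z ξ) hu
      (hs.taylor_y h.L_pos.le hcv x' (h.feasible_subset_thick hy') (h.add_smul_mem_thick hy' hu.le)))

theorem norm_smul_smul_le {d : ℕ} {u : E d} {t : ℝ} (hu : ‖u‖ = 1) (ht : t ∈ Icc (0 : ℝ) 1) : ‖t • u‖ ≤ 1 := by
  rw [norm_smul, hu, mul_one, Real.norm_eq_abs, abs_of_nonneg ht.1]; exact ht.2

/-- In dimension one there is no smoothing error at all. Without this case the additive errors in
`exists_changeBound` would not stay below `3/2 L²/(m+T)^(4/3)`. -/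
theorem lintegral_zoGradX_sub_le_of_one (h : Setup P L τ δ μ₁ μ₂ U) (hd : d₁ = 1) (x x' : E d₁)
    {y y' : E d₂} (hy : y ∈ P.feasible) (hy' : y' ∈ P.feasible) :
    ∫⁻ q, ‖P.zoGradX μ₁ x' y' q.1 q.2 - P.zoGradX μ₁ x y q.1 q.2‖ₑ ^ 2 ∂(P.law.prod (unifSphere d₁))
      ≤ ENNReal.ofReal (L ^ 2 * (‖x' - x‖ ^ 2 + ‖y' - y‖ ^ 2)) := by
  have := h.isProb
  have key := lintegral_prod_unifSphere_le (a := 0) (c := L ^ 2 * (‖x' - x‖ ^ 2 + ‖y' - y‖ ^ 2)) (M := 0)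
    h.one_le_d₁ ((h.aestronglyMeasurable_zoGradX x' hy').sub (h.aestronglyMeasurable_zoGradX x hy))
    le_rfl (by positivity) (fun _ => 0) (fun ξ => by simp) fun ξ u hu => by
      have hs := h.smooth.smoothPair_loss ξ
      have := norm_estimator_sub_sq_le_of_lipschitz (φ := fun z => P.loss z y ξ)
        (ψ := fun z => P.loss z y' ξ) (x := x) (x' := x') (C := L * √(‖x' - x‖ ^ 2 + ‖y' - y‖ ^ 2))
        h.μ₁_pos hu (fun t _ => hs.diff_x _ y (h.mem_U hy))
        (fun t _ => hs.diff_x _ y' (h.mem_U hy')) (fun t _ => by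
          have := hs.gradX_lip_sq (x' + t • μ₁ • u) (x + t • μ₁ • u) (h.mem_U hy') (h.mem_U hy)
          rw [add_sub_add_right_eq_sub] at this
          refine abs_le_of_sq_le_sq' ?_ (by have := h.L_pos; positivity) |>.2
          rwa [mul_pow, Real.sq_sqrt (by positivity)])
      rw [mul_pow L, Real.sq_sqrt (by positivity)] at this
      refine this.trans (le_of_eq ?_)
      ring
  simpa [hd] using key

theorem lintegral_zoGradY_sub_le_of_one (h : Setup P L τ δ μ₁ μ₂ U) (hd : d₂ = 1) (x x' : E d₁)
    {y y' : E d₂} (hy : y ∈ P.feasible) (hy' : y' ∈ P.feasible) :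
    ∫⁻ q, ‖P.zoGradY μ₂ x' y' q.1 q.2 - P.zoGradY μ₂ x y q.1 q.2‖ₑ ^ 2 ∂(P.law.prod (unifSphere d₂))
      ≤ ENNReal.ofReal (L ^ 2 * (‖x' - x‖ ^ 2 + ‖y' - y‖ ^ 2)) := by
  have := h.isProb
  have key := lintegral_prod_unifSphere_le (a := 0) (c := L ^ 2 * (‖x' - x‖ ^ 2 + ‖y' - y‖ ^ 2)) (M := 0)
    h.one_le_d₂ ((h.aestronglyMeasurable_zoGradY x' hy').sub (h.aestronglyMeasurable_zoGradY x hy))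
    le_rfl (by positivity) (fun _ => 0) (fun ξ => by simp) fun ξ u hu => by
      have hs := (h.smooth.smoothPair_loss ξ).mono h.subset
      have hmem : ∀ z ∈ P.feasible, ∀ t ∈ Icc (0 : ℝ) 1, z + t • μ₂ • u ∈ cthickening μ₂ P.feasible := by
        intro z hz t ht
        rw [smul_comm]
        exact h.add_smul_mem_thick hz (norm_smul_smul_le hu ht)
      have := norm_estimator_sub_sq_le_of_lipschitz (φ := fun z => P.loss x z ξ)
        (ψ := fun z => P.loss x' z ξ) (x := y) (x' := y') (C := L * √(‖x' - x‖ ^ 2 + ‖y' - y‖ ^ 2))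
        h.μ₂_pos hu (fun t ht => hs.diff_y x _ (hmem y hy t ht))
        (fun t ht => hs.diff_y x' _ (hmem y' hy' t ht)) (fun t ht => by
          have := hs.gradY_lip_sq x' x (hmem y' hy' t ht) (hmem y hy t ht)
          rw [add_sub_add_right_eq_sub] at this
          refine abs_le_of_sq_le_sq' ?_ (by have := h.L_pos; positivity) |>.2
          rwa [mul_pow, Real.sq_sqrt (by positivity)])
      rw [mul_pow L, Real.sq_sqrt (by positivity)] at this
      refine this.trans (le_of_eq ?_)
      ring
  simpa [hd] using key

end Moments

end Setup

end AccZOMDA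

/-! ### Mini-batch means and recursive momentum. -/

namespace AccZOMDA
open Set Metric Filter Topology
open scoped RealInnerProductSpace ENNReal

section BatchMean

variable {S : Type*} [MeasurableSpace S] {ν : Measure S} {d b : ℕ}

theorem lintegral_enorm_sq_eq {f : S → E d} (hf : MemLp f 2 ν) :
    ∫⁻ s, ‖f s‖ₑ ^ 2 ∂ν = ENNReal.ofReal (∫ s, ‖f s‖ ^ 2 ∂ν) := by
  rw [ofReal_integral_eq_lintegral_ofReal (hf.integrable_norm_pow two_ne_zero)
    (Eventually.of_forall fun _ => by positivity)]
  refine lintegral_congr fun s => ?_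
  rw [ENNReal.ofReal_pow (norm_nonneg _), ofReal_norm]

theorem integral_norm_sq_le_of_lintegral {f : S → E d} (hf : MemLp f 2 ν) {C : ℝ} (hC : 0 ≤ C)
    (h : ∫⁻ s, ‖f s‖ₑ ^ 2 ∂ν ≤ ENNReal.ofReal C) : ∫ s, ‖f s‖ ^ 2 ∂ν ≤ C := by
  rw [lintegral_enorm_sq_eq hf] at h
  exact (ENNReal.ofReal_le_ofReal_iff hC).1 h

variable [IsProbabilityMeasure ν]

/-- The cross term with `c` vanishes because `q` is centred, and the variances of independent
summands add. The vector version applies this to each coordinate. -/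
theorem integral_sum_pi_sq {q : S → ℝ} (hq : MemLp q 2 ν) (h0 : ∫ s, q s ∂ν = 0) (c : ℝ) :
    ∫ B : Fin b → S, (c + 1 / (b : ℝ) * ∑ i, q (B i)) ^ 2 ∂(Measure.pi fun _ => ν)
      = c ^ 2 + (1 / (b : ℝ)) ^ 2 * (b * ∫ s, q s ^ 2 ∂ν) := by
  have hev : ∀ i : Fin b, MemLp (fun B : Fin b → S => q (B i)) 2 (Measure.pi fun _ => ν) := fun i =>
    hq.comp_measurePreserving (measurePreserving_eval (fun _ => ν) i)
  have hsum : MemLp (fun B : Fin b → S => ∑ i, q (B i)) 2 (Measure.pi fun _ => ν) :=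
    memLp_finsetSum _ fun i _ => hev i
  have hmean : ∫ B : Fin b → S, ∑ i, q (B i) ∂(Measure.pi fun _ => ν) = 0 := by
    rw [integral_finsetSum _ fun i _ => (hev i).integrable one_le_two]
    refine Finset.sum_eq_zero fun i _ => ?_
    have mp := measurePreserving_eval (fun _ : Fin b => ν) i
    have := integral_map mp.aemeasurable (f := q) (by rw [mp.map_eq]; exact hq.1)
    rw [mp.map_eq, h0] at this
    exact this.symm
  have hvar : ∫ B : Fin b → S, (∑ i, q (B i)) ^ 2 ∂(Measure.pi fun _ => ν) = b * ∫ s, q s ^ 2 ∂ν := by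
    have h1 := variance_sum_pi (μ := fun _ : Fin b => ν) (X := fun _ => q) fun _ => hq
    rw [Finset.sum_const, Finset.card_univ, Fintype.card_fin, nsmul_eq_mul,
      variance_of_integral_eq_zero hq.aemeasurable h0] at h1
    rw [← h1, ← variance_of_integral_eq_zero hsum.aemeasurable hmean]
    congr 1
    ext B
    simp
  have e : ∀ B : Fin b → S, (c + 1 / (b : ℝ) * ∑ i, q (B i)) ^ 2
      = c ^ 2 + (2 * c * (1 / (b : ℝ)) * ∑ i, q (B i) + (1 / (b : ℝ)) ^ 2 * (∑ i, q (B i)) ^ 2) :=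
    fun B => by ring
  simp_rw [e]
  have i1 := (hsum.integrable one_le_two).const_mul (2 * c * (1 / (b : ℝ)))
  have i2 := hsum.integrable_sq.const_mul ((1 / (b : ℝ)) ^ 2)
  have i3 : Integrable (fun B : Fin b → S => 2 * c * (1 / (b : ℝ)) * ∑ i, q (B i)
      + (1 / (b : ℝ)) ^ 2 * (∑ i, q (B i)) ^ 2) (Measure.pi fun _ => ν) := i1.add i2
  rw [integral_add (integrable_const _) i3, integral_add i1 i2, integral_const_mul,
    integral_const_mul, hmean, hvar]
  simp

theorem integral_norm_add_batch_mean_sq (hb : 1 ≤ b) {q : S → E d} (hq : MemLp q 2 ν)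
    (h0 : ∫ s, q s ∂ν = 0) (c : E d) :
    ∫ B : Fin b → S, ‖c + (1 / (b : ℝ)) • ∑ i, q (B i)‖ ^ 2 ∂(Measure.pi fun _ => ν)
      = ‖c‖ ^ 2 + 1 / (b : ℝ) * ∫ s, ‖q s‖ ^ 2 ∂ν := by
  have hqj : ∀ j, MemLp (fun s => q s j) 2 ν := fun j =>
    MemLp.of_le hq (by
      have := hq.1
      fun_prop) (Eventually.of_forall fun s => PiLp.norm_apply_le _ j)
  have h0j : ∀ j, ∫ s, q s j ∂ν = 0 := fun j => by
    have := (EuclideanSpace.proj (𝕜 := ℝ) j).integral_comp_comm (hq.integrable one_le_two)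
    rw [h0] at this
    simpa using this
  have hev : ∀ j, ∀ i : Fin b, MemLp (fun B : Fin b → S => q (B i) j) 2 (Measure.pi fun _ => ν) :=
    fun j i => (hqj j).comp_measurePreserving (measurePreserving_eval (fun _ => ν) i)
  have e : ∀ B : Fin b → S, ‖c + (1 / (b : ℝ)) • ∑ i, q (B i)‖ ^ 2
      = ∑ j, (c j + 1 / (b : ℝ) * ∑ i, q (B i) j) ^ 2 := fun B => by
    rw [EuclideanSpace.real_norm_sq_eq]
    simp
  simp_rw [e]
  rw [integral_finsetSum]
  · simp_rw [fun j => integral_sum_pi_sq (b := b) (hqj j) (h0j j) (c j), EuclideanSpace.real_norm_sq_eq]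
    rw [integral_finsetSum _ fun j _ => (hqj j).integrable_sq, Finset.sum_add_distrib, ← Finset.mul_sum,
      ← Finset.mul_sum]
    have : (b : ℝ) ≠ 0 := by positivity
    field_simp
  · intro j _
    exact ((memLp_const (c j)).add ((memLp_finsetSum _ fun i _ => hev j i).const_mul
      (1 / (b : ℝ)))).integrable_sq

theorem memLp_add_batch_mean {q : S → E d} (hq : MemLp q 2 ν) (c : E d) :
    MemLp (fun B : Fin b → S => c + (1 / (b : ℝ)) • ∑ i, q (B i)) 2 (Measure.pi fun _ => ν) :=
  (memLp_const c).add ((memLp_finsetSum _ fun i _ =>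
    hq.comp_measurePreserving (measurePreserving_eval (fun _ => ν) i)).const_smul (1 / (b : ℝ)))

/-- Centring a random vector subtracts the squared norm of its mean from the second moment. -/
theorem integral_norm_sub_mean_sq_le {X : S → E d} (hX : MemLp X 2 ν) :
    ∫ s, ‖X s - ∫ r, X r ∂ν‖ ^ 2 ∂ν ≤ ∫ s, ‖X s‖ ^ 2 ∂ν := by
  set m := ∫ r, X r ∂ν with hm
  have e : ∀ s, ‖X s - m‖ ^ 2 = ‖X s‖ ^ 2 - 2 * ⟪m, X s⟫ + ‖m‖ ^ 2 := fun s => by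
    rw [norm_sub_sq_real, real_inner_comm]
  have i1 := hX.integrable_norm_pow two_ne_zero
  have i2 := ((hX.integrable one_le_two).const_inner (𝕜 := ℝ) m).const_mul 2
  have i3 : Integrable (fun s => ‖X s‖ ^ 2 - 2 * ⟪m, X s⟫) ν := i1.sub i2
  simp_rw [e]
  rw [integral_add i3 (integrable_const _), integral_sub i1 i2, integral_const_mul,
    integral_inner (hX.integrable one_le_two), ← hm, real_inner_self_eq_norm_sq]
  simp
  nlinarith [sq_nonneg ‖m‖]

/-- The mean-square error of a mini-batch estimator. -/
theorem lintegral_batch_mean_sub_le (hb : 1 ≤ b) {X : S → E d} {m : E d} (hX : MemLp X 2 ν)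
    (hm : ∫ s, X s ∂ν = m) {D : ℝ} (hD : 0 ≤ D) (hv : ∫⁻ s, ‖X s - m‖ₑ ^ 2 ∂ν ≤ ENNReal.ofReal D) :
    ∫⁻ B : Fin b → S, ‖(1 / (b : ℝ)) • ∑ i, X (B i) - m‖ₑ ^ 2 ∂(Measure.pi fun _ => ν)
      ≤ ENNReal.ofReal (D / b) := by
  have hb0 : (b : ℝ) ≠ 0 := by positivity
  have hq : MemLp (fun s => X s - m) 2 ν := hX.sub (memLp_const m)
  have h0 : ∫ s, (X s - m) ∂ν = 0 := by
    rw [integral_sub (hX.integrable one_le_two) (integrable_const _), hm]; simp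
  have e : ∀ B : Fin b → S, (1 / (b : ℝ)) • ∑ i, X (B i) - m
      = 0 + (1 / (b : ℝ)) • ∑ i, (X (B i) - m) := fun B => by
    rw [Finset.sum_sub_distrib, smul_sub, Finset.sum_const, Finset.card_univ, Fintype.card_fin,
      ← Nat.cast_smul_eq_nsmul ℝ, smul_smul, one_div_mul_cancel hb0, one_smul, zero_add]
  simp_rw [e]
  rw [lintegral_enorm_sq_eq (memLp_add_batch_mean hq 0), integral_norm_add_batch_mean_sq hb hq h0]
  refine ENNReal.ofReal_le_ofReal ?_
  have := integral_norm_sq_le_of_lintegral hq hD hv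
  calc _ = 1 / (b : ℝ) * ∫ s, ‖X s - m‖ ^ 2 ∂ν := by rw [norm_zero]; ring
    _ ≤ 1 / (b : ℝ) * D := by gcongr
    _ = D / b := by ring

theorem norm_combination_sq_le {a c : E d} {α : ℝ} (h0 : 0 ≤ α) (h1 : α ≤ 1) :
    ‖(1 - α) • a + α • c‖ ^ 2 ≤ 2 * ‖a‖ ^ 2 + 2 * α ^ 2 * ‖c‖ ^ 2 := by
  have h2 : ‖(1 - α) • a + α • c‖ ≤ ‖a‖ + α * ‖c‖ := by
    refine (norm_add_le _ _).trans ?_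
    rw [norm_smul, norm_smul, Real.norm_eq_abs, Real.norm_eq_abs, abs_of_nonneg h0,
      abs_of_nonneg (sub_nonneg.2 h1)]
    nlinarith [norm_nonneg a]
  calc _ ≤ (‖a‖ + α * ‖c‖) ^ 2 := by gcongr
    _ ≤ _ := by nlinarith [sq_nonneg (‖a‖ - α * ‖c‖)]

/-- The mean-square error of the recursive-momentum estimator. -/
theorem lintegral_momentum_sub_le (hb : 1 ≤ b) {X X' : S → E d} {m m' v : E d} (hX : MemLp X 2 ν)
    (hX' : MemLp X' 2 ν) (hm : ∫ s, X s ∂ν = m) (hm' : ∫ s, X' s ∂ν = m') {D M α : ℝ} (hD : 0 ≤ D)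
    (hM : 0 ≤ M) (hv : ∫⁻ s, ‖X' s - m'‖ₑ ^ 2 ∂ν ≤ ENNReal.ofReal D)
    (hd : ∫⁻ s, ‖X' s - X s‖ₑ ^ 2 ∂ν ≤ ENNReal.ofReal M) (h0 : 0 ≤ α) (h1 : α ≤ 1) :
    ∫⁻ B : Fin b → S, ‖(1 / (b : ℝ)) • ∑ i, X' (B i)
        + (1 - α) • (v - (1 / (b : ℝ)) • ∑ i, X (B i)) - m'‖ₑ ^ 2 ∂(Measure.pi fun _ => ν)
      ≤ ENNReal.ofReal ((1 - α) * ‖v - m‖ ^ 2 + 2 / b * M + 2 * α ^ 2 * D / b) := by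
  have hb0 : (b : ℝ) ≠ 0 := by positivity
  have hXd : MemLp (fun s => X' s - X s) 2 ν := hX'.sub hX
  have hmd : ∫ s, (X' s - X s) ∂ν = m' - m := by
    rw [integral_sub (hX'.integrable one_le_two) (hX.integrable one_le_two), hm, hm']
  have hdm : MemLp (fun s => X' s - X s - (m' - m)) 2 ν := hXd.sub (memLp_const _)
  have hvm : MemLp (fun s => X' s - m') 2 ν := hX'.sub (memLp_const _)
  -- The new error equals `1 - α` times the old one plus the batch mean of this centred variable: a
  -- part `1 - α` measures the change of the estimator, a part `α` its plain noise.
  set q : S → E d := fun s => (1 - α) • (X' s - X s - (m' - m)) + α • (X' s - m') with hq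
  have hqL : MemLp q 2 ν := (hdm.const_smul (1 - α)).add (hvm.const_smul α)
  have hq0 : ∫ s, q s ∂ν = 0 := by
    have i1 := (hdm.const_smul (1 - α)).integrable one_le_two
    have i2 := (hvm.const_smul α).integrable one_le_two
    have e1 : ∫ s, (X' s - X s - (m' - m)) ∂ν = 0 := by
      rw [integral_sub (hXd.integrable one_le_two) (integrable_const _), hmd]; simp
    have e2 : ∫ s, (X' s - m') ∂ν = 0 := by
      rw [integral_sub (hX'.integrable one_le_two) (integrable_const _), hm']; simp
    calc ∫ s, q s ∂ν = ∫ s, (1 - α) • (X' s - X s - (m' - m)) ∂ν + ∫ s, α • (X' s - m') ∂ν :=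
          integral_add i1 i2
      _ = 0 := by rw [integral_smul, integral_smul, e1, e2]; simp
  have e : ∀ B : Fin b → S, (1 / (b : ℝ)) • ∑ i, X' (B i)
        + (1 - α) • (v - (1 / (b : ℝ)) • ∑ i, X (B i)) - m'
      = (1 - α) • (v - m) + (1 / (b : ℝ)) • ∑ i, q (B i) := fun B => by
    have h3 : ∀ z : E d, z = (1 / (b : ℝ)) • (b : ℝ) • z := fun z => by
      rw [smul_smul, one_div_mul_cancel hb0, one_smul]
    simp only [hq, Finset.sum_add_distrib, ← Finset.smul_sum, Finset.sum_sub_distrib, Finset.sum_const,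
      Finset.card_univ, Fintype.card_fin, ← Nat.cast_smul_eq_nsmul ℝ]
    have h4 := h3 m
    have h5 := h3 m'
    set A := ∑ i, X' (B i)
    set A2 := ∑ i, X (B i)
    have e1 : (1 / (b : ℝ)) • ((1 - α) • (A - A2 - ((b : ℝ) • m' - (b : ℝ) • m)) + α • (A - (b : ℝ) • m'))
      = (1 - α) • ((1 / (b : ℝ)) • A - (1 / (b : ℝ)) • A2 - ((1 / (b : ℝ)) • (b : ℝ) • m'
        - (1 / (b : ℝ)) • (b : ℝ) • m)) + α • ((1 / (b : ℝ)) • A - (1 / (b : ℝ)) • (b : ℝ) • m') := by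
      module
    rw [e1, ← h4, ← h5]
    module
  simp_rw [e]
  rw [lintegral_enorm_sq_eq (memLp_add_batch_mean hqL _), integral_norm_add_batch_mean_sq hb hqL hq0]
  refine ENNReal.ofReal_le_ofReal ?_
  have k1 : ∫ s, ‖q s‖ ^ 2 ∂ν ≤ 2 * M + 2 * α ^ 2 * D := by
    calc ∫ s, ‖q s‖ ^ 2 ∂ν
        ≤ ∫ s, (2 * ‖X' s - X s - (m' - m)‖ ^ 2 + 2 * α ^ 2 * ‖X' s - m'‖ ^ 2) ∂ν :=
          integral_mono (hqL.integrable_norm_pow two_ne_zero)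
            (((hdm.integrable_norm_pow two_ne_zero).const_mul 2).add
              ((hvm.integrable_norm_pow two_ne_zero).const_mul _))
            fun s => norm_combination_sq_le h0 h1
      _ = 2 * ∫ s, ‖X' s - X s - (m' - m)‖ ^ 2 ∂ν + 2 * α ^ 2 * ∫ s, ‖X' s - m'‖ ^ 2 ∂ν := by
          rw [integral_add ((hdm.integrable_norm_pow two_ne_zero).const_mul 2)
            ((hvm.integrable_norm_pow two_ne_zero).const_mul _), integral_const_mul,
            integral_const_mul]
      _ ≤ 2 * M + 2 * α ^ 2 * D := by
          have k2 := integral_norm_sub_mean_sq_le hXd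
          rw [hmd] at k2
          have k3 := integral_norm_sq_le_of_lintegral hXd hM hd
          have k4 := integral_norm_sq_le_of_lintegral hvm hD hv
          have k5 := k2.trans k3
          gcongr
  -- `(1 - α)² ≤ 1 - α`; the linear factor is enough to offset the growth of the weights.
  have k6 : ‖(1 - α) • (v - m)‖ ^ 2 ≤ (1 - α) * ‖v - m‖ ^ 2 := by
    rw [norm_smul, mul_pow, Real.norm_eq_abs, sq_abs]
    refine mul_le_mul_of_nonneg_right ?_ (sq_nonneg _)
    nlinarith
  calc _ ≤ (1 - α) * ‖v - m‖ ^ 2 + 1 / (b : ℝ) * (2 * M + 2 * α ^ 2 * D) := by gcongr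
    _ = _ := by ring

end BatchMean

end AccZOMDA

/-! ### The algorithm as a Markov chain. -/

namespace AccZOMDA
open Set Metric Filter Topology
open scoped RealInnerProductSpace ENNReal

variable {d₁ d₂ b : ℕ} {Ξ : Type u} [MeasurableSpace Ξ]

/-- The law of one random triple `(ξ, û, ũ)`. -/
noncomputable def Problem.tripleLaw (P : Problem d₁ d₂ Ξ) : Measure (Ξ × E d₁ × E d₂) :=
  P.law.prod ((unifSphere d₁).prod (unifSphere d₂))

/-- The law of one mini-batch. -/
noncomputable def Problem.batchLaw (P : Problem d₁ d₂ Ξ) (b : ℕ) : Measure (Batch d₁ d₂ b Ξ) :=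
  Measure.pi fun _ => P.tripleLaw

/-- The next iterate in `x`. -/
noncomputable def nextX (p : Params) (t : ℕ) (s : State d₁ d₂) : E d₁ := s.x - (p.γ * p.eta t) • s.v

/-- The projected ascent step in `y`. -/
noncomputable def ascentY (P : Problem d₁ d₂ Ξ) (p : Params) (s : State d₁ d₂) : E d₂ :=
  proj P.feasible (s.y + p.lam • s.w)

/-- The next iterate in `y`. -/
noncomputable def nextY (P : Problem d₁ d₂ Ξ) (p : Params) (t : ℕ) (s : State d₁ d₂) : E d₂ :=
  s.y + p.eta t • (ascentY P p s - s.y)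

/-- Pulled back from the four vectors only, so the query counter plays no role in measurability. -/
instance : MeasurableSpace (State d₁ d₂) :=
  MeasurableSpace.comap (fun s => ((s.x, s.y), (s.v, s.w))) inferInstance

namespace State

theorem measurable_tuple : Measurable fun s : State d₁ d₂ => ((s.x, s.y), (s.v, s.w)) :=
  comap_measurable _

@[fun_prop] theorem measurable_x : Measurable (State.x : State d₁ d₂ → E d₁) :=
  measurable_fst.comp (measurable_fst.comp measurable_tuple)

@[fun_prop] theorem measurable_y : Measurable (State.y : State d₁ d₂ → E d₂) :=
  measurable_snd.comp (measurable_fst.comp measurable_tuple)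

@[fun_prop] theorem measurable_v : Measurable (State.v : State d₁ d₂ → E d₁) :=
  measurable_fst.comp (measurable_snd.comp measurable_tuple)

@[fun_prop] theorem measurable_w : Measurable (State.w : State d₁ d₂ → E d₂) :=
  measurable_snd.comp (measurable_snd.comp measurable_tuple)

theorem measurable_of {α : Type*} [MeasurableSpace α] {F : α → State d₁ d₂}
    (hx : Measurable fun a => (F a).x) (hy : Measurable fun a => (F a).y)
    (hv : Measurable fun a => (F a).v) (hw : Measurable fun a => (F a).w) : Measurable F :=
  measurable_comap_iff.2 ((hx.prodMk hy).prodMk (hv.prodMk hw))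

end State

theorem step_x (P : Problem d₁ d₂ Ξ) (p : Params) (t : ℕ) (B : Batch d₁ d₂ b Ξ) (s : State d₁ d₂) :
    (step P p t B s).x = nextX p t s := rfl

theorem step_y (P : Problem d₁ d₂ Ξ) (p : Params) (t : ℕ) (B : Batch d₁ d₂ b Ξ) (s : State d₁ d₂) :
    (step P p t B s).y = nextY P p t s := rfl

theorem step_v (P : Problem d₁ d₂ Ξ) (p : Params) (t : ℕ) (B : Batch d₁ d₂ b Ξ) (s : State d₁ d₂) :
    (step P p t B s).v = batchGradX P p (nextX p t s) (nextY P p t s) B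
      + (1 - p.c₁ * p.eta t ^ 2) • (s.v - batchGradX P p s.x s.y B) := rfl

theorem step_w (P : Problem d₁ d₂ Ξ) (p : Params) (t : ℕ) (B : Batch d₁ d₂ b Ξ) (s : State d₁ d₂) :
    (step P p t B s).w = batchGradY P p (nextX p t s) (nextY P p t s) B
      + (1 - p.c₂ * p.eta t ^ 2) • (s.w - batchGradY P p s.x s.y B) := rfl

namespace Setup

variable {P : Problem d₁ d₂ Ξ} {L τ δ : ℝ} {p : Params} {U : Set (E d₂)}

theorem isProb_tripleLaw {μ₁ μ₂ : ℝ} (h : Setup P L τ δ μ₁ μ₂ U) : IsProbabilityMeasure P.tripleLaw := by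
  have := h.isProb
  have := isProbabilityMeasure_unifSphere h.one_le_d₁
  have := isProbabilityMeasure_unifSphere h.one_le_d₂
  unfold Problem.tripleLaw
  infer_instance

theorem isProb_batchLaw {μ₁ μ₂ : ℝ} (h : Setup P L τ δ μ₁ μ₂ U) (b : ℕ) :
    IsProbabilityMeasure (P.batchLaw b) := by
  have := h.isProb_tripleLaw
  unfold Problem.batchLaw
  infer_instance

theorem measurePreserving_pair_x {μ₁ μ₂ : ℝ} (h : Setup P L τ δ μ₁ μ₂ U) :
    MeasurePreserving (fun q : Ξ × E d₁ × E d₂ => (q.1, q.2.1)) P.tripleLaw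
      (P.law.prod (unifSphere d₁)) := by
  have := h.isProb
  have := isProbabilityMeasure_unifSphere h.one_le_d₁
  have := isProbabilityMeasure_unifSphere h.one_le_d₂
  exact (MeasurePreserving.id P.law).prod measurePreserving_fst

theorem measurePreserving_pair_y {μ₁ μ₂ : ℝ} (h : Setup P L τ δ μ₁ μ₂ U) :
    MeasurePreserving (fun q : Ξ × E d₁ × E d₂ => (q.1, q.2.2)) P.tripleLaw
      (P.law.prod (unifSphere d₂)) := by
  have := h.isProb
  have := isProbabilityMeasure_unifSphere h.one_le_d₁
  have := isProbabilityMeasure_unifSphere h.one_le_d₂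
  exact (MeasurePreserving.id P.law).prod measurePreserving_snd

theorem lintegral_comp_of_aemeasurable {α β : Type*} [MeasurableSpace α] [MeasurableSpace β] {μ : Measure α}
    {ν : Measure β} {g : α → β} (hg : MeasurePreserving g μ ν) {f : β → ℝ≥0∞} (hf : AEMeasurable f ν) :
    ∫⁻ a, f (g a) ∂μ = ∫⁻ c, f c ∂ν := by
  rw [← hg.map_eq] at hf ⊢
  exact (lintegral_map' hf hg.aemeasurable).symm

theorem integral_comp_of_aestronglyMeasurable {α β F : Type*} [MeasurableSpace α] [MeasurableSpace β]
    [NormedAddCommGroup F] [NormedSpace ℝ F] {μ : Measure α}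
    {ν : Measure β} {g : α → β} (hg : MeasurePreserving g μ ν) {f : β → F} (hf : AEStronglyMeasurable f ν) :
    ∫ a, f (g a) ∂μ = ∫ c, f c ∂ν := by
  rw [← hg.map_eq] at hf ⊢
  exact (integral_map hg.aemeasurable hf).symm

section Momentum

theorem lintegral_step_v_le (h : Setup P L τ δ p.μ₁ p.μ₂ U) (hb : 1 ≤ b) {t : ℕ} {s : State d₁ d₂} (hy : s.y ∈ P.feasible)
    (hy' : nextY P p t s ∈ P.feasible) {M : ℝ} (hM : 0 ≤ M)
    (hd : ∫⁻ q, ‖P.zoGradX p.μ₁ (nextX p t s) (nextY P p t s) q.1 q.2 - P.zoGradX p.μ₁ s.x s.y q.1 q.2‖ₑ ^ 2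
      ∂(P.law.prod (unifSphere d₁)) ≤ ENNReal.ofReal M)
    (h0 : 0 ≤ p.c₁ * p.eta t ^ 2) (h1 : p.c₁ * p.eta t ^ 2 ≤ 1) :
    ∫⁻ B, ‖(step P p t B s).v - P.meanX p.μ₁ (nextX p t s) (nextY P p t s)‖ₑ ^ 2 ∂(P.batchLaw b)
      ≤ ENNReal.ofReal ((1 - p.c₁ * p.eta t ^ 2) * ‖s.v - P.meanX p.μ₁ s.x s.y‖ ^ 2 + 2 / b * M
        + 2 * (p.c₁ * p.eta t ^ 2) ^ 2 * δ ^ 2 / b) := by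
  have := h.isProb_tripleLaw
  have hmp := h.measurePreserving_pair_x
  have hX := h.memLp_zoGradX s.x hy
  have hX' := h.memLp_zoGradX (nextX p t s) hy'
  exact lintegral_momentum_sub_le hb (hX.comp_measurePreserving hmp) (hX'.comp_measurePreserving hmp)
    ((integral_comp_of_aestronglyMeasurable hmp hX.1).trans (h.integral_zoGradX _ hy))
    ((integral_comp_of_aestronglyMeasurable hmp hX'.1).trans (h.integral_zoGradX _ hy')) (sq_nonneg δ) hM
    ((lintegral_comp_of_aemeasurable hmp ((hX'.1.sub aestronglyMeasurable_const).enorm.pow_const 2)).trans_le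
      (h.assum.variance_x _ _ hy'))
    ((lintegral_comp_of_aemeasurable hmp ((hX'.1.sub hX.1).enorm.pow_const 2)).trans_le hd) h0 h1

theorem lintegral_step_w_le (h : Setup P L τ δ p.μ₁ p.μ₂ U) (hb : 1 ≤ b) {t : ℕ} {s : State d₁ d₂} (hy : s.y ∈ P.feasible)
    (hy' : nextY P p t s ∈ P.feasible) {M : ℝ} (hM : 0 ≤ M)
    (hd : ∫⁻ q, ‖P.zoGradY p.μ₂ (nextX p t s) (nextY P p t s) q.1 q.2 - P.zoGradY p.μ₂ s.x s.y q.1 q.2‖ₑ ^ 2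
      ∂(P.law.prod (unifSphere d₂)) ≤ ENNReal.ofReal M)
    (h0 : 0 ≤ p.c₂ * p.eta t ^ 2) (h1 : p.c₂ * p.eta t ^ 2 ≤ 1) :
    ∫⁻ B, ‖(step P p t B s).w - P.meanY p.μ₂ (nextX p t s) (nextY P p t s)‖ₑ ^ 2 ∂(P.batchLaw b)
      ≤ ENNReal.ofReal ((1 - p.c₂ * p.eta t ^ 2) * ‖s.w - P.meanY p.μ₂ s.x s.y‖ ^ 2 + 2 / b * M
        + 2 * (p.c₂ * p.eta t ^ 2) ^ 2 * δ ^ 2 / b) := by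
  have := h.isProb_tripleLaw
  have hmp := h.measurePreserving_pair_y
  have hX := h.memLp_zoGradY s.x hy
  have hX' := h.memLp_zoGradY (nextX p t s) hy'
  exact lintegral_momentum_sub_le hb (hX.comp_measurePreserving hmp) (hX'.comp_measurePreserving hmp)
    ((integral_comp_of_aestronglyMeasurable hmp hX.1).trans (h.integral_zoGradY _ hy))
    ((integral_comp_of_aestronglyMeasurable hmp hX'.1).trans (h.integral_zoGradY _ hy')) (sq_nonneg δ) hM
    ((lintegral_comp_of_aemeasurable hmp ((hX'.1.sub aestronglyMeasurable_const).enorm.pow_const 2)).trans_le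
      (h.assum.variance_y _ _ hy'))
    ((lintegral_comp_of_aemeasurable hmp ((hX'.1.sub hX.1).enorm.pow_const 2)).trans_le hd) h0 h1

theorem lintegral_init_v_le (h : Setup P L τ δ p.μ₁ p.μ₂ U) (hb : 1 ≤ b) (x : E d₁) {y : E d₂} (hy : y ∈ P.feasible) :
    ∫⁻ B : Batch d₁ d₂ b Ξ, ‖(init P p x y B).v - P.meanX p.μ₁ x y‖ₑ ^ 2 ∂(P.batchLaw b)
      ≤ ENNReal.ofReal (δ ^ 2 / b) := by
  have := h.isProb_tripleLaw
  have hmp := h.measurePreserving_pair_x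
  have hX := h.memLp_zoGradX x hy
  exact lintegral_batch_mean_sub_le hb (hX.comp_measurePreserving hmp)
    ((integral_comp_of_aestronglyMeasurable hmp hX.1).trans (h.integral_zoGradX _ hy)) (sq_nonneg δ)
    ((lintegral_comp_of_aemeasurable hmp ((hX.1.sub aestronglyMeasurable_const).enorm.pow_const 2)).trans_le
      (h.assum.variance_x _ _ hy))

theorem lintegral_init_w_le (h : Setup P L τ δ p.μ₁ p.μ₂ U) (hb : 1 ≤ b) (x : E d₁) {y : E d₂} (hy : y ∈ P.feasible) :
    ∫⁻ B : Batch d₁ d₂ b Ξ, ‖(init P p x y B).w - P.meanY p.μ₂ x y‖ₑ ^ 2 ∂(P.batchLaw b)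
      ≤ ENNReal.ofReal (δ ^ 2 / b) := by
  have := h.isProb_tripleLaw
  have hmp := h.measurePreserving_pair_y
  have hX := h.memLp_zoGradY x hy
  exact lintegral_batch_mean_sub_le hb (hX.comp_measurePreserving hmp)
    ((integral_comp_of_aestronglyMeasurable hmp hX.1).trans (h.integral_zoGradY _ hy)) (sq_nonneg δ)
    ((lintegral_comp_of_aemeasurable hmp ((hX.1.sub aestronglyMeasurable_const).enorm.pow_const 2)).trans_le
      (h.assum.variance_y _ _ hy))

/-! ### Measurability and agreement of the retracted algorithm -/

theorem measurable_retract_batchGradX (h : Setup P L τ δ p.μ₁ p.μ₂ U) : Measurable fun q : (E d₁ × E d₂) × Batch d₁ d₂ b Ξ =>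
    batchGradX (retraction P p.μ₂) p q.1.1 q.1.2 q.2 := by
  have hm := h.measurable_retract_zoGradX
  unfold batchGradX
  refine (Finset.measurable_fun_sum _ fun i _ => ?_).const_smul (1 / (b : ℝ))
  exact hm.comp (f := fun q : (E d₁ × E d₂) × Batch d₁ d₂ b Ξ => (q.1, ((q.2 i).1, (q.2 i).2.1)))
    (by fun_prop)

theorem measurable_retract_batchGradY (h : Setup P L τ δ p.μ₁ p.μ₂ U) : Measurable fun q : (E d₁ × E d₂) × Batch d₁ d₂ b Ξ =>
    batchGradY (retraction P p.μ₂) p q.1.1 q.1.2 q.2 := by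
  have hm := h.measurable_retract_zoGradY
  unfold batchGradY
  refine (Finset.measurable_fun_sum _ fun i _ => ?_).const_smul (1 / (b : ℝ))
  exact hm.comp (f := fun q : (E d₁ × E d₂) × Batch d₁ d₂ b Ξ => (q.1, ((q.2 i).1, (q.2 i).2.2)))
    (by fun_prop)

theorem measurable_nextX (t : ℕ) : Measurable (nextX p t : State d₁ d₂ → E d₁) := by
  unfold nextX
  fun_prop

theorem measurable_nextY (h : Setup P L τ δ p.μ₁ p.μ₂ U) (t : ℕ) : Measurable (nextY P p t : State d₁ d₂ → E d₂) := by
  have hp := (continuous_proj h.nonempty h.assum.isClosed h.assum.convex).measurable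
  unfold nextY ascentY
  fun_prop

theorem measurable_retract_step (h : Setup P L τ δ p.μ₁ p.μ₂ U) (t : ℕ) : Measurable fun q : State d₁ d₂ × Batch d₁ d₂ b Ξ =>
    step (retraction P p.μ₂) p t q.2 q.1 := by
  have hx := measurable_nextX (d₁ := d₁) (d₂ := d₂) (p := p) t
  have hy : Measurable (nextY (retraction P p.μ₂) p t : State d₁ d₂ → E d₂) := h.measurable_nextY t
  have e1 : Measurable fun q : State d₁ d₂ × Batch d₁ d₂ b Ξ =>
      ((nextX p t q.1, nextY (retraction P p.μ₂) p t q.1), q.2) := by fun_prop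
  have e2 : Measurable fun q : State d₁ d₂ × Batch d₁ d₂ b Ξ => ((q.1.x, q.1.y), q.2) := by fun_prop
  have x1 := h.measurable_retract_batchGradX.comp e1
  have x2 := h.measurable_retract_batchGradX.comp e2
  have y1 := h.measurable_retract_batchGradY.comp e1
  have y2 := h.measurable_retract_batchGradY.comp e2
  simp only [Function.comp_def] at x1 x2 y1 y2
  refine State.measurable_of ?_ ?_ ?_ ?_
  · simp only [step_x]
    exact hx.comp measurable_fst
  · simp only [step_y]
    exact hy.comp measurable_fst
  · simp only [step_v]
    fun_prop
  · simp only [step_w]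
    fun_prop

theorem measurable_retract_init (h : Setup P L τ δ p.μ₁ p.μ₂ U) (x : E d₁) (y : E d₂) :
    Measurable fun B : Batch d₁ d₂ b Ξ => init (retraction P p.μ₂) p x y B :=
  State.measurable_of measurable_const measurable_const
    (h.measurable_retract_batchGradX.comp (f := fun B : Batch d₁ d₂ b Ξ => ((x, y), B)) (by fun_prop))
    (h.measurable_retract_batchGradY.comp (f := fun B : Batch d₁ d₂ b Ξ => ((x, y), B)) (by fun_prop))

theorem retract_batchGradX_eq (h : Setup P L τ δ p.μ₁ p.μ₂ U) (x : E d₁) {y : E d₂} (hy : y ∈ P.feasible) (B : Batch d₁ d₂ b Ξ) :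
    batchGradX (retraction P p.μ₂) p x y B = batchGradX P p x y B := by
  unfold batchGradX
  simp_rw [h.retract_zoGradX_eq x hy]

theorem retract_batchGradY_eq (h : Setup P L τ δ p.μ₁ p.μ₂ U) (x : E d₁) {y : E d₂} (hy : y ∈ P.feasible) {B : Batch d₁ d₂ b Ξ}
    (hB : ∀ i, ‖(B i).2.2‖ ≤ 1) : batchGradY (retraction P p.μ₂) p x y B = batchGradY P p x y B := by
  unfold batchGradY
  simp_rw [fun i => h.retract_zoGradY_eq x hy (B i).1 (hB i)]

theorem retract_step_eq (h : Setup P L τ δ p.μ₁ p.μ₂ U) {t : ℕ} {s : State d₁ d₂} (hy : s.y ∈ P.feasible)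
    (hy' : nextY P p t s ∈ P.feasible) {B : Batch d₁ d₂ b Ξ} (hB : ∀ i, ‖(B i).2.2‖ ≤ 1) :
    step (retraction P p.μ₂) p t B s = step P p t B s := by
  have e1 := h.retract_batchGradX_eq s.x hy B
  have e2 := h.retract_batchGradX_eq (nextX p t s) hy' B
  have e3 := h.retract_batchGradY_eq s.x hy hB
  have e4 := h.retract_batchGradY_eq (nextX p t s) hy' hB
  unfold nextX nextY ascentY at e2 e4
  unfold step
  dsimp only
  rw [e1, e3]
  congr 1
  · rw [← e2]; rfl
  · rw [← e4]; rfl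

theorem retract_init_eq (h : Setup P L τ δ p.μ₁ p.μ₂ U) (x : E d₁) {y : E d₂} (hy : y ∈ P.feasible) {B : Batch d₁ d₂ b Ξ}
    (hB : ∀ i, ‖(B i).2.2‖ ≤ 1) : init (retraction P p.μ₂) p x y B = init P p x y B := by
  unfold init
  rw [h.retract_batchGradX_eq x hy, h.retract_batchGradY_eq x hy hB]

theorem nextY_mem (h : Setup P L τ δ p.μ₁ p.μ₂ U) {t : ℕ} (h0 : 0 ≤ p.eta t) (h1 : p.eta t ≤ 1) {s : State d₁ d₂} (hy : s.y ∈ P.feasible) :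
    nextY P p t s ∈ P.feasible :=
  h.assum.convex.add_smul_sub_mem hy (proj_mem h.nonempty h.assum.isClosed h.assum.convex _) ⟨h0, h1⟩

theorem ae_tripleLaw (h : Setup P L τ δ p.μ₁ p.μ₂ U) : ∀ᵐ q ∂P.tripleLaw, ‖q.2.2‖ ≤ 1 := by
  have := h.isProb
  have hmp := h.measurePreserving_pair_y
  filter_upwards [hmp.quasiMeasurePreserving.ae (ae_norm_eq_one_prod h.one_le_d₂ P.law)] with q hq
  exact hq.le

theorem ae_batchLaw (h : Setup P L τ δ p.μ₁ p.μ₂ U) (b : ℕ) : ∀ᵐ B ∂P.batchLaw b, ∀ i, ‖(B i).2.2‖ ≤ 1 := by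
  have := h.isProb_tripleLaw
  rw [ae_all_iff]
  intro i
  exact (measurePreserving_eval (fun _ : Fin b => P.tripleLaw) i).quasiMeasurePreserving.ae h.ae_tripleLaw

theorem retract_run_mem (h : Setup P L τ δ p.μ₁ p.μ₂ U) (he0 : ∀ t, 0 ≤ p.eta t) (he1 : ∀ t, p.eta t ≤ 1) (x : E d₁) {y : E d₂}
    (hy : y ∈ P.feasible) (B : ℕ → Batch d₁ d₂ b Ξ) (n : ℕ) :
    (run (retraction P p.μ₂) p x y B n).y ∈ P.feasible := by
  induction n with
  | zero => exact hy
  | succ n ih => exact h.nextY_mem (he0 _) (he1 _) ih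

/-- All queried points lie in the closed thickening as long as the directions have norm at most 1
and the iterates stay feasible, and there the retraction does nothing. -/
theorem retract_run_eq (h : Setup P L τ δ p.μ₁ p.μ₂ U) (he0 : ∀ t, 0 ≤ p.eta t) (he1 : ∀ t, p.eta t ≤ 1) (x : E d₁) {y : E d₂}
    (hy : y ∈ P.feasible) {B : ℕ → Batch d₁ d₂ b Ξ} (hB : ∀ n i, ‖(B n i).2.2‖ ≤ 1) (n : ℕ) :
    run (retraction P p.μ₂) p x y B n = run P p x y B n := by
  induction n with
  | zero => exact h.retract_init_eq x hy (hB 0)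
  | succ n ih =>
    have hm := h.retract_run_mem he0 he1 x hy B n
    have := h.retract_step_eq (t := n + 1) hm (h.nextY_mem (he0 _) (he1 _) hm) (hB (n + 1))
    rw [run, run, this, ih]

end Momentum

section Sampling

variable {Ω : Type v} {Z : ℕ → Ω → Batch d₁ d₂ b Ξ}

theorem measurable_retract_run {m : MeasurableSpace Ω} (h : Setup P L τ δ p.μ₁ p.μ₂ U) (x : E d₁) (y : E d₂)
    {n : ℕ} (hm : ∀ k ≤ n, Measurable[m] (Z k)) :
    Measurable[m] fun ω => run (retraction P p.μ₂) p x y (fun j => Z j ω) n := by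
  induction n with
  | zero => exact (h.measurable_retract_init x y).comp (hm 0 le_rfl)
  | succ n ih =>
    exact (h.measurable_retract_step (n + 1)).comp
      ((ih fun k hk => hm k (hk.trans n.le_succ)).prodMk (hm (n + 1) le_rfl))

variable [MeasurableSpace Ω] {Pr : Measure Ω}

theorem measurable_batch (hZ : IsSampling P Pr Z) (n : ℕ) : Measurable (Z n) :=
  measurable_pi_iff.2 (hZ.measurable n)

/-- The state after `n` iterations is a function of the triples of times at most `n`, and these
indices are disjoint from those of time `n + 1`. -/
theorem indepFun_retract_run (h : Setup P L τ δ p.μ₁ p.μ₂ U) (hZ : IsSampling P Pr Z) (x : E d₁) (y : E d₂)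
    (n : ℕ) :
    IndepFun (fun ω => run (retraction P p.μ₂) p x y (fun j => Z j ω) n) (Z (n + 1)) Pr := by
  let m : ℕ × Fin b → MeasurableSpace Ω := fun q => MeasurableSpace.comap (fun ω => Z q.1 ω q.2) inferInstance
  have hle : ∀ q, m q ≤ ‹MeasurableSpace Ω› := fun q => (hZ.measurable q.1 q.2).comap_le
  have hind : Indep (⨆ q ∈ {q : ℕ × Fin b | q.1 ≤ n}, m q) (⨆ q ∈ {q : ℕ × Fin b | q.1 = n + 1}, m q) Pr := by
    refine indep_iSup_of_disjoint hle hZ.indep (Set.disjoint_left.2 fun q h1 h2 => ?_)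
    simp only [mem_ofPred_eq] at h1 h2
    omega
  have hmeas : ∀ (A : Set (ℕ × Fin b)) (k : ℕ), (∀ i, (k, i) ∈ A) → Measurable[⨆ q ∈ A, m q] (Z k) := by
    intro A k hk
    refine @measurable_pi_lambda _ _ _ (⨆ q ∈ A, m q) _ _ fun i => ?_
    have h1 : m (k, i) ≤ ⨆ q ∈ A, m q := le_iSup₂ (f := fun q (_ : q ∈ A) => m q) (k, i) (hk i)
    exact (comap_measurable (fun ω => Z k ω i)).mono h1 le_rfl
  rw [IndepFun_iff_Indep]
  refine indep_of_indep_of_le_left (indep_of_indep_of_le_right hind ?_) ?_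
  · exact (hmeas _ (n + 1) fun i => rfl).comap_le
  · exact (measurable_retract_run (m := ⨆ q ∈ {q : ℕ × Fin b | q.1 ≤ n}, m q) h x y
      fun k hk => hmeas _ k fun i => hk).comap_le

variable [IsProbabilityMeasure Pr]

theorem map_batch_eq (hZ : IsSampling P Pr Z) (n : ℕ) : Pr.map (Z n) = P.batchLaw b := by
  have h1 : iIndepFun (fun (i : Fin b) ω => Z n ω i) Pr :=
    hZ.indep.precomp (g := fun i : Fin b => (n, i)) (fun i j hij => by simpa using hij)
  have h2 := (iIndepFun_iff_map_fun_eq_pi_map fun i => (hZ.measurable n i).aemeasurable).1 h1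
  simp_rw [hZ.map_eq] at h2
  exact h2

/-- The Markov property: by independence, the joint law of the state and the next batch is a
product. Stating it for lower integrals avoids integrability hypotheses. -/
theorem lintegral_retract_run_succ (h : Setup P L τ δ p.μ₁ p.μ₂ U) (hZ : IsSampling P Pr Z) (x : E d₁) (y : E d₂)
    (n : ℕ) {F : State d₁ d₂ → ℝ≥0∞} (hF : Measurable F) :
    ∫⁻ ω, F (run (retraction P p.μ₂) p x y (fun j => Z j ω) (n + 1)) ∂Pr
      = ∫⁻ ω, ∫⁻ B, F (step (retraction P p.μ₂) p (n + 1) B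
          (run (retraction P p.μ₂) p x y (fun j => Z j ω) n)) ∂(P.batchLaw b) ∂Pr := by
  have hr := h.measurable_retract_run (p := p) (Z := Z) x y (n := n) fun k _ => measurable_batch hZ k
  have hz := measurable_batch hZ (n + 1)
  have hFs := hF.comp (h.measurable_retract_step (b := b) (n + 1))
  have hi := (indepFun_iff_map_prod_eq_prod_map_map hr.aemeasurable hz.aemeasurable).1
    (h.indepFun_retract_run hZ x y n)
  have := h.isProb_batchLaw b
  have h1 := lintegral_map (μ := Pr) hFs (hr.prodMk hz)
  rw [hi, map_batch_eq hZ, lintegral_prod _ hFs.aemeasurable, lintegral_map hFs.lintegral_prod_right' hr] at h1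
  exact h1.symm

theorem ae_sampling (h : Setup P L τ δ p.μ₁ p.μ₂ U) (hZ : IsSampling P Pr Z) :
    ∀ᵐ ω ∂Pr, ∀ n i, ‖(Z n ω i).2.2‖ ≤ 1 := by
  rw [ae_all_iff]
  intro n
  have h1 := h.ae_batchLaw b
  rw [← map_batch_eq hZ n] at h1
  exact ae_of_ae_map (measurable_batch hZ n).aemeasurable h1

end Sampling

end Setup

end AccZOMDA

/-! ### The Lyapunov function and its telescoping. -/

namespace AccZOMDA
open Set Metric Filter Topology
open scoped RealInnerProductSpace ENNReal

variable {d₁ d₂ b : ℕ} {Ξ : Type u} [MeasurableSpace Ξ]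

/-- The mean-square error of the momentum estimator in `x` at a state. -/
noncomputable def errX (P : Problem d₁ d₂ Ξ) (μ₁ : ℝ) (s : State d₁ d₂) : ℝ :=
  ‖s.v - P.meanX μ₁ s.x (proj P.feasible s.y)‖ ^ 2

/-- The mean-square error of the momentum estimator in `y` at a state. -/
noncomputable def errY (P : Problem d₁ d₂ Ξ) (μ₂ : ℝ) (s : State d₁ d₂) : ℝ :=
  ‖s.w - P.meanY μ₂ s.x (proj P.feasible s.y)‖ ^ 2

/-- The squared distance of `y` to the maximizer. -/
noncomputable def gapY (P : Problem d₁ d₂ Ξ) (x : E d₁) (y : E d₂) : ℝ :=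
  ‖y - argmaxOn P.f P.feasible x‖ ^ 2

/-- The Lyapunov function with weights `W`, `A`, `B`. -/
noncomputable def lyapunov (P : Problem d₁ d₂ Ξ) (p : Params) (pot : E d₁ → ℝ) (W A B : ℝ)
    (s : State d₁ d₂) : ℝ :=
  pot s.x + W * gapY P s.x s.y + (A * errX P p.μ₁ s + B * errY P p.μ₂ s)

namespace Setup

variable {P : Problem d₁ d₂ Ξ} {L τ δ : ℝ} {p : Params} {U : Set (E d₂)} {pot : E d₁ → ℝ}

theorem continuous_argmax {μ₁ μ₂ : ℝ} (h : Setup P L τ δ μ₁ μ₂ U) :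
    Continuous (argmaxOn P.f P.feasible) :=
  (LipschitzWith.of_dist_le_mul (K := Real.toNNReal (L / τ)) fun z z' => by
    rw [dist_eq_norm, dist_eq_norm, Real.coe_toNNReal _ (div_pos h.L_pos h.τ_pos).le]
    exact h.smoothMax.norm_argmax_sub_le z z').continuous

theorem measurable_errX (h : Setup P L τ δ p.μ₁ p.μ₂ U) : Measurable (errX P p.μ₁) := by
  have hm := h.measurable_meanX_proj.comp
    (f := fun s : State d₁ d₂ => (s.x, s.y)) (by fun_prop)
  exact (State.measurable_v.sub hm).norm.pow_const 2

theorem measurable_errY (h : Setup P L τ δ p.μ₁ p.μ₂ U) : Measurable (errY P p.μ₂) := by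
  have hm := h.measurable_meanY_proj.comp
    (f := fun s : State d₁ d₂ => (s.x, s.y)) (by fun_prop)
  exact (State.measurable_w.sub hm).norm.pow_const 2

theorem measurable_gapY (h : Setup P L τ δ p.μ₁ p.μ₂ U) :
    Measurable fun s : State d₁ d₂ => gapY P s.x s.y := by
  have hm := h.continuous_argmax.measurable
  unfold gapY
  fun_prop

theorem measurable_lyapunov (h : Setup P L τ δ p.μ₁ p.μ₂ U) (hpot : Measurable pot) (W A B : ℝ) :
    Measurable (lyapunov P p pot W A B) := by
  have h1 := h.measurable_errX
  have h2 := h.measurable_errY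
  have h3 := h.measurable_gapY
  unfold lyapunov
  fun_prop

theorem errX_eq (h : Setup P L τ δ p.μ₁ p.μ₂ U) {s : State d₁ d₂} (hy : s.y ∈ P.feasible) :
    errX P p.μ₁ s = ‖s.v - P.meanX p.μ₁ s.x s.y‖ ^ 2 := by
  rw [errX, proj_of_mem h.assum.isClosed h.assum.convex hy]

theorem errY_eq (h : Setup P L τ δ p.μ₁ p.μ₂ U) {s : State d₁ d₂} (hy : s.y ∈ P.feasible) :
    errY P p.μ₂ s = ‖s.w - P.meanY p.μ₂ s.x s.y‖ ^ 2 := by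
  rw [errY, proj_of_mem h.assum.isClosed h.assum.convex hy]

theorem ofReal_norm_sq {d : ℕ} (z : E d) : ENNReal.ofReal (‖z‖ ^ 2) = ‖z‖ₑ ^ 2 := by
  rw [ENNReal.ofReal_pow (norm_nonneg _), ofReal_norm]

/-- Integrating the Lyapunov function over the law of the state. -/
theorem lintegral_lyapunov_le (h : Setup P L τ δ p.μ₁ p.μ₂ U) {α : Type*} [MeasurableSpace α]
    {ν : Measure α} [IsProbabilityMeasure ν] {F : α → State d₁ d₂} (hF : Measurable F)
    {x : E d₁} {y : E d₂} (hx : ∀ a, (F a).x = x) (hy : ∀ a, (F a).y = y)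
    (hpot : 0 ≤ pot x) {W A B a e : ℝ} (hW : 0 ≤ W) (hA : 0 ≤ A) (hB : 0 ≤ B) (ha : 0 ≤ a) (he : 0 ≤ e)
    (h1 : ∫⁻ q, ENNReal.ofReal (errX P p.μ₁ (F q)) ∂ν ≤ ENNReal.ofReal a)
    (h2 : ∫⁻ q, ENNReal.ofReal (errY P p.μ₂ (F q)) ∂ν ≤ ENNReal.ofReal e) :
    ∫⁻ q, ENNReal.ofReal (lyapunov P p pot W A B (F q)) ∂ν
      ≤ ENNReal.ofReal (pot x + W * gapY P x y + (A * a + B * e)) := by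
  have hc : 0 ≤ pot x + W * gapY P x y := by unfold gapY; positivity
  have nX : ∀ s : State d₁ d₂, 0 ≤ errX P p.μ₁ s := fun s => sq_nonneg _
  have nY : ∀ s : State d₁ d₂, 0 ≤ errY P p.μ₂ s := fun s => sq_nonneg _
  have e1 : ∀ q, ENNReal.ofReal (lyapunov P p pot W A B (F q))
      = ENNReal.ofReal (pot x + W * gapY P x y) + (ENNReal.ofReal A * ENNReal.ofReal (errX P p.μ₁ (F q))
        + ENNReal.ofReal B * ENNReal.ofReal (errY P p.μ₂ (F q))) := fun q => by
    have := nX (F q)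
    have := nY (F q)
    rw [lyapunov, hx, hy, ENNReal.ofReal_add hc (by positivity),
      ENNReal.ofReal_add (p := A * errX P p.μ₁ (F q)) (q := B * errY P p.μ₂ (F q)) (by positivity)
        (by positivity), ENNReal.ofReal_mul hA, ENNReal.ofReal_mul hB]
  simp_rw [e1]
  have m1 : Measurable fun q => ENNReal.ofReal (errX P p.μ₁ (F q)) := (h.measurable_errX.comp hF).ennreal_ofReal
  have m2 : Measurable fun q => ENNReal.ofReal (errY P p.μ₂ (F q)) := (h.measurable_errY.comp hF).ennreal_ofReal
  rw [lintegral_add_left measurable_const, lintegral_add_left (m1.const_mul _), lintegral_const_mul _ m1,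
    lintegral_const_mul _ m2, lintegral_const, measure_univ, mul_one, ENNReal.ofReal_add hc (by positivity),
    ENNReal.ofReal_add (p := A * a) (q := B * e) (by positivity) (by positivity), ENNReal.ofReal_mul hA,
    ENNReal.ofReal_mul hB]
  gcongr

/-- The one-step expected value of the Lyapunov function, bounded in terms of the current state. -/
noncomputable def nextBound (P : Problem d₁ d₂ Ξ) (p : Params) (b : ℕ) (δ : ℝ) (pot : E d₁ → ℝ)
    (W A B MX MY : ℝ) (t : ℕ) (s : State d₁ d₂) : ℝ :=
  pot (nextX p t s) + W * gapY P (nextX p t s) (nextY P p t s)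
    + (A * ((1 - p.c₁ * p.eta t ^ 2) * errX P p.μ₁ s + 2 / b * MX + 2 * (p.c₁ * p.eta t ^ 2) ^ 2 * δ ^ 2 / b)
      + B * ((1 - p.c₂ * p.eta t ^ 2) * errY P p.μ₂ s + 2 / b * MY + 2 * (p.c₂ * p.eta t ^ 2) ^ 2 * δ ^ 2 / b))

/-- Bounds on the mean-square change of the one-sample estimators in one iteration. -/
structure ChangeBound (P : Problem d₁ d₂ Ξ) (p : Params) (t : ℕ) (s : State d₁ d₂) (MX MY : ℝ) : Prop where
  nonneg_x : 0 ≤ MX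
  nonneg_y : 0 ≤ MY
  le_x : ∫⁻ q, ‖P.zoGradX p.μ₁ (nextX p t s) (nextY P p t s) q.1 q.2 - P.zoGradX p.μ₁ s.x s.y q.1 q.2‖ₑ ^ 2
      ∂(P.law.prod (unifSphere d₁)) ≤ ENNReal.ofReal MX
  le_y : ∫⁻ q, ‖P.zoGradY p.μ₂ (nextX p t s) (nextY P p t s) q.1 q.2 - P.zoGradY p.μ₂ s.x s.y q.1 q.2‖ₑ ^ 2
      ∂(P.law.prod (unifSphere d₂)) ≤ ENNReal.ofReal MY

/-- The step sizes are in the admissible range. -/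
structure StepRange (p : Params) (t : ℕ) : Prop where
  eta_nonneg : 0 ≤ p.eta t
  eta_le : p.eta t ≤ 1
  c₁_nonneg : 0 ≤ p.c₁ * p.eta t ^ 2
  c₁_le : p.c₁ * p.eta t ^ 2 ≤ 1
  c₂_nonneg : 0 ≤ p.c₂ * p.eta t ^ 2
  c₂_le : p.c₂ * p.eta t ^ 2 ≤ 1

/-- The next `x` and `y` are determined by the current state, so only the two estimation errors are
averaged over the fresh batch. -/
theorem lintegral_lyapunov_step_le (h : Setup P L τ δ p.μ₁ p.μ₂ U) (hb : 1 ≤ b) {t : ℕ} (hr : StepRange p t)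
    {s : State d₁ d₂} (hy : s.y ∈ P.feasible) (hpot : ∀ x, 0 ≤ pot x) {W A B MX MY : ℝ} (hW : 0 ≤ W)
    (hA : 0 ≤ A) (hB : 0 ≤ B) (hM : ChangeBound P p t s MX MY) :
    ∫⁻ B', ENNReal.ofReal (lyapunov P p pot W A B (step (retraction P p.μ₂) p t B' s)) ∂(P.batchLaw b)
      ≤ ENNReal.ofReal (nextBound P p b δ pot W A B MX MY t s) := by
  have := h.isProb_batchLaw b
  have hy' : nextY P p t s ∈ P.feasible := h.nextY_mem hr.eta_nonneg hr.eta_le hy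
  have hm : Measurable fun B' : Batch d₁ d₂ b Ξ => step (retraction P p.μ₂) p t B' s :=
    (h.measurable_retract_step t).comp (f := fun B' : Batch d₁ d₂ b Ξ => (s, B')) (by fun_prop)
  have hMX := hM.nonneg_x
  have hMY := hM.nonneg_y
  have s1 := sub_nonneg.2 hr.c₁_le
  have s2 := sub_nonneg.2 hr.c₂_le
  have nX : 0 ≤ errX P p.μ₁ s := sq_nonneg _
  have nY : 0 ≤ errY P p.μ₂ s := sq_nonneg _
  refine h.lintegral_lyapunov_le hm (fun _ => rfl) (fun _ => rfl) (hpot _) hW hA hB (by positivity)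
    (by positivity) ?_ ?_
  · rw [h.errX_eq hy]
    refine le_trans (le_of_eq ?_) (h.lintegral_step_v_le hb hy hy' hMX hM.le_x hr.c₁_nonneg hr.c₁_le)
    refine lintegral_congr_ae ?_
    filter_upwards [h.ae_batchLaw b] with B' hB'
    rw [h.retract_step_eq hy hy' hB', h.errX_eq (by exact hy'), ofReal_norm_sq]
    rfl
  · rw [h.errY_eq hy]
    refine le_trans (le_of_eq ?_) (h.lintegral_step_w_le hb hy hy' hMY hM.le_y hr.c₂_nonneg hr.c₂_le)
    refine lintegral_congr_ae ?_
    filter_upwards [h.ae_batchLaw b] with B' hB'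
    rw [h.retract_step_eq hy hy' hB', h.errY_eq (by exact hy'), ofReal_norm_sq]
    rfl

section Iteration

variable {Ω : Type v} [MeasurableSpace Ω] {Pr : Measure Ω} [IsProbabilityMeasure Pr]
  {Z : ℕ → Ω → Batch d₁ d₂ b Ξ}

/-- The distance term vanishes because the algorithm starts at the maximizer; what remains besides
the potential is the variance of the two initial batch means. -/
theorem lintegral_lyapunov_init_le (h : Setup P L τ δ p.μ₁ p.μ₂ U) (hZ : IsSampling P Pr Z) (hb : 1 ≤ b)
    (x : E d₁) {y : E d₂} (hy : y ∈ P.feasible) (hmax : IsMaxOn (P.f x) P.feasible y)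
    (hpot : ∀ x, 0 ≤ pot x) (hpm : Measurable pot) {W A B : ℝ} (hW : 0 ≤ W) (hA : 0 ≤ A) (hB : 0 ≤ B) :
    ∫⁻ ω, ENNReal.ofReal (lyapunov P p pot W A B (run (retraction P p.μ₂) p x y (fun j => Z j ω) 0)) ∂Pr
      ≤ ENNReal.ofReal (pot x + (A + B) * (δ ^ 2 / b)) := by
  have := h.isProb_batchLaw b
  have hm := h.measurable_retract_init (b := b) x y
  have h1 := lintegral_map (μ := Pr) ((h.measurable_lyapunov hpm W A B).comp hm).ennreal_ofReal
    (measurable_batch hZ 0)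
  rw [map_batch_eq hZ] at h1
  refine le_trans h1.symm.le ?_
  have h2 := h.lintegral_lyapunov_le (ν := P.batchLaw b) (pot := pot) hm (fun _ => rfl) (fun _ => rfl)
    (hpot x) (a := δ ^ 2 / b) (e := δ ^ 2 / b) hW hA hB (by positivity) (by positivity)
    (by
      refine le_trans (le_of_eq ?_) (h.lintegral_init_v_le hb x hy)
      refine lintegral_congr_ae ?_
      filter_upwards [h.ae_batchLaw b] with B' hB'
      rw [h.retract_init_eq x hy hB', h.errX_eq (by exact hy), ofReal_norm_sq]
      rfl)
    (by
      refine le_trans (le_of_eq ?_) (h.lintegral_init_w_le hb x hy)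
      refine lintegral_congr_ae ?_
      filter_upwards [h.ae_batchLaw b] with B' hB'
      rw [h.retract_init_eq x hy hB', h.errY_eq (by exact hy), ofReal_norm_sq]
      rfl)
  refine h2.trans (ENNReal.ofReal_le_ofReal ?_)
  rw [gapY, ← h.smoothMax.eq_argmax hy hmax, sub_self, norm_zero]
  exact le_of_eq (by ring)

/-- Telescoping the expected decrease of the Lyapunov function along the algorithm. -/
theorem lintegral_telescope (h : Setup P L τ δ p.μ₁ p.μ₂ U) (hZ : IsSampling P Pr Z) (hb : 1 ≤ b)
    (hr : ∀ t, StepRange p t)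
    (x : E d₁) {y : E d₂} (hy : y ∈ P.feasible) (hmax : IsMaxOn (P.f x) P.feasible y)
    (hpot : ∀ x, 0 ≤ pot x) (hpm : Measurable pot) {W A B : ℕ → ℝ} (hW : ∀ n, 0 ≤ W n)
    (hA : ∀ n, 0 ≤ A n) (hB : ∀ n, 0 ≤ B n) {ψ : ℕ → E d₁ → ℝ} (hψ : ∀ n x, 0 ≤ ψ n x)
    (hψm : ∀ n, Measurable (ψ n)) {err : ℕ → ℝ} (herr : ∀ n, 0 ≤ err n) {N : ℕ}
    (hstep : ∀ n < N, ∀ s : State d₁ d₂, s.y ∈ P.feasible → ∃ MX MY, ChangeBound P p (n + 1) s MX MY ∧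
      nextBound P p b δ pot (W (n + 1)) (A (n + 1)) (B (n + 1)) MX MY (n + 1) s + ψ n s.x
        ≤ lyapunov P p pot (W n) (A n) (B n) s + err n) :
    ∫⁻ ω, ENNReal.ofReal (pot (run (retraction P p.μ₂) p x y (fun j => Z j ω) N).x) ∂Pr
      + ∑ n ∈ Finset.range N, ∫⁻ ω, ENNReal.ofReal
        (ψ n (run (retraction P p.μ₂) p x y (fun j => Z j ω) n).x) ∂Pr
      ≤ ENNReal.ofReal (pot x + (A 0 + B 0) * (δ ^ 2 / b) + ∑ n ∈ Finset.range N, err n) := by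
  have nL : ∀ n s, 0 ≤ lyapunov P p pot (W n) (A n) (B n) s := fun n s => by
    have := hpot s.x
    have := hW n
    have := hA n
    have := hB n
    unfold lyapunov gapY errX errY
    positivity
  set S : ℕ → Ω → State d₁ d₂ := fun n ω => run (retraction P p.μ₂) p x y (fun j => Z j ω) n with hS
  have hSm : ∀ n, Measurable (S n) := fun n => h.measurable_retract_run x y fun k _ => measurable_batch hZ k
  have hSy : ∀ n ω, (S n ω).y ∈ P.feasible := fun n ω =>
    h.retract_run_mem (fun t => (hr t).eta_nonneg) (fun t => (hr t).eta_le) x hy _ n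
  have key : ∀ n ≤ N, ∫⁻ ω, ENNReal.ofReal (lyapunov P p pot (W n) (A n) (B n) (S n ω)) ∂Pr
      + ∑ k ∈ Finset.range n, ∫⁻ ω, ENNReal.ofReal (ψ k (S k ω).x) ∂Pr
      ≤ ENNReal.ofReal (pot x + (A 0 + B 0) * (δ ^ 2 / b) + ∑ k ∈ Finset.range n, err k) := by
    intro n
    induction n with
    | zero =>
      intro _
      simpa using h.lintegral_lyapunov_init_le hZ hb x hy hmax hpot hpm (hW 0) (hA 0) (hB 0)
    | succ n ih =>
      intro hn
      have ih := ih (n.le_succ.trans hn)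
      have h1 : ∫⁻ ω, ENNReal.ofReal (lyapunov P p pot (W (n + 1)) (A (n + 1)) (B (n + 1)) (S (n + 1) ω)) ∂Pr
          + ∫⁻ ω, ENNReal.ofReal (ψ n (S n ω).x) ∂Pr
          ≤ ∫⁻ ω, ENNReal.ofReal (lyapunov P p pot (W n) (A n) (B n) (S n ω)) ∂Pr + ENNReal.ofReal (err n) := by
        have e1 := h.lintegral_retract_run_succ hZ x y n
          (h.measurable_lyapunov hpm (W (n + 1)) (A (n + 1)) (B (n + 1))).ennreal_ofReal
        have hψS : Measurable fun ω => ENNReal.ofReal (ψ n (S n ω).x) :=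
          ((hψm n).comp (State.measurable_x.comp (hSm n))).ennreal_ofReal
        rw [e1, ← lintegral_add_right _ hψS]
        calc _ ≤ ∫⁻ ω, (ENNReal.ofReal (lyapunov P p pot (W n) (A n) (B n) (S n ω))
              + ENNReal.ofReal (err n)) ∂Pr := by
              refine lintegral_mono fun ω => ?_
              obtain ⟨MX, MY, hM, hle⟩ := hstep n hn (S n ω) (hSy n ω)
              have h2 := h.lintegral_lyapunov_step_le (pot := pot) hb (hr (n + 1)) (hSy n ω) hpot
                (hW (n + 1)) (hA (n + 1)) (hB (n + 1)) hM
              refine (add_le_add h2 le_rfl).trans ?_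
              have n1 : 0 ≤ nextBound P p b δ pot (W (n + 1)) (A (n + 1)) (B (n + 1)) MX MY (n + 1) (S n ω) := by
                have := hpot (nextX p (n + 1) (S n ω))
                have := hW (n + 1)
                have := hA (n + 1)
                have := hB (n + 1)
                have := sub_nonneg.2 (hr (n + 1)).c₁_le
                have := sub_nonneg.2 (hr (n + 1)).c₂_le
                have := hM.nonneg_x
                have := hM.nonneg_y
                unfold nextBound gapY errX errY
                positivity
              rw [← ENNReal.ofReal_add n1 (hψ n _), ← ENNReal.ofReal_add (nL n _) (herr n)]
              exact ENNReal.ofReal_le_ofReal hle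
          _ = _ := by
              rw [lintegral_add_right _ measurable_const, lintegral_const, measure_univ, mul_one]
      rw [Finset.sum_range_succ, Finset.sum_range_succ, ← add_assoc (pot x + _),
        ENNReal.ofReal_add (by
          have := hpot x
          have := hA 0
          have := hB 0
          have := Finset.sum_nonneg fun k (_ : k ∈ Finset.range n) => herr k
          positivity) (herr n)]
      refine le_trans ?_ (add_le_add ih le_rfl)
      calc _ = (∫⁻ ω, ENNReal.ofReal (lyapunov P p pot (W (n + 1)) (A (n + 1)) (B (n + 1)) (S (n + 1) ω)) ∂Pr
          + ∫⁻ ω, ENNReal.ofReal (ψ n (S n ω).x) ∂Pr)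
            + ∑ k ∈ Finset.range n, ∫⁻ ω, ENNReal.ofReal (ψ k (S k ω).x) ∂Pr := by ring
        _ ≤ _ := add_le_add h1 le_rfl
        _ = _ := by ring
  refine le_trans (add_le_add (lintegral_mono fun ω => ENNReal.ofReal_le_ofReal ?_) le_rfl) (key N le_rfl)
  have := hW N
  have := hA N
  have := hB N
  have : 0 ≤ W N * gapY P (S N ω).x (S N ω).y + (A N * errX P p.μ₁ (S N ω) + B N * errY P p.μ₂ (S N ω)) := by
    unfold gapY errX errY
    positivity
  unfold lyapunov
  linarith

end Iteration

end Setup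

end AccZOMDA

/-! ### Step-size sums and the accumulated errors. -/

namespace AccZOMDA
open Set Metric Filter Topology
open scoped RealInnerProductSpace ENNReal

namespace Params

/-- The cube root of `m + t`. -/
noncomputable def cbrt (p : Params) (t : ℕ) : ℝ := (p.m + t) ^ (1 / 3 : ℝ)

variable {p : Params}

theorem eta_eq (p : Params) (t : ℕ) : p.eta t = p.k / p.cbrt t := rfl

theorem cbrt_pow_three (hm : 2 ≤ p.m) (t : ℕ) : p.cbrt t ^ 3 = p.m + t := by
  rw [cbrt, ← Real.rpow_natCast, ← Real.rpow_mul (by positivity)]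
  norm_num

theorem cbrt_pos (hm : 2 ≤ p.m) (t : ℕ) : 0 < p.cbrt t := by
  unfold cbrt; positivity

theorem rpow_two_thirds (hm : 2 ≤ p.m) (t : ℕ) : (p.m + t) ^ (2 / 3 : ℝ) = p.cbrt t ^ 2 := by
  rw [cbrt, ← Real.rpow_natCast, ← Real.rpow_mul (by positivity)]
  norm_num

theorem cbrt_succ_pow_three (hm : 2 ≤ p.m) (t : ℕ) : p.cbrt (t + 1) ^ 3 = p.cbrt t ^ 3 + 1 := by
  rw [cbrt_pow_three hm, cbrt_pow_three hm]; push_cast; ring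

theorem cbrt_mono (hm : 2 ≤ p.m) {s t : ℕ} (h : s ≤ t) : p.cbrt s ≤ p.cbrt t := by
  unfold cbrt
  gcongr

/-- Discrete comparison with the integral of `t^(-1/3)`. With `r³ = q³ + 1` one increment reduces to
`(r - q)²(r + 2q) ≥ 0`. -/
theorem sum_inv_cbrt_le (hm : 2 ≤ p.m) (N : ℕ) :
    ∑ n ∈ Finset.range N, 1 / p.cbrt (n + 1) ≤ 3 / 2 * (p.cbrt N ^ 2 - p.cbrt 0 ^ 2) := by
  induction N with
  | zero => simp
  | succ n ih =>
    rw [Finset.sum_range_succ]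
    have h1 := cbrt_succ_pow_three hm n
    have hq := cbrt_pos hm n
    have hr := cbrt_pos hm (n + 1)
    set q := p.cbrt n
    set r := p.cbrt (n + 1)
    have h2 : 1 / r ≤ 3 / 2 * (r ^ 2 - q ^ 2) := by
      rw [div_le_iff₀ hr]
      nlinarith [mul_nonneg (sq_nonneg (r - q)) (by positivity : 0 ≤ r + 2 * q)]
    linarith

theorem sum_inv_cbrt_le_mul (hm : 2 ≤ p.m) (N : ℕ) :
    ∑ n ∈ Finset.range N, 1 / p.cbrt (n + 1) ≤ 3 / 2 * (N / p.cbrt N) := by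
  refine (sum_inv_cbrt_le hm N).trans ?_
  have h0 := cbrt_pow_three hm 0
  have hN := cbrt_pow_three hm N
  have hr := cbrt_pos hm N
  have hq := cbrt_pos hm 0
  have hle := cbrt_mono hm (Nat.zero_le N)
  set q := p.cbrt 0
  set r := p.cbrt N
  refine mul_le_mul_of_nonneg_left ?_ (by norm_num)
  rw [le_div_iff₀ hr]
  simp only [Nat.cast_zero, add_zero] at h0
  nlinarith [mul_nonneg (sq_nonneg q) (sub_nonneg.2 hle)]

/-- Comparison with the integral of `t^(1/3)`, reducing to `(r - q)²(3r² + 2rq + q²) ≥ 0`. -/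
theorem sum_cbrt_le (hm : 2 ≤ p.m) (N : ℕ) :
    ∑ n ∈ Finset.range N, p.cbrt (n + 1) ≤ 3 / 4 * p.cbrt (N + 1) ^ 4 := by
  induction N with
  | zero =>
    have := cbrt_pos hm 1
    simp only [Finset.range_zero, Finset.sum_empty, zero_add]
    positivity
  | succ n ih =>
    rw [Finset.sum_range_succ]
    have h1 := cbrt_succ_pow_three hm (n + 1)
    have hq := cbrt_pos hm (n + 1)
    have hr := cbrt_pos hm (n + 1 + 1)
    set q := p.cbrt (n + 1)
    set r := p.cbrt (n + 1 + 1)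
    have h2 : q ≤ 3 / 4 * (r ^ 4 - q ^ 4) := by
      nlinarith [mul_nonneg (sq_nonneg (r - q)) (by positivity : 0 ≤ 3 * r ^ 2 + 2 * r * q + q ^ 2)]
    linarith

/-- A harmonic sum, compared termwise with increments of the logarithm. This is the source of
`ln(m+T)` in `M'`. -/
theorem sum_inv_cbrt_cube_le (hm : 2 ≤ p.m) (N : ℕ) :
    ∑ n ∈ Finset.range N, 1 / p.cbrt (n + 1) ^ 3 ≤ Real.log (p.m + N) := by
  induction N with
  | zero => simpa using Real.log_nonneg (by linarith : (1 : ℝ) ≤ p.m)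
  | succ n ih =>
    rw [Finset.sum_range_succ, cbrt_pow_three hm]
    have h1 : (0 : ℝ) < p.m + n := by positivity
    have h2 : (0 : ℝ) < p.m + (n + 1 : ℕ) := by positivity
    have h3 := Real.log_le_sub_one_of_pos (div_pos h1 h2)
    rw [Real.log_div h1.ne' h2.ne'] at h3
    have h4 : (p.m + n) / (p.m + (n + 1 : ℕ)) - 1 = -(1 / (p.m + (n + 1 : ℕ))) := by
      field_simp
      push_cast
      ring
    linarith

namespace Admissible

variable {d₁ d₂ b T : ℕ} {L τ : ℝ}

theorem k_le_cbrt (h : p.Admissible d₁ d₂ b T L τ) (t : ℕ) : p.k ≤ p.cbrt t := by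
  have h1 := h.m_ge_k
  have h2 := cbrt_pow_three h.m_ge_two t
  have h3 := cbrt_pos h.m_ge_two t
  refine le_of_pow_le_pow_left₀ three_ne_zero h3.le ?_
  rw [h2]
  have : (0 : ℝ) ≤ t := t.cast_nonneg
  linarith

theorem eta_pos (h : p.Admissible d₁ d₂ b T L τ) (t : ℕ) : 0 < p.eta t :=
  div_pos h.k_pos (cbrt_pos h.m_ge_two t)

theorem eta_le_one (h : p.Admissible d₁ d₂ b T L τ) (t : ℕ) : p.eta t ≤ 1 := by
  rw [eta_eq, div_le_one (cbrt_pos h.m_ge_two t)]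
  exact h.k_le_cbrt t

theorem eta_anti (h : p.Admissible d₁ d₂ b T L τ) {s t : ℕ} (hst : s ≤ t) : p.eta t ≤ p.eta s := by
  rw [eta_eq, eta_eq]
  exact div_le_div_of_nonneg_left h.k_pos.le (cbrt_pos h.m_ge_two s) (cbrt_mono h.m_ge_two hst)

theorem c₁_pos (h : p.Admissible d₁ d₂ b T L τ) : 0 < p.c₁ := by
  have := h.k_pos
  exact lt_of_lt_of_le (by positivity) h.c₁_ge

theorem c₂_pos (h : p.Admissible d₁ d₂ b T L τ) : 0 < p.c₂ := by
  have := h.k_pos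
  exact lt_of_lt_of_le (by positivity) h.c₂_ge

theorem mul_eta_sq_le_one (h : p.Admissible d₁ d₂ b T L τ) {c : ℝ} (hc : 0 < c) (hm : (c * p.k) ^ 3 ≤ p.m)
    (t : ℕ) : c * p.eta t ^ 2 ≤ 1 := by
  have h1 : c * p.k ≤ p.cbrt t := by
    refine le_of_pow_le_pow_left₀ three_ne_zero (cbrt_pos h.m_ge_two t).le ?_
    rw [cbrt_pow_three h.m_ge_two]
    have : (0 : ℝ) ≤ t := t.cast_nonneg
    linarith
  have h2 : c * p.eta t ≤ 1 := by
    rw [eta_eq, ← mul_div_assoc, div_le_one (cbrt_pos h.m_ge_two t)]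
    exact h1
  have := h.eta_le_one t
  have := h.eta_pos t
  have h3 : 0 ≤ c * p.eta t := by positivity
  nlinarith

theorem stepRange (h : p.Admissible d₁ d₂ b T L τ) (t : ℕ) : Setup.StepRange p t where
  eta_nonneg := (h.eta_pos t).le
  eta_le := h.eta_le_one t
  c₁_nonneg := mul_nonneg h.c₁_pos.le (sq_nonneg _)
  c₁_le := h.mul_eta_sq_le_one h.c₁_pos h.m_ge_c₁ t
  c₂_nonneg := mul_nonneg h.c₂_pos.le (sq_nonneg _)
  c₂_le := h.mul_eta_sq_le_one h.c₂_pos h.m_ge_c₂ t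

/-- The growth of the weights `1/η`, which the contraction `cη²` of the momentum error must beat;
hence the term `2/(3k³)` in the conditions on `c₁` and `c₂`. From `r³ - q³ = 1` follows `3qr(r - q)
≤ 1`, and `k ≤ q`. -/
theorem inv_eta_sub_le (h : p.Admissible d₁ d₂ b T L τ) (t : ℕ) :
    1 / p.eta (t + 1) - 1 / p.eta t ≤ 2 / (3 * p.k ^ 3) * p.eta (t + 1) := by
  have h1 := cbrt_succ_pow_three h.m_ge_two t
  have hq := cbrt_pos h.m_ge_two t
  have hr := cbrt_pos h.m_ge_two (t + 1)
  have hkq := h.k_le_cbrt t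
  have hk := h.k_pos
  have hle := cbrt_mono h.m_ge_two t.le_succ
  rw [eta_eq, eta_eq]
  set q := p.cbrt t
  set r := p.cbrt (t + 1)
  have hrq : 0 ≤ r - q := sub_nonneg.2 hle
  have h2 : 3 * p.k * r * (r - q) ≤ 2 := by
    have h3 : 3 * p.k * r * (r - q) ≤ 3 * q * r * (r - q) := by gcongr
    nlinarith [mul_nonneg hrq (sq_nonneg (r - q))]
  rw [one_div_div, one_div_div, ← sub_div]
  rw [div_mul_div_comm, div_le_div_iff₀ hk (by positivity)]
  have : (r - q) * (3 * p.k ^ 3 * r) = p.k ^ 2 * (3 * p.k * r * (r - q)) := by ring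
  rw [this]
  nlinarith [sq_nonneg p.k]

theorem sum_eta_le (h : p.Admissible d₁ d₂ b T L τ) (N : ℕ) :
    ∑ n ∈ Finset.range N, p.eta (n + 1) ≤ 3 / 2 * (N * p.eta N) := by
  have := mul_le_mul_of_nonneg_left (sum_inv_cbrt_le_mul h.m_ge_two N) h.k_pos.le
  rw [Finset.mul_sum] at this
  simp_rw [mul_one_div, ← eta_eq] at this
  refine this.trans (le_of_eq ?_)
  rw [eta_eq]
  ring

theorem sum_inv_eta_le (h : p.Admissible d₁ d₂ b T L τ) (N : ℕ) :
    ∑ n ∈ Finset.range N, 1 / p.eta (n + 1) ≤ 3 / 4 * p.cbrt (N + 1) ^ 4 / p.k := by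
  have := div_le_div_of_nonneg_right (sum_cbrt_le h.m_ge_two N) h.k_pos.le
  rw [Finset.sum_div] at this
  simp_rw [eta_eq, one_div_div]
  exact this

theorem sum_eta_cube_le (h : p.Admissible d₁ d₂ b T L τ) (N : ℕ) :
    ∑ n ∈ Finset.range N, p.eta (n + 1) ^ 3 ≤ p.k ^ 3 * Real.log (p.m + N) := by
  have hk := h.k_pos
  have := mul_le_mul_of_nonneg_left (sum_inv_cbrt_cube_le h.m_ge_two N) (pow_nonneg hk.le 3)
  rw [Finset.mul_sum] at this
  simp_rw [eta_eq, div_pow]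
  simpa only [mul_one_div] using this

end Admissible

end Params

namespace Setup

variable {d₁ d₂ b T : ℕ} {Ξ : Type u} [MeasurableSpace Ξ] {P : Problem d₁ d₂ Ξ} {L τ δ : ℝ} {p : Params}
  {U : Set (E d₂)} {pot φ : E d₁ → ℝ}

/-- The expected one-step decrease of the Lyapunov function with weights `W`, `γ / (τ² η)` and
`w γ / (τ² η)`, up to the noise and the bias of the momentum estimators. -/
def StepDecrease (P : Problem d₁ d₂ Ξ) (p : Params) (b : ℕ) (τ : ℝ) (pot φ : E d₁ → ℝ) (W w ε β : ℝ)
    (n : ℕ) (s : State d₁ d₂) : Prop :=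
  ∃ MX MY BX BY : ℝ, 0 ≤ MX ∧ 0 ≤ MY ∧ 0 ≤ BX ∧ 0 ≤ BY ∧ BX + w * BY ≤ β ∧
    ChangeBound P p (n + 1) s (MX + BX) (MY + BY) ∧
    pot (nextX p (n + 1) s) + W * gapY P (nextX p (n + 1) s) (nextY P p (n + 1) s)
      + p.γ / (τ ^ 2 * p.eta (n + 1)) * ((1 - p.c₁ * p.eta (n + 1) ^ 2) * errX P p.μ₁ s
        + w * ((1 - p.c₂ * p.eta (n + 1) ^ 2) * errY P p.μ₂ s) + 2 / b * (MX + w * MY))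
      + p.γ * p.eta (n + 1) / 2 * φ s.x ^ 2
    ≤ lyapunov P p pot W (p.γ / (τ ^ 2 * p.eta n)) (w * (p.γ / (τ ^ 2 * p.eta n))) s
      + p.γ * p.eta (n + 1) * ε

/-- The sum of the errors, relative to `γ k`. -/
noncomputable def totalError (p : Params) (b T : ℕ) (L τ δ ε : ℝ) : ℝ :=
  2 * δ ^ 2 / (b * τ ^ 2 * p.k * p.eta 0) + 9 * L ^ 2 / (4 * b * τ ^ 2 * p.k ^ 2)
    + 2 * (p.c₁ ^ 2 + p.c₂ ^ 2) * δ ^ 2 * p.k ^ 2 / (b * τ ^ 2) * Real.log (p.m + T)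
    + ε / p.k * ∑ n ∈ Finset.range T, p.eta (n + 1)

variable {Ω : Type v} [MeasurableSpace Ω] {Pr : Measure Ω} [IsProbabilityMeasure Pr]
  {Z : ℕ → Ω → Batch d₁ d₂ b Ξ}

/-- The momentum noise is charged only for `n + 1 < N`, so at most `T - 1` reciprocal step sizes
occur. Their sum is at most `3/4 (m+T)^(4/3)/k`, and this power cancels the one in `β`; the result
is the term `9L²/(4bτ²k²)` of `M'`. -/
theorem sum_step_errors_le (h : p.Admissible d₁ d₂ b T L τ) (hτ : 0 < τ) {ε β w : ℝ} (hε : 0 ≤ ε)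
    (hβ : β = 3 / 2 * L ^ 2 / p.cbrt T ^ 4) (hw1 : w ≤ 1) {N : ℕ} (hN : N ≤ T) :
    ∑ n ∈ Finset.range N, (p.γ * p.eta (n + 1) * ε + if n + 1 < N then
        p.γ / (τ ^ 2 * p.eta (n + 1)) * (2 / b * β + 2 * ((p.c₁ * p.eta (n + 1) ^ 2) ^ 2
          + w * (p.c₂ * p.eta (n + 1) ^ 2) ^ 2) * δ ^ 2 / b) else 0)
      + 2 * p.γ * δ ^ 2 / (b * τ ^ 2 * p.eta 0) ≤ p.γ * p.k * totalError p b T L τ δ ε := by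
  have hγ := h.γ_pos
  have hk := h.k_pos
  have hb : (0 : ℝ) < b := by exact_mod_cast h.one_le_b
  have hr := Params.cbrt_pos h.m_ge_two T
  have he := h.eta_pos
  have hβ0 : 0 ≤ β := by rw [hβ]; positivity
  rw [Finset.sum_add_distrib]
  have h1 : ∑ n ∈ Finset.range N, p.γ * p.eta (n + 1) * ε
      ≤ p.γ * ε * ∑ n ∈ Finset.range T, p.eta (n + 1) := by
    rw [Finset.mul_sum]
    refine (Finset.sum_le_sum_of_subset_of_nonneg (Finset.range_mono hN) fun n _ _ => ?_).trans
      (le_of_eq (Finset.sum_congr rfl fun n _ => by ring))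
    have := he (n + 1)
    positivity
  have h2 : ∑ n ∈ Finset.range N, (if n + 1 < N then
        p.γ / (τ ^ 2 * p.eta (n + 1)) * (2 / b * β + 2 * ((p.c₁ * p.eta (n + 1) ^ 2) ^ 2
          + w * (p.c₂ * p.eta (n + 1) ^ 2) ^ 2) * δ ^ 2 / b) else 0)
      ≤ ∑ n ∈ Finset.range (T - 1), (p.γ * (2 / b * β) / τ ^ 2 * (1 / p.eta (n + 1))
          + 2 * p.γ * (p.c₁ ^ 2 + p.c₂ ^ 2) * δ ^ 2 / (b * τ ^ 2) * p.eta (n + 1) ^ 3) := by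
    rw [← Finset.sum_filter]
    refine Finset.sum_le_sum_of_subset_of_nonneg ?_ (fun n _ _ => ?_) |>.trans'
      (Finset.sum_le_sum (f := fun n => p.γ / (τ ^ 2 * p.eta (n + 1)) * (2 / b * β +
        2 * ((p.c₁ * p.eta (n + 1) ^ 2) ^ 2
          + w * (p.c₂ * p.eta (n + 1) ^ 2) ^ 2) * δ ^ 2 / b)) fun n _ => ?_)
    · intro n hn
      simp only [Finset.mem_filter, Finset.mem_range] at hn ⊢
      omega
    · have := he (n + 1)
      positivity
    · have hn := he (n + 1)
      have e1 : p.γ / (τ ^ 2 * p.eta (n + 1)) * (2 / b * β + 2 * ((p.c₁ * p.eta (n + 1) ^ 2) ^ 2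
          + w * (p.c₂ * p.eta (n + 1) ^ 2) ^ 2) * δ ^ 2 / b)
          = p.γ * (2 / b * β) / τ ^ 2 * (1 / p.eta (n + 1))
            + 2 * p.γ * (p.c₁ ^ 2 + w * p.c₂ ^ 2) * δ ^ 2 / (b * τ ^ 2) * p.eta (n + 1) ^ 3 := by
        field_simp
      rw [e1]
      gcongr
      nlinarith [sq_nonneg p.c₂]
  have h3 : ∑ n ∈ Finset.range (T - 1), (p.γ * (2 / b * β) / τ ^ 2 * (1 / p.eta (n + 1))
          + 2 * p.γ * (p.c₁ ^ 2 + p.c₂ ^ 2) * δ ^ 2 / (b * τ ^ 2) * p.eta (n + 1) ^ 3)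
      ≤ p.γ * (2 / b * β) / τ ^ 2 * (3 / 4 * p.cbrt T ^ 4 / p.k)
        + 2 * p.γ * (p.c₁ ^ 2 + p.c₂ ^ 2) * δ ^ 2 / (b * τ ^ 2) * (p.k ^ 3 * Real.log (p.m + T)) := by
    rw [Finset.sum_add_distrib, ← Finset.mul_sum, ← Finset.mul_sum]
    have k1 : ∑ n ∈ Finset.range (T - 1), 1 / p.eta (n + 1) ≤ 3 / 4 * p.cbrt T ^ 4 / p.k := by
      rcases Nat.eq_zero_or_pos T with rfl | hT
      · simp only [Nat.zero_sub, Finset.range_zero, Finset.sum_empty]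
        positivity
      · have := h.sum_inv_eta_le (T - 1)
        rwa [Nat.sub_add_cancel hT] at this
    have k2 : ∑ n ∈ Finset.range (T - 1), p.eta (n + 1) ^ 3 ≤ p.k ^ 3 * Real.log (p.m + T) := by
      refine (Finset.sum_le_sum_of_subset_of_nonneg (Finset.range_mono (Nat.sub_le T 1)) fun n _ _ => ?_).trans
        (h.sum_eta_cube_le T)
      have := he (n + 1)
      positivity
    gcongr
  have e0 := he 0
  have e2 : p.γ * p.k * totalError p b T L τ δ ε = 2 * p.γ * δ ^ 2 / (b * τ ^ 2 * p.eta 0)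
      + p.γ * (2 / b * β) / τ ^ 2 * (3 / 4 * p.cbrt T ^ 4 / p.k)
      + 2 * p.γ * (p.c₁ ^ 2 + p.c₂ ^ 2) * δ ^ 2 / (b * τ ^ 2) * (p.k ^ 3 * Real.log (p.m + T))
      + p.γ * ε * ∑ n ∈ Finset.range T, p.eta (n + 1) := by
    rw [totalError, hβ]
    field_simp
    ring
  rw [e2]
  linarith

/-- Stopping at every `N ≤ T`, not only at `T`, bounds the expected potential at intermediate times
too; the interpolation argument needs this. -/
theorem lintegral_sum_le (h : Setup P L τ δ p.μ₁ p.μ₂ U) (hA : p.Admissible d₁ d₂ b T L τ)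
    (hZ : IsSampling P Pr Z) (x : E d₁) {y : E d₂} (hy : y ∈ P.feasible) (hmax : IsMaxOn (P.f x) P.feasible y)
    (hpot : ∀ x, 0 ≤ pot x) (hpm : Measurable pot) (hφ : Measurable φ) {W w ε β : ℝ} (hW : 0 ≤ W)
    (hw0 : 0 ≤ w) (hw1 : w ≤ 1) (hε : 0 ≤ ε) (hβ : β = 3 / 2 * L ^ 2 / p.cbrt T ^ 4)
    (hstep : ∀ n, ∀ s : State d₁ d₂, s.y ∈ P.feasible → StepDecrease P p b τ pot φ W w ε β n s)
    {N : ℕ} (hN : N ≤ T) :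
    ∫⁻ ω, ENNReal.ofReal (pot (run (retraction P p.μ₂) p x y (fun j => Z j ω) N).x) ∂Pr
      + ∑ n ∈ Finset.range N, ∫⁻ ω, ENNReal.ofReal (p.γ * p.eta (n + 1) / 2 *
        φ (run (retraction P p.μ₂) p x y (fun j => Z j ω) n).x ^ 2) ∂Pr
      ≤ ENNReal.ofReal (pot x + p.γ * p.k * totalError p b T L τ δ ε) := by
  have hγ := hA.γ_pos
  have he := hA.eta_pos
  have hb : (0 : ℝ) < b := by exact_mod_cast hA.one_le_b
  have hβ0 : 0 ≤ β := by
    have := Params.cbrt_pos hA.m_ge_two T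
    rw [hβ]; positivity
  have hAn : ∀ n, 0 ≤ p.γ / (τ ^ 2 * p.eta n) := fun n => by have := he n; positivity
  set err : ℕ → ℝ := fun n => p.γ * p.eta (n + 1) * ε + if n + 1 < N then
        p.γ / (τ ^ 2 * p.eta (n + 1)) * (2 / b * β + 2 * ((p.c₁ * p.eta (n + 1) ^ 2) ^ 2
          + w * (p.c₂ * p.eta (n + 1) ^ 2) ^ 2) * δ ^ 2 / b) else 0 with herr
  have herr0 : ∀ n, 0 ≤ err n := fun n => by
    have := he (n + 1)
    simp only [herr]
    split_ifs <;> positivity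
  have main := h.lintegral_telescope (pot := pot) hZ hA.one_le_b hA.stepRange x hy hmax hpot hpm
    -- All weights are switched off at time `N`: the final state counts only through its potential,
    -- and the last iteration contributes no momentum noise.
    (W := fun n => if n < N then W else 0) (A := fun n => if n < N then p.γ / (τ ^ 2 * p.eta n) else 0)
    (B := fun n => if n < N then w * (p.γ / (τ ^ 2 * p.eta n)) else 0)
    (fun n => by split_ifs <;> [exact hW; exact le_rfl])
    (fun n => by split_ifs <;> [exact hAn n; exact le_rfl])
    (fun n => by split_ifs <;> [exact mul_nonneg hw0 (hAn n); exact le_rfl])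
    (ψ := fun n z => p.γ * p.eta (n + 1) / 2 * φ z ^ 2)
    (fun n z => by have := he (n + 1); positivity) (fun n => by fun_prop) (err := err) herr0 (N := N)
    (fun n hn s hs => by
      obtain ⟨MX, MY, BX, BY, hMX, hMY, hBX, hBY, hB, hC, hle⟩ := hstep n s hs
      refine ⟨MX + BX, MY + BY, hC, ?_⟩
      simp only [if_pos hn, herr, nextBound]
      have hnn := hAn (n + 1)
      have a0 : 0 ≤ errX P p.μ₁ s := sq_nonneg _
      have e0 : 0 ≤ errY P p.μ₂ s := sq_nonneg _
      have s1 := sub_nonneg.2 (hA.stepRange (n + 1)).c₁_le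
      have s2 := sub_nonneg.2 (hA.stepRange (n + 1)).c₂_le
      have g0 : 0 ≤ gapY P (nextX p (n + 1) s) (nextY P p (n + 1) s) := sq_nonneg _
      set A' := p.γ / (τ ^ 2 * p.eta (n + 1))
      by_cases hnN : n + 1 < N
      · simp only [if_pos hnN]
        have hbb : 2 / (b : ℝ) * (BX + w * BY) ≤ 2 / b * β := by gcongr
        have := mul_le_mul_of_nonneg_left hbb hnn
        generalize p.γ / (τ ^ 2 * p.eta n) = A at hle ⊢
        simp only [div_eq_mul_inv] at hle this ⊢
        linarith
      · simp only [if_neg hnN]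
        have t1 : 0 ≤ A' * ((1 - p.c₁ * p.eta (n + 1) ^ 2) * errX P p.μ₁ s
          + w * ((1 - p.c₂ * p.eta (n + 1) ^ 2) * errY P p.μ₂ s) + 2 / b * (MX + w * MY)) := by positivity
        have t2 := mul_nonneg hW g0
        linarith)
  refine main.trans (ENNReal.ofReal_le_ofReal ?_)
  have h1 := sum_step_errors_le (δ := δ) hA h.τ_pos hε hβ hw1 hN
  have h2 : ((if 0 < N then p.γ / (τ ^ 2 * p.eta 0) else 0) + (if 0 < N then w * (p.γ / (τ ^ 2 * p.eta 0)) else 0))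
      * (δ ^ 2 / b) ≤ 2 * p.γ * δ ^ 2 / (b * τ ^ 2 * p.eta 0) := by
    have h3 := hAn 0
    have h4 : (if 0 < N then p.γ / (τ ^ 2 * p.eta 0) else 0) + (if 0 < N then w * (p.γ / (τ ^ 2 * p.eta 0)) else 0)
        ≤ 2 * (p.γ / (τ ^ 2 * p.eta 0)) := by
      split_ifs
      · nlinarith
      · simp; positivity
    refine (mul_le_mul_of_nonneg_right h4 (by positivity)).trans (le_of_eq ?_)
    have := he 0
    have := h.τ_pos
    field_simp
  linarith

end Setup

end AccZOMDA

/-! ### The balance of constants in one step. -/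

namespace AccZOMDA
open Set Metric Filter Topology
open scoped RealInnerProductSpace ENNReal

section RealInequalities

theorem sq_step_bound {γ lam τ L r : ℝ} (hL : 0 < L) (hτ : 0 < τ) (hlam : 0 < lam) (hr : 0 < r) (hγ : 0 < γ)
    (h : γ ≤ lam * τ / (2 * L) * √(6 / r / (36 * lam ^ 2 + 625 * (L / τ) ^ 2))) :
    2 * r * γ ^ 2 * L ^ 2 * (36 * lam ^ 2 + 625 * (L / τ) ^ 2) ≤ 3 * lam ^ 2 * τ ^ 2 := by
  have h1 : γ ^ 2 ≤ (lam * τ / (2 * L)) ^ 2 * (6 / r / (36 * lam ^ 2 + 625 * (L / τ) ^ 2)) := by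
    have := pow_le_pow_left₀ hγ.le h 2
    rwa [mul_pow, Real.sq_sqrt (by positivity)] at this
  have hX : 0 < 36 * lam ^ 2 + 625 * (L / τ) ^ 2 := by positivity
  set X := 36 * lam ^ 2 + 625 * (L / τ) ^ 2
  have h2 : (lam * τ / (2 * L)) ^ 2 * (6 / r / X) = 3 * lam ^ 2 * τ ^ 2 / (2 * r * L ^ 2 * X) := by
    field_simp
    ring
  rw [h2, le_div_iff₀ (by positivity)] at h1
  linarith

/-- Here and in the next three identities the weight `45rγL²/(λτ)` of the distance multiplies one
coefficient of the distance recursion. It is chosen so that half the contraction, `ητλ/2`, pays for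
the term `γη/2 · 45L² D` of the descent, as `r ≥ 1`. -/
theorem weight_mul_dist {γ η τ L lam r : ℝ} (hτ : 0 < τ) (hlam : 0 < lam) :
    45 * r * γ * L ^ 2 / (lam * τ) * (η * τ * lam / 2) = r * (γ * η / 2 * (45 * L ^ 2)) := by
  field_simp

theorem weight_mul_err {γ η τ L lam r : ℝ} (hτ : 0 < τ) (hlam : 0 < lam) :
    45 * r * γ * L ^ 2 / (lam * τ) * (13 / 12 * (η * lam / τ)) = γ * η * (195 / 4 * r * L ^ 2 / τ ^ 2) := by
  field_simp
  ring

theorem weight_mul_move {γ η τ L lam r : ℝ} (hτ : 0 < τ) (hlam : 0 < lam) :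
    45 * r * γ * L ^ 2 / (lam * τ) * (5 / 6 * η) = 12 * r * γ * η * L ^ 2 / τ ^ 2 * (75 * τ / 24 / lam) := by
  field_simp
  ring

theorem weight_mul_speed {γ η τ L lam r : ℝ} (hτ : 0 < τ) (hlam : 0 < lam) :
    45 * r * γ * L ^ 2 / (lam * τ) * (13 / 6 * (η / (τ * lam)) * (L / τ) ^ 2 * γ ^ 2)
        + γ * η * (12 * r * γ ^ 2 * L ^ 2 / τ ^ 2)
      = γ * η * (195 / 2 * r * γ ^ 2 * L ^ 4 / (lam ^ 2 * τ ^ 4) + 12 * r * γ ^ 2 * L ^ 2 / τ ^ 2) := by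
  field_simp
  ring

/-- Part of the contraction `cη²` offsets the growth of `1/η`; the rest, `zτ²η²`, leaves room for an
error with coefficient `γηz`. -/
theorem momentum_coefficient_le {γ η η₀ τ k c z : ℝ} (hγ : 0 < γ) (hη : 0 < η) (hτ : 0 < τ)
    (h5 : 1 / η - 1 / η₀ ≤ 2 / (3 * k ^ 3) * η) (hc : 2 / (3 * k ^ 3) + z * τ ^ 2 ≤ c) :
    γ / (τ ^ 2 * η) * (1 - c * η ^ 2) + γ * η * z ≤ γ / (τ ^ 2 * η₀) := by
  have e1 : γ / (τ ^ 2 * η) * (1 - c * η ^ 2) + γ * η * z - γ / (τ ^ 2 * η₀)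
      = γ / τ ^ 2 * (1 / η - 1 / η₀ - c * η + z * τ ^ 2 * η) := by
    have e : γ / (τ ^ 2 * η₀) = γ / τ ^ 2 * (1 / η₀) := by rw [div_mul_div_comm, mul_one]
    rw [e]
    generalize 1 / η₀ = i
    field_simp
    ring
  have e2 : 1 / η - 1 / η₀ - c * η + z * τ ^ 2 * η ≤ 0 := by nlinarith
  have e3 := mul_nonpos_of_nonneg_of_nonpos (show 0 ≤ γ / τ ^ 2 by positivity) e2
  linarith

/-- The combined decrease of all terms of the Lyapunov function. -/
theorem lyapunov_decrease {γ η η₀ τ L lam r bb k c₁ c₂ D D' Y V S a e q p p' φ ε M dt : ℝ}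
    (hγ : 0 < γ) (hη : 0 < η) (hτ : 0 < τ) (hL : 0 < L) (hlam : 0 < lam) (hr : 1 ≤ r)
    (hbb : 0 < bb) (hrd : dt = r * bb) (hD : 0 ≤ D) (hY : 0 ≤ Y) (hV : 0 ≤ V) (ha : 0 ≤ a)
    (he : 0 ≤ e)
    (h1 : p' ≤ p - γ * η / 2 * φ ^ 2 + γ * η / 2 * (9 / 2 * a + 45 * L ^ 2 * D) - γ * η / 4 * V + γ * η * ε)
    (h2 : D' ≤ (1 - η * τ * lam / 2) * D - 5 / 6 * η * Y + 13 / 12 * (η * lam / τ) * S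
      + 13 / 6 * (η / (τ * lam)) * (L / τ) ^ 2 * γ ^ 2 * V)
    (h3 : S ≤ 4 * e + 4 / 3 * q) (h4 : M = 6 * dt * L ^ 2 * (γ ^ 2 * η ^ 2 * V + η ^ 2 * Y))
    (h5 : 1 / η - 1 / η₀ ≤ 2 / (3 * k ^ 3) * η) (hc₁ : 2 / (3 * k ^ 3) + 9 * τ ^ 2 / 4 ≤ c₁)
    (hc₂ : 2 / (3 * k ^ 3) + 195 * r * L ^ 2 ≤ c₂) (h6 : lam ≤ 75 * τ / 24)
    (h7 : 195 / 2 * r * γ ^ 2 * L ^ 4 / (lam ^ 2 * τ ^ 4) + 12 * r * γ ^ 2 * L ^ 2 / τ ^ 2 ≤ 1 / 4) :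
    p' + 45 * r * γ * L ^ 2 / (lam * τ) * D' + γ / (τ ^ 2 * η) * ((1 - c₁ * η ^ 2) * a
        + 1 * ((1 - c₂ * η ^ 2) * e) + 2 / bb * M) + γ * η / 2 * φ ^ 2
      ≤ p + 45 * r * γ * L ^ 2 / (lam * τ) * D
        + (γ / (τ ^ 2 * η₀) * a + 1 * (γ / (τ ^ 2 * η₀)) * e) + γ * η * (ε + 65 * r * L ^ 2 / τ ^ 2 * q) := by
  have hr0 : 0 < r := by linarith
  have hW0 : 0 ≤ 45 * r * γ * L ^ 2 / (lam * τ) := by positivity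
  have cD := weight_mul_dist (γ := γ) (η := η) (L := L) (r := r) hτ hlam
  have cD' : γ * η / 2 * (45 * L ^ 2) ≤ r * (γ * η / 2 * (45 * L ^ 2)) :=
    le_mul_of_one_le_left (by positivity) hr
  have cS := weight_mul_err (γ := γ) (η := η) (L := L) (r := r) hτ hlam
  have cY := weight_mul_move (γ := γ) (η := η) (L := L) (r := r) hτ hlam
  -- The condition `λ ≤ 75τ/24` makes the gain from the move in `y` cover the momentum noise caused
  -- by that move: `45 · 5/6 = 12 · 75/24`.
  have cY' : 12 * r * γ * η * L ^ 2 / τ ^ 2 ≤ 12 * r * γ * η * L ^ 2 / τ ^ 2 * (75 * τ / 24 / lam) :=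
    le_mul_of_one_le_right (by positivity) ((one_le_div hlam).2 h6)
  have cV := weight_mul_speed (γ := γ) (η := η) (L := L) (r := r) hτ hlam
  have cV' := mul_le_mul_of_nonneg_left h7 (show 0 ≤ γ * η by positivity)
  -- `9/4` is half the coefficient `9/2` in the descent of the potential.
  have cA := momentum_coefficient_le (z := 9 / 4) hγ hη hτ h5 (c := c₁) (by linarith)
  -- `195 = 4 · 195/4`: the weighted gradient error in `y` is at most four times the momentum error
  -- plus a bias.
  have cE := momentum_coefficient_le (z := 195 * r * L ^ 2 / τ ^ 2) hγ hη hτ h5 (c := c₂)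
    (by rwa [div_mul_cancel₀ _ (by positivity)])
  have cM : γ / (τ ^ 2 * η) * (2 / bb * M) = γ * η * (12 * r * γ ^ 2 * L ^ 2 / τ ^ 2) * V
      + 12 * r * γ * η * L ^ 2 / τ ^ 2 * Y := by
    rw [h4, hrd]
    field_simp
    ring
  -- The bias part of the gradient error in `y` gives `195/4 · 4/3 = 65`, the coefficient of `q` in
  -- the conclusion.
  have hWS := mul_le_mul_of_nonneg_left h3 (show 0 ≤ γ * η * (195 / 4 * r * L ^ 2 / τ ^ 2) by positivity)
  have g2 : γ * η * (195 / 4 * r * L ^ 2 / τ ^ 2) * (4 * e + 4 / 3 * q)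
      = γ * η * (195 * r * L ^ 2 / τ ^ 2) * e + γ * η * (65 * r * L ^ 2 / τ ^ 2 * q) := by ring
  rw [g2] at hWS
  clear g2 h3 h4 h5 hc₁ hc₂ h6 h7 hrd
  -- Products of parameters become atoms, so that the final combination is linear.
  generalize 45 * r * γ * L ^ 2 / (lam * τ) = W at *
  generalize 13 / 6 * (η / (τ * lam)) * (L / τ) ^ 2 * γ ^ 2 = v at *
  generalize 13 / 12 * (η * lam / τ) = c at *
  have hWD := mul_le_mul_of_nonneg_left h2 hW0
  have fD := mul_le_mul_of_nonneg_right (cD'.trans cD.ge) hD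
  have fA := mul_le_mul_of_nonneg_right cA ha
  have fE := mul_le_mul_of_nonneg_right cE he
  have fY := mul_le_mul_of_nonneg_right (cY'.trans cY.ge) hY
  have fV := mul_le_mul_of_nonneg_right (cV.le.trans cV') hV
  have g1 : W * ((1 - η * τ * lam / 2) * D - 5 / 6 * η * Y + c * S + v * V)
      = W * D - W * (η * τ * lam / 2) * D - W * (5 / 6 * η) * Y + W * c * S + W * v * V := by ring
  rw [g1, cS] at hWD
  have g3 : γ / (τ ^ 2 * η) * ((1 - c₁ * η ^ 2) * a + 1 * ((1 - c₂ * η ^ 2) * e) + 2 / bb * M)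
      = γ / (τ ^ 2 * η) * (1 - c₁ * η ^ 2) * a + γ / (τ ^ 2 * η) * (1 - c₂ * η ^ 2) * e
        + γ / (τ ^ 2 * η) * (2 / bb * M) := by ring
  rw [g3, cM]
  clear cD cD' cS cY cY' cV cV' cA cE cM g1 g3 h2 hW0
  generalize γ / (τ ^ 2 * η) = A' at *
  generalize γ / (τ ^ 2 * η₀) = A at *
  generalize 12 * r * γ * η * L ^ 2 / τ ^ 2 = z1 at *
  generalize 12 * r * γ ^ 2 * L ^ 2 / τ ^ 2 = z2 at *
  generalize 195 / 4 * r * L ^ 2 / τ ^ 2 = z3 at *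
  generalize 195 * r * L ^ 2 / τ ^ 2 = z4 at *
  generalize 65 * r * L ^ 2 / τ ^ 2 = z5 at *
  linarith

/-- The squared condition on `γ`, divided by 12, bounds `rγ²L²(6λ² + 625/6 κ²)` by `λ²τ²/4`; the
claim needs the same with `12λ² + 195/2 κ²`. -/
theorem step_bound_of_sq {γ lam τ L r : ℝ} (hL : 0 < L) (hτ : 0 < τ) (hlam : 0 < lam) (hτL : τ ≤ L)
    (h1 : lam ≤ 1 / (6 * L)) (h2 : lam ≤ 75 * τ / 24)
    (h : 2 * r * γ ^ 2 * L ^ 2 * (36 * lam ^ 2 + 625 * (L / τ) ^ 2) ≤ 3 * lam ^ 2 * τ ^ 2) (hr : 0 < r) :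
    195 / 2 * r * γ ^ 2 * L ^ 4 / (lam ^ 2 * τ ^ 4) + 12 * r * γ ^ 2 * L ^ 2 / τ ^ 2 ≤ 1 / 4 := by
  set κ := L / τ with hκ
  have hLκ : L = κ * τ := by rw [hκ]; field_simp
  have hκ1 : 1 ≤ κ := (one_le_div hτ).2 hτL
  have h3 : lam ^ 2 ≤ 75 / 144 := by
    have e1 : 1 / (6 * L) * (75 * τ / 24) = 75 / 144 * (τ / L) := by field_simp; norm_num
    have e2 : τ / L ≤ 1 := (div_le_one hL).2 hτL
    have e3 : lam * lam ≤ 1 / (6 * L) * (75 * τ / 24) := by gcongr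
    nlinarith
  -- Exactly the comparison `6λ² ≤ (625/6 - 195/2) κ²`. The product of the two upper bounds on `λ`
  -- gives `λ² ≤ 75/144`, with room to spare.
  have h4 : 36 * lam ^ 2 ≤ 40 * κ ^ 2 := by nlinarith
  have e1 : 195 / 2 * r * γ ^ 2 * L ^ 4 / (lam ^ 2 * τ ^ 4) + 12 * r * γ ^ 2 * L ^ 2 / τ ^ 2
      = (r * γ ^ 2 * L ^ 2 * (195 / 2 * κ ^ 2 + 12 * lam ^ 2)) / (lam ^ 2 * τ ^ 2) := by
    rw [hLκ]; field_simp
  rw [e1, div_le_iff₀ (by positivity)]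
  have h5 : 0 ≤ r * γ ^ 2 * L ^ 2 := by positivity
  nlinarith [mul_le_mul_of_nonneg_left h4 h5]

end RealInequalities

theorem norm_add_sq_le_mul {d : ℕ} {ρ : ℝ} (hρ : 0 < ρ) (a c : E d) :
    ‖a + c‖ ^ 2 ≤ (1 + ρ) * ‖a‖ ^ 2 + (1 + 1 / ρ) * ‖c‖ ^ 2 := by
  have h1 : ‖a + c‖ ^ 2 ≤ (‖a‖ + ‖c‖) ^ 2 := by gcongr; exact norm_add_le a c
  have h2 : 0 ≤ (ρ * ‖a‖ - ‖c‖) ^ 2 / ρ := by positivity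
  have h3 : (ρ * ‖a‖ - ‖c‖) ^ 2 / ρ = ρ * ‖a‖ ^ 2 - 2 * ‖a‖ * ‖c‖ + 1 / ρ * ‖c‖ ^ 2 := by
    field_simp
    ring
  nlinarith

theorem norm_segment_sq_le {d : ℕ} {t : ℝ} (h0 : 0 ≤ t) (h1 : t ≤ 1) (a c : E d) :
    ‖(1 - t) • a + t • c‖ ^ 2 ≤ (1 - t) * ‖a‖ ^ 2 + t * ‖c‖ ^ 2 := by
  have h2 : ‖(1 - t) • a + t • c‖ ≤ (1 - t) * ‖a‖ + t * ‖c‖ := by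
    refine (norm_add_le _ _).trans ?_
    rw [norm_smul, norm_smul, Real.norm_eq_abs, Real.norm_eq_abs, abs_of_nonneg h0,
      abs_of_nonneg (sub_nonneg.2 h1)]
  have h3 : ‖(1 - t) • a + t • c‖ ^ 2 ≤ ((1 - t) * ‖a‖ + t * ‖c‖) ^ 2 := by gcongr
  nlinarith [mul_nonneg (mul_nonneg h0 (sub_nonneg.2 h1)) (sq_nonneg (‖a‖ - ‖c‖))]

namespace Setup

variable {d₁ d₂ b T : ℕ} {Ξ : Type u} [MeasurableSpace Ξ] {P : Problem d₁ d₂ Ξ} {L τ δ : ℝ} {p : Params}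
  {U : Set (E d₂)} {pot φ : E d₁ → ℝ}

/-- The expected decrease of the potential in one step, in terms of the errors. -/
def Descent (P : Problem d₁ d₂ Ξ) (p : Params) (L : ℝ) (pot φ : E d₁ → ℝ) (ε : ℝ) (t : ℕ)
    (s : State d₁ d₂) : Prop :=
  pot (nextX p t s) ≤ pot s.x - p.γ * p.eta t / 2 * φ s.x ^ 2
    + p.γ * p.eta t / 2 * (9 / 2 * errX P p.μ₁ s + 45 * L ^ 2 * gapY P s.x s.y)
    - p.γ * p.eta t / 4 * ‖s.v‖ ^ 2 + p.γ * p.eta t * ε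

theorem norm_nextX_sub_sq (hγ : 0 < p.γ) (t : ℕ) (hη : 0 < p.eta t) (s : State d₁ d₂) :
    ‖nextX p t s - s.x‖ ^ 2 = p.γ ^ 2 * p.eta t ^ 2 * ‖s.v‖ ^ 2 := by
  rw [nextX, sub_sub_cancel_left, norm_neg, norm_smul, Real.norm_eq_abs, abs_of_pos (by positivity)]
  ring

theorem norm_nextY_sub_sq (t : ℕ) (s : State d₁ d₂) :
    ‖nextY P p t s - s.y‖ ^ 2 = p.eta t ^ 2 * ‖ascentY P p s - s.y‖ ^ 2 := by
  rw [nextY, add_sub_cancel_left, norm_smul, Real.norm_eq_abs, mul_pow, sq_abs]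

/-- The projected step contracts, convexity transfers this to the `η`-average, and Young's
inequality then follows the maximizer from the old `x` to the new one. -/
theorem gapY_next_le (h : Setup P L τ δ p.μ₁ p.μ₂ U) (hτL : τ ≤ L) (hlam : 0 < p.lam)
    (hlamL : p.lam ≤ 1 / (6 * L)) (hγ : 0 < p.γ) {t : ℕ} (hη : 0 < p.eta t) (hη1 : p.eta t ≤ 1)
    {s : State d₁ d₂} (hy : s.y ∈ P.feasible) :
    gapY P (nextX p t s) (nextY P p t s) ≤ (1 - p.eta t * τ * p.lam / 2) * gapY P s.x s.y
      - 5 / 6 * p.eta t * ‖ascentY P p s - s.y‖ ^ 2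
      + 13 / 12 * (p.eta t * p.lam / τ) * ‖gradY P.f s.x s.y - s.w‖ ^ 2
      + 13 / 6 * (p.eta t / (τ * p.lam)) * (L / τ) ^ 2 * p.γ ^ 2 * ‖s.v‖ ^ 2 := by
  have hτ := h.τ_pos
  have hL := h.L_pos
  have hlL : p.lam * L ≤ 1 / 6 := by
    rw [le_div_iff₀ (by positivity)] at hlamL
    linarith
  have hlτ : τ * p.lam ≤ 1 / 6 := by nlinarith
  have h1 : ‖ascentY P p s - argmaxOn P.f P.feasible s.x‖ ^ 2 ≤ (1 - τ * p.lam) * gapY P s.x s.y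
      - 5 / 6 * ‖ascentY P p s - s.y‖ ^ 2 + p.lam / τ * ‖gradY P.f s.x s.y - s.w‖ ^ 2 :=
    StrongConcaveOn.norm_proj_step_sub_sq_le (h.assum.strongConcave s.x) hτ h.assum.isClosed
      (fun y hy => h.smoothPair_f.diff_y s.x y (h.mem_U hy)) hlam
      (fun y hy y' hy' => h.smoothPair_f.gradY_lip_y hL.le s.x (h.mem_U hy) (h.mem_U hy')) hlL hy
      (h.smoothMax.argmax_mem s.x) (h.smoothMax.argmax_spec s.x).2 s.w
  have h2 : ‖nextY P p t s - argmaxOn P.f P.feasible s.x‖ ^ 2 ≤ (1 - p.eta t * τ * p.lam) * gapY P s.x s.y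
      - 5 / 6 * p.eta t * ‖ascentY P p s - s.y‖ ^ 2
      + p.eta t * p.lam / τ * ‖gradY P.f s.x s.y - s.w‖ ^ 2 := by
    have e1 : nextY P p t s - argmaxOn P.f P.feasible s.x
        = (1 - p.eta t) • (s.y - argmaxOn P.f P.feasible s.x)
          + p.eta t • (ascentY P p s - argmaxOn P.f P.feasible s.x) := by
      unfold nextY
      module
    have e2 := norm_segment_sq_le hη.le hη1 (s.y - argmaxOn P.f P.feasible s.x)
      (ascentY P p s - argmaxOn P.f P.feasible s.x)
    rw [← e1] at e2
    refine e2.trans ?_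
    have e3 := mul_le_mul_of_nonneg_left h1 hη.le
    have e4 : ‖s.y - argmaxOn P.f P.feasible s.x‖ ^ 2 = gapY P s.x s.y := rfl
    rw [e4]
    refine (add_le_add le_rfl e3).trans (le_of_eq (by ring))
  set η := p.eta t
  -- The Young parameter spends half of the contraction on the motion of the maximizer. Since `τλ ≤
  -- 1/6`, it is at most `1/12`, whence `13/12` and `13/6`.
  set ρ := η * τ * p.lam / 2 with hρ
  have hρ0 : 0 < ρ := by positivity
  have hρ1 : ρ ≤ 1 / 12 := by nlinarith
  have h3 := norm_add_sq_le_mul hρ0 (nextY P p t s - argmaxOn P.f P.feasible s.x)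
    (argmaxOn P.f P.feasible s.x - argmaxOn P.f P.feasible (nextX p t s))
  rw [sub_add_sub_cancel] at h3
  have h4 : ‖argmaxOn P.f P.feasible s.x - argmaxOn P.f P.feasible (nextX p t s)‖ ^ 2
      ≤ (L / τ) ^ 2 * (p.γ ^ 2 * η ^ 2 * ‖s.v‖ ^ 2) := by
    rw [← norm_nextX_sub_sq hγ t hη, ← mul_pow, norm_sub_rev]
    gcongr
    exact h.smoothMax.norm_argmax_sub_le _ _
  have D0 : 0 ≤ gapY P s.x s.y := sq_nonneg _
  set D := gapY P s.x s.y
  set Y := ‖ascentY P p s - s.y‖ ^ 2 with hY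
  set S := ‖gradY P.f s.x s.y - s.w‖ ^ 2 with hS
  set V := ‖s.v‖ ^ 2 with hV
  have Y0 : 0 ≤ Y := sq_nonneg _
  have S0 : 0 ≤ S := sq_nonneg _
  have V0 : 0 ≤ V := sq_nonneg _
  have h5 := mul_le_mul_of_nonneg_left h2 (show 0 ≤ 1 + ρ by positivity)
  have h6 := mul_le_mul_of_nonneg_left h4 (show 0 ≤ 1 + 1 / ρ by positivity)
  refine h3.trans ((add_le_add h5 h6).trans ?_)
  have k1 : (1 + ρ) * (1 - η * τ * p.lam) * D ≤ (1 - η * τ * p.lam / 2) * D := by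
    refine mul_le_mul_of_nonneg_right ?_ D0
    nlinarith
  have k2 : 5 / 6 * η * Y ≤ (1 + ρ) * (5 / 6 * η * Y) :=
    le_mul_of_one_le_left (by positivity) (by linarith)
  have k3 : (1 + ρ) * (η * p.lam / τ * S) ≤ 13 / 12 * (η * p.lam / τ * S) :=
    mul_le_mul_of_nonneg_right (by linarith) (by positivity)
  have k4 : (1 + 1 / ρ) * η ^ 2 ≤ 13 / 6 * (η / (τ * p.lam)) := by
    have e1 : (1 + 1 / ρ) * η ^ 2 = (η * (τ * p.lam) + 2) * (η / (τ * p.lam)) := by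
      rw [hρ]; field_simp
    rw [e1]
    refine mul_le_mul_of_nonneg_right ?_ (by positivity)
    nlinarith
  have k5 := mul_le_mul_of_nonneg_right k4 (show 0 ≤ (L / τ) ^ 2 * p.γ ^ 2 * V by positivity)
  have k6 : (1 - ρ) * D = (1 - η * τ * p.lam / 2) * D := by rw [hρ]
  rw [hρ.symm] at k1
  generalize 1 / ρ = i at *
  generalize L / τ = κ at *
  generalize η * p.lam / τ = c at *
  generalize η / (τ * p.lam) = c' at *
  linarith

theorem norm_gradY_sub_sq_le (h : Setup P L τ δ p.μ₁ p.μ₂ U) {s : State d₁ d₂} (hy : s.y ∈ P.feasible) :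
    ‖gradY P.f s.x s.y - s.w‖ ^ 2 ≤ 4 * errY P p.μ₂ s + 4 / 3 * (L * p.μ₂ * (d₂ / (d₂ + 1))) ^ 2 := by
  have h1 := h.norm_meanY_sub_gradY_le s.x hy
  rw [norm_sub_rev] at h1
  have h2 := norm_add_sq_le_mul (ρ := 1 / 3) (by norm_num) (gradY P.f s.x s.y - P.meanY p.μ₂ s.x s.y)
    (P.meanY p.μ₂ s.x s.y - s.w)
  rw [sub_add_sub_cancel] at h2
  rw [h.errY_eq hy, norm_sub_rev s.w]
  have h3 := pow_le_pow_left₀ (norm_nonneg _) h1 2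
  norm_num at h2 ⊢
  linarith

end Setup

namespace Params.Admissible

variable {d₁ d₂ b T : ℕ} {L τ : ℝ} {p : Params}

theorem d_mul_μ₁_le (h : p.Admissible d₁ d₂ b T L τ) (hd₁ : 1 ≤ d₁) : d₁ * p.μ₁ ≤ 1 / p.cbrt T ^ 2 := by
  have hd : (0 : ℝ) < d₁ := by exact_mod_cast hd₁
  have h1 := h.μ₁_le
  rw [rpow_two_thirds h.m_ge_two] at h1
  have h2 := mul_le_mul_of_nonneg_left h1 hd.le
  refine h2.trans (le_of_eq ?_)
  have := cbrt_pos h.m_ge_two T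
  field_simp

theorem d_mul_μ₂_sq_le (h : p.Admissible d₁ d₂ b T L τ) (hd₁ : 1 ≤ d₁) (hd₂ : 1 ≤ d₂) :
    (d₁ + d₂ : ℝ) * (d₂ * p.μ₂) ^ 2 ≤ 1 / p.cbrt T ^ 4 := by
  have hd1 : (0 : ℝ) < d₁ := by exact_mod_cast hd₁
  have hd2 : (0 : ℝ) < d₂ := by exact_mod_cast hd₂
  have h1 := h.μ₂_le
  have hμ := h.μ₂_pos
  have hr := cbrt_pos h.m_ge_two T
  rw [rpow_two_thirds h.m_ge_two] at h1
  have hq : ((d₁ + d₂ : ℝ) ^ (1 / 2 : ℝ)) ^ 2 = d₁ + d₂ := by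
    rw [← Real.rpow_natCast, ← Real.rpow_mul (by positivity)]
    norm_num
  have hq0 : 0 < (d₁ + d₂ : ℝ) ^ (1 / 2 : ℝ) := by positivity
  set q := (d₁ + d₂ : ℝ) ^ (1 / 2 : ℝ)
  have h2 : q * (d₂ * p.μ₂) ≤ 1 / p.cbrt T ^ 2 := by
    have h3 := mul_le_mul_of_nonneg_left h1 (show 0 ≤ q * d₂ by positivity)
    calc q * (d₂ * p.μ₂) = q * d₂ * p.μ₂ := by ring
      _ ≤ _ := h3
      _ = _ := by field_simp
  rw [← hq, ← mul_pow]
  refine (pow_le_pow_left₀ (by positivity) h2 2).trans (le_of_eq ?_)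
  rw [div_pow, one_pow, ← pow_mul]

theorem mu₁_ball_le (h : p.Admissible d₁ d₂ b T L τ) (hd₁ : 1 ≤ d₁) :
    p.μ₁ * (d₁ / (d₁ + 1)) ≤ 1 / ((d₁ + 1) * p.cbrt T ^ 2) := by
  have hd : (0 : ℝ) < d₁ := by exact_mod_cast hd₁
  have hr := cbrt_pos h.m_ge_two T
  have h1 := div_le_div_of_nonneg_right (h.d_mul_μ₁_le hd₁) (show (0 : ℝ) ≤ d₁ + 1 by positivity)
  calc p.μ₁ * (d₁ / (d₁ + 1)) = d₁ * p.μ₁ / (d₁ + 1) := by ring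
    _ ≤ _ := h1
    _ = _ := by field_simp

theorem bias_y_le (h : p.Admissible d₁ d₂ b T L τ) (hd₁ : 1 ≤ d₁) (hd₂ : 1 ≤ d₂) :
    (d₁ + d₂ : ℝ) * (L * p.μ₂ * (d₂ / (d₂ + 1))) ^ 2 ≤ L ^ 2 / (4 * p.cbrt T ^ 4) := by
  have hd2 : (1 : ℝ) ≤ d₂ := by exact_mod_cast hd₂
  have h1 := h.d_mul_μ₂_sq_le hd₁ hd₂
  have hr := cbrt_pos h.m_ge_two T
  have e1 : (d₁ + d₂ : ℝ) * (L * p.μ₂ * (d₂ / (d₂ + 1))) ^ 2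
      = (d₁ + d₂ : ℝ) * (d₂ * p.μ₂) ^ 2 * (L ^ 2 / (d₂ + 1) ^ 2) := by
    field_simp
  rw [e1]
  calc _ ≤ 1 / p.cbrt T ^ 4 * (L ^ 2 / 2 ^ 2) := by
        gcongr
        linarith
    _ = _ := by field_simp; norm_num

end Params.Admissible

namespace Setup

variable {d₁ d₂ b T : ℕ} {Ξ : Type u} [MeasurableSpace Ξ] {P : Problem d₁ d₂ Ξ} {L τ δ : ℝ} {p : Params}
  {U : Set (E d₂)} {pot φ : E d₁ → ℝ}

/-- The choice `θ = 5` gives the displacement coefficient `6d` and the smoothing coefficient `6/5`.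
The two bounds are split into displacement and additive parts, because the additive parts are summed
over time separately. -/
theorem exists_changeBound (h : Setup P L τ δ p.μ₁ p.μ₂ U) (hA : p.Admissible d₁ d₂ b T L τ) (t : ℕ)
    {s : State d₁ d₂} (hy : s.y ∈ P.feasible) :
    ∃ MX MY BX BY : ℝ, 0 ≤ MX ∧ 0 ≤ MY ∧ 0 ≤ BX ∧ 0 ≤ BY ∧ BX + 1 * BY ≤ 3 / 2 * L ^ 2 / p.cbrt T ^ 4 ∧
      ChangeBound P p t s (MX + BX) (MY + BY) ∧
      MX + 1 * MY = 6 * (d₁ + d₂) * L ^ 2 * (p.γ ^ 2 * p.eta t ^ 2 * ‖s.v‖ ^ 2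
        + p.eta t ^ 2 * ‖ascentY P p s - s.y‖ ^ 2) := by
  have hy' : nextY P p t s ∈ P.feasible := h.nextY_mem (hA.eta_pos t).le (hA.eta_le_one t) hy
  have hx1 := h.lintegral_zoGradX_sub_le (θ := 5) (by norm_num) s.x (nextX p t s) hy hy'
  have hx2 := fun hd => h.lintegral_zoGradX_sub_le_of_one hd s.x (nextX p t s) hy hy'
  have hy1 := h.lintegral_zoGradY_sub_le (θ := 5) (by norm_num) s.x (nextX p t s) hy hy'
  have hy2 := fun hd => h.lintegral_zoGradY_sub_le_of_one hd s.x (nextX p t s) hy hy'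
  rw [norm_nextX_sub_sq hA.γ_pos t (hA.eta_pos t), norm_nextY_sub_sq] at hx1 hx2 hy1 hy2
  set Q := p.γ ^ 2 * p.eta t ^ 2 * ‖s.v‖ ^ 2 + p.eta t ^ 2 * ‖ascentY P p s - s.y‖ ^ 2
  have hQ : 0 ≤ Q := by positivity
  have hL := h.L_pos
  have hr := Params.cbrt_pos hA.m_ge_two T
  have b1 : (d₁ * p.μ₁) ^ 2 ≤ 1 / p.cbrt T ^ 4 := by
    have := hA.μ₁_pos
    refine (pow_le_pow_left₀ (by positivity) (hA.d_mul_μ₁_le h.one_le_d₁) 2).trans (le_of_eq ?_)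
    rw [div_pow, one_pow, ← pow_mul]
  have b2 := hA.d_mul_μ₂_sq_le h.one_le_d₁ h.one_le_d₂
  have hd1 : (1 : ℝ) ≤ d₁ := by exact_mod_cast h.one_le_d₁
  have hd2 : (1 : ℝ) ≤ d₂ := by exact_mod_cast h.one_le_d₂
  set u := (d₁ * p.μ₁) ^ 2 with hu
  set w := (d₂ * p.μ₂) ^ 2 with hw
  have hu0 : 0 ≤ u := sq_nonneg _
  have hw0 : 0 ≤ w := sq_nonneg _
  set z := 1 / p.cbrt T ^ 4 with hz
  have hz0 : 0 ≤ z := by positivity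
  -- With `u ≤ z` and `(d₁ + d₂)w ≤ z`, dimensions at least 2 give `w ≤ z/4` and the total `6/5 ·
  -- 5/4 = 3/2`. If one of the dimensions is 1, its additive term is absent and the other is at most
  -- `6/5 z`.
  have key : 6 / 5 * (if d₁ = 1 then 0 else u) + 6 / 5 * (if d₂ = 1 then 0 else w) ≤ 3 / 2 * z := by
    split_ifs with e1 e2 e2
    · linarith
    · nlinarith
    · linarith
    · have f1 : (2 : ℝ) ≤ d₁ := by have := h.one_le_d₁; exact_mod_cast (by omega : 2 ≤ d₁)
      have f2 : (2 : ℝ) ≤ d₂ := by have := h.one_le_d₂; exact_mod_cast (by omega : 2 ≤ d₂)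
      nlinarith
  refine ⟨6 * d₁ * L ^ 2 * Q, 6 * d₂ * L ^ 2 * Q, 6 / 5 * L ^ 2 * (if d₁ = 1 then 0 else u),
    6 / 5 * L ^ 2 * (if d₂ = 1 then 0 else w), by positivity, by positivity, ?_, ?_, ?_,
    ⟨?_, ?_, ?_, ?_⟩, by ring⟩
  · split_ifs <;> positivity
  · split_ifs <;> positivity
  · have := mul_le_mul_of_nonneg_left key (sq_nonneg L)
    calc _ = L ^ 2 * (6 / 5 * (if d₁ = 1 then 0 else u) + 6 / 5 * (if d₂ = 1 then 0 else w)) := by ring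
      _ ≤ L ^ 2 * (3 / 2 * z) := this
      _ = _ := by rw [hz]; ring
  · split_ifs <;> positivity
  · split_ifs <;> positivity
  · split_ifs with e
    · refine (hx2 e).trans (ENNReal.ofReal_le_ofReal ?_)
      have : 0 ≤ L ^ 2 * Q := by positivity
      nlinarith
    · refine hx1.trans (ENNReal.ofReal_le_ofReal (le_of_eq ?_))
      rw [hu]; ring
  · split_ifs with e
    · refine (hy2 e).trans (ENNReal.ofReal_le_ofReal ?_)
      have : 0 ≤ L ^ 2 * Q := by positivity
      nlinarith
    · refine hy1.trans (ENNReal.ofReal_le_ofReal (le_of_eq ?_))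
      rw [hw]; ring

/-- The decrease of the Lyapunov function, from the descent of the potential. -/
theorem stepDecrease_of_descent (h : Setup P L τ δ p.μ₁ p.μ₂ U) (hA : p.Admissible d₁ d₂ b T L τ)
    (hτL : τ ≤ L) {ε : ℝ} {n : ℕ} {s : State d₁ d₂} (hy : s.y ∈ P.feasible)
    (hd : Descent P p L pot φ ε (n + 1) s) :
    StepDecrease P p b τ pot φ (45 * ((d₁ + d₂ : ℝ) / b) * p.γ * L ^ 2 / (p.lam * τ)) 1
      (ε + 65 / 4 * L ^ 4 / (b * τ ^ 2 * p.cbrt T ^ 4)) (3 / 2 * L ^ 2 / p.cbrt T ^ 4) n s := by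
  obtain ⟨MX, MY, BX, BY, hMX, hMY, hBX, hBY, hB, hC, hM⟩ := h.exists_changeBound hA (n + 1) hy
  refine ⟨MX, MY, BX, BY, hMX, hMY, hBX, hBY, hB, hC, ?_⟩
  have hb : (0 : ℝ) < b := by exact_mod_cast hA.one_le_b
  have hbd : (b : ℝ) ≤ d₁ + d₂ := by exact_mod_cast hA.b_le
  have hdt : (0 : ℝ) < d₁ + d₂ := by linarith
  have hτ := h.τ_pos
  have hr1 : 1 ≤ (d₁ + d₂ : ℝ) / b := (one_le_div hb).2 hbd
  have hγ := hA.γ_pos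
  have hη := hA.eta_pos (n + 1)
  have hgam := sq_step_bound h.L_pos h.τ_pos hA.lam_pos (show 0 < (d₁ + d₂ : ℝ) / b by positivity) hA.γ_pos
    (by
      have := hA.γ_le
      rwa [show (6 : ℝ) / ((d₁ + d₂ : ℝ) / b) = 6 * b / (d₁ + d₂ : ℝ) by field_simp])
  -- The assumed coefficient `625/3` exceeds 195.
  have hc2 : 2 / (3 * p.k ^ 3) + 195 * ((d₁ + d₂ : ℝ) / b) * L ^ 2 ≤ p.c₂ := by
    refine le_trans ?_ hA.c₂_ge
    have e1 : 625 * (d₁ + d₂ : ℝ) * L ^ 2 / (3 * b) = 625 / 3 * ((d₁ + d₂ : ℝ) / b * L ^ 2) := by field_simp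
    have e2 : 0 ≤ (d₁ + d₂ : ℝ) / b * L ^ 2 := by positivity
    rw [e1]
    linarith
  have main := lyapunov_decrease (D := gapY P s.x s.y) (dt := d₁ + d₂) hγ hη hτ h.L_pos hA.lam_pos hr1 hb
    (by field_simp) (sq_nonneg _) (sq_nonneg ‖ascentY P p s - s.y‖) (sq_nonneg ‖s.v‖)
    (show 0 ≤ errX P p.μ₁ s from sq_nonneg _) (show 0 ≤ errY P p.μ₂ s from sq_nonneg _) hd
    (h.gapY_next_le hτL hA.lam_pos hA.lam_le_L hγ hη (hA.eta_le_one _) hy) (h.norm_gradY_sub_sq_le hy)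
    hM (hA.inv_eta_sub_le n) hA.c₁_ge hc2 hA.lam_le_τ
    (step_bound_of_sq h.L_pos hτ hA.lam_pos hτL hA.lam_le_L hA.lam_le_τ hgam (by positivity))
  refine main.trans ?_
  rw [lyapunov]
  refine add_le_add le_rfl (mul_le_mul_of_nonneg_left (add_le_add le_rfl ?_) (by positivity))
  have hby := hA.bias_y_le h.one_le_d₁ h.one_le_d₂
  have hcb := Params.cbrt_pos hA.m_ge_two T
  calc 65 * ((d₁ + d₂ : ℝ) / b) * L ^ 2 / τ ^ 2 * (L * p.μ₂ * (d₂ / (d₂ + 1))) ^ 2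
      = 65 * L ^ 2 / (b * τ ^ 2) * ((d₁ + d₂ : ℝ) * (L * p.μ₂ * (d₂ / (d₂ + 1))) ^ 2) := by field_simp
    _ ≤ 65 * L ^ 2 / (b * τ ^ 2) * (L ^ 2 / (4 * p.cbrt T ^ 4)) := by gcongr
    _ = _ := by field_simp

end Setup

end AccZOMDA

/-! ### Descent of the primal function and of its smoothing. -/

namespace AccZOMDA
open Set Metric Filter Topology
open scoped RealInnerProductSpace ENNReal

theorem le_of_gradient_lipschitz {d : ℕ} {F : E d → ℝ} {K : ℝ} (hF : Differentiable ℝ F)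
    (hK : ∀ x z, ‖gradient F x - gradient F z‖ ≤ K * ‖x - z‖) (x v : E d) {c : ℝ} (hc : 0 ≤ c) :
    F (x - c • v) ≤ F x - c * ⟪gradient F x, v⟫ + K / 2 * c ^ 2 * ‖v‖ ^ 2 := by
  have h := (abs_le.1 (abs_sub_sub_inner_gradient_le convex_univ (mem_univ x) (mem_univ (x - c • v))
    (fun w _ => hF w) fun w _ => hK w x)).2
  rw [sub_sub_cancel_left, inner_neg_right, real_inner_smul_right, norm_neg, norm_smul, Real.norm_eq_abs,
    abs_of_nonneg hc] at h
  nlinarith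

/-- A descent step along an inexact gradient `v`, measured by an approximation `G` of the gradient. -/
theorem descent_inexact {d : ℕ} {F : E d → ℝ} {K : ℝ} (hF : Differentiable ℝ F)
    (hK : ∀ x z, ‖gradient F x - gradient F z‖ ≤ K * ‖x - z‖) (x v G : E d) {c ρ : ℝ} (hc : 0 < c)
    (hρ : 0 < ρ) (hKc : K * c / 2 + ρ ≤ 1 / 4) :
    F (x - c • v) ≤ F x - c / 2 * ‖G‖ ^ 2 + c / 2 * ‖G - v‖ ^ 2 - c / 4 * ‖v‖ ^ 2
      + c * (‖gradient F x - G‖ ^ 2 / (4 * ρ)) := by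
  have h1 := le_of_gradient_lipschitz hF hK x v hc.le
  set R := gradient F x - G with hR
  have h2 : ⟪gradient F x, v⟫ = ⟪G, v⟫ + ⟪R, v⟫ := by rw [← inner_add_left, hR, add_sub_cancel]
  have h3 := norm_sub_sq_real G v
  have h4 : -⟪R, v⟫ ≤ ρ * ‖v‖ ^ 2 + ‖R‖ ^ 2 / (4 * ρ) := by
    have h5 := neg_le_of_abs_le (abs_real_inner_le_norm R v)
    have h6 : 0 ≤ (2 * ρ * ‖v‖ - ‖R‖) ^ 2 / (4 * ρ) := by positivity
    have h7 : (2 * ρ * ‖v‖ - ‖R‖) ^ 2 / (4 * ρ) = ρ * ‖v‖ ^ 2 - ‖R‖ * ‖v‖ + ‖R‖ ^ 2 / (4 * ρ) := by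
      field_simp
      ring
    linarith
  rw [h2] at h1
  generalize ‖R‖ ^ 2 / (4 * ρ) = z at *
  have h8 := mul_le_mul_of_nonneg_left h4 hc.le
  have h9 := mul_le_mul_of_nonneg_right hKc (show 0 ≤ c * ‖v‖ ^ 2 by positivity)
  have h10 : ⟪G, v⟫ = (‖G‖ ^ 2 + ‖v‖ ^ 2 - ‖G - v‖ ^ 2) / 2 := by linarith
  rw [h10] at h1
  nlinarith

theorem descent_exact {d : ℕ} {F : E d → ℝ} {K : ℝ} (hF : Differentiable ℝ F)
    (hK : ∀ x z, ‖gradient F x - gradient F z‖ ≤ K * ‖x - z‖) (x v : E d) {c : ℝ} (hc : 0 < c)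
    (hKc : K * c ≤ 1 / 2) :
    F (x - c • v) ≤ F x - c / 2 * ‖gradient F x‖ ^ 2 + c / 2 * ‖gradient F x - v‖ ^ 2 - c / 4 * ‖v‖ ^ 2 := by
  have h1 := le_of_gradient_lipschitz hF hK x v hc.le
  have h3 := norm_sub_sq_real (gradient F x) v
  have h9 := mul_le_mul_of_nonneg_right hKc (show 0 ≤ c * ‖v‖ ^ 2 by positivity)
  have h10 : ⟪gradient F x, v⟫ = (‖gradient F x‖ ^ 2 + ‖v‖ ^ 2 - ‖gradient F x - v‖ ^ 2) / 2 := by linarith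
  rw [h10] at h1
  nlinarith

section SmoothingGlobal

variable {d : ℕ} {F : E d → ℝ} {K μ : ℝ}

theorem hasGradientAt_smoothing_global (hμ : 0 < μ) (hF : Differentiable ℝ F)
    (hK : ∀ x z, ‖gradient F x - gradient F z‖ ≤ K * ‖x - z‖) (x : E d) :
    HasGradientAt (smoothing μ F) (⨍ u in closedBall (0 : E d) 1, gradient F (x + μ • u)) x :=
  hasGradientAt_smoothing (ρ := μ + 1) hμ (by linarith) (fun z _ => hF z) fun z _ z' _ => hK z z'

theorem gradient_smoothing_lip (hμ : 0 < μ) (hF : Differentiable ℝ F)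
    (hK : ∀ x z, ‖gradient F x - gradient F z‖ ≤ K * ‖x - z‖) (x z : E d) :
    ‖gradient (smoothing μ F) x - gradient (smoothing μ F) z‖ ≤ K * ‖x - z‖ := by
  rw [(hasGradientAt_smoothing_global hμ hF hK x).gradient,
    (hasGradientAt_smoothing_global hμ hF hK z).gradient]
  have hi : ∀ w, IntegrableOn (fun u => gradient F (w + μ • u)) (closedBall 0 1) := fun w =>
    integrableOn_gradient_add (ρ := μ + 1) hμ (by linarith) fun z _ z' _ => hK z z'
  refine Setup.norm_average_sub_average_le (hi x) (hi z) fun u _ => ?_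
  refine (hK _ _).trans (le_of_eq ?_)
  rw [add_sub_add_right_eq_sub]

theorem differentiable_smoothing (hμ : 0 < μ) (hF : Differentiable ℝ F)
    (hK : ∀ x z, ‖gradient F x - gradient F z‖ ≤ K * ‖x - z‖) : Differentiable ℝ (smoothing μ F) :=
  fun x => (hasGradientAt_smoothing_global hμ hF hK x).differentiableAt

theorem continuous_gradient_of_lipschitz (hK : ∀ x z, ‖gradient F x - gradient F z‖ ≤ K * ‖x - z‖) :
    Continuous (gradient F) :=
  (LipschitzWith.of_dist_le_mul (K := Real.toNNReal K) fun z z' => by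
    rw [dist_eq_norm, dist_eq_norm]
    refine (hK z z').trans ?_
    gcongr
    exact Real.le_coe_toNNReal K).continuous

theorem integrableOn_add_smul (hF : Continuous F) (x : E d) :
    IntegrableOn (fun u => F (x + μ • u)) (closedBall 0 1) :=
  (hF.comp (by fun_prop)).continuousOn.integrableOn_compact (isCompact_closedBall _ _)

theorem le_smoothing (hF : Continuous F) {a : ℝ} (h : ∀ z, a ≤ F z) (x : E d) : a ≤ smoothing μ F x := by
  rw [smoothing, ← average_ball_const (d := d) a]
  exact average_ball_mono (integrableOn_const measure_closedBall_lt_top.ne) (integrableOn_add_smul hF x)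
    fun u _ => h _

end SmoothingGlobal

namespace Setup

variable {d₁ d₂ b T : ℕ} {Ξ : Type u} [MeasurableSpace Ξ] {P : Problem d₁ d₂ Ξ} {L τ δ : ℝ} {p : Params}
  {U : Set (E d₂)}

section Primal

variable {μ₁ μ₂ : ℝ}

theorem hasGradientAt_g (h : Setup P L τ δ μ₁ μ₂ U) (x : E d₁) :
    HasGradientAt P.g (gradX P.f x (argmaxOn P.f P.feasible x)) x := by
  rw [h.g_eq]
  exact h.smoothMax.hasGradientAt_maxValue x

theorem gradient_g (h : Setup P L τ δ μ₁ μ₂ U) (x : E d₁) :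
    gradient P.g x = gradX P.f x (argmaxOn P.f P.feasible x) := (h.hasGradientAt_g x).gradient

theorem differentiable_g (h : Setup P L τ δ μ₁ μ₂ U) : Differentiable ℝ P.g := fun x =>
  (h.hasGradientAt_g x).differentiableAt

theorem gradient_g_lip (h : Setup P L τ δ μ₁ μ₂ U) (x z : E d₁) :
    ‖gradient P.g x - gradient P.g z‖ ≤ L * √(1 + (L / τ) ^ 2) * ‖x - z‖ := by
  rw [h.g_eq]
  exact h.smoothMax.gradient_maxValue_lip h.smoothMax.norm_argmax_sub_le x z

theorem gStar_le (h : Setup P L τ δ μ₁ μ₂ U) (x : E d₁) : P.gStar ≤ P.g x := ciInf_le h.assum.bddBelow x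

theorem gStar_le_smoothing (h : Setup P L τ δ μ₁ μ₂ U) (μ : ℝ) (x : E d₁) : P.gStar ≤ smoothing μ P.g x :=
  le_smoothing h.differentiable_g.continuous h.gStar_le x

theorem norm_gradient_g_sub_meanX_le (h : Setup P L τ δ μ₁ μ₂ U) (x : E d₁) :
    ‖gradient P.g x - P.meanX μ₁ x (argmaxOn P.f P.feasible x)‖ ≤ L * μ₁ * (d₁ / (d₁ + 1)) := by
  rw [h.gradient_g, norm_sub_rev]
  exact h.norm_meanX_sub_gradX_le x (h.smoothMax.argmax_mem x)

/-- The gradient of the smoothed `g` follows the maximizer over the `μ₁`-ball, while `meanX` freezes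
it at the centre; the difference is the motion of the maximizer. The constant `K` stays free because
it is 0 when the feasible set is a point. -/
theorem norm_gradient_smoothing_sub_meanX_le (h : Setup P L τ δ μ₁ μ₂ U) {K : ℝ}
    (hK : ∀ x x', ‖argmaxOn P.f P.feasible x - argmaxOn P.f P.feasible x'‖ ≤ K * ‖x - x'‖) (x : E d₁) :
    ‖gradient (smoothing μ₁ P.g) x - P.meanX μ₁ x (argmaxOn P.f P.feasible x)‖
      ≤ L * K * μ₁ * (d₁ / (d₁ + 1)) := by
  have hy := h.smoothMax.argmax_mem x
  rw [(hasGradientAt_smoothing_global h.μ₁_pos h.differentiable_g h.gradient_g_lip x).gradient,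
    h.meanX_eq x hy]
  have hi : IntegrableOn (fun u => gradient P.g (x + μ₁ • u)) (closedBall 0 1) :=
    integrableOn_gradient_add (ρ := μ₁ + 1) h.μ₁_pos (by linarith) fun z _ z' _ => h.gradient_g_lip z z'
  rw [← average_ball_sub hi (h.integrableOn_gradX x hy)]
  refine norm_average_ball_le_of_le h.one_le_d₁ (hi.sub (h.integrableOn_gradX x hy)) fun u _ => ?_
  change ‖gradient P.g (x + μ₁ • u) - gradX P.f (x + μ₁ • u) (argmaxOn P.f P.feasible x)‖ ≤ _
  rw [h.gradient_g]
  refine (h.smoothPair_f.gradX_lip_y h.L_pos.le _ (h.mem_U (h.smoothMax.argmax_mem _)) (h.mem_U hy)).trans ?_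
  have h1 := hK (x + μ₁ • u) x
  rw [add_sub_cancel_left, norm_smul, Real.norm_eq_abs, abs_of_pos h.μ₁_pos] at h1
  calc _ ≤ L * (K * (μ₁ * ‖u‖)) := mul_le_mul_of_nonneg_left h1 h.L_pos.le
    _ = _ := by ring

theorem sqrt_le_Lg (h : Setup P L τ δ μ₁ μ₂ U) : L * √(1 + (L / τ) ^ 2) ≤ L + L ^ 2 / τ := by
  have hL := h.L_pos
  have hτ := h.τ_pos
  have h1 : √(1 + (L / τ) ^ 2) ≤ 1 + L / τ := by
    rw [Real.sqrt_le_left (by positivity)]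
    have : 0 < L / τ := by positivity
    nlinarith
  calc _ ≤ L * (1 + L / τ) := mul_le_mul_of_nonneg_left h1 hL.le
    _ = _ := by ring

end Primal

theorem γ_eta_mul_le (h : Setup P L τ δ p.μ₁ p.μ₂ U) (hA : p.Admissible d₁ d₂ b T L τ) (t : ℕ) :
    (L + L ^ 2 / τ) * (p.γ * p.eta t) ≤ 1 / 2 := by
  have hL := h.L_pos
  have hτ := h.τ_pos
  have hk := hA.k_pos
  have h1 := hA.γ_le_m
  have h2 : p.m ^ (1 / 3 : ℝ) ≤ p.cbrt t := by
    have := Params.cbrt_mono hA.m_ge_two t.zero_le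
    rwa [Params.cbrt, Nat.cast_zero, add_zero] at this
  have hc := Params.cbrt_pos hA.m_ge_two t
  have h3 : p.γ ≤ p.cbrt t / (2 * (L + L ^ 2 / τ) * p.k) := h1.trans (by gcongr)
  rw [Params.eta_eq]
  calc (L + L ^ 2 / τ) * (p.γ * (p.k / p.cbrt t))
      ≤ (L + L ^ 2 / τ) * (p.cbrt t / (2 * (L + L ^ 2 / τ) * p.k) * (p.k / p.cbrt t)) := by gcongr
    _ = 1 / 2 := by
      have : 0 < L + L ^ 2 / τ := by positivity
      field_simp

theorem norm_meanX_sub_sq_le (h : Setup P L τ δ p.μ₁ p.μ₂ U) {s : State d₁ d₂} (hy : s.y ∈ P.feasible) :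
    ‖P.meanX p.μ₁ s.x (argmaxOn P.f P.feasible s.x) - P.meanX p.μ₁ s.x s.y‖ ^ 2 ≤ L ^ 2 * gapY P s.x s.y := by
  have h1 := h.norm_meanX_sub_le s.x s.x (h.smoothMax.argmax_mem s.x) hy
  rw [sub_self, norm_zero, zero_pow two_ne_zero, zero_add, Real.sqrt_sq (norm_nonneg _)] at h1
  refine (pow_le_pow_left₀ (norm_nonneg _) h1 2).trans (le_of_eq ?_)
  rw [mul_pow, gapY, norm_sub_rev]

theorem bias_x_le (hA : p.Admissible d₁ d₂ b T L τ) (hL : 0 ≤ L) (hd₁ : 1 ≤ d₁) :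
    L * p.μ₁ * (d₁ / (d₁ + 1)) ≤ L * (1 / (2 * p.cbrt T ^ 2)) := by
  rw [mul_assoc]
  refine mul_le_mul_of_nonneg_left ((hA.mu₁_ball_le hd₁).trans ?_) hL
  have := Params.cbrt_pos hA.m_ge_two T
  have hd : (1 : ℝ) ≤ d₁ := by exact_mod_cast hd₁
  gcongr
  linarith

/-- The descent of `g` itself. -/
theorem descent_g (h : Setup P L τ δ p.μ₁ p.μ₂ U) (hA : p.Admissible d₁ d₂ b T L τ) (t : ℕ)
    {s : State d₁ d₂} (hy : s.y ∈ P.feasible) :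
    Descent P p L (fun x => P.g x - P.gStar) (fun x => ‖gradient P.g x‖)
      (2 / 3 * (L * (1 / (2 * p.cbrt T ^ 2))) ^ 2) t s := by
  have hη := hA.eta_pos t
  have hγ := hA.γ_pos
  have hc : 0 < p.γ * p.eta t := by positivity
  have h1 := descent_exact h.differentiable_g h.gradient_g_lip s.x s.v hc
    ((mul_le_mul_of_nonneg_right h.sqrt_le_Lg hc.le).trans (h.γ_eta_mul_le hA t))
  have h2 : ‖gradient P.g s.x - s.v‖ ^ 2 ≤ 9 / 2 * errX P p.μ₁ s + 45 * L ^ 2 * gapY P s.x s.y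
      + 4 / 3 * (L * (1 / (2 * p.cbrt T ^ 2))) ^ 2 := by
    -- Weight `9/2` on the error of `v`, and `9/7` on everything else.
    have n1 := norm_add_sq_le_mul (ρ := 7 / 2) (by norm_num) (P.meanX p.μ₁ s.x s.y - s.v)
      (gradient P.g s.x - P.meanX p.μ₁ s.x s.y)
    rw [add_comm, sub_add_sub_cancel] at n1
    -- Together with `9/7` this gives `9/7 · 28 = 36 ≤ 45` on the distance and `9/7 · 28/27 = 4/3`
    -- on the bias.
    have n2 := norm_add_sq_le_mul (ρ := 27) (by norm_num)
      (P.meanX p.μ₁ s.x (argmaxOn P.f P.feasible s.x) - P.meanX p.μ₁ s.x s.y)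
      (gradient P.g s.x - P.meanX p.μ₁ s.x (argmaxOn P.f P.feasible s.x))
    rw [add_comm (P.meanX p.μ₁ s.x (argmaxOn P.f P.feasible s.x) - P.meanX p.μ₁ s.x s.y),
      sub_add_sub_cancel] at n2
    have n3 := h.norm_meanX_sub_sq_le hy
    have n4 := pow_le_pow_left₀ (norm_nonneg _) ((h.norm_gradient_g_sub_meanX_le s.x).trans
      (bias_x_le hA h.L_pos.le h.one_le_d₁)) 2
    have n5 : ‖P.meanX p.μ₁ s.x s.y - s.v‖ ^ 2 = errX P p.μ₁ s := by rw [h.errX_eq hy, norm_sub_rev]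
    have n6 : 0 ≤ L ^ 2 * gapY P s.x s.y := mul_nonneg (sq_nonneg _) (sq_nonneg _)
    rw [n5] at n1
    norm_num at n1 n2 n4 ⊢
    linarith
  have h3 := mul_le_mul_of_nonneg_left h2 (show 0 ≤ p.γ * p.eta t / 2 by positivity)
  unfold Descent nextX
  linarith

/-- The descent of the smoothed primal function. -/
theorem descent_smoothing (h : Setup P L τ δ p.μ₁ p.μ₂ U) (hA : p.Admissible d₁ d₂ b T L τ) (hτL : τ ≤ L) (t : ℕ)
    {s : State d₁ d₂} (hy : s.y ∈ P.feasible) :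
    Descent P p L (fun x => smoothing p.μ₁ P.g x - P.gStar)
      (fun x => ‖P.meanX p.μ₁ x (argmaxOn P.f P.feasible x)‖)
      (25 / 24 * (L ^ 2 / τ * (1 / ((d₁ + 1) * p.cbrt T ^ 2))) ^ 2) t s := by
  have hη := hA.eta_pos t
  have hη1 := hA.eta_le_one t
  have hγ := hA.γ_pos
  have hL := h.L_pos
  have hτ := h.τ_pos
  have hlam := hA.lam_pos
  have hc : 0 < p.γ * p.eta t := by positivity
  have hb : (0 : ℝ) < b := by exact_mod_cast hA.one_le_b
  have hbd : (b : ℝ) ≤ d₁ + d₂ := by exact_mod_cast hA.b_le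
  have hr1 : 1 ≤ (d₁ + d₂ : ℝ) / b := (one_le_div hb).2 hbd
  have hgam := sq_step_bound h.L_pos h.τ_pos hA.lam_pos (show 0 < (d₁ + d₂ : ℝ) / b by positivity) hA.γ_pos
    (by
      have := hA.γ_le
      have hdt : (0 : ℝ) < d₁ + d₂ := by linarith
      rwa [show (6 : ℝ) / ((d₁ + d₂ : ℝ) / b) = 6 * b / (d₁ + d₂ : ℝ) by field_simp])
  -- The condition on `γ` makes the step far shorter than smoothness requires. The curvature term
  -- then takes only `1/100` of the available `1/4`, leaving `6/25` for Young's inequality against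
  -- the bias; this is the source of `25/24`.
  have hsmall : L * √(1 + (L / τ) ^ 2) * (p.γ * p.eta t) ≤ 1 / 50 := by
    have k1 : L * √(1 + (L / τ) ^ 2) ≤ 2 * (L ^ 2 / τ) := by
      refine h.sqrt_le_Lg.trans ?_
      have : L ≤ L ^ 2 / τ := by rw [le_div_iff₀ hτ]; nlinarith
      linarith
    have k2 : p.γ * L ^ 3 ≤ 1 / 100 * τ ^ 2 := by
      have e1 : 1250 * p.γ ^ 2 * L ^ 2 * (L / τ) ^ 2 ≤ 3 * p.lam ^ 2 * τ ^ 2 := by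
        refine le_trans ?_ hgam
        have e2 : 0 ≤ p.γ ^ 2 * L ^ 2 * (L / τ) ^ 2 := by positivity
        have e3 : 0 ≤ ((d₁ + d₂ : ℝ) / b) * (p.γ ^ 2 * L ^ 2 * p.lam ^ 2) := by positivity
        nlinarith
      have e4 : p.lam * L ≤ 1 / 6 := by
        have := hA.lam_le_L
        rw [le_div_iff₀ (by positivity)] at this
        linarith
      have e5 : 1250 * (p.γ * L ^ 3) ^ 2 ≤ 3 * (p.lam * L) ^ 2 * (τ ^ 2) ^ 2 := by
        have := mul_le_mul_of_nonneg_right e1 (show 0 ≤ L ^ 2 * τ ^ 2 by positivity)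
        have e6 : 1250 * p.γ ^ 2 * L ^ 2 * (L / τ) ^ 2 * (L ^ 2 * τ ^ 2) = 1250 * (p.γ * L ^ 3) ^ 2 := by
          field_simp
        rw [e6] at this
        linarith
      have e7 : (p.lam * L) ^ 2 ≤ 1 / 36 := by
        have : 0 ≤ p.lam * L := by positivity
        nlinarith
      refine abs_le_of_sq_le_sq' ?_ (by positivity) |>.2
      have : 0 ≤ (τ ^ 2) ^ 2 := by positivity
      nlinarith
    calc _ ≤ 2 * (L ^ 2 / τ) * (p.γ * 1) := by gcongr
      _ = 2 * (p.γ * L ^ 3) / (τ * L) := by field_simp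
      _ ≤ 2 * (1 / 100 * τ ^ 2) / (τ * L) := by gcongr
      _ = 1 / 50 * (τ / L) := by field_simp; norm_num
      _ ≤ 1 / 50 * 1 := by
        gcongr
        exact (div_le_one hL).2 hτL
      _ = 1 / 50 := by norm_num
  have h1 := descent_inexact (differentiable_smoothing h.μ₁_pos h.differentiable_g h.gradient_g_lip)
    (gradient_smoothing_lip h.μ₁_pos h.differentiable_g h.gradient_g_lip) s.x s.v
    (P.meanX p.μ₁ s.x (argmaxOn P.f P.feasible s.x)) (ρ := 6 / 25) hc (by norm_num) (by linarith)
  have h2 : ‖P.meanX p.μ₁ s.x (argmaxOn P.f P.feasible s.x) - s.v‖ ^ 2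
      ≤ 9 / 2 * errX P p.μ₁ s + 45 * L ^ 2 * gapY P s.x s.y := by
    have n1 := norm_add_sq_le_mul (ρ := 7 / 2) (by norm_num) (P.meanX p.μ₁ s.x s.y - s.v)
      (P.meanX p.μ₁ s.x (argmaxOn P.f P.feasible s.x) - P.meanX p.μ₁ s.x s.y)
    rw [add_comm, sub_add_sub_cancel] at n1
    have n3 := h.norm_meanX_sub_sq_le hy
    have n5 : ‖P.meanX p.μ₁ s.x s.y - s.v‖ ^ 2 = errX P p.μ₁ s := by rw [h.errX_eq hy, norm_sub_rev]
    have n6 : 0 ≤ L ^ 2 * gapY P s.x s.y := mul_nonneg (sq_nonneg _) (sq_nonneg _)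
    rw [n5] at n1
    norm_num at n1 ⊢
    linarith
  have h3 := mul_le_mul_of_nonneg_left h2 (show 0 ≤ p.γ * p.eta t / 2 by positivity)
  have h4 : ‖gradient (smoothing p.μ₁ P.g) s.x - P.meanX p.μ₁ s.x (argmaxOn P.f P.feasible s.x)‖ ^ 2
      / (4 * (6 / 25)) ≤ 25 / 24 * (L ^ 2 / τ * (1 / ((d₁ + 1) * p.cbrt T ^ 2))) ^ 2 := by
    have m1 := h.norm_gradient_smoothing_sub_meanX_le h.smoothMax.norm_argmax_sub_le s.x
    have m2 : L * (L / τ) * p.μ₁ * (d₁ / (d₁ + 1)) ≤ L ^ 2 / τ * (1 / ((d₁ + 1) * p.cbrt T ^ 2)) := by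
      rw [mul_assoc, show L * (L / τ) = L ^ 2 / τ by ring]
      exact mul_le_mul_of_nonneg_left (hA.mu₁_ball_le h.one_le_d₁) (by positivity)
    have m3 := pow_le_pow_left₀ (norm_nonneg _) (m1.trans m2) 2
    refine le_trans (le_of_eq ?_) (mul_le_mul_of_nonneg_left m3 (show (0 : ℝ) ≤ 25 / 24 by norm_num))
    ring
  have h5 := mul_le_mul_of_nonneg_left h4 hc.le
  unfold Descent nextX
  dsimp only
  linarith

/-- When the strong concavity exceeds the smoothness, the feasible set is a singleton and the
estimator in `y` plays no role. -/
theorem stepDecrease_of_lt (h : Setup P L τ δ p.μ₁ p.μ₂ U) (hA : p.Admissible d₁ d₂ b T L τ) (hLτ : L < τ)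
    (n : ℕ) {s : State d₁ d₂} (hy : s.y ∈ P.feasible) :
    StepDecrease P p b τ (fun x => smoothing p.μ₁ P.g x - P.gStar)
      (fun x => ‖P.meanX p.μ₁ x (argmaxOn P.f P.feasible x)‖) 0 0 0 (3 / 2 * L ^ 2 / p.cbrt T ^ 4) n s := by
  have hη := hA.eta_pos (n + 1)
  have hη1 := hA.eta_le_one (n + 1)
  have hγ := hA.γ_pos
  have hL := h.L_pos
  have hτ := h.τ_pos
  have hlam := hA.lam_pos
  have hb : (0 : ℝ) < b := by exact_mod_cast hA.one_le_b
  have hd₁ : (1 : ℝ) ≤ d₁ := by exact_mod_cast h.one_le_d₁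
  have hd₂ : (1 : ℝ) ≤ d₂ := by exact_mod_cast h.one_le_d₂
  -- Two distinct feasible points would force `τ ≤ L`.
  have hsub : ∀ q ∈ P.feasible, ∀ q' ∈ P.feasible, q = q' := fun q hq q' hq' => by
    by_contra hne
    exact absurd (h.smoothMax.le_of_nontrivial hq hq' hne) (not_le.2 hLτ)
  have hmem := h.smoothMax.argmax_mem
  have hy' : nextY P p (n + 1) s ∈ P.feasible := h.nextY_mem hη.le hη1 hy
  have hyy : nextY P p (n + 1) s = s.y := hsub _ hy' _ hy
  have hc : 0 < p.γ * p.eta (n + 1) := by positivity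
  have hgam := sq_step_bound h.L_pos h.τ_pos hA.lam_pos (show 0 < (d₁ + d₂ : ℝ) / b by positivity) hA.γ_pos
    (by
      have := hA.γ_le
      rwa [show (6 : ℝ) / ((d₁ + d₂ : ℝ) / b) = 6 * b / (d₁ + d₂ : ℝ) by field_simp])
  have hx1 := h.lintegral_zoGradX_sub_le (θ := 2) (by norm_num) s.x (nextX p (n + 1) s) hy hy'
  have hy1 := h.lintegral_zoGradY_sub_le (θ := 2) (by norm_num) s.x (nextX p (n + 1) s) hy hy'
  have b1 : (d₁ * p.μ₁) ^ 2 ≤ 1 / p.cbrt T ^ 4 := by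
    have := hA.μ₁_pos
    refine (pow_le_pow_left₀ (by positivity) (hA.d_mul_μ₁_le h.one_le_d₁) 2).trans (le_of_eq ?_)
    rw [div_pow, one_pow, ← pow_mul]
  refine ⟨(1 + 2) * d₁ * (L ^ 2 * (‖nextX p (n + 1) s - s.x‖ ^ 2 + ‖nextY P p (n + 1) s - s.y‖ ^ 2)),
    (1 + 2) * d₂ * (L ^ 2 * (‖nextX p (n + 1) s - s.x‖ ^ 2 + ‖nextY P p (n + 1) s - s.y‖ ^ 2)),
    d₁ ^ 2 * ((1 + 1 / 2) * (L ^ 2 * p.μ₁ ^ 2)), d₂ ^ 2 * ((1 + 1 / 2) * (L ^ 2 * p.μ₂ ^ 2)),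
    by positivity, by positivity, by positivity, by positivity, ?_,
    ⟨by positivity, by positivity, hx1, hy1⟩, ?_⟩
  · calc _ = 3 / 2 * L ^ 2 * (d₁ * p.μ₁) ^ 2 := by ring
      _ ≤ 3 / 2 * L ^ 2 * (1 / p.cbrt T ^ 4) := by gcongr
      _ = _ := by ring
  -- The maximizer is constant, so the smoothed potential has no bias and the exact descent
  -- inequality applies.
  · have hGN : gradient (smoothing p.μ₁ P.g) s.x = P.meanX p.μ₁ s.x (argmaxOn P.f P.feasible s.x) := by
      have := h.norm_gradient_smoothing_sub_meanX_le (K := 0)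
        (fun x x' => by rw [hsub _ (hmem x) _ (hmem x'), sub_self, norm_zero, zero_mul]) s.x
      rw [mul_zero, zero_mul, zero_mul] at this
      exact sub_eq_zero.1 (norm_le_zero_iff.1 this)
    have h1 := descent_exact (differentiable_smoothing h.μ₁_pos h.differentiable_g h.gradient_g_lip)
      (gradient_smoothing_lip h.μ₁_pos h.differentiable_g h.gradient_g_lip) s.x s.v hc
      ((mul_le_mul_of_nonneg_right h.sqrt_le_Lg hc.le).trans (h.γ_eta_mul_le hA (n + 1)))
    have ea : ‖P.meanX p.μ₁ s.x (argmaxOn P.f P.feasible s.x) - s.v‖ ^ 2 = errX P p.μ₁ s := by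
      rw [h.errX_eq hy, norm_sub_rev, hsub _ (hmem s.x) _ hy]
    rw [hGN, ea] at h1
    have ha : 0 ≤ errX P p.μ₁ s := sq_nonneg _
    rw [hyy, sub_self, norm_zero, norm_nextX_sub_sq hγ _ hη]
    have cA := momentum_coefficient_le (z := 9 / 4) hγ hη hτ (hA.inv_eta_sub_le n) (c := p.c₁)
      (by have := hA.c₁_ge; linarith)
    have fA := mul_le_mul_of_nonneg_right cA ha
    have cM : p.γ / (τ ^ 2 * p.eta (n + 1)) * (2 / b * ((1 + 2) * d₁ * (L ^ 2 * (p.γ ^ 2 * p.eta (n + 1) ^ 2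
        * ‖s.v‖ ^ 2 + 0 ^ 2)))) ≤ p.γ * p.eta (n + 1) / 4 * ‖s.v‖ ^ 2 := by
      have e1 : p.γ / (τ ^ 2 * p.eta (n + 1)) * (2 / b * ((1 + 2) * d₁ * (L ^ 2 * (p.γ ^ 2 * p.eta (n + 1) ^ 2
        * ‖s.v‖ ^ 2 + 0 ^ 2)))) = p.γ * p.eta (n + 1) / 4 * ‖s.v‖ ^ 2
          * (24 * (d₁ / b) * p.γ ^ 2 * L ^ 2 / τ ^ 2) := by
        field_simp
        ring
      rw [e1]
      refine mul_le_of_le_one_right (by positivity) ?_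
      rw [div_le_one (by positivity)]
      -- Of the squared condition on `γ` only the part with `36λ²` is kept; the part with `κ` pays
      -- for the motion of `y`, which does not occur here.
      have e2 : 72 * ((d₁ + d₂ : ℝ) / b) * p.γ ^ 2 * L ^ 2 * p.lam ^ 2 ≤ 3 * p.lam ^ 2 * τ ^ 2 := by
        refine le_trans ?_ hgam
        have : 0 ≤ (d₁ + d₂ : ℝ) / b * p.γ ^ 2 * L ^ 2 * (L / τ) ^ 2 := by positivity
        linarith
      have e3 : 24 * ((d₁ + d₂ : ℝ) / b) * p.γ ^ 2 * L ^ 2 ≤ τ ^ 2 := by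
        have : 0 < 3 * p.lam ^ 2 := by positivity
        nlinarith
      refine le_trans ?_ e3
      gcongr
      linarith
    unfold lyapunov nextX
    dsimp only
    generalize p.γ / (τ ^ 2 * p.eta (n + 1)) = A' at *
    generalize p.γ / (τ ^ 2 * p.eta n) = A at *
    have fa2 : p.γ * p.eta (n + 1) / 2 * errX P p.μ₁ s ≤ p.γ * p.eta (n + 1) * (9 / 4) * errX P p.μ₁ s := by
      refine mul_le_mul_of_nonneg_right ?_ ha
      linarith
    linarith

end Setup

end AccZOMDA

/-! ### From second moments to the averaged gradient norm. -/

namespace AccZOMDA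
open Set Metric Filter Topology
open scoped RealInnerProductSpace ENNReal

section SqrtBounds

variable {d : ℕ} {F : E d → ℝ} {K : ℝ}

/-- A gradient step of length `1/K` lowers `F` by at least `‖∇F‖²/(2K)`, and `F` cannot fall below
`a`. -/
theorem norm_gradient_sq_le (hK0 : 0 < K) (hF : Differentiable ℝ F)
    (hK : ∀ x z, ‖gradient F x - gradient F z‖ ≤ K * ‖x - z‖) {a : ℝ} (ha : ∀ z, a ≤ F z) (x : E d) :
    ‖gradient F x‖ ^ 2 ≤ 2 * K * (F x - a) := by
  have h1 := le_of_gradient_lipschitz hF hK x (gradient F x) (c := 1 / K) (by positivity)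
  have h2 := ha (x - (1 / K) • gradient F x)
  rw [real_inner_self_eq_norm_sq] at h1
  have h3 : K / 2 * (1 / K) ^ 2 * ‖gradient F x‖ ^ 2 = 1 / K * ‖gradient F x‖ ^ 2 / 2 := by
    field_simp
  have h4 : 1 / K * ‖gradient F x‖ ^ 2 / 2 ≤ F x - a := by linarith
  calc ‖gradient F x‖ ^ 2 = 2 * K * (1 / K * ‖gradient F x‖ ^ 2 / 2) := by field_simp
    _ ≤ _ := by gcongr

/-- By the preceding bound the gradient of `√(F - a)` has norm at most `√(K/2)`; the proof stays
with squares because the root may vanish. -/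
theorem sqrt_sub_le (hK0 : 0 < K) (hF : Differentiable ℝ F)
    (hK : ∀ x z, ‖gradient F x - gradient F z‖ ≤ K * ‖x - z‖) {a : ℝ} (ha : ∀ z, a ≤ F z) (x z : E d) :
    √(F z - a) ≤ √(F x - a) + √(K / 2) * ‖z - x‖ := by
  refine Real.sqrt_le_iff.2 ⟨by positivity, ?_⟩
  have h1 := le_of_gradient_lipschitz hF hK x (x - z) (c := 1) (by norm_num)
  rw [one_smul, sub_sub_cancel, one_mul, one_pow, mul_one, norm_sub_rev x z] at h1
  have h2 := norm_gradient_sq_le hK0 hF hK ha x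
  have h3 : ‖gradient F x‖ ≤ 2 * √(K / 2) * √(F x - a) := by
    refine abs_le_of_sq_le_sq' ?_ (by positivity) |>.2
    rw [mul_pow, mul_pow, Real.sq_sqrt (by positivity), Real.sq_sqrt (sub_nonneg.2 (ha x))]
    linarith
  have h4 : -⟪gradient F x, x - z⟫ ≤ ‖gradient F x‖ * ‖z - x‖ := by
    rw [norm_sub_rev z x]
    exact (neg_le_abs _).trans (abs_real_inner_le_norm _ _)
  have h5 := mul_le_mul_of_nonneg_right h3 (norm_nonneg (z - x))
  rw [add_sq, mul_pow, Real.sq_sqrt (sub_nonneg.2 (ha x)), Real.sq_sqrt (show 0 ≤ K / 2 by positivity)]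
  linarith

/-- The square of the root is bounded below by its tangent at `c`, namely `s² ≥ 2cs - c²`, which is
linear in `s` and can be averaged with the Lipschitz bound and the mean of `‖u‖`. The choice of `c`
makes the average equal `a + c²`. -/
theorem sqrt_sub_smoothing_le (hd : 1 ≤ d) {μ : ℝ} (hμ : 0 < μ) (hK0 : 0 < K) (hF : Differentiable ℝ F)
    (hK : ∀ x z, ‖gradient F x - gradient F z‖ ≤ K * ‖x - z‖) {a : ℝ} (ha : ∀ z, a ≤ F z) (x : E d) :
    √(F x - a) ≤ √(smoothing μ F x - a) + √(K / 2) * (μ * (d / (d + 1))) := by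
  set c := √(F x - a) - √(K / 2) * (μ * (d / (d + 1))) with hc
  suffices h : c ≤ √(smoothing μ F x - a) by linarith
  rcases le_or_gt c 0 with h0 | h0
  · exact h0.trans (Real.sqrt_nonneg _)
  refine Real.le_sqrt_of_sq_le ?_
  have hpt : ∀ u ∈ closedBall (0 : E d) 1,
      a + 2 * c * √(F x - a) - c ^ 2 - 2 * c * √(K / 2) * μ * ‖u‖ ≤ F (x + μ • u) := fun u _ => by
    have h1 := sqrt_sub_le hK0 hF hK ha (x + μ • u) x
    rw [sub_add_cancel_left, norm_neg, norm_smul, Real.norm_eq_abs, abs_of_pos hμ] at h1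
    have h2 := Real.sq_sqrt (sub_nonneg.2 (ha (x + μ • u)))
    have h3 := mul_le_mul_of_nonneg_left h1 h0.le
    nlinarith [sq_nonneg (√(F (x + μ • u) - a) - c)]
  have i1 : IntegrableOn (fun _ : E d => a + 2 * c * √(F x - a) - c ^ 2) (closedBall 0 1) :=
    integrableOn_const measure_closedBall_lt_top.ne
  have i2 : IntegrableOn (fun u : E d => 2 * c * √(K / 2) * μ * ‖u‖) (closedBall 0 1) :=
    (integrableOn_norm_ball d).const_mul _
  have h4 := average_ball_mono (i1.sub i2) (integrableOn_add_smul (μ := μ) hF.continuous x) hpt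
  have h5 : ⨍ u in closedBall (0 : E d) 1, (a + 2 * c * √(F x - a) - c ^ 2 - 2 * c * √(K / 2) * μ * ‖u‖)
      = a + 2 * c * √(F x - a) - c ^ 2 - 2 * c * √(K / 2) * μ * (d / (d + 1)) := by
    rw [average_ball_sub i1 i2, average_ball_const, ← average_norm_ball hd, setAverage_eq, setAverage_eq,
      integral_const_mul, smul_eq_mul, smul_eq_mul]
    ring
  have h6 : ⨍ u in closedBall (0 : E d) 1, F (x + μ • u) = smoothing μ F x := rfl
  have h7 : a + 2 * c * √(F x - a) - c ^ 2 - 2 * c * √(K / 2) * μ * (d / (d + 1)) = a + c ^ 2 := by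
    rw [show √(F x - a) = c + √(K / 2) * (μ * (d / (d + 1))) by rw [hc]; ring]
    ring
  change ⨍ u in closedBall (0 : E d) 1, (a + 2 * c * √(F x - a) - c ^ 2 - 2 * c * √(K / 2) * μ * ‖u‖) ≤ _ at h4
  rw [h5, h6, h7] at h4
  linarith

/-- Two bounds on the mean square `A` of the gradient, combined to an interpolated bound on `√A`. -/
theorem sqrt_le_of_two_bounds {A M Q c gap h₀ H Ls L κ μ : ℝ} (hQ : 0 < Q) (hc : 0 < c) (hgap : 0 ≤ gap)
    (hh₀ : 0 ≤ h₀) (hR : gap ≤ c * M) (hLs : 0 < Ls) (hL : 0 < L) (hκ : 1 ≤ κ)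
    (hLs2 : Ls ^ 2 = L ^ 2 * (1 + κ ^ 2)) (hμ : 0 ≤ μ) (hs : √h₀ ≤ √gap + √(Ls / 2) * μ)
    (hH : H ≤ h₀ + (c * M - gap) + c / Q * (L * μ) ^ 2) (h1 : A ≤ 2 * Ls * H) (h2 : A ≤ 2 * (Q / c) * H) :
    √A ≤ √(2 * M * Q) + L * (1 + κ) * μ := by
  have hM : 0 ≤ M := by
    have : 0 ≤ c * M := hgap.trans hR
    exact nonneg_of_mul_nonneg_right this hc
  -- Whichever bound on `A` is better holds with rate `K`. Afterwards `K c ≤ Q` controls the main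
  -- term and `K ≤ Ls` the smoothing term.
  set K := min Ls (Q / c) with hK
  have hK0 : 0 < K := lt_min hLs (by positivity)
  have hK1 : K ≤ Ls := min_le_left _ _
  have hK2 : K * c ≤ Q := (le_div_iff₀ hc).1 (min_le_right _ _)
  have h3 : A ≤ 2 * K * H := by
    rcases min_choice Ls (Q / c) with h | h <;> rw [hK, h] <;> assumption
  set e := √(Ls / 2) * μ with he
  have he0 : 0 ≤ e := by positivity
  have he2 : e ^ 2 = Ls / 2 * μ ^ 2 := by rw [he, mul_pow, Real.sq_sqrt (by positivity)]
  set z := √(c * M) with hz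
  have hz2 : z ^ 2 = c * M := Real.sq_sqrt (by positivity)
  have hz0 : 0 ≤ z := Real.sqrt_nonneg _
  have h4 : h₀ + (c * M - gap) ≤ (z + e) ^ 2 := by
    have k1 := pow_le_pow_left₀ (Real.sqrt_nonneg _) hs 2
    rw [Real.sq_sqrt hh₀, add_sq, Real.sq_sqrt hgap] at k1
    have k2 : √gap ≤ z := Real.sqrt_le_sqrt hR
    have k3 := mul_le_mul_of_nonneg_right k2 he0
    rw [add_sq, hz2]
    linarith
  set a := √(2 * M * Q) with ha
  have ha2 : a ^ 2 = 2 * M * Q := Real.sq_sqrt (by positivity)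
  have ha0 : 0 ≤ a := Real.sqrt_nonneg _
  -- The cross term uses both bounds on `K`, one for each factor of `K²`, so it fits the cross term
  -- of the square to be reached.
  have h5 : 2 * K * z * e ≤ a * (Ls * μ) := by
    refine abs_le_of_sq_le_sq' ?_ (by positivity) |>.2
    have k1 : (2 * K * z * e) ^ 2 = 2 * K * (K * c) * M * Ls * μ ^ 2 := by
      rw [mul_pow, he2, mul_pow, hz2]
      ring
    have k2 : (a * (Ls * μ)) ^ 2 = 2 * Ls * Q * M * Ls * μ ^ 2 := by
      rw [mul_pow, ha2]
      ring
    rw [k1, k2]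
    gcongr
  have h6 : A ≤ (a + L * (1 + κ) * μ) ^ 2 := by
    have k1 : 2 * K * H ≤ 2 * K * ((z + e) ^ 2 + c / Q * (L * μ) ^ 2) := by
      gcongr
      linarith
    have k2 : 2 * K * (c / Q * (L * μ) ^ 2) ≤ 2 * (L * μ) ^ 2 := by
      have : K * c / Q ≤ 1 := (div_le_one hQ).2 hK2
      calc _ = 2 * (K * c / Q) * (L * μ) ^ 2 := by ring
        _ ≤ 2 * 1 * (L * μ) ^ 2 := by gcongr
        _ = _ := by ring
    have k3 : 2 * K * z ^ 2 ≤ a ^ 2 := by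
      rw [hz2, ha2]
      linarith [mul_le_mul_of_nonneg_right hK2 hM]
    have k4 : 2 * K * e ^ 2 ≤ Ls ^ 2 * μ ^ 2 := by
      rw [he2]
      linarith [mul_le_mul_of_nonneg_right hK1 (show 0 ≤ Ls * μ ^ 2 by positivity)]
    have k5 : Ls ≤ L * (1 + κ) := by
      refine abs_le_of_sq_le_sq' ?_ (by positivity) |>.2
      rw [hLs2, mul_pow]
      have e1 : (1 + κ) ^ 2 = 1 + κ ^ 2 + 2 * κ := by ring
      gcongr
      rw [e1]
      linarith
    have k6 : a * (Ls * μ) ≤ a * (L * (1 + κ) * μ) := by gcongr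
    -- The extra bias of the potential `g` fits into the gap between `1 + κ²` and `(1 + κ)²`; this
    -- uses `κ ≥ 1`.
    have k7 : Ls ^ 2 * μ ^ 2 + 2 * (L * μ) ^ 2 ≤ (L * (1 + κ) * μ) ^ 2 := by
      have e1 : Ls ^ 2 * μ ^ 2 + 2 * (L * μ) ^ 2 = (L * μ) ^ 2 * (3 + κ ^ 2) := by rw [hLs2]; ring
      have e2 : (L * (1 + κ) * μ) ^ 2 = (L * μ) ^ 2 * (1 + 2 * κ + κ ^ 2) := by ring
      rw [e1, e2]
      gcongr
      linarith
    have e1 : 2 * K * ((z + e) ^ 2 + c / Q * (L * μ) ^ 2)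
        = 2 * K * z ^ 2 + 2 * (2 * K * z * e) + 2 * K * e ^ 2 + 2 * K * (c / Q * (L * μ) ^ 2) := by ring
    have e2 : (a + L * (1 + κ) * μ) ^ 2
        = a ^ 2 + 2 * (a * (L * (1 + κ) * μ)) + (L * (1 + κ) * μ) ^ 2 := by ring
    rw [e2]
    rw [e1] at k1
    linarith
  exact Real.sqrt_le_iff.2 ⟨by positivity, h6⟩

end SqrtBounds

section Moments

variable {Ω : Type v} [MeasurableSpace Ω] {Pr : Measure Ω}

theorem integral_sq_le [IsProbabilityMeasure Pr] {F : Ω → ℝ} (hF : MemLp F 2 Pr) : (∫ ω, F ω ∂Pr) ^ 2 ≤ ∫ ω, F ω ^ 2 ∂Pr := by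
  have h1 := variance_eq_sub hF
  have h2 := variance_nonneg F Pr
  rw [h1] at h2
  simpa using h2

/-- Jensen's inequality twice, over the probability space and over time. -/
theorem mean_integral_le_sqrt [IsProbabilityMeasure Pr] {T : ℕ} (hT : 1 ≤ T) {F : ℕ → Ω → ℝ} (hF : ∀ n < T, MemLp (F n) 2 Pr) {A : ℝ}
    (hA : ∑ n ∈ Finset.range T, ∫ ω, F n ω ^ 2 ∂Pr ≤ T * A) :
    1 / (T : ℝ) * ∑ n ∈ Finset.range T, ∫ ω, F n ω ∂Pr ≤ √A := by
  have hT0 : (0 : ℝ) < T := by exact_mod_cast hT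
  refine Real.le_sqrt_of_sq_le ?_
  have h1 := sq_sum_le_card_mul_sum_sq (s := Finset.range T) (f := fun n => ∫ ω, F n ω ∂Pr)
  rw [Finset.card_range] at h1
  have h2 : ∑ n ∈ Finset.range T, (∫ ω, F n ω ∂Pr) ^ 2 ≤ ∑ n ∈ Finset.range T, ∫ ω, F n ω ^ 2 ∂Pr :=
    Finset.sum_le_sum fun n hn => integral_sq_le (hF n (Finset.mem_range.1 hn))
  rw [mul_pow, div_pow, one_pow]
  calc 1 / (T : ℝ) ^ 2 * (∑ n ∈ Finset.range T, ∫ ω, F n ω ∂Pr) ^ 2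
      ≤ 1 / (T : ℝ) ^ 2 * (T * (T * A)) := by
        gcongr
        exact h1.trans (mul_le_mul_of_nonneg_left (h2.trans hA) hT0.le)
    _ = A := by field_simp

theorem memLp_two_of_lintegral {F : Ω → ℝ} (hF : AEStronglyMeasurable F Pr) {c H : ℝ} (hc : 0 < c)
    (h : ∫⁻ ω, ENNReal.ofReal (c * F ω ^ 2) ∂Pr ≤ ENNReal.ofReal H) : MemLp F 2 Pr := by
  refine Setup.memLp_of_lintegral_le (C := H / c) hF ?_
  have e1 : ∀ ω, ENNReal.ofReal (c * F ω ^ 2) = ENNReal.ofReal c * ‖F ω‖ₑ ^ 2 := fun ω => by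
    rw [ENNReal.ofReal_mul hc.le, ← sq_abs, ← Real.norm_eq_abs, ENNReal.ofReal_pow (norm_nonneg _), ofReal_norm]
  simp_rw [e1] at h
  rw [lintegral_const_mul' _ _ ENNReal.ofReal_ne_top] at h
  rw [ENNReal.ofReal_div_of_pos hc, ENNReal.le_div_iff_mul_le (by simp [hc]) (by simp), mul_comm]
  exact h

end Moments

namespace Setup

variable {d₁ d₂ b T : ℕ} {Ξ : Type u} [MeasurableSpace Ξ] {P : Problem d₁ d₂ Ξ} {L τ δ : ℝ} {p : Params}
  {U : Set (E d₂)} {pot φ : E d₁ → ℝ}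

theorem totalError_add (ε ε' : ℝ) : totalError p b T L τ δ (ε + ε')
    = totalError p b T L τ δ ε' + ε / p.k * ∑ n ∈ Finset.range T, p.eta (n + 1) := by
  unfold totalError
  ring

theorem totalError_nonneg (hA : p.Admissible d₁ d₂ b T L τ) {ε : ℝ} (hε : 0 ≤ ε) :
    0 ≤ totalError p b T L τ δ ε := by
  have hk := hA.k_pos
  have h0 := hA.eta_pos 0
  have hm := hA.m_ge_two
  have h1 : 0 ≤ Real.log (p.m + T) := Real.log_nonneg (by
    have : (0 : ℝ) ≤ T := T.cast_nonneg
    linarith)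
  have h2 : 0 ≤ ∑ n ∈ Finset.range T, p.eta (n + 1) := Finset.sum_nonneg fun n _ => (hA.eta_pos _).le
  unfold totalError
  positivity

/-- As `∑ η ≤ 3/2 T η_T` and `T ≤ m + T`, a constant bias `ε` accumulates to at most `3/2 ε
(m+T)^(2/3)`. The hypothesis says precisely that this fits into the third term of `M'`. -/
theorem totalError_le_M' (hA : p.Admissible d₁ d₂ b T L τ) {ε : ℝ} (hε : 0 ≤ ε)
    (h : 3 / 2 * ε * p.cbrt T ^ 4 ≤ (36 * τ ^ 2 * L ^ 2 + 625 * L ^ 4) / (8 * b * τ ^ 2)) (gap : ℝ) :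
    gap + p.γ * p.k * totalError p b T L τ δ ε ≤ p.γ * p.k * p.M' b T L τ δ gap := by
  have hk := hA.k_pos
  have hγ := hA.γ_pos
  have hr := Params.cbrt_pos hA.m_ge_two T
  have h1 : ε / p.k * ∑ n ∈ Finset.range T, p.eta (n + 1)
      ≤ (36 * τ ^ 2 * L ^ 2 + 625 * L ^ 4) / (8 * b * τ ^ 2) * (p.m + T) ^ (-(2 / 3) : ℝ) := by
    have e1 : (p.m + T) ^ (-(2 / 3) : ℝ) = 1 / p.cbrt T ^ 2 := by
      have := hA.m_ge_two
      rw [Real.rpow_neg (by positivity), Params.rpow_two_thirds hA.m_ge_two, one_div]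
    have h2 := hA.sum_eta_le T
    have h3 : (T : ℝ) ≤ p.cbrt T ^ 3 := by
      rw [Params.cbrt_pow_three hA.m_ge_two]
      have := hA.m_ge_two
      linarith
    rw [e1]
    calc ε / p.k * ∑ n ∈ Finset.range T, p.eta (n + 1) ≤ ε / p.k * (3 / 2 * (T * p.eta T)) := by gcongr
      _ = 3 / 2 * ε * T / p.cbrt T := by rw [Params.eta_eq]; field_simp
      _ ≤ 3 / 2 * ε * p.cbrt T ^ 3 / p.cbrt T := by gcongr
      _ = 3 / 2 * ε * p.cbrt T ^ 4 * (1 / p.cbrt T ^ 2) := by field_simp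
      _ ≤ _ := by gcongr
  have e2 : p.γ * p.k * (gap / (p.γ * p.k)) = gap := by field_simp
  have h4 := mul_le_mul_of_nonneg_left h1 (show 0 ≤ p.γ * p.k by positivity)
  unfold totalError Params.M'
  linarith

variable {Ω : Type v} [MeasurableSpace Ω] {Pr : Measure Ω} {Z : ℕ → Ω → Batch d₁ d₂ b Ξ}

/-- The iterates `x` of the retracted algorithm. -/
noncomputable def iter (P : Problem d₁ d₂ Ξ) (p : Params) (x : E d₁) (y : E d₂) (Z : ℕ → Ω → Batch d₁ d₂ b Ξ)
    (n : ℕ) (ω : Ω) : E d₁ := (run (retraction P p.μ₂) p x y (fun j => Z j ω) n).x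

theorem measurable_iter (h : Setup P L τ δ p.μ₁ p.μ₂ U) (hZ : IsSampling P Pr Z) (x : E d₁) (y : E d₂) (n : ℕ) :
    Measurable (iter P p x y Z n) :=
  State.measurable_x.comp (h.measurable_retract_run x y fun k _ => measurable_batch hZ k)

theorem gradNorm_ae_eq [IsProbabilityMeasure Pr] (h : Setup P L τ δ p.μ₁ p.μ₂ U) (hA : p.Admissible d₁ d₂ b T L τ)
    (hZ : IsSampling P Pr Z) (x : E d₁) {y : E d₂} (hy : y ∈ P.feasible) (n : ℕ) :
    gradNorm P p x y Z n =ᵐ[Pr] fun ω => ‖gradient P.g (iter P p x y Z n ω)‖ := by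
  filter_upwards [h.ae_sampling hZ] with ω hω
  rw [gradNorm, iter, h.retract_run_eq (fun t => (hA.eta_pos t).le) hA.eta_le_one x hy hω n]

/-- Second moments along the iterates. -/
theorem second_moments (h : Setup P L τ δ p.μ₁ p.μ₂ U) (hA : p.Admissible d₁ d₂ b T L τ)
    (hZ : IsSampling P Pr Z) {x : E d₁} {y : E d₂} (hφ : Measurable φ) {H : ℝ} (hH : 0 ≤ H)
    (hsum : ∑ n ∈ Finset.range T, ∫⁻ ω, ENNReal.ofReal (p.γ * p.eta (n + 1) / 2 *
        φ (iter P p x y Z n ω) ^ 2) ∂Pr ≤ ENNReal.ofReal H) :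
    (∀ n < T, MemLp (fun ω => φ (iter P p x y Z n ω)) 2 Pr) ∧
      ∑ n ∈ Finset.range T, ∫ ω, φ (iter P p x y Z n ω) ^ 2 ∂Pr ≤ 2 * p.cbrt T / (p.γ * p.k) * H := by
  have hγ := hA.γ_pos
  have hk := hA.k_pos
  have he := hA.eta_pos
  have hm : ∀ n < T, MemLp (fun ω => φ (iter P p x y Z n ω)) 2 Pr := fun n hn => by
    have hn0 := he (n + 1)
    refine memLp_two_of_lintegral (c := p.γ * p.eta (n + 1) / 2) (H := H)
      (hφ.comp (h.measurable_iter hZ x y n)).aestronglyMeasurable (by positivity) (le_trans ?_ hsum)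
    exact Finset.single_le_sum (f := fun n => ∫⁻ ω, ENNReal.ofReal (p.γ * p.eta (n + 1) / 2 *
        φ (iter P p x y Z n ω) ^ 2) ∂Pr) (fun _ _ => zero_le) (Finset.mem_range.2 hn)
  refine ⟨hm, ?_⟩
  have h1 : ∑ n ∈ Finset.range T, ENNReal.ofReal (p.γ * p.eta T / 2 * ∫ ω, φ (iter P p x y Z n ω) ^ 2 ∂Pr)
      ≤ ENNReal.ofReal H := by
    refine le_trans (Finset.sum_le_sum fun n hn => ?_) hsum
    have hn' := Finset.mem_range.1 hn
    have hn0 := he (n + 1)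
    rw [← integral_const_mul, ofReal_integral_eq_lintegral_ofReal ((hm n hn').integrable_sq.const_mul _)
      (Eventually.of_forall fun ω => by have := he T; positivity)]
    refine lintegral_mono fun ω => ENNReal.ofReal_le_ofReal ?_
    have := hA.eta_anti (show n + 1 ≤ T from hn')
    gcongr
  rw [← ENNReal.ofReal_sum_of_nonneg (fun n _ => by
      have := he T
      have : 0 ≤ ∫ ω, φ (iter P p x y Z n ω) ^ 2 ∂Pr := integral_nonneg fun _ => sq_nonneg _
      positivity), ENNReal.ofReal_le_ofReal_iff hH, ← Finset.mul_sum] at h1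
  have hr := Params.cbrt_pos hA.m_ge_two T
  calc _ = 2 * p.cbrt T / (p.γ * p.k) * (p.γ * p.eta T / 2 *
        ∑ n ∈ Finset.range T, ∫ ω, φ (iter P p x y Z n ω) ^ 2 ∂Pr) := by
        rw [Params.eta_eq]; field_simp
    _ ≤ _ := by gcongr

variable [IsProbabilityMeasure Pr]

/-- Subadditivity of the power `1/6` splits `(m + T)^(1/6)`, which produces the two terms of the
rate. -/
theorem sqrt_rate_le (hA : p.Admissible d₁ d₂ b T L τ) (hT : 1 ≤ T) {M : ℝ} (hM : 0 ≤ M) :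
    √(2 * M * (p.cbrt T / T)) ≤ √(2 * M) * p.m ^ (1 / 6 : ℝ) / (T : ℝ) ^ (1 / 2 : ℝ)
      + √(2 * M) / (T : ℝ) ^ (1 / 3 : ℝ) := by
  have hm := hA.m_ge_two
  have hT0 : (0 : ℝ) < T := by exact_mod_cast hT
  have h1 : √(p.cbrt T) ≤ p.m ^ (1 / 6 : ℝ) + (T : ℝ) ^ (1 / 6 : ℝ) := by
    rw [Params.cbrt, Real.sqrt_eq_rpow, ← Real.rpow_mul (by positivity)]
    norm_num
    exact Real.rpow_add_le_add_rpow (by positivity) hT0.le (by norm_num) (by norm_num)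
  have h2 : (T : ℝ) ^ (1 / 2 : ℝ) = (T : ℝ) ^ (1 / 6 : ℝ) * (T : ℝ) ^ (1 / 3 : ℝ) := by
    rw [← Real.rpow_add hT0]
    norm_num
  have h3 : 0 < (T : ℝ) ^ (1 / 6 : ℝ) := by positivity
  have h4 : 0 < (T : ℝ) ^ (1 / 3 : ℝ) := by positivity
  rw [Real.sqrt_mul (by positivity), Real.sqrt_div' _ hT0.le, Real.sqrt_eq_rpow (T : ℝ)]
  calc √(2 * M) * (√(p.cbrt T) / (T : ℝ) ^ (1 / 2 : ℝ))
      ≤ √(2 * M) * ((p.m ^ (1 / 6 : ℝ) + (T : ℝ) ^ (1 / 6 : ℝ)) / (T : ℝ) ^ (1 / 2 : ℝ)) := by gcongr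
    _ = _ := by rw [h2]; field_simp

theorem avgGradNorm_eq (h : Setup P L τ δ p.μ₁ p.μ₂ U) (hA : p.Admissible d₁ d₂ b T L τ)
    (hZ : IsSampling P Pr Z) (x : E d₁) {y : E d₂} (hy : y ∈ P.feasible) :
    avgGradNorm P p Pr x y Z T
      = 1 / (T : ℝ) * ∑ n ∈ Finset.range T, ∫ ω, ‖gradient P.g (iter P p x y Z n ω)‖ ∂Pr := by
  unfold avgGradNorm
  congr 1
  exact Finset.sum_congr rfl fun n _ => integral_congr_ae (h.gradNorm_ae_eq hA hZ x hy n)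

/-- The convergence bound via a surrogate `φ` of the norm of the gradient. -/
theorem avgGradNorm_le_of_surrogate (h : Setup P L τ δ p.μ₁ p.μ₂ U) (hA : p.Admissible d₁ d₂ b T L τ)
    (hT : 1 ≤ T) (hZ : IsSampling P Pr Z) (x : E d₁) {y : E d₂} (hy : y ∈ P.feasible)
    (hmax : IsMaxOn (P.f x) P.feasible y) (hpot : ∀ x, 0 ≤ pot x) (hpm : Measurable pot) (hφ : Measurable φ)
    {W w ε β : ℝ} (hW : 0 ≤ W)
    (hw0 : 0 ≤ w) (hw1 : w ≤ 1) (hε : 0 ≤ ε) (hβ : β = 3 / 2 * L ^ 2 / p.cbrt T ^ 4)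
    (hstep : ∀ n, ∀ s : State d₁ d₂, s.y ∈ P.feasible → StepDecrease P p b τ pot φ W w ε β n s)
    {M : ℝ} (hM : pot x + p.γ * p.k * totalError p b T L τ δ ε ≤ p.γ * p.k * M)
    (hgφ : ∀ z, ‖gradient P.g z‖ ≤ φ z + L * (1 / (2 * p.cbrt T ^ 2))) :
    (∀ n < T, Integrable (gradNorm P p x y Z n) Pr) ∧ avgGradNorm P p Pr x y Z T ≤ √(2 * M) * p.m ^ (1 / 6 : ℝ) / (T : ℝ) ^ (1 / 2 : ℝ)
      + √(2 * M) / (T : ℝ) ^ (1 / 3 : ℝ) + L / (2 * (p.m + T) ^ (2 / 3 : ℝ)) := by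
  have hγ := hA.γ_pos
  have hk := hA.k_pos
  have hr := Params.cbrt_pos hA.m_ge_two T
  have hT0 : (0 : ℝ) < T := by exact_mod_cast hT
  have hte := totalError_nonneg (δ := δ) hA hε
  have hH0 : 0 ≤ pot x + p.γ * p.k * totalError p b T L τ δ ε := by
    have := hpot x
    positivity
  have hM0 : 0 ≤ M := nonneg_of_mul_nonneg_right (hH0.trans hM) (by positivity)
  have hsum := h.lintegral_sum_le hA hZ x hy hmax hpot hpm hφ hW hw0 hw1 hε hβ hstep le_rfl
  obtain ⟨hL2, hle⟩ := h.second_moments hA hZ hφ hH0 (le_trans le_add_self hsum)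
  have hmean := mean_integral_le_sqrt hT hL2 (A := 2 * M * (p.cbrt T / T)) (by
    refine hle.trans ?_
    calc _ ≤ 2 * p.cbrt T / (p.γ * p.k) * (p.γ * p.k * M) := by gcongr
      _ = _ := by field_simp)
  have hrate := sqrt_rate_le hA hT hM0
  refine ⟨fun n hn => ?_, ?_⟩
  · refine Integrable.congr ?_ (h.gradNorm_ae_eq hA hZ x hy n).symm
    have hcg := (continuous_gradient_of_lipschitz h.gradient_g_lip).norm.measurable
    refine (((hL2 n hn).integrable one_le_two).add
      (integrable_const (L * (1 / (2 * p.cbrt T ^ 2))))).mono'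
      (hcg.comp (h.measurable_iter hZ x y n)).aestronglyMeasurable (Eventually.of_forall fun ω => ?_)
    rw [norm_norm]
    exact hgφ _
  rw [h.avgGradNorm_eq hA hZ x hy, Params.rpow_two_thirds hA.m_ge_two]
  have hb : ∀ n ∈ Finset.range T, ∫ ω, ‖gradient P.g (iter P p x y Z n ω)‖ ∂Pr
      ≤ ∫ ω, φ (iter P p x y Z n ω) ∂Pr + L * (1 / (2 * p.cbrt T ^ 2)) := fun n hn => by
    have hi := (hL2 n (Finset.mem_range.1 hn)).integrable one_le_two
    have e1 : ∫ ω, φ (iter P p x y Z n ω) ∂Pr + L * (1 / (2 * p.cbrt T ^ 2))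
        = ∫ ω, (φ (iter P p x y Z n ω) + L * (1 / (2 * p.cbrt T ^ 2))) ∂Pr := by
      rw [integral_add hi (integrable_const _)]; simp
    rw [e1]
    exact integral_mono_of_nonneg (Eventually.of_forall fun _ => norm_nonneg _) (hi.add (integrable_const _))
      (Eventually.of_forall fun ω => hgφ _)
  have h1 := Finset.sum_le_sum hb
  rw [Finset.sum_add_distrib, Finset.sum_const, Finset.card_range, nsmul_eq_mul] at h1
  have h2 := mul_le_mul_of_nonneg_left h1 (show 0 ≤ 1 / (T : ℝ) by positivity)
  have e2 : 1 / (T : ℝ) * (∑ n ∈ Finset.range T, ∫ ω, φ (iter P p x y Z n ω) ∂Pr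
      + T * (L * (1 / (2 * p.cbrt T ^ 2))))
      = 1 / (T : ℝ) * ∑ n ∈ Finset.range T, ∫ ω, φ (iter P p x y Z n ω) ∂Pr + L / (2 * p.cbrt T ^ 2) := by
    field_simp
  rw [e2] at h2
  linarith

/-- The bounds obtained from the descent of `g` itself. -/
theorem gradient_moments (h : Setup P L τ δ p.μ₁ p.μ₂ U) (hA : p.Admissible d₁ d₂ b T L τ) (hτL : τ ≤ L)
    (hZ : IsSampling P Pr Z) (x : E d₁) {y : E d₂} (hy : y ∈ P.feasible)
    (hmax : IsMaxOn (P.f x) P.feasible y) {ε H : ℝ}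
    (hε : ε = 2 / 3 * (L * (1 / (2 * p.cbrt T ^ 2))) ^ 2 + 65 / 4 * L ^ 4 / (b * τ ^ 2 * p.cbrt T ^ 4))
    (hH : H = P.g x - P.gStar + p.γ * p.k * totalError p b T L τ δ ε) :
    (∀ n < T, MemLp (fun ω => ‖gradient P.g (iter P p x y Z n ω)‖) 2 Pr) ∧
      ∑ n ∈ Finset.range T, ∫ ω, ‖gradient P.g (iter P p x y Z n ω)‖ ^ 2 ∂Pr
        ≤ 2 * p.cbrt T / (p.γ * p.k) * H ∧
      ∑ n ∈ Finset.range T, ∫ ω, ‖gradient P.g (iter P p x y Z n ω)‖ ^ 2 ∂Pr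
        ≤ T * (2 * (L * √(1 + (L / τ) ^ 2)) * H) := by
  have hγ := hA.γ_pos
  have hk := hA.k_pos
  have hL := h.L_pos
  have hτ := h.τ_pos
  have hlam := hA.lam_pos
  have hr := Params.cbrt_pos hA.m_ge_two T
  have hε0 : 0 ≤ ε := by rw [hε]; positivity
  have hte := totalError_nonneg (δ := δ) hA hε0
  have hpot : ∀ z, 0 ≤ P.g z - P.gStar := fun z => sub_nonneg.2 (h.gStar_le z)
  have hH0 : 0 ≤ H := by
    have := hpot x
    rw [hH]
    positivity
  have hcg := (continuous_gradient_of_lipschitz h.gradient_g_lip).norm.measurable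
  have hpm : Measurable fun z => P.g z - P.gStar := h.differentiable_g.continuous.measurable.sub_const _
  have hsum : ∀ N ≤ T, _ := fun N hN => h.lintegral_sum_le hA hZ x hy hmax hpot hpm hcg
    (W := 45 * ((d₁ + d₂ : ℝ) / b) * p.γ * L ^ 2 / (p.lam * τ)) (w := 1) (by positivity) zero_le_one le_rfl hε0
    rfl (fun n s hs => hε ▸ h.stepDecrease_of_descent hA hτL hs (h.descent_g hA (n + 1) hs)) (N := N) hN
  have hs1 := hsum T le_rfl
  rw [← hH] at hs1
  obtain ⟨hL2, hle⟩ := h.second_moments hA hZ hcg hH0 (le_trans le_add_self hs1)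
  refine ⟨hL2, hle, ?_⟩
  have hLs : 0 < L * √(1 + (L / τ) ^ 2) := by positivity
  -- The second bound: telescoping up to time `n` bounds the expected potential there, and
  -- smoothness bounds the squared gradient by the potential.
  have hb : ∀ n ∈ Finset.range T, ∫ ω, ‖gradient P.g (iter P p x y Z n ω)‖ ^ 2 ∂Pr
      ≤ 2 * (L * √(1 + (L / τ) ^ 2)) * H := fun n hn => by
    have hn' := Finset.mem_range.1 hn
    have h1 := le_trans le_self_add (hsum n hn'.le)
    rw [← hH] at h1
    have h2 : ENNReal.ofReal (∫ ω, ‖gradient P.g (iter P p x y Z n ω)‖ ^ 2 ∂Pr)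
        ≤ ENNReal.ofReal (2 * (L * √(1 + (L / τ) ^ 2)) * H) := by
      rw [ofReal_integral_eq_lintegral_ofReal (hL2 n hn').integrable_sq
        (Eventually.of_forall fun _ => sq_nonneg _), ENNReal.ofReal_mul (by positivity)]
      refine le_trans ?_ (mul_le_mul_right h1 _)
      rw [← lintegral_const_mul' _ _ ENNReal.ofReal_ne_top]
      refine lintegral_mono fun ω => ?_
      rw [← ENNReal.ofReal_mul (by positivity)]
      exact ENNReal.ofReal_le_ofReal (norm_gradient_sq_le hLs h.differentiable_g h.gradient_g_lip h.gStar_le _)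
    exact (ENNReal.ofReal_le_ofReal_iff (by positivity)).1 h2
  refine (Finset.sum_le_sum hb).trans (le_of_eq ?_)
  rw [Finset.sum_const, Finset.card_range, nsmul_eq_mul]

end Setup

end AccZOMDA

/-! ### The convergence bound in its three regimes. -/

namespace AccZOMDA
open Set Metric Filter Topology
open scoped RealInnerProductSpace ENNReal

namespace Setup

variable {d₁ d₂ b T : ℕ} {Ξ : Type u} [MeasurableSpace Ξ] {P : Problem d₁ d₂ Ξ} {L τ δ : ℝ} {p : Params}
  {U : Set (E d₂)} {Ω : Type v} [MeasurableSpace Ω] {Pr : Measure Ω} [IsProbabilityMeasure Pr]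
  {Z : ℕ → Ω → Batch d₁ d₂ b Ξ}

theorem measurable_norm_meanX_argmax {μ₁ μ₂ : ℝ} (h : Setup P L τ δ μ₁ μ₂ U) :
    Measurable fun x => ‖P.meanX μ₁ x (argmaxOn P.f P.feasible x)‖ := by
  have hm := (h.measurable_meanX_proj.comp
    (f := fun x : E d₁ => (x, argmaxOn P.f P.feasible x))
    (measurable_id.prodMk h.continuous_argmax.measurable)).norm
  convert hm using 2 with x
  simp only [Function.comp]
  rw [proj_of_mem h.assum.isClosed h.assum.convex (h.smoothMax.argmax_mem x)]

theorem norm_gradient_g_le (h : Setup P L τ δ p.μ₁ p.μ₂ U) (hA : p.Admissible d₁ d₂ b T L τ) (z : E d₁) :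
    ‖gradient P.g z‖ ≤ ‖P.meanX p.μ₁ z (argmaxOn P.f P.feasible z)‖ + L * (1 / (2 * p.cbrt T ^ 2)) := by
  have h1 := h.norm_gradient_g_sub_meanX_le z
  have h2 := bias_x_le hA h.L_pos.le h.one_le_d₁
  have h3 := norm_le_norm_add_norm_sub (P.meanX p.μ₁ z (argmaxOn P.f P.feasible z)) (gradient P.g z)
  rw [norm_sub_rev] at h3
  linarith

theorem measurable_smoothing_gap (h : Setup P L τ δ p.μ₁ p.μ₂ U) :
    Measurable fun z => smoothing p.μ₁ P.g z - P.gStar :=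
  (differentiable_smoothing h.μ₁_pos h.differentiable_g h.gradient_g_lip).continuous.measurable.sub_const _

/-- The surrogate bound when the strong concavity exceeds the smoothness. -/
theorem convergence_of_lt (h : Setup P L τ δ p.μ₁ p.μ₂ U) (hA : p.Admissible d₁ d₂ b T L τ) (hLτ : L < τ)
    (hT : 1 ≤ T) (hZ : IsSampling P Pr Z) (x : E d₁) {y : E d₂} (hy : y ∈ P.feasible)
    (hmax : IsMaxOn (P.f x) P.feasible y) :
    (∀ n < T, Integrable (gradNorm P p x y Z n) Pr) ∧ avgGradNorm P p Pr x y Z T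
      ≤ √(2 * p.M' b T L τ δ (smoothing p.μ₁ P.g x - P.gStar)) * p.m ^ (1 / 6 : ℝ) / (T : ℝ) ^ (1 / 2 : ℝ)
        + √(2 * p.M' b T L τ δ (smoothing p.μ₁ P.g x - P.gStar)) / (T : ℝ) ^ (1 / 3 : ℝ)
        + L / (2 * (p.m + T) ^ (2 / 3 : ℝ)) := by
  have hL := h.L_pos
  refine h.avgGradNorm_le_of_surrogate hA hT hZ x hy hmax
    (pot := fun z => smoothing p.μ₁ P.g z - P.gStar)
    (fun z => sub_nonneg.2 (h.gStar_le_smoothing p.μ₁ z)) h.measurable_smoothing_gap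
    h.measurable_norm_meanX_argmax le_rfl le_rfl zero_le_one le_rfl rfl
    (fun n s hs => h.stepDecrease_of_lt hA hLτ n hs)
    (totalError_le_M' hA le_rfl (by rw [mul_zero, zero_mul]; positivity) _) (h.norm_gradient_g_le hA)

/-- The surrogate bound for batches that are small relative to the dimension. -/
theorem convergence_of_batch_le (h : Setup P L τ δ p.μ₁ p.μ₂ U) (hA : p.Admissible d₁ d₂ b T L τ)
    (hτL : τ ≤ L) (hb : b ≤ 100 * d₁)
    (hT : 1 ≤ T) (hZ : IsSampling P Pr Z) (x : E d₁) {y : E d₂} (hy : y ∈ P.feasible)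
    (hmax : IsMaxOn (P.f x) P.feasible y) :
    (∀ n < T, Integrable (gradNorm P p x y Z n) Pr) ∧ avgGradNorm P p Pr x y Z T
      ≤ √(2 * p.M' b T L τ δ (smoothing p.μ₁ P.g x - P.gStar)) * p.m ^ (1 / 6 : ℝ) / (T : ℝ) ^ (1 / 2 : ℝ)
        + √(2 * p.M' b T L τ δ (smoothing p.μ₁ P.g x - P.gStar)) / (T : ℝ) ^ (1 / 3 : ℝ)
        + L / (2 * (p.m + T) ^ (2 / 3 : ℝ)) := by
  have hL := h.L_pos
  have hτ := h.τ_pos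
  have hγ := hA.γ_pos
  have hlam := hA.lam_pos
  have hr := Params.cbrt_pos hA.m_ge_two T
  have hb0 : (1 : ℝ) ≤ b := by exact_mod_cast hA.one_le_b
  have hb1 : (b : ℝ) ≤ 100 * d₁ := by exact_mod_cast hb
  refine h.avgGradNorm_le_of_surrogate hA hT hZ x hy hmax
    (pot := fun z => smoothing p.μ₁ P.g z - P.gStar)
    (fun z => sub_nonneg.2 (h.gStar_le_smoothing p.μ₁ z)) h.measurable_smoothing_gap
    h.measurable_norm_meanX_argmax
    (W := 45 * ((d₁ + d₂ : ℝ) / b) * p.γ * L ^ 2 / (p.lam * τ)) (w := 1) (by positivity) zero_le_one le_rfl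
    (ε := 25 / 24 * (L ^ 2 / τ * (1 / ((d₁ + 1) * p.cbrt T ^ 2))) ^ 2
      + 65 / 4 * L ^ 4 / (b * τ ^ 2 * p.cbrt T ^ 4)) (by positivity) rfl
    (fun n s hs => h.stepDecrease_of_descent hA hτL hs (h.descent_smoothing hA hτL (n + 1) hs))
    (totalError_le_M' hA (by positivity) ?_ _) (h.norm_gradient_g_le hA)
  have e1 : 3 / 2 * (25 / 24 * (L ^ 2 / τ * (1 / ((d₁ + 1) * p.cbrt T ^ 2))) ^ 2
      + 65 / 4 * L ^ 4 / (b * τ ^ 2 * p.cbrt T ^ 4)) * p.cbrt T ^ 4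
      = L ^ 4 / τ ^ 2 * (25 / 16 * (1 / (d₁ + 1 : ℝ) ^ 2) + 195 / 8 * (1 / b)) := by
    field_simp
    ring
  have e2 : (36 * τ ^ 2 * L ^ 2 + 625 * L ^ 4) / (8 * b * τ ^ 2)
      = L ^ 4 / τ ^ 2 * (625 / 8 * (1 / b)) + 36 * L ^ 2 / (8 * b) := by
    field_simp
    ring
  -- `b ≤ 100 d₁ ≤ 25(d₁ + 1)²`, the last step because `(d₁ - 1)² ≥ 0`.
  have h2 : 1 / (d₁ + 1 : ℝ) ^ 2 ≤ 25 * (1 / b) := by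
    rw [mul_one_div, div_le_div_iff₀ (by positivity) (by positivity)]
    nlinarith [sq_nonneg ((d₁ : ℝ) - 1)]
  -- `25/16 · 25 + 195/8 = 1015/16`, below `625/8 = 1250/16`.
  have h3 : 25 / 16 * (1 / (d₁ + 1 : ℝ) ^ 2) + 195 / 8 * (1 / b) ≤ 625 / 8 * (1 / b) := by
    have : 0 < 1 / (b : ℝ) := by positivity
    linarith
  rw [e1, e2]
  have h4 := mul_le_mul_of_nonneg_left h3 (show 0 ≤ L ^ 4 / τ ^ 2 by positivity)
  have h5 : 0 ≤ 36 * L ^ 2 / (8 * b) := by positivity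
  linarith

/-- For large batches the bias of the smoothed potential is not known to be of order `1/b`, so `g`
itself serves as the potential. The initial values are compared through their square roots, and the
excess over `M'` ends up in the last term, whose constant grows to `L_g`. -/
theorem convergence_of_le (h : Setup P L τ δ p.μ₁ p.μ₂ U) (hA : p.Admissible d₁ d₂ b T L τ)
    (hτL : τ ≤ L) (hT : 1 ≤ T) (hZ : IsSampling P Pr Z) (x : E d₁) {y : E d₂} (hy : y ∈ P.feasible)
    (hmax : IsMaxOn (P.f x) P.feasible y) :
    (∀ n < T, Integrable (gradNorm P p x y Z n) Pr) ∧ avgGradNorm P p Pr x y Z T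
      ≤ √(2 * p.M' b T L τ δ (smoothing p.μ₁ P.g x - P.gStar)) * p.m ^ (1 / 6 : ℝ) / (T : ℝ) ^ (1 / 2 : ℝ)
        + √(2 * p.M' b T L τ δ (smoothing p.μ₁ P.g x - P.gStar)) / (T : ℝ) ^ (1 / 3 : ℝ)
        + (L + L ^ 2 / τ) / (2 * (p.m + T) ^ (2 / 3 : ℝ)) := by
  have hL := h.L_pos
  have hτ := h.τ_pos
  have hγ := hA.γ_pos
  have hk := hA.k_pos
  have hr := Params.cbrt_pos hA.m_ge_two T
  have hT0 : (0 : ℝ) < T := by exact_mod_cast hT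
  have hb0 : (1 : ℝ) ≤ b := by exact_mod_cast hA.one_le_b
  obtain ⟨hm, hs1, hs2⟩ := h.gradient_moments hA hτL hZ x hy hmax rfl rfl
  refine ⟨fun n hn => ((hm n hn).integrable one_le_two).congr (h.gradNorm_ae_eq hA hZ x hy n).symm, ?_⟩
  set gap := smoothing p.μ₁ P.g x - P.gStar with hgap
  set ε₁ := 2 / 3 * (L * (1 / (2 * p.cbrt T ^ 2))) ^ 2 with hε₁
  set ε₂ := 65 / 4 * L ^ 4 / (b * τ ^ 2 * p.cbrt T ^ 4) with hε₂
  set H := P.g x - P.gStar + p.γ * p.k * totalError p b T L τ δ (ε₁ + ε₂) with hH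
  set M := p.M' b T L τ δ gap with hM
  have hgap0 : 0 ≤ gap := sub_nonneg.2 (h.gStar_le_smoothing p.μ₁ x)
  have hε₂0 : 0 ≤ ε₂ := by positivity
  have hgM : gap + p.γ * p.k * totalError p b T L τ δ ε₂ ≤ p.γ * p.k * M := by
    refine totalError_le_M' hA hε₂0 ?_ gap
    have e1 : 3 / 2 * ε₂ * p.cbrt T ^ 4 = 195 / 8 * L ^ 4 / (b * τ ^ 2) := by
      rw [hε₂]
      field_simp
      ring
    have e2 : (36 * τ ^ 2 * L ^ 2 + 625 * L ^ 4) / (8 * b * τ ^ 2)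
        = 625 / 8 * L ^ 4 / (b * τ ^ 2) + 36 * L ^ 2 / (8 * b) := by
      field_simp
      ring
    have h1 : 0 ≤ L ^ 4 / (b * τ ^ 2) := by positivity
    have h2 : 0 ≤ 36 * L ^ 2 / (8 * b) := by positivity
    rw [e1, e2, mul_div_assoc, mul_div_assoc]
    linarith
  have hte := totalError_nonneg (δ := δ) hA hε₂0
  have hR : gap ≤ p.γ * p.k * M := by
    have : 0 ≤ p.γ * p.k * totalError p b T L τ δ ε₂ := by positivity
    linarith
  -- The bias `ε₁` of `g` is kept outside `M'`, in the form that the interpolation of the two bounds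
  -- expects.
  have hHle : H ≤ P.g x - P.gStar + (p.γ * p.k * M - gap)
      + p.γ * p.k / (p.cbrt T / T) * (L * (1 / (2 * p.cbrt T ^ 2))) ^ 2 := by
    have h1 : p.γ * p.k * (ε₁ / p.k * ∑ n ∈ Finset.range T, p.eta (n + 1))
        ≤ p.γ * p.k / (p.cbrt T / T) * (L * (1 / (2 * p.cbrt T ^ 2))) ^ 2 := by
      calc _ ≤ p.γ * p.k * (ε₁ / p.k * (3 / 2 * (T * p.eta T))) := by
            gcongr
            exact hA.sum_eta_le T
        _ = _ := by
            rw [Params.eta_eq, hε₁]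
            field_simp
    rw [hH, totalError_add, mul_add]
    linarith
  have hLs : 0 < L * √(1 + (L / τ) ^ 2) := by positivity
  have hsq : √(P.g x - P.gStar) ≤ √gap + √(L * √(1 + (L / τ) ^ 2) / 2) * (1 / (2 * p.cbrt T ^ 2)) := by
    refine (sqrt_sub_smoothing_le h.one_le_d₁ h.μ₁_pos hLs h.differentiable_g h.gradient_g_lip h.gStar_le x).trans ?_
    gcongr
    refine (hA.mu₁_ball_le h.one_le_d₁).trans ?_
    have hd : (1 : ℝ) ≤ d₁ := by exact_mod_cast h.one_le_d₁
    gcongr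
    linarith
  set A := 1 / (T : ℝ) * ∑ n ∈ Finset.range T, ∫ ω, ‖gradient P.g (iter P p x y Z n ω)‖ ^ 2 ∂Pr with hAdef
  have hmain := sqrt_le_of_two_bounds (A := A) (M := M) (Q := p.cbrt T / T) (c := p.γ * p.k) (L := L)
    (κ := L / τ) (by positivity) (by positivity) hgap0 (sub_nonneg.2 (h.gStar_le x)) hR hLs hL
    ((one_le_div hτ).2 hτL)
    (by rw [mul_pow, Real.sq_sqrt (by positivity)]) (show 0 ≤ 1 / (2 * p.cbrt T ^ 2) by positivity) hsq hHle
    (by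
      rw [hAdef]
      calc _ ≤ 1 / (T : ℝ) * (T * (2 * (L * √(1 + (L / τ) ^ 2)) * H)) := by gcongr
        _ = _ := by field_simp)
    (by
      rw [hAdef]
      calc _ ≤ 1 / (T : ℝ) * (2 * p.cbrt T / (p.γ * p.k) * H) := by gcongr
        _ = _ := by field_simp)
  have hmean := mean_integral_le_sqrt hT hm (A := A) (by
    rw [hAdef]
    refine le_of_eq ?_
    field_simp)
  have hM0 : 0 ≤ M := nonneg_of_mul_nonneg_right (hgap0.trans hR) (by positivity)
  have hrate := sqrt_rate_le hA hT hM0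
  rw [h.avgGradNorm_eq hA hZ x hy, Params.rpow_two_thirds hA.m_ge_two]
  have e3 : L * (1 + L / τ) * (1 / (2 * p.cbrt T ^ 2)) = (L + L ^ 2 / τ) / (2 * p.cbrt T ^ 2) := by
    field_simp
  rw [e3] at hmain
  linarith

end Setup

theorem Problem.Assumptions.exists_setup {d₁ d₂ : ℕ} (hd₁ : 1 ≤ d₁) (hd₂ : 1 ≤ d₂) {L τ δ μ₁ μ₂ : ℝ}
    (hL : 0 < L) (hτ : 0 < τ) (hμ₁ : 0 < μ₁) (hμ₂ : 0 < μ₂) {Ξ : Type u} [MeasurableSpace Ξ]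
    {P : Problem d₁ d₂ Ξ} (hP : P.Assumptions L τ δ μ₁ μ₂) (hne : P.feasible.Nonempty) :
    ∃ U, Setup P L τ δ μ₁ μ₂ U := by
  obtain ⟨U, hU, hsub, hsm⟩ := hP.smooth
  exact ⟨U, hd₁, hd₂, hL, hτ, hμ₁, hμ₂, hP, hU, hsub, hsm, hne⟩

/-- The convergence bound. -/
theorem convergence {d₁ d₂ b T : ℕ} (hd₁ : 1 ≤ d₁) (hd₂ : 1 ≤ d₂) (hT : 1 ≤ T)
    {L τ δ : ℝ} (hL : 0 < L) (hτ : 0 < τ) {p : Params} (hA : p.Admissible d₁ d₂ b T L τ)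
    {Ξ : Type u} [MeasurableSpace Ξ] {P : Problem d₁ d₂ Ξ} (hP : P.Assumptions L τ δ p.μ₁ p.μ₂)
    {x₁ : E d₁} {y₁ : E d₂} (hy : y₁ ∈ P.feasible) (hmax : IsMaxOn (P.f x₁) P.feasible y₁)
    {Ω : Type v} [MeasurableSpace Ω] {Pr : Measure Ω} [IsProbabilityMeasure Pr]
    {Z : ℕ → Ω → Batch d₁ d₂ b Ξ} (hZ : IsSampling P Pr Z) :
    Differentiable ℝ P.g ∧
    (∀ n < T, Integrable (gradNorm P p x₁ y₁ Z n) Pr) ∧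
    avgGradNorm P p Pr x₁ y₁ Z T ≤
      √(2 * p.M' b T L τ δ (smoothing p.μ₁ P.g x₁ - P.gStar)) * p.m ^ (1 / 6 : ℝ) / (T : ℝ) ^ (1 / 2 : ℝ)
        + √(2 * p.M' b T L τ δ (smoothing p.μ₁ P.g x₁ - P.gStar)) / (T : ℝ) ^ (1 / 3 : ℝ)
        + (L + L ^ 2 / τ) / (2 * (p.m + T) ^ (2 / 3 : ℝ)) ∧
    (b ≤ 100 * d₁ → avgGradNorm P p Pr x₁ y₁ Z T ≤
      √(2 * p.M' b T L τ δ (smoothing p.μ₁ P.g x₁ - P.gStar)) * p.m ^ (1 / 6 : ℝ) / (T : ℝ) ^ (1 / 2 : ℝ)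
        + √(2 * p.M' b T L τ δ (smoothing p.μ₁ P.g x₁ - P.gStar)) / (T : ℝ) ^ (1 / 3 : ℝ)
        + L / (2 * (p.m + T) ^ (2 / 3 : ℝ))) := by
  obtain ⟨U, h⟩ := hP.exists_setup hd₁ hd₂ hL hτ hA.μ₁_pos hA.μ₂_pos ⟨y₁, hy⟩
  refine ⟨h.differentiable_g, ?_⟩
  rcases le_or_gt τ L with hτL | hLτ
  · have h1 := h.convergence_of_le hA hτL hT hZ x₁ hy hmax
    exact ⟨h1.1, h1.2, fun hb => (h.convergence_of_batch_le hA hτL hb hT hZ x₁ hy hmax).2⟩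
  · have h1 := h.convergence_of_lt hA hLτ hT hZ x₁ hy hmax
    refine ⟨h1.1, h1.2.trans ?_, fun _ => h1.2⟩
    have hm := hA.m_ge_two
    have h2 : 0 ≤ L ^ 2 / τ := by positivity
    gcongr
    linarith

end AccZOMDA

/-! ### Parameters for the query complexity. -/

namespace AccZOMDA
open Set Metric Filter Topology
open scoped RealInnerProductSpace ENNReal

/-- Pointwise on the ball the root grows by at most `√(K/2) μ`; squaring and averaging bounds the
smoothed gap by the actual one. -/
theorem smoothing_sub_le {d : ℕ} {F : E d → ℝ} {K : ℝ} (hK0 : 0 < K) (hF : Differentiable ℝ F)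
    (hK : ∀ x z, ‖gradient F x - gradient F z‖ ≤ K * ‖x - z‖) {a : ℝ} (ha : ∀ z, a ≤ F z) {μ : ℝ} (hμ : 0 < μ)
    (x : E d) : smoothing μ F x - a ≤ 2 * (F x - a) + K * μ ^ 2 := by
  have hpt : ∀ u ∈ closedBall (0 : E d) 1, F (x + μ • u) ≤ a + (2 * (F x - a) + K * μ ^ 2) := fun u hu => by
    have hu1 : ‖u‖ ≤ 1 := by simpa using hu
    have h1 := sqrt_sub_le hK0 hF hK ha x (x + μ • u)
    rw [add_sub_cancel_left, norm_smul, Real.norm_eq_abs, abs_of_pos hμ] at h1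
    have h2 : √(F (x + μ • u) - a) ≤ √(F x - a) + √(K / 2) * μ := by
      refine h1.trans ?_
      gcongr
      exact mul_le_of_le_one_right hμ.le hu1
    have h3 := pow_le_pow_left₀ (Real.sqrt_nonneg _) h2 2
    have h4 := add_sq_le (a := √(F x - a)) (b := √(K / 2) * μ)
    rw [Real.sq_sqrt (sub_nonneg.2 (ha _))] at h3
    rw [mul_pow, Real.sq_sqrt (sub_nonneg.2 (ha _)), Real.sq_sqrt (show 0 ≤ K / 2 by positivity)] at h4
    linarith
  have h1 := average_ball_mono (integrableOn_add_smul (μ := μ) hF.continuous x)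
    (integrableOn_const measure_closedBall_lt_top.ne) hpt
  rw [average_ball_const] at h1
  change smoothing μ F x ≤ _ at h1
  linarith

theorem run_queries {d₁ d₂ b : ℕ} {Ξ : Type u} [MeasurableSpace Ξ] (P : Problem d₁ d₂ Ξ) (p : Params)
    (x₁ : E d₁) (y₁ : E d₂) (B : ℕ → Batch d₁ d₂ b Ξ) (n : ℕ) :
    (run P p x₁ y₁ B n).queries = 4 * b + 8 * b * n := by
  induction n with
  | zero => simp only [run, init]; ring
  | succ n ih =>
    simp only [run, step] at ih ⊢
    rw [ih]
    ring

/-- The parameters for the query complexity; `ρ` stands for `d̃ / b`. -/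
noncomputable def Params.ofRatio (d₁ d₂ T : ℕ) (L τ lam k a C N ρ : ℝ) : Params where
  γ := a * lam / ((L / τ) ^ 2 * √ρ)
  lam := lam
  k := k
  m := (N * ρ) ^ 3
  c₁ := C * ρ
  c₂ := C * ρ
  μ₁ := min (1 / (d₁ * ((N * ρ) ^ 3 + T) ^ (2 / 3 : ℝ))) (1 / (2 * L * (L / τ) + 1))
  μ₂ := 1 / ((d₁ + d₂ : ℝ) ^ (1 / 2 : ℝ) * d₂ * ((N * ρ) ^ 3 + T) ^ (2 / 3 : ℝ))

section

variable {d₁ d₂ b T : ℕ} {L τ lam k a C N ρ : ℝ}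

theorem cube_rpow_third {z : ℝ} (hz : 0 ≤ z) : (z ^ 3) ^ (1 / 3 : ℝ) = z := by
  rw [← Real.rpow_natCast, ← Real.rpow_mul hz]
  norm_num

theorem Params.ofRatio_admissible (hd₁ : 1 ≤ d₁) (hd₂ : 1 ≤ d₂) (hb : 1 ≤ b) (hbd : b ≤ d₁ + d₂)
    (hL : 0 < L) (hτ : 0 < τ) (hτL : τ ≤ L) (hk : 0 < k) (hlam : 0 < lam) (hlamL : lam ≤ 1 / (6 * L))
    (hlamτ : lam ≤ 75 * τ / 24) (ha : 0 < a) (ha2 : a ^ 2 = 1 / (1 / L ^ 2 + 625))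
    (hC : C = 2 / (3 * k ^ 3) + 625 * L ^ 2 / 3) (hN : N = 2 + k + C * k) (hρ : ρ = (d₁ + d₂ : ℝ) / b) :
    (ofRatio d₁ d₂ T L τ lam k a C N ρ).Admissible d₁ d₂ b T L τ := by
  have hb0 : (1 : ℝ) ≤ b := by exact_mod_cast hb
  have hbd' : (b : ℝ) ≤ d₁ + d₂ := by exact_mod_cast hbd
  have hd₁' : (1 : ℝ) ≤ d₁ := by exact_mod_cast hd₁
  have hd₂' : (1 : ℝ) ≤ d₂ := by exact_mod_cast hd₂
  have hρ1 : 1 ≤ ρ := by rw [hρ, one_le_div (by positivity)]; exact hbd'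
  have hρ0 : 0 < ρ := by linarith
  have hC0 : 0 < C := by rw [hC]; positivity
  have hCk : 0 < C * k := by positivity
  have hN0 : 0 < N := by rw [hN]; positivity
  have hκ1 : 1 ≤ L / τ := (one_le_div hτ).2 hτL
  have hκ0 : 0 < L / τ := by positivity
  have hq1 : 1 ≤ √ρ := Real.one_le_sqrt.2 hρ1
  have hq0 : 0 < √ρ := by positivity
  have hT0 : (0 : ℝ) ≤ T := T.cast_nonneg
  have hle : ∀ z, 0 ≤ z → z ≤ N → z ^ 3 ≤ (N * ρ) ^ 3 := fun z hz hzN =>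
    pow_le_pow_left₀ hz (hzN.trans (le_mul_of_one_le_right hN0.le hρ1)) 3
  have h2N : 2 ≤ N := by rw [hN]; linarith
  constructor
  · exact hb
  · exact hbd
  · exact hk
  · change 2 / (3 * k ^ 3) + 9 * τ ^ 2 / 4 ≤ C * ρ
    have h1 : τ ^ 2 ≤ L ^ 2 := by gcongr
    have h2 : C ≤ C * ρ := le_mul_of_one_le_right hC0.le hρ1
    have h3 : 0 < L ^ 2 := by positivity
    rw [hC] at h2 ⊢
    linarith
  · change 2 / (3 * k ^ 3) + 625 * (d₁ + d₂ : ℝ) * L ^ 2 / (3 * b) ≤ C * ρ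
    have e1 : 625 * (d₁ + d₂ : ℝ) * L ^ 2 / (3 * b) = 625 * L ^ 2 / 3 * ρ := by
      rw [hρ]
      field_simp
    have h2 : 2 / (3 * k ^ 3) ≤ 2 / (3 * k ^ 3) * ρ := le_mul_of_one_le_right (by positivity) hρ1
    rw [e1, hC, add_mul]
    linarith
  · change 2 ≤ (N * ρ) ^ 3
    have := hle 2 (by norm_num) h2N
    linarith
  · exact hle k hk.le (by rw [hN]; linarith)
  · change (C * ρ * k) ^ 3 ≤ (N * ρ) ^ 3
    rw [mul_right_comm]
    gcongr
    rw [hN]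
    linarith
  · change (C * ρ * k) ^ 3 ≤ (N * ρ) ^ 3
    rw [mul_right_comm]
    gcongr
    rw [hN]
    linarith
  · exact hlam
  · exact hlamL
  · exact hlamτ
  · change 0 < a * lam / ((L / τ) ^ 2 * √ρ)
    positivity
  · change a * lam / ((L / τ) ^ 2 * √ρ) ≤ lam * τ / (2 * L) *
      √(6 * b / (d₁ + d₂ : ℝ) / (36 * lam ^ 2 + 625 * (L / τ) ^ 2))
    -- The value of `a` comes from `36λ² ≤ 1/L² ≤ κ²/L²`, by which `36λ² + 625κ² ≤ κ²/a²`; what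
    -- remains is `4 ≤ 6`.
    have h1 : 2 * a / (L / τ * √ρ) ≤ √(6 * b / (d₁ + d₂ : ℝ) / (36 * lam ^ 2 + 625 * (L / τ) ^ 2)) := by
      refine Real.le_sqrt_of_sq_le ?_
      have e1 : (2 * a / (L / τ * √ρ)) ^ 2 = 4 / ρ / ((1 / L ^ 2 + 625) * (L / τ) ^ 2) := by
        rw [div_pow, mul_pow, mul_pow, Real.sq_sqrt hρ0.le, ha2]
        field_simp
        norm_num
      have e2 : 6 * b / (d₁ + d₂ : ℝ) = 6 / ρ := by rw [hρ]; field_simp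
      have h2 : 36 * lam ^ 2 ≤ 1 / L ^ 2 := by
        have := pow_le_pow_left₀ hlam.le hlamL 2
        calc 36 * lam ^ 2 ≤ 36 * (1 / (6 * L)) ^ 2 := by gcongr
          _ = 1 / L ^ 2 := by field_simp; norm_num
      have h3 : 1 / L ^ 2 ≤ 1 / L ^ 2 * (L / τ) ^ 2 :=
        le_mul_of_one_le_right (by positivity) (one_le_pow₀ hκ1)
      rw [e1, e2]
      gcongr
      · norm_num
      · rw [add_mul]
        linarith
    calc a * lam / ((L / τ) ^ 2 * √ρ) = lam * τ / (2 * L) * (2 * a / (L / τ * √ρ)) := by field_simp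
      _ ≤ _ := by gcongr
  · change a * lam / ((L / τ) ^ 2 * √ρ) ≤ ((N * ρ) ^ 3) ^ (1 / 3 : ℝ) / (2 * (L + L ^ 2 / τ) * k)
    rw [cube_rpow_third (by positivity)]
    have ha1 : a ≤ 1 := by
      refine abs_le_of_sq_le_sq' ?_ zero_le_one |>.2
      rw [ha2, one_pow, div_le_one (by positivity)]
      have : 0 < 1 / L ^ 2 := by positivity
      linarith
    have h1 : k ≤ N * ρ := by
      have : N ≤ N * ρ := le_mul_of_one_le_right hN0.le hρ1
      have : k ≤ N := by rw [hN]; linarith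
      linarith
    have h2 : L + L ^ 2 / τ ≤ 2 * L * (L / τ) := by
      have e : L + L ^ 2 / τ = L * (1 + L / τ) := by field_simp
      rw [e]
      nlinarith
    calc a * lam / ((L / τ) ^ 2 * √ρ) ≤ 1 * (1 / (6 * L)) / ((L / τ) ^ 2 * 1) := by gcongr
      _ ≤ 1 * (1 / (4 * L)) / ((L / τ) ^ 1 * 1) := by
        have := pow_le_pow_right₀ hκ1 one_le_two
        gcongr
        norm_num
      _ = k / (2 * (2 * L * (L / τ)) * k) := by field_simp; norm_num
      _ ≤ _ := by gcongr
  · change 0 < min _ _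
    positivity
  · exact min_le_left _ _
  · change 0 < 1 / _
    positivity
  · exact le_rfl

theorem weighted_sum_le {ρ ℓ z₁ z₂ z₃ z₄ : ℝ} (hρ : 1 ≤ ρ) (hℓ : 0 ≤ ℓ) (h₁ : 0 ≤ z₁) (h₂ : 0 ≤ z₂)
    (h₃ : 0 ≤ z₃) (h₄ : 0 ≤ z₄) :
    z₁ * ρ + z₂ + z₃ + z₄ * (ρ ^ 2 * ℓ) ≤ (z₁ + z₂ + z₃ + z₄) * (ρ ^ 2 * (1 + ℓ)) := by
  have h5 : ρ ≤ ρ ^ 2 := by nlinarith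
  have h6 : 0 ≤ ρ ^ 2 * ℓ := by positivity
  have hA : ρ ≤ ρ ^ 2 * (1 + ℓ) := by linarith
  have hB : 1 ≤ ρ ^ 2 * (1 + ℓ) := by linarith
  have hD : ρ ^ 2 * ℓ ≤ ρ ^ 2 * (1 + ℓ) := by linarith [sq_nonneg ρ]
  have y1 := mul_le_mul_of_nonneg_left hA h₁
  have y2 := mul_le_mul_of_nonneg_left hB h₂
  have y3 := mul_le_mul_of_nonneg_left hB h₃
  have y4 := mul_le_mul_of_nonneg_left hD h₄
  linarith

/-- Every term is measured in units of `κ²/λ`, using `1/τ² = κ²/L²` and, for the terms without `γ`,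
`λ ≤ 1/(6L)`. The dimension then enters only through `√ρ` and `ρ²/b`. -/
theorem Params.M'_ofRatio_le {δ gap G C₀ : ℝ} (hb : 1 ≤ b) (hL : 0 < L) (hτ : 0 < τ) (hτL : τ ≤ L) (hk : 0 < k)
    (hlam : 0 < lam) (hlamL : lam ≤ 1 / (6 * L)) (ha : 0 < a) (hC : 0 < C) (hN : 2 ≤ N) (hρ : 1 ≤ ρ)
    (hgap : gap ≤ G) (hC₀ : C₀ = 2 * δ ^ 2 * N / k ^ 2 + 661 * L ^ 4 / 8 + 9 * L ^ 2 / (4 * k ^ 2)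
      + 4 * C ^ 2 * δ ^ 2 * k ^ 2) :
    (ofRatio d₁ d₂ T L τ lam k a C N ρ).M' b T L τ δ gap
      ≤ (L / τ) ^ 2 / lam * (G / (a * k) * √ρ
        + C₀ / (6 * L ^ 3) * (ρ ^ 2 / b * (1 + Real.log ((N * ρ) ^ 3 + T)))) := by
  have hb0 : (1 : ℝ) ≤ b := by exact_mod_cast hb
  have hT0 : (0 : ℝ) ≤ T := T.cast_nonneg
  have hq0 : 0 < √ρ := by positivity
  have hm1 : 1 ≤ (N * ρ) ^ 3 + T := by
    have : 1 ≤ (N * ρ) ^ 3 := one_le_pow₀ (by nlinarith)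
    linarith
  have hl0 : 0 ≤ Real.log ((N * ρ) ^ 3 + T) := Real.log_nonneg hm1
  set ℓ := Real.log ((N * ρ) ^ 3 + T) with hℓ
  have e : (ofRatio d₁ d₂ T L τ lam k a C N ρ).M' b T L τ δ gap
      = gap / (a * lam / ((L / τ) ^ 2 * √ρ) * k)
        + 2 * δ ^ 2 / (b * τ ^ 2 * k * (k / (N * ρ)))
        + (36 * τ ^ 2 * L ^ 2 + 625 * L ^ 4) / (8 * b * τ ^ 2) * ((N * ρ) ^ 3 + T) ^ (-(2 / 3) : ℝ)
        + 9 * L ^ 2 / (4 * b * τ ^ 2 * k ^ 2)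
        + 2 * ((C * ρ) ^ 2 + (C * ρ) ^ 2) * δ ^ 2 * k ^ 2 / (b * τ ^ 2) * ℓ := by
    have e1 : (ofRatio d₁ d₂ T L τ lam k a C N ρ).eta 0 = k / (N * ρ) := by
      change k / ((N * ρ) ^ 3 + ((0 : ℕ) : ℝ)) ^ (1 / 3 : ℝ) = _
      rw [Nat.cast_zero, add_zero, cube_rpow_third (by positivity)]
    unfold M'
    rw [e1]
    rfl
  have t1 : gap / (a * lam / ((L / τ) ^ 2 * √ρ) * k) ≤ (L / τ) ^ 2 / lam * (G / (a * k) * √ρ) := by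
    calc _ ≤ G / (a * lam / ((L / τ) ^ 2 * √ρ) * k) := by gcongr
      _ = _ := by field_simp
  have t3 : (36 * τ ^ 2 * L ^ 2 + 625 * L ^ 4) / (8 * b * τ ^ 2) * ((N * ρ) ^ 3 + T) ^ (-(2 / 3) : ℝ)
      ≤ 661 * L ^ 4 / 8 * (1 / (b * τ ^ 2)) := by
    have h1 : ((N * ρ) ^ 3 + T) ^ (-(2 / 3) : ℝ) ≤ 1 := Real.rpow_le_one_of_one_le_of_nonpos hm1 (by norm_num)
    calc _ ≤ (36 * L ^ 2 * L ^ 2 + 625 * L ^ 4) / (8 * b * τ ^ 2) * 1 := by gcongr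
      _ = _ := by field_simp; ring
  have h6 : (1 / (b * τ ^ 2)) * (C₀ * (ρ ^ 2 * (1 + ℓ)))
      ≤ (L / τ) ^ 2 / lam * (C₀ / (6 * L ^ 3) * (ρ ^ 2 / b * (1 + ℓ))) := by
    have h1 : 6 * L * lam ≤ 1 := by
      rw [le_div_iff₀ (by positivity)] at hlamL
      linarith
    have hC₀0 : 0 ≤ C₀ := by rw [hC₀]; positivity
    have h2 : 1 ≤ 1 / (6 * L * lam) := (one_le_div (by positivity)).2 h1
    calc _ ≤ (1 / (b * τ ^ 2)) * (C₀ * (ρ ^ 2 * (1 + ℓ))) * (1 / (6 * L * lam)) :=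
          le_mul_of_one_le_right (by positivity) h2
      _ = _ := by field_simp
  have t2 : 2 * δ ^ 2 / (b * τ ^ 2 * k * (k / (N * ρ))) = (1 / (b * τ ^ 2)) * (2 * δ ^ 2 * N / k ^ 2 * ρ) := by
    field_simp
  have t4 : 9 * L ^ 2 / (4 * b * τ ^ 2 * k ^ 2) = (1 / (b * τ ^ 2)) * (9 * L ^ 2 / (4 * k ^ 2)) := by
    field_simp
  have t5 : 2 * ((C * ρ) ^ 2 + (C * ρ) ^ 2) * δ ^ 2 * k ^ 2 / (b * τ ^ 2) * ℓ
      = (1 / (b * τ ^ 2)) * (4 * C ^ 2 * δ ^ 2 * k ^ 2 * (ρ ^ 2 * ℓ)) := by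
    field_simp
    ring
  have h7 : (1 / (b * τ ^ 2)) * (2 * δ ^ 2 * N / k ^ 2 * ρ + 661 * L ^ 4 / 8 + 9 * L ^ 2 / (4 * k ^ 2)
      + 4 * C ^ 2 * δ ^ 2 * k ^ 2 * (ρ ^ 2 * ℓ)) ≤ (1 / (b * τ ^ 2)) * (C₀ * (ρ ^ 2 * (1 + ℓ))) := by
    refine mul_le_mul_of_nonneg_left ?_ (by positivity)
    rw [hC₀]
    exact weighted_sum_le hρ hl0 (by positivity) (by positivity) (by positivity) (by positivity)
  rw [e, t2, t4, t5, mul_add ((L / τ) ^ 2 / lam)]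
  linarith

end

end AccZOMDA

/-! ### The choice of `T` and the query count. -/

namespace AccZOMDA
open Set Metric Filter Topology
open scoped RealInnerProductSpace ENNReal

/-- The extra upper bound on `μ₁` is there so that the smoothed initial gap is controlled by the
given one, uniformly in `κ`. -/
theorem Setup.smoothing_gap_le {d₁ d₂ : ℕ} {Ξ : Type u} [MeasurableSpace Ξ] {P : Problem d₁ d₂ Ξ}
    {L τ δ μ₁ μ₂ Δ : ℝ} {U : Set (E d₂)} (h : Setup P L τ δ μ₁ μ₂ U) (hτL : τ ≤ L)
    (hμ : μ₁ ≤ 1 / (2 * L * (L / τ) + 1)) {x : E d₁} (hΔ : P.g x - P.gStar ≤ Δ) :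
    smoothing μ₁ P.g x - P.gStar ≤ 2 * |Δ| + 1 := by
  have hL := h.L_pos
  have hτ := h.τ_pos
  have hμ0 := h.μ₁_pos
  have h1 := smoothing_sub_le (K := L * √(1 + (L / τ) ^ 2)) (by positivity) h.differentiable_g h.gradient_g_lip
    h.gStar_le hμ0 x
  have hκ : 1 ≤ L / τ := (one_le_div hτ).2 hτL
  have h2 : L + L ^ 2 / τ ≤ 2 * L * (L / τ) := by
    have e : L + L ^ 2 / τ = L * (1 + L / τ) := by field_simp
    rw [e]
    nlinarith
  have h3 := h.sqrt_le_Lg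
  set K := 2 * L * (L / τ) with hK
  have hK0 : 0 < K := by positivity
  have h4 : L * √(1 + (L / τ) ^ 2) * μ₁ ^ 2 ≤ 1 := by
    calc _ ≤ K * (1 / (K + 1)) ^ 2 := by
          gcongr
          exact h3.trans h2
      _ = K / (K + 1) ^ 2 := by rw [div_pow, one_pow, mul_one_div]
      _ ≤ 1 := by
          rw [div_le_one (by positivity)]
          nlinarith
  have := le_abs_self Δ
  linarith

/-- With `m ≤ r³ ≤ T` the first term is dominated by the second. Each of these is at most `ε/4`, and
the bias term at most `ε/2`. -/
theorem rate_le {m M K r ε : ℝ} {T : ℕ} (hm : 0 < m) (hr : 0 < r) (hε : 0 < ε) (hmr : m ≤ r ^ 3)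
    (hT : r ^ 3 ≤ T) (hM : 32 * M ≤ (ε * r) ^ 2) (hKr : K ≤ ε * r ^ 2) :
    √(2 * M) * m ^ (1 / 6 : ℝ) / (T : ℝ) ^ (1 / 2 : ℝ) + √(2 * M) / (T : ℝ) ^ (1 / 3 : ℝ)
      + K / (2 * (m + T) ^ (2 / 3 : ℝ)) ≤ ε := by
  have hr3 : 0 < r ^ 3 := by positivity
  have hT0 : (0 : ℝ) < T := by linarith
  have h1 : √(2 * M) ≤ ε * r / 4 := Real.sqrt_le_iff.2 ⟨by positivity, by
    rw [div_pow]
    linarith⟩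
  have h2 : r ≤ (T : ℝ) ^ (1 / 3 : ℝ) := by
    calc r = (r ^ 3) ^ (1 / 3 : ℝ) := (cube_rpow_third hr.le).symm
      _ ≤ _ := by gcongr
  have h3 : r ^ 2 ≤ (m + T) ^ (2 / 3 : ℝ) := by
    calc r ^ 2 = (r ^ 3) ^ (2 / 3 : ℝ) := by
          rw [← Real.rpow_natCast, ← Real.rpow_natCast, ← Real.rpow_mul hr.le]
          norm_num
      _ ≤ _ := by
          gcongr
          linarith
  have h4 : √(2 * M) * m ^ (1 / 6 : ℝ) / (T : ℝ) ^ (1 / 2 : ℝ) ≤ √(2 * M) / (T : ℝ) ^ (1 / 3 : ℝ) := by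
    have e : (T : ℝ) ^ (1 / 2 : ℝ) = (T : ℝ) ^ (1 / 6 : ℝ) * (T : ℝ) ^ (1 / 3 : ℝ) := by
      rw [← Real.rpow_add hT0]
      norm_num
    have h6 : 0 < (T : ℝ) ^ (1 / 6 : ℝ) := by positivity
    calc _ ≤ √(2 * M) * (T : ℝ) ^ (1 / 6 : ℝ) / (T : ℝ) ^ (1 / 2 : ℝ) := by
          gcongr
          linarith
      _ = _ := by rw [e]; field_simp
  have h5 : √(2 * M) / (T : ℝ) ^ (1 / 3 : ℝ) ≤ ε / 4 := by
    calc _ ≤ ε * r / 4 / r := by gcongr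
      _ = ε / 4 := by field_simp
  have h6 : K / (2 * (m + T) ^ (2 / 3 : ℝ)) ≤ ε / 2 := by
    calc _ ≤ ε * r ^ 2 / (2 * r ^ 2) := by gcongr
      _ = ε / 2 := by field_simp
  linarith

/-- `m + t` is at most `3r³`, and `r` is polynomial in `B`. What matters later is that the constant
is linear in `R`. -/
theorem log_add_le {R w B m r t : ℝ} (hR : 0 < R) (hw : 0 < w) (hB : 1 ≤ B) (hm : 0 < m) (hr : 1 ≤ r)
    (hmr : m ≤ r ^ 3) (ht : 0 ≤ t) (htr : t ≤ r ^ 3 + 1) (hrB : r ≤ R * w * B ^ 2) :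
    1 + Real.log (m + t) ≤ (9 + 3 * w + 3 * R) * (1 + Real.log B) := by
  have h0 : 0 ≤ Real.log B := Real.log_nonneg hB
  have hr1 : 1 ≤ r ^ 3 := one_le_pow₀ hr
  have h1 : Real.log (m + t) ≤ Real.log (3 * r ^ 3) := Real.log_le_log (by linarith) (by linarith)
  have h2 : Real.log (3 * r ^ 3) = Real.log 3 + 3 * Real.log r := by
    rw [Real.log_mul (by norm_num) (by positivity), Real.log_pow]
    norm_num
  have h3 : Real.log r ≤ Real.log R + Real.log w + 2 * Real.log B := by
    refine (Real.log_le_log (by linarith) hrB).trans (le_of_eq ?_)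
    rw [Real.log_mul (by positivity) (by positivity), Real.log_mul (by positivity) (by positivity), Real.log_pow]
    norm_num
  have h4 := Real.log_le_sub_one_of_pos hR
  have h5 := Real.log_le_sub_one_of_pos hw
  have h6 := Real.log_le_sub_one_of_pos (show (0 : ℝ) < 3 by norm_num)
  have h7 : 0 ≤ (3 + 3 * w + 3 * R) * Real.log B := by positivity
  linarith

/-- The choice of the number of iterations, `T = ⌈r ^ 3⌉`. -/
theorem exists_scale {L N C₂ : ℝ} (hL : 0 < L) (hN : 2 ≤ N) (hC₂ : 0 ≤ C₂) : ∃ R : ℝ, 1 ≤ R ∧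
    ∀ lam κ ε d X ρ : ℝ, 0 < lam → lam ≤ 1 / (6 * L) → 1 ≤ κ → 0 < ε → ε ≤ 1 → 1 ≤ X → X ≤ d →
      1 ≤ ρ → ρ ≤ X * (κ / ε) →
    ∃ r : ℝ, r = R * X * (κ / ε) * √(1 + Real.log (1 + κ * d / (lam * ε))) / √lam ∧ 1 ≤ r ∧ N * ρ ≤ r ∧
      2 * L * κ ≤ ε * r ^ 2 ∧ ∀ t : ℝ, 0 ≤ t → t ≤ r ^ 3 + 1 →
        32 * (κ ^ 2 / lam * (C₂ * X ^ 2 * (1 + Real.log ((N * ρ) ^ 3 + t)))) ≤ (ε * r) ^ 2 := by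
  set w := 1 + 1 / (6 * L) with hw
  have hw1 : 1 ≤ w := by
    have : 0 < 1 / (6 * L) := by positivity
    linarith
  -- The scale `r` appears inside the logarithm that it must dominate. This costs a factor linear in
  -- `R`, while the target grows like `R²`, so a large `R` closes the loop.
  set R := 1 + N * w + 32 * C₂ * (13 + 3 * w) with hR
  have hR1 : 1 ≤ R := by
    have : 0 ≤ N * w := by positivity
    have : 0 ≤ 32 * C₂ * (13 + 3 * w) := by positivity
    linarith
  have hRN : N * w ≤ R := by
    have : 0 ≤ 32 * C₂ * (13 + 3 * w) := by positivity
    linarith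
  have hRC : 32 * C₂ * (9 + 3 * w + 3 * R) ≤ R ^ 2 := by
    have h1 : 32 * C₂ * (13 + 3 * w) ≤ R := by
      have : 0 ≤ N * w := by positivity
      linarith
    have h2 : 9 + 3 * w + 3 * R ≤ (13 + 3 * w) * R := by nlinarith
    calc _ ≤ 32 * C₂ * ((13 + 3 * w) * R) := by gcongr
      _ = 32 * C₂ * (13 + 3 * w) * R := by ring
      _ ≤ R * R := by gcongr
      _ = R ^ 2 := by ring
  refine ⟨R, hR1, fun lam κ ε d X ρ hlam hlamL hκ hε hε1 hX hXd hρ hρX => ⟨_, rfl, ?_⟩⟩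
  have hd : 1 ≤ d := hX.trans hXd
  set B := 1 + κ * d / (lam * ε) with hB
  have hB1 : 1 ≤ B := by
    have : 0 ≤ κ * d / (lam * ε) := by positivity
    linarith
  set ℓ := 1 + Real.log B with hℓ
  have hℓ1 : 1 ≤ ℓ := by
    have := Real.log_nonneg hB1
    linarith
  have hℓB : ℓ ≤ B := by
    have := Real.log_le_sub_one_of_pos (show 0 < B by linarith)
    linarith
  set z := κ / ε with hz
  have hz1 : 1 ≤ z := (one_le_div hε).2 (hε1.trans hκ)
  have hzε : ε * z = κ := by rw [hz]; field_simp
  have hj1 : 1 ≤ √ℓ := Real.one_le_sqrt.2 hℓ1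
  have hj2 : √ℓ ^ 2 = ℓ := Real.sq_sqrt (by linarith)
  have hl0 : 0 < √lam := Real.sqrt_pos.2 hlam
  have hl2 : √lam ^ 2 = lam := Real.sq_sqrt hlam.le
  have hlw : √lam ≤ w := by
    refine Real.sqrt_le_iff.2 ⟨by positivity, le_trans ?_ (le_self_pow₀ hw1 two_ne_zero)⟩
    linarith
  set r := R * X * z * √ℓ / √lam with hr
  have hr0 : 0 < r := by positivity
  have hNr : N * ρ ≤ r := by
    rw [hr, le_div_iff₀ hl0]
    calc N * ρ * √lam ≤ N * (X * z) * w := by gcongr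
      _ = N * w * (X * z) * 1 := by ring
      _ ≤ R * (X * z) * √ℓ := by gcongr
      _ = R * X * z * √ℓ := by ring
  have hr2 : r ^ 2 = R ^ 2 * X ^ 2 * z ^ 2 * ℓ / lam := by
    rw [hr, div_pow, mul_pow, mul_pow, mul_pow, hj2, hl2]
  have hr1 : 1 ≤ r := (one_le_mul_of_one_le_of_one_le (by linarith) hρ).trans hNr
  refine ⟨hr1, hNr, ?_, fun t ht0 ht => ?_⟩
  · have h1 : 6 * L ≤ 1 / lam := by
      rw [le_div_iff₀ hlam]
      rw [le_div_iff₀ (by positivity)] at hlamL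
      linarith
    have h2 : κ ≤ κ * z := le_mul_of_one_le_right (by linarith) hz1
    calc 2 * L * κ ≤ 6 * L * (κ * z) := by gcongr; norm_num
      _ ≤ 1 / lam * (κ * z) := by gcongr
      _ = 1 ^ 2 * 1 ^ 2 * (ε * z) * z * 1 / lam := by rw [hzε]; ring
      _ ≤ R ^ 2 * X ^ 2 * (ε * z) * z * ℓ / lam := by
        gcongr
      _ = _ := by rw [hr2]; ring
  · have hrB : r ≤ R * w * B ^ 2 := by
      have h1 : √ℓ ≤ B := Real.sqrt_le_iff.2 ⟨by linarith, hℓB.trans (le_self_pow₀ hB1 two_ne_zero)⟩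
      have h2 : X * z ≤ lam * B := by
        have e : lam * B = lam + d * z := by
          rw [hB, hz]
          field_simp
        rw [e]
        have : X * z ≤ d * z := by gcongr
        linarith
      rw [hr, div_le_iff₀ hl0]
      calc R * X * z * √ℓ = R * (X * z) * √ℓ := by ring
        _ ≤ R * (lam * B) * B := by gcongr
        _ = R * √lam * B ^ 2 * √lam := by rw [← hl2, Real.sqrt_sq hl0.le]; ring
        _ ≤ R * w * B ^ 2 * √lam := by gcongr
    have h3 := log_add_le (R := R) (w := w) (m := (N * ρ) ^ 3) (by linarith) (by linarith) hB1 (by positivity) hr1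
      (pow_le_pow_left₀ (by positivity) hNr 3) ht0 ht hrB
    calc _ ≤ 32 * (κ ^ 2 / lam * (C₂ * X ^ 2 * ((9 + 3 * w + 3 * R) * ℓ))) := by gcongr
      _ = 32 * C₂ * (9 + 3 * w + 3 * R) * (X ^ 2 * κ ^ 2 * ℓ / lam) := by ring
      _ ≤ R ^ 2 * (X ^ 2 * κ ^ 2 * ℓ / lam) := by gcongr
      _ = _ := by
        rw [mul_pow ε r, hr2, ← hzε]
        ring

theorem query_count_le {lam κ ε ℓ X R b D s t : ℝ} (hlam : 0 < lam) (hκ : 0 ≤ κ) (hε : 0 < ε) (hℓ : 0 ≤ ℓ)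
    (hR : 0 ≤ R) (hb : 0 ≤ b) (hs : s = R * X * (κ / ε) * √ℓ / √lam) (hs1 : 1 ≤ s) (ht : t ≤ s ^ 3 + 1)
    (hX : b * X ^ 3 ≤ 2 * D) :
    4 * b + 8 * b * t
      ≤ 40 * R ^ 3 * lam ^ (-(3 / 2) : ℝ) * (κ ^ 3 * D * ε ^ (-3 : ℝ)) * ℓ ^ (3 / 2 : ℝ) := by
  have hs3 : 1 ≤ s ^ 3 := one_le_pow₀ hs1
  have e1 : lam ^ (-(3 / 2) : ℝ) = 1 / √lam ^ 3 := by
    rw [Real.rpow_neg hlam.le, Real.sqrt_eq_rpow, ← Real.rpow_natCast, ← Real.rpow_mul hlam.le, one_div]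
    norm_num
  have e2 : ℓ ^ (3 / 2 : ℝ) = √ℓ ^ 3 := by
    rw [Real.sqrt_eq_rpow, ← Real.rpow_natCast, ← Real.rpow_mul hℓ]
    norm_num
  have e3 : ε ^ (-3 : ℝ) = 1 / ε ^ 3 := by
    rw [Real.rpow_neg hε.le, one_div]
    norm_cast
  have hl0 : 0 < √lam := Real.sqrt_pos.2 hlam
  have h1 : 4 * b + 8 * b * t ≤ 20 * (b * s ^ 3) := by
    have h2 : b * 1 ≤ b * s ^ 3 := by gcongr
    have h3 : b * t ≤ b * (s ^ 3 + 1) := by gcongr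
    linarith
  have e4 : s ^ 3 = R ^ 3 * X ^ 3 * (κ ^ 3 / ε ^ 3) * √ℓ ^ 3 / √lam ^ 3 := by
    rw [hs, div_pow, mul_pow, mul_pow, mul_pow, div_pow]
  calc _ ≤ 20 * (b * s ^ 3) := h1
    _ = 20 * R ^ 3 * (b * X ^ 3) * (κ ^ 3 / ε ^ 3 * √ℓ ^ 3 / √lam ^ 3) := by rw [e4]; ring
    _ ≤ 20 * R ^ 3 * (2 * D) * (κ ^ 3 / ε ^ 3 * √ℓ ^ 3 / √lam ^ 3) := by gcongr
    _ = _ := by rw [e1, e2, e3]; ring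

theorem log_one_add_nonneg {t : ℝ} (ht : 0 ≤ t) : 0 ≤ Real.log (1 + t) := Real.log_nonneg (by linarith)

/-- `X` is the dimension factor of the scale `T^(1/3)`. Its square must dominate both dimension
factors `√ρ` and `ρ²/b` of `M'`; the condition `ρ ≤ X κ/ε` ensures `m ≤ T`; and `b X³` is the
dimension factor of the total cost, which is of order `bT`. -/
theorem queryComplexity_of {bs : ℕ → ℕ} {a r : ℝ} (hbs : ∀ d : ℕ, 2 ≤ d → 1 ≤ bs d ∧ bs d ≤ d ∧
    ∃ X : ℝ, 1 ≤ X ∧ X ≤ d ∧ √(d / bs d) ≤ X ^ 2 ∧ ((d : ℝ) / bs d) ^ 2 / bs d ≤ X ^ 2 ∧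
      (∀ z : ℝ, 1 ≤ z → (d : ℝ) ^ r ≤ z → d / bs d ≤ X * z) ∧ bs d * X ^ 3 ≤ 2 * (d : ℝ) ^ a) :
    QueryComplexity.{u, v} bs a r := by
  intro L k δ Δ hL hk
  set C := 2 / (3 * k ^ 3) + 625 * L ^ 2 / 3 with hC
  have hC0 : 0 < C := by positivity
  set N := 2 + k + C * k with hN
  have hN2 : 2 ≤ N := by
    have : 0 < C * k := by positivity
    linarith
  set q := 1 / √(1 / L ^ 2 + 625) with hq
  have hq0 : 0 < q := by positivity
  have hq2 : q ^ 2 = 1 / (1 / L ^ 2 + 625) := by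
    rw [hq, div_pow, one_pow, Real.sq_sqrt (by positivity)]
  set C₀ := 2 * δ ^ 2 * N / k ^ 2 + 661 * L ^ 4 / 8 + 9 * L ^ 2 / (4 * k ^ 2) + 4 * C ^ 2 * δ ^ 2 * k ^ 2 with hC₀
  have hC₀0 : 0 ≤ C₀ := by positivity
  set C₂ := (2 * |Δ| + 1) / (q * k) + C₀ / (6 * L ^ 3) with hC₂
  have hC₂0 : 0 ≤ C₂ := by positivity
  obtain ⟨R, hR1, hscale⟩ := exists_scale hL hN2 hC₂0
  refine ⟨40 * R ^ 3, by positivity, ?_⟩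
  intro d₁ d₂ hd₁ hd₂ τ lam hτ hτL hlam hlamL hlamτ ε hε hε1 hεr
  obtain ⟨hb1, hbd, X, hX1, hXd, hXq, hXρ, hXz, hXb⟩ := hbs (d₁ + d₂) (by lia)
  set b := bs (d₁ + d₂) with hb
  rw [Nat.cast_add] at hXd hXq hXρ hXz hXb
  have hb0 : (1 : ℝ) ≤ b := by exact_mod_cast hb1
  have hbd' : (b : ℝ) ≤ d₁ + d₂ := by exact_mod_cast hbd
  have hd0 : (0 : ℝ) < d₁ + d₂ := by linarith
  have hκ1 : 1 ≤ L / τ := (one_le_div hτ).2 hτL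
  set ρ := (d₁ + d₂ : ℝ) / b with hρ
  have hρ1 : 1 ≤ ρ := (one_le_div (by linarith)).2 hbd'
  have hz : (d₁ + d₂ : ℝ) ^ r ≤ L / τ / ε := by
    rw [le_div_iff₀ hε]
    rw [Real.rpow_neg hd0.le, ← div_eq_mul_inv, le_div_iff₀ (by positivity)] at hεr
    linarith
  obtain ⟨s, hs, hs1, hNs, hKs, hMs⟩ := hscale lam (L / τ) ε (d₁ + d₂) X ρ hlam hlamL hκ1 hε hε1 hX1 hXd hρ1
    (hXz _ ((one_le_div hε).2 (hε1.trans hκ1)) hz)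
  have hs3 : 1 ≤ s ^ 3 := one_le_pow₀ hs1
  set T := ⌈s ^ 3⌉₊ with hT
  have hTs : s ^ 3 ≤ T := Nat.le_ceil _
  have hTs' : (T : ℝ) ≤ s ^ 3 + 1 := (Nat.ceil_lt_add_one (by linarith)).le
  have hT1 : 1 ≤ T := by
    have : (1 : ℝ) ≤ T := hs3.trans hTs
    exact_mod_cast this
  have hA := Params.ofRatio_admissible (T := T) hd₁ hd₂ hb1 hbd hL hτ hτL hk hlam hlamL hlamτ hq0 hq2 hC hN hρ
  refine ⟨T, Params.ofRatio d₁ d₂ T L τ lam k q C N ρ, hT1, rfl, rfl, hA, ?_⟩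
  intro Ξ _ P hP x₁ y₁ hy hmax hΔ Ω _ Pr _ Z hZ
  refine ⟨?_, fun ω => ?_⟩
  · refine (convergence hd₁ hd₂ hT1 hL hτ hA hP hy hmax hZ).2.2.1.trans ?_
    obtain ⟨U, h⟩ := hP.exists_setup hd₁ hd₂ hL hτ hA.μ₁_pos hA.μ₂_pos ⟨y₁, hy⟩
    have hgap := h.smoothing_gap_le hτL (min_le_right _ _) hΔ
    have hM := Params.M'_ofRatio_le (d₁ := d₁) (d₂ := d₂) (T := T) hb1 hL hτ hτL hk hlam hlamL hq0 hC0 hN2 hρ1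
      hgap hC₀
    refine rate_le (r := s) (m := (N * ρ) ^ 3) (by positivity) (by linarith) hε
      (pow_le_pow_left₀ (by positivity) hNs 3) hTs ?_ ?_
    · refine le_trans ?_ (hMs T T.cast_nonneg hTs')
      refine mul_le_mul_of_nonneg_left (hM.trans ?_) (by norm_num)
      refine mul_le_mul_of_nonneg_left ?_ (by positivity)
      have hl : 0 ≤ Real.log ((N * ρ) ^ 3 + T) := Real.log_nonneg (by
        have : 1 ≤ (N * ρ) ^ 3 := one_le_pow₀ (one_le_mul_of_one_le_of_one_le (by linarith) hρ1)
        have : (0 : ℝ) ≤ T := T.cast_nonneg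
        linarith)
      have h1 : √ρ ≤ X ^ 2 * (1 + Real.log ((N * ρ) ^ 3 + T)) :=
        hXq.trans (le_mul_of_one_le_right (by positivity) (by linarith))
      calc _ ≤ (2 * |Δ| + 1) / (q * k) * (X ^ 2 * (1 + Real.log ((N * ρ) ^ 3 + T)))
            + C₀ / (6 * L ^ 3) * (X ^ 2 * (1 + Real.log ((N * ρ) ^ 3 + T))) := by gcongr
        _ = _ := by rw [hC₂]; ring
    · refine le_trans ?_ hKs
      have e : L + L ^ 2 / τ = L * (1 + L / τ) := by field_simp
      rw [e]
      linarith [mul_le_mul_of_nonneg_left hκ1 hL.le]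
  · rw [run_queries]
    push_cast
    have hℓ : 0 ≤ L / τ * (d₁ + d₂ : ℝ) / (lam * ε) := by positivity
    exact query_count_le hlam (by linarith) hε (add_nonneg zero_le_one (log_one_add_nonneg hℓ)) (by linarith)
      (by linarith) hs hs1 hTs' hXb

/-- For `b = 1` one has `ρ = d`, and `ρ² ≤ X²` forces `X = d`; then `m ≤ T` needs no restriction on
`ε`. -/
theorem queryComplexity_single : QueryComplexity.{u, v} (fun _ => 1) 3 0 := by
  refine queryComplexity_of fun d hd => ⟨le_rfl, by lia, d, ?_⟩
  have hd' : (2 : ℝ) ≤ d := by exact_mod_cast hd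
  rw [Nat.cast_one, div_one, div_one, one_mul]
  refine ⟨by linarith, le_rfl, ?_, le_rfl, fun z hz _ => le_mul_of_one_le_right (by linarith) hz, ?_⟩
  · exact Real.sqrt_le_iff.2 ⟨by positivity, by nlinarith [one_le_pow₀ (n := 2) (show (1 : ℝ) ≤ d by linarith)]⟩
  · have e : (d : ℝ) ^ (3 : ℝ) = (d : ℝ) ^ 3 := by norm_cast
    rw [e]
    have : 0 ≤ (d : ℝ) ^ 3 := by positivity
    linarith

/-- For `b` about `d^(3/5)` the ratio `ρ` is about `d^(2/5)`, so `√ρ` and `ρ²/b` are both about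
`d^(1/5)`: this balance determines the exponent. Then `X = d^(1/10)`, the cost factor is `d^(3/5 +
3/10)`, and `ρ ≤ X κ/ε` becomes the restriction `ε ≤ κ d^(-3/10)`. -/
theorem queryComplexity_batch :
    QueryComplexity.{u, v} (fun d => ⌈(d : ℝ) ^ (3 / 5 : ℝ)⌉₊) (9 / 10) (3 / 10) := by
  refine queryComplexity_of fun d hd => ?_
  have hd' : (1 : ℝ) ≤ d := by
    have : (2 : ℝ) ≤ d := by exact_mod_cast hd
    linarith
  have hd0 : (0 : ℝ) < d := by linarith
  -- everything is a power of the tenth root of the dimension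
  set X := (d : ℝ) ^ (1 / 10 : ℝ) with hX
  have hX1 : 1 ≤ X := Real.one_le_rpow hd' (by norm_num)
  have hpow : ∀ n : ℕ, X ^ n = (d : ℝ) ^ ((n : ℝ) / 10) := fun n => by
    rw [hX, ← Real.rpow_natCast, ← Real.rpow_mul hd0.le]
    congr 1
    ring
  have e6 : (d : ℝ) ^ (3 / 5 : ℝ) = X ^ 6 := by rw [hpow]; norm_num
  have e9 : (d : ℝ) ^ (9 / 10 : ℝ) = X ^ 9 := by rw [hpow]; norm_num
  have e3 : (d : ℝ) ^ (3 / 10 : ℝ) = X ^ 3 := by rw [hpow]; norm_num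
  have e10 : (d : ℝ) = X ^ 10 := by rw [hpow]; norm_num
  rw [e6, e9, e3]
  have h6 : 1 ≤ X ^ 6 := one_le_pow₀ hX1
  set b := ⌈X ^ 6⌉₊ with hb
  have hb1 : X ^ 6 ≤ b := Nat.le_ceil _
  have hb2 : (b : ℝ) ≤ 2 * X ^ 6 := by
    have := (Nat.ceil_lt_add_one (show 0 ≤ X ^ 6 by linarith)).le
    linarith
  have hbd : b ≤ d := Nat.ceil_le.2 (by
    conv_rhs => rw [e10]
    exact pow_le_pow_right₀ hX1 (by norm_num))
  have hratio : (d : ℝ) / b ≤ X ^ 4 := by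
    rw [div_le_iff₀ (by linarith)]
    calc (d : ℝ) = X ^ 4 * X ^ 6 := by rw [← pow_add]; exact e10
      _ ≤ _ := by gcongr
  refine ⟨by exact_mod_cast h6.trans hb1, hbd, X, hX1, ?_, ?_, ?_, fun z _ hz => ?_, ?_⟩
  · rw [e10]
    exact le_self_pow₀ hX1 (by norm_num)
  · refine Real.sqrt_le_iff.2 ⟨by positivity, hratio.trans (le_of_eq ?_)⟩
    ring
  · rw [div_le_iff₀ (by linarith)]
    calc ((d : ℝ) / b) ^ 2 ≤ (X ^ 4) ^ 2 := by gcongr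
      _ = X ^ 2 * X ^ 6 := by ring
      _ ≤ _ := by gcongr
  · calc (d : ℝ) / b ≤ X ^ 4 := hratio
      _ = X * X ^ 3 := by ring
      _ ≤ _ := by gcongr
  · calc (b : ℝ) * X ^ 3 ≤ 2 * X ^ 6 * X ^ 3 := by gcongr
      _ = _ := by ring

end AccZOMDA

theorem theorem4 :
    -- the convergence bound
    (∀ (d₁ d₂ b T : ℕ), 1 ≤ d₁ → 1 ≤ d₂ → 1 ≤ T →
      ∀ (L τ δ : ℝ), 0 < L → 0 < τ →
      ∀ (p : Params), p.Admissible d₁ d₂ b T L τ →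
      ∀ (Ξ : Type u) [MeasurableSpace Ξ] (P : Problem d₁ d₂ Ξ), P.Assumptions L τ δ p.μ₁ p.μ₂ →
      ∀ (x₁ : E d₁) (y₁ : E d₂), y₁ ∈ P.feasible → IsMaxOn (P.f x₁) P.feasible y₁ →
      ∀ (Ω : Type v) [MeasurableSpace Ω] (Pr : Measure Ω) [IsProbabilityMeasure Pr]
        (Z : ℕ → Ω → Batch d₁ d₂ b Ξ), IsSampling P Pr Z →
        let M := p.M' b T L τ δ (smoothing p.μ₁ P.g x₁ - P.gStar)
        Differentiable ℝ P.g ∧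
        (∀ n < T, Integrable (gradNorm P p x₁ y₁ Z n) Pr) ∧
        avgGradNorm P p Pr x₁ y₁ Z T ≤
          Real.sqrt (2 * M) * p.m ^ (1 / 6 : ℝ) / (T : ℝ) ^ (1 / 2 : ℝ)
            + Real.sqrt (2 * M) / (T : ℝ) ^ (1 / 3 : ℝ)
            + (L + L ^ 2 / τ) / (2 * (p.m + T) ^ (2 / 3 : ℝ)) ∧
        (b ≤ 100 * d₁ → avgGradNorm P p Pr x₁ y₁ Z T ≤
          Real.sqrt (2 * M) * p.m ^ (1 / 6 : ℝ) / (T : ℝ) ^ (1 / 2 : ℝ)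
            + Real.sqrt (2 * M) / (T : ℝ) ^ (1 / 3 : ℝ)
            + L / (2 * (p.m + T) ^ (2 / 3 : ℝ)))) ∧
    -- the query complexity for mini-batch size `1`
    QueryComplexity.{u, v} (fun _ => 1) 3 0 ∧
    -- the query complexity for mini-batch size `d̃^{3/5}`, rounded up
    QueryComplexity.{u, v} (fun d => ⌈(d : ℝ) ^ (3 / 5 : ℝ)⌉₊) (9 / 10) (3 / 10) := by
  refine ⟨?_, queryComplexity_single, queryComplexity_batch⟩
  intro d₁ d₂ b T hd₁ hd₂ hT L τ δ hL hτ p hA Ξ _ P hP x₁ y₁ hy hmax Ω _ Pr _ Z hZ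
  exact convergence hd₁ hd₂ hT hL hτ hA hP hy hmax hZ
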